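/- **Setting.** Let $d\in\{2,3\}$ and let $\Omega\subset\mathbb R^d$ be a bounded Lipschitz domain with $\partial\Omega_D,\partial\Omega_N\subset\partial\Omega$ disjoint and $\overline{\partial\Omega_D}\cup\overline{\partial\Omega_N}=\partial\Omega$. Let $A$ be a measurable symmetric matrix field on $\Omega$ with $\alpha|\xi|^2\le A(x)\xi\cdot\xi\le\beta|\xi|^2$, $0<\alpha<\beta<\infty$, and let $f\in L^2(\Omega)$, $g\in H^{-1/2}(\partial\Omega_N)$, $q\in H^{1/2}(\partial\Omega_D)$. For open $\omega\subset\Omega$ put $$a_\omega(u,v)=\int_\omega A\nabla u\cdot\nabla v\,dx,\quad \|u\|_{a,\omega}=a_\omega(u,u)^{1/2},\quad F_\omega(v)=\int_{\partial\omega\cap\partial\Omega_N}gv\,ds+\int_\omega fv\,dx,$$ $$H^1_{0D}(\omega)=\{v\in H^1(\omega): v=0\text{ on }(\partial\omega\cap\Omega)\cup(\partial\omega\cap\partial\Omega_D)\},$$ boundary values being understood in the sense of traces. Let $u_0\in H^1(\Omega)$ be a weak solution of the mixed problem: $u_0=q$ on $\partial\Omega_D$ and $a_\Omega(u_0,v)=F_\Omega(v)$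 for all $v\in H^1_{0D}(\Omega)$. Let $\omega_i\subset\omega_i^*\subset\Omega$, where $\omega_i$ is open and $\omega_i^*$ is a Lipschitz domain (in particular $\omega_i,\omega_i^*$ may touch $\partial\Omega$). Let $\chi_i$ be a partition of unity function on $\omega_i$: $0\le\chi_i\le1$ on $\Omega$, $\chi_i=0$ on $\Omega\setminus\omega_i$, $\chi_i\in C^1(\omega_i)$, and $\chi_i$ is Lipschitz continuous on $\Omega$. *Local particular function.* Let $\psi_i^r\in H^1_{0D}(\omega_i^*)$ satisfy $a_{\omega_i^*}(\psi_i^r,v)=F_{\omega_i^*}(v)$ for all $v\in H^1_{0D}(\omega_i^*)$. Let $\psi_i^d\in H^1(\omega_i^*)$ satisfy $\psi_i^d=q$ on $\partial\omega_i^*\cap\partial\Omega_D$ and $a_{\omega_i^*}(\psi_i^d,v)=0$ for all $v\in H^1(\omega_i^*)$ with $v=0$ on $\partial\omega_i^*\cap\partial\Omega_D$. Put $u_i^p=(\psi_i^r+\psi_i^d)|_{\omega_i}$. *Harmonic spaces.* Let $$H_{A,D}(\omega_i^*)=\{u\in H^1(\omega_i^*):a_{\omega_i^*}(u,v)=0\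 \ \forall v\in H^1_{0D}(\omega_i^*)\},$$ $$H^0_{A,D}(\omega_i^*)=\{u\in H_{A,D}(\omega_i^*):u=0\text{ on }\partial\omega_i^*\cap\partial\Omega_D\},$$ and let $H^0_{A,N}(\omega_i^*)$ be the set of all $u\in H^1(\omega_i^*)$ such that $a_{\omega_i^*}(u,v)=0$ for all $v\in H^1(\omega_i^*)$ with $v=0$ on $\partial\omega_i^*\cap\Omega$, and such that $$\mathcal M_{\omega_i}(u)=\frac{\int_{\omega_i}A\nabla(\chi_iu)\cdot\nabla\chi_i\,dx}{\int_{\omega_i}A\nabla\chi_i\cdot\nabla\chi_i\,dx}=0.$$ *Local approximation space.* Let $v_1,v_2,\dots$ be linearly independent eigenfunctions, associated with all the eigenvalues $\lambda_1\le\lambda_2\le\cdots$ counted with multiplicity, of the problem $$v\in H^0_{A,D}(\omega_i^*),\qquad a_{\omega_i^*}(v,\varphi)=\lambda\,a_{\omega_i}(\chi_iv,\chi_i\varphi)\quad\forall\varphi\in H^0_{A,D}(\omega_i^*),$$ and put $S_n(\omega_i)=\operatorname{span}\{v_1|_{\omega_i},\dots,v_n|_{\omega_i}\}$ (the span of all $v_k|_{\omega_i}$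 if there are fewer than $n$ of them). *$n$-width.* Put $$d_n(\omega_i,\omega_i^*)=\inf_{Q}\ \sup_{u\in V}\ \inf_{v\in Q}\frac{\|\chi_iu-v\|_{a,\omega_i}}{\|u\|_{a,\omega_i^*}},$$ where $Q$ runs over the subspaces of $H^1_{0D}(\omega_i)$ of dimension at most $n$, the quotient $0/0$ counts as $0$, and $V=H^0_{A,D}(\omega_i^*)$ if $\partial\omega_i^*\cap\partial\Omega_D$ has positive surface measure, $V=H^0_{A,N}(\omega_i^*)$ otherwise. **Theorem.** If $\partial\omega_i^*\cap\partial\Omega_D$ has positive surface measure, then for every $n\ge0$ we have $d_n(\omega_i,\omega_i^*)<\infty$ and there is $\phi_i\in S_n(\omega_i)$ with $$\|\chi_i(u_0-u_i^p-\phi_i)\|_{a,\omega_i}\le d_n(\omega_i,\omega_i^*)\,\|u_0\|_{a,\omega_i^*}.$$ If $\partial\omega_i^*\cap\partial\Omega_D$ is empty, or has surface measure zero, then for every $n\ge1$ we have $d_{n-1}(\omega_i,\omega_i^*)<\infty$ and there is $\phi_i\in S_n(\omega_i)$ with $$\|\chi_i(u_0-u_i^p-\phi_i)\|_{a,\omega_i}\le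 d_{n-1}(\omega_i,\omega_i^*)\,\|u_0\|_{a,\omega_i^*}.$$ -/

import Mathlib

open MeasureTheory Filter Topology
open scoped ENNReal NNReal

noncomputable section

namespace MSGFEM

/-- The space `ℝ^d` with its Euclidean norm. -/
abbrev Space (d : ℕ) := EuclideanSpace ℝ (Fin d)

variable {d : ℕ}

/-! ### Lipschitz domains and boundary parts -/

/-- A bounded domain (open, connected, nonempty) with Lipschitz boundary: near each boundary
point, in suitable orthonormal coordinates with last axis `e`, the domain is the set lying above
the graph of a Lipschitz function `γ` of the remaining coordinates `y - ⟪e, y⟫ e`. -/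
structure IsLipschitzDomain (Ω : Set (Space d)) : Prop where
  isOpen : IsOpen Ω
  isConnected : IsConnected Ω
  isBounded : Bornology.IsBounded Ω
  localGraph : ∀ x ∈ frontier Ω, ∃ (e : Space d) (γ : Space d → ℝ) (K : ℝ≥0) (r : ℝ),
    ‖e‖ = 1 ∧ LipschitzWith K γ ∧ 0 < r ∧
      ∀ y ∈ Metric.ball x r, y ∈ Ω ↔ γ (y - inner ℝ e y • e) < inner ℝ e y

/-- `D` and `N` (the Dirichlet and the Neumann part) decompose the boundary of `Ω`. -/
structure IsBoundaryDecomposition (Ω D N : Set (Space d)) : Prop where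
  measurableSet_dirichlet : MeasurableSet D
  measurableSet_neumann : MeasurableSet N
  disjoint : Disjoint D N
  subset_dirichlet : D ⊆ frontier Ω
  subset_neumann : N ⊆ frontier Ω
  closure_union : closure D ∪ closure N = frontier Ω

/-- Surface measure: the `(d-1)`-dimensional Hausdorff measure on `ℝ^d`. -/
def surface (d : ℕ) : Measure (Space d) := Measure.hausdorffMeasure ((d : ℝ) - 1)

/-! ### The Sobolev space `H¹`

Elements of `H¹(ω)` are represented by functions on `ℝ^d`, of which only the values on `ω`, up to
null sets, matter.  Thus a function also stands for its restrictions to smaller sets. -/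

/-- `G` is a weak gradient of `u` on `ω`. -/
def HasWeakGrad (ω : Set (Space d)) (u : Space d → ℝ) (G : Space d → Space d) : Prop :=
  ∀ φ : Space d → ℝ, ContDiff ℝ ((⊤ : ℕ∞) : WithTop ℕ∞) φ → HasCompactSupport φ → tsupport φ ⊆ ω → ∀ i : Fin d,
    ∫ x in ω, u x * fderiv ℝ φ x (EuclideanSpace.single i 1) = -∫ x in ω, G x i * φ x

/-- `G` is a square-integrable weak gradient of `u` on `ω`. -/
def IsL2Grad (ω : Set (Space d)) (u : Space d → ℝ) (G : Space d → Space d) : Prop :=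
  MemLp G 2 (volume.restrict ω) ∧ HasWeakGrad ω u G

/-- `u ∈ H¹(ω)`. -/
def MemH1 (ω : Set (Space d)) (u : Space d → ℝ) : Prop :=
  MemLp u 2 (volume.restrict ω) ∧ ∃ G, IsL2Grad ω u G

open Classical in
/-- The weak gradient of `u ∈ H¹(ω)` (unique almost everywhere in `ω`); `0` if there is none. -/
def wgrad (ω : Set (Space d)) (u : Space d → ℝ) : Space d → Space d :=
  if h : ∃ G, IsL2Grad ω u G then h.choose else 0

/-- The norm of `H¹(ω)`. -/
def normH1 (ω : Set (Space d)) (u : Space d → ℝ) : ℝ :=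
  √((∫ x in ω, u x ^ 2) + ∫ x in ω, ‖wgrad ω u x‖ ^ 2)

/-! ### Boundary values -/

/-- `u ∈ H¹(ω)` and `u = q` on `Γ ⊆ ∂ω` in the sense of traces: `(u, q)` is the limit, in
`H¹(ω) × L²(Γ)`, of pairs `(φ|_ω, φ|_Γ)` with `φ` Lipschitz continuous on `ℝ^d`. -/
def HasTrace (ω Γ : Set (Space d)) (u q : Space d → ℝ) : Prop :=
  MemH1 ω u ∧ MemLp q 2 ((surface d).restrict Γ) ∧
    ∃ φ : ℕ → Space d → ℝ, (∀ n, ∃ K : ℝ≥0, LipschitzWith K (φ n)) ∧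
      Tendsto (fun n => normH1 ω (φ n - u)) atTop (𝓝 0) ∧
      Tendsto (fun n => eLpNorm (φ n - q) 2 ((surface d).restrict Γ)) atTop (𝓝 0)

open Classical in
/-- The trace of `u ∈ H¹(ω)` on `Γ ⊆ ∂ω` (unique almost everywhere on `Γ` if `ω` is a Lipschitz
domain). -/
def trace (ω Γ : Set (Space d)) (u : Space d → ℝ) : Space d → ℝ :=
  if h : ∃ q, HasTrace ω Γ u q then h.choose else 0

/-- `H¹_{0D}(ω)`, for `ω ⊆ Ω`: the functions in `H¹(ω)` vanishing on
`(∂ω ∩ Ω) ∪ (∂ω ∩ ∂Ω_D)`.  For `ω = Ω` these are the functions vanishing on `∂Ω_D`. -/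
def H10D (Ω D ω : Set (Space d)) : Set (Space d → ℝ) :=
  {v | HasTrace ω ((frontier ω ∩ Ω) ∪ (frontier ω ∩ D)) v 0}

/-! ### The elliptic problem -/

/-- The matrix field `A` is measurable and symmetric on `Ω`, with
`α |ξ|² ≤ A(x) ξ · ξ ≤ β |ξ|²`. -/
structure IsElliptic (Ω : Set (Space d)) (A : Space d → Matrix (Fin d) (Fin d) ℝ) (α β : ℝ) :
    Prop where
  pos : 0 < α
  measurable : ∀ i j, AEMeasurable (fun x => A x i j) (volume.restrict Ω)
  symm : ∀ᵐ x ∂(volume.restrict Ω), (A x).IsSymm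
  bounds : ∀ᵐ x ∂(volume.restrict Ω), ∀ ξ : Fin d → ℝ,
    α * ∑ i, ξ i ^ 2 ≤ ∑ i, ∑ j, A x i j * ξ i * ξ j ∧
      ∑ i, ∑ j, A x i j * ξ i * ξ j ≤ β * ∑ i, ξ i ^ 2

/-- `a_ω(u, v) = ∫_ω A ∇u · ∇v`. -/
def energy (A : Space d → Matrix (Fin d) (Fin d) ℝ) (ω : Set (Space d)) (u v : Space d → ℝ) : ℝ :=
  ∫ x in ω, ∑ i, ∑ j, A x i j * wgrad ω u x j * wgrad ω v x i

/-- `‖u‖_{a,ω} = a_ω(u, u)^{1/2}`. -/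
def energyNorm (A : Space d → Matrix (Fin d) (Fin d) ℝ) (ω : Set (Space d)) (u : Space d → ℝ) : ℝ :=
  √(energy A ω u u)

/-- `g ∈ H^{-1/2}(∂Ω_N)`: `g` is a linear functional on boundary functions, bounded on the traces
on `∂Ω_N` of the functions `v ∈ H¹_{0D}(Ω)` with respect to the quotient norm
`‖h‖ = inf {‖v‖_{H¹(Ω)} : v ∈ H¹_{0D}(Ω), v = h on ∂Ω_N}`.  (The values of `g` on other functions
are never used.) -/
def MemHNegHalf (Ω D N : Set (Space d)) (g : (Space d → ℝ) →ₗ[ℝ] ℝ) : Prop :=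
  ∃ C : ℝ, ∀ v h : Space d → ℝ, v ∈ H10D Ω D Ω → HasTrace Ω N v h → |g h| ≤ C * normH1 Ω v

/-- `F_ω(v) = ∫_{∂ω ∩ ∂Ω_N} g v ds + ∫_ω f v dx`, where the first integral is the pairing of `g`
with the trace of `v` on `∂ω ∩ ∂Ω_N`, continued by zero to the rest of `∂Ω_N`. -/
def load (N : Set (Space d)) (f : Space d → ℝ) (g : (Space d → ℝ) →ₗ[ℝ] ℝ) (ω : Set (Space d))
    (v : Space d → ℝ) : ℝ :=
  g ((frontier ω).indicator (trace ω (frontier ω ∩ N) v)) + ∫ x in ω, f x * v x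

/-- `u₀` is a weak solution of `-div(A∇u) = f` in `Ω`, `n · A∇u = g` on `∂Ω_N`, `u = q` on
`∂Ω_D`. -/
def IsWeakSolution (Ω D N : Set (Space d)) (A : Space d → Matrix (Fin d) (Fin d) ℝ)
    (f : Space d → ℝ) (g : (Space d → ℝ) →ₗ[ℝ] ℝ) (q u₀ : Space d → ℝ) : Prop :=
  HasTrace Ω D u₀ q ∧ ∀ v ∈ H10D Ω D Ω, energy A Ω u₀ v = load N f g Ω v

/-- `ψ` is a weak solution of `-div(A∇ψ) = f` in `ω'`, `n · A∇ψ = g` on `∂ω' ∩ ∂Ω_N`, `ψ = 0` on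
`∂ω' ∩ Ω` and on `∂ω' ∩ ∂Ω_D`. -/
def IsLocalLoadSolution (Ω D N : Set (Space d)) (A : Space d → Matrix (Fin d) (Fin d) ℝ)
    (f : Space d → ℝ) (g : (Space d → ℝ) →ₗ[ℝ] ℝ) (ω' : Set (Space d)) (ψ : Space d → ℝ) : Prop :=
  ψ ∈ H10D Ω D ω' ∧ ∀ v ∈ H10D Ω D ω', energy A ω' ψ v = load N f g ω' v

/-- `ψ` is a weak solution of `-div(A∇ψ) = 0` in `ω'`, `n · A∇ψ = 0` on `∂ω' ∩ ∂Ω_N` and on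
`∂ω' ∩ Ω`, `ψ = q` on `∂ω' ∩ ∂Ω_D`. -/
def IsLocalDirichletSolution (D : Set (Space d)) (A : Space d → Matrix (Fin d) (Fin d) ℝ)
    (q : Space d → ℝ) (ω' : Set (Space d)) (ψ : Space d → ℝ) : Prop :=
  HasTrace ω' (frontier ω' ∩ D) ψ q ∧
    ∀ v, HasTrace ω' (frontier ω' ∩ D) v 0 → energy A ω' ψ v = 0

/-! ### Partition of unity functions and `A`-harmonic spaces -/

/-- `χ` is a partition of unity function on `Ω` belonging to the subdomain `ω`. -/
structure IsPartitionFunction (Ω ω : Set (Space d)) (χ : Space d → ℝ) : Prop where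
  mem_Icc : ∀ x ∈ Ω, χ x ∈ Set.Icc (0 : ℝ) 1
  eq_zero : ∀ x ∈ Ω \ ω, χ x = 0
  contDiffOn : ContDiffOn ℝ 1 χ ω
  lipschitz : ∃ K : ℝ≥0, LipschitzOnWith K χ Ω

/-- `H_{A,D}(ω')`: the functions in `H¹(ω')` that are `a_{ω'}`-orthogonal to `H¹_{0D}(ω')`. -/
def HAD (Ω D : Set (Space d)) (A : Space d → Matrix (Fin d) (Fin d) ℝ) (ω' : Set (Space d)) :
    Set (Space d → ℝ) :=
  {u | MemH1 ω' u ∧ ∀ v ∈ H10D Ω D ω', energy A ω' u v = 0}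

/-- `H⁰_{A,D}(ω')`: the functions in `H_{A,D}(ω')` that vanish on `∂ω' ∩ ∂Ω_D`. -/
def HAD0 (Ω D : Set (Space d)) (A : Space d → Matrix (Fin d) (Fin d) ℝ) (ω' : Set (Space d)) :
    Set (Space d → ℝ) :=
  {u | u ∈ HAD Ω D A ω' ∧ HasTrace ω' (frontier ω' ∩ D) u 0}

/-- The weighted mean `M_ω(v) = ∫_ω A∇(χv)·∇χ / ∫_ω A∇χ·∇χ`. -/
def weightedMean (A : Space d → Matrix (Fin d) (Fin d) ℝ) (ω : Set (Space d)) (χ v : Space d → ℝ) :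
    ℝ :=
  energy A ω (χ * v) χ / energy A ω χ χ

/-- `H⁰_{A,N}(ω')`: the functions `u ∈ H¹(ω')` that are `a_{ω'}`-orthogonal to all functions of
`H¹(ω')` vanishing on `∂ω' ∩ Ω`, and satisfy `M_ω(u) = 0`. -/
def HAN0 (Ω : Set (Space d)) (A : Space d → Matrix (Fin d) (Fin d) ℝ) (ω ω' : Set (Space d))
    (χ : Space d → ℝ) : Set (Space d → ℝ) :=
  {u | u ∈ HAD Ω ∅ A ω' ∧ weightedMean A ω χ u = 0}

/-- The Kolmogorov `n`-width, in the space `W` with `‖·‖_{a,ω}`, of `u ↦ χ u` on the space `V` with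
`‖·‖_{a,ω'}`:
`inf_Q sup_{u ∈ V} inf_{v ∈ Q} ‖χ u - v‖_{a,ω} / ‖u‖_{a,ω'}`,
with `Q` ranging over the subspaces of `W` of dimension at most `n` (`0 / 0 = 0` here). -/
def nWidth (A : Space d → Matrix (Fin d) (Fin d) ℝ) (ω ω' : Set (Space d)) (χ : Space d → ℝ)
    (V W : Set (Space d → ℝ)) (n : ℕ) : ℝ≥0∞ :=
  ⨅ (Q : Submodule ℝ (Space d → ℝ)) (_ : (Q : Set (Space d → ℝ)) ⊆ W ∧ Module.rank ℝ Q ≤ n),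
    ⨆ u ∈ V, ⨅ v ∈ Q,
      ENNReal.ofReal (energyNorm A ω (χ * u - v)) / ENNReal.ofReal (energyNorm A ω' u)

/-! ### The local eigenproblem -/

/-- `v` is an eigenfunction, with eigenvalue `μ`, of
`a_{ω'}(v, φ) = μ a_ω(χ v, χ φ)` for all `φ ∈ V`. -/
def IsEigenpair (A : Space d → Matrix (Fin d) (Fin d) ℝ) (ω ω' : Set (Space d)) (χ : Space d → ℝ)
    (V : Set (Space d → ℝ)) (μ : ℝ) (v : Space d → ℝ) : Prop :=
  v ∈ V ∧ ¬ v =ᵐ[volume.restrict ω'] 0 ∧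
    ∀ φ ∈ V, energy A ω' v φ = μ * energy A ω (χ * v) (χ * φ)

/-- `(lam k, v k)`, `k < L`, is a list of all eigenvalues in increasing order, repeated according
to multiplicity, with associated linearly independent eigenfunctions.  Its length `L` may be finite
or infinite. -/
structure IsEigensystem (A : Space d → Matrix (Fin d) (Fin d) ℝ) (ω ω' : Set (Space d))
    (χ : Space d → ℝ) (V : Set (Space d → ℝ)) (L : ℕ∞) (lam : ℕ → ℝ) (v : ℕ → Space d → ℝ) :
    Prop where
  eigenpair : ∀ k : ℕ, (k : ℕ∞) < L → IsEigenpair A ω ω' χ V (lam k) (v k)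
  mono : ∀ j k : ℕ, j ≤ k → (k : ℕ∞) < L → lam j ≤ lam k
  independent : ∀ m : ℕ, (m : ℕ∞) ≤ L → ∀ c : ℕ → ℝ,
    (∑ k ∈ Finset.range m, c k • v k) =ᵐ[volume.restrict ω'] 0 → ∀ k < m, c k = 0
  exhaustive : ∀ (μ : ℝ) (w : Space d → ℝ), IsEigenpair A ω ω' χ V μ w →
    ∃ u ∈ Submodule.span ℝ {s | ∃ k : ℕ, (k : ℕ∞) < L ∧ lam k = μ ∧ v k = s},
      w =ᵐ[volume.restrict ω'] u

/-- The span of the first `n` eigenfunctions (of all of them, if there are fewer than `n`). -/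
def localSpace (L : ℕ∞) (v : ℕ → Space d → ℝ) (n : ℕ) : Submodule ℝ (Space d → ℝ) :=
  Submodule.span ℝ {s | ∃ k : ℕ, k < n ∧ (k : ℕ∞) < L ∧ v k = s}

end MSGFEM

end

open MSGFEM

namespace MSGFEM

variable {d : ℕ} {ω ω' : Set (Space d)} {u v : Space d → ℝ} {G H : Space d → Space d}

/-! ### Functions with a square-integrable weak gradient -/

/-! Put w = u₀ - (ψr + ψd). A test function on ω', extended by zero, is a test function on Ω, so w
is harmonic, i.e. an element of `HAD0`. The three pieces w, ψr, ψd are pairwise orthogonal for the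
energy of ω', hence the energy of w is at most that of u₀ (`LocalSetting.sub_particular_mem`). It
remains to approximate an element of `HAD0` by the first n eigenfunctions.

On `HAD0` let a(u, v) be the energy of ω' and b(u, v) the energy on ω of χu and χv; the eigenproblem
is a(v_k, ·) = λ_k b(v_k, ·), with k counted from 0. Let y be a b-orthogonal projection of w onto
the span of v_0, ..., v_{n-1}. The eigenvalue equation makes w - y also a-orthogonal to this span,
so a(w - y, w - y) ≤ a(w, w) (`energy_sub_projection_le`). On the b-orthogonal complement of the
span, either b vanishes or λ_n b ≤ a (`rayleigh_le`). Hence b(w - y, w - y) ≤ a(w, w) / λ_n.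
Conversely a ≤ λ_n b on the span of v_0, ..., v_n (`rayleigh_ge`), and for a space Q of dimension at
most n some nonzero u in that span has χu orthogonal to Q, so that no element of Q is closer to χu
than 0. This gives λ_n^(-1/2) ≤ d_n (`sqrt_le_nWidth`). Only this lower bound of the width is
needed, together with its finiteness, which follows from Q = 0.

The variational principle `rayleigh_le` rests on compactness. Since χ²u is an admissible test
function, b(u, u) is bounded by the integral of u² over ω' (`LocalSetting.caccioppoli`), and
Rellich's theorem (`IsLipschitzDomain.rellich`) makes bounded sequences b-Cauchy, provided that the
energy controls the L² norm. If the Dirichlet part has positive measure, this is Friedrichs'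
inequality. Otherwise constants are harmonic with energy zero: λ_0 = 0 is simple, v_0 is a nonzero
constant, and all other v_k are b-orthogonal to 1, which is the condition defining `HAN0`. The
argument is then run in that subspace, where one eigenfunction has been spent on the constants and
the index of the width drops to n - 1. Subtracting the mean leaves a unchanged and does not decrease
b there, so Poincaré's inequality takes the place of Friedrichs'. `LocalSetting.Reduction` and
`LocalSetting.exists_approximation` treat both cases at once.

The Sobolev theory comes from two devices. Mollification, with a shift along the chart axis near the
boundary, gives density of smooth functions. Integrals over thin strips along the boundary, divided
by the width, are comparable to surface integrals; this gives the trace inequality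
(`IsLipschitzDomain.trace_sq_le`), extension by zero (`HasTrace.sobolevPair_indicator`) and the
collar estimate that reduces Rellich's theorem to a grid of cubes. -/

/-- `u ∈ H¹(ω)` with weak gradient `G`. -/
structure SobolevPair (ω : Set (Space d)) (u : Space d → ℝ) (G : Space d → Space d) : Prop where
  memLp : MemLp u 2 (volume.restrict ω)
  memLp_grad : MemLp G 2 (volume.restrict ω)
  weak : HasWeakGrad ω u G

/-- Unfolds the choice in `wgrad`. Afterwards computations use any explicit weak gradient and are
transferred by `SobolevPair.wgrad_ae_eq`. -/
theorem MemH1.sobolevPair (h : MemH1 ω u) : SobolevPair ω u (wgrad ω u) := by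
  obtain ⟨hu, hG⟩ := h
  have : wgrad ω u = hG.choose := by simp [wgrad, hG]
  rw [this]
  exact ⟨hu, hG.choose_spec.1, hG.choose_spec.2⟩

theorem SobolevPair.memH1 (h : SobolevPair ω u G) : MemH1 ω u :=
  ⟨h.memLp, G, h.memLp_grad, h.weak⟩

/-- The partial derivative of a test function is a test function. -/
theorem continuous_fderiv_single {φ : Space d → ℝ} (hφ : ContDiff ℝ ((⊤ : ℕ∞) : WithTop ℕ∞) φ)
    (i : Fin d) : Continuous fun x => fderiv ℝ φ x (EuclideanSpace.single i 1) :=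
  (hφ.continuous_fderiv (by simp)).clm_apply continuous_const

theorem memLp_test {ψ : Space d → ℝ} (hψ : Continuous ψ) (hc : HasCompactSupport ψ)
    (p : ℝ≥0∞) (μ : Measure (Space d)) [IsFiniteMeasureOnCompacts μ] : MemLp ψ p μ :=
  hψ.memLp_of_hasCompactSupport hc

theorem memLp_fderiv_single {φ : Space d → ℝ} (hφ : ContDiff ℝ ((⊤ : ℕ∞) : WithTop ℕ∞) φ)
    (hc : HasCompactSupport φ) (i : Fin d) (p : ℝ≥0∞) (μ : Measure (Space d))
    [IsFiniteMeasureOnCompacts μ] :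
    MemLp (fun x => fderiv ℝ φ x (EuclideanSpace.single i 1)) p μ :=
  memLp_test (continuous_fderiv_single hφ i) (hc.fderiv_apply ℝ _) p μ

theorem memLp_coord {μ : Measure (Space d)} {p : ℝ≥0∞} (h : MemLp G p μ) (i : Fin d) :
    MemLp (fun x => G x i) p μ :=
  h.continuousLinearMap_comp (EuclideanSpace.proj (𝕜 := ℝ) i)

theorem integrable_mul_of_memLp_two {α : Type*} [MeasurableSpace α] {μ : Measure α} {f g : α → ℝ}
    (hf : MemLp f 2 μ) (hg : MemLp g 2 μ) : Integrable (fun x => f x * g x) μ :=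
  hf.integrable_mul hg

theorem SobolevPair.add (hu : SobolevPair ω u G) (hv : SobolevPair ω v H) :
    SobolevPair ω (u + v) (G + H) := by
  refine ⟨hu.memLp.add hv.memLp, hu.memLp_grad.add hv.memLp_grad, fun φ hφ hc hs i => ?_⟩
  have hd := memLp_fderiv_single hφ hc i 2 (volume.restrict ω)
  have hl := memLp_test hφ.continuous hc 2 (volume.restrict ω)
  have e1 : ∫ x in ω, (u + v) x * fderiv ℝ φ x (EuclideanSpace.single i 1) =
      (∫ x in ω, u x * fderiv ℝ φ x (EuclideanSpace.single i 1)) +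
        ∫ x in ω, v x * fderiv ℝ φ x (EuclideanSpace.single i 1) := by
    rw [← integral_add (integrable_mul_of_memLp_two hu.memLp hd)
      (integrable_mul_of_memLp_two hv.memLp hd)]
    simp [add_mul]
  have e2 : ∫ x in ω, (G + H) x i * φ x =
      (∫ x in ω, G x i * φ x) + ∫ x in ω, H x i * φ x := by
    rw [← integral_add (integrable_mul_of_memLp_two (memLp_coord hu.memLp_grad i) hl)
      (integrable_mul_of_memLp_two (memLp_coord hv.memLp_grad i) hl)]
    simp [add_mul]
  rw [e1, e2, hu.weak φ hφ hc hs i, hv.weak φ hφ hc hs i]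
  ring

theorem SobolevPair.smul (c : ℝ) (hu : SobolevPair ω u G) : SobolevPair ω (c • u) (c • G) := by
  refine ⟨hu.memLp.const_smul c, hu.memLp_grad.const_smul c, fun φ hφ hc hs i => ?_⟩
  have := hu.weak φ hφ hc hs i
  simp only [Pi.smul_apply, PiLp.smul_apply, smul_eq_mul, mul_assoc, integral_const_mul, this]
  ring

theorem SobolevPair.zero : SobolevPair ω (0 : Space d → ℝ) (0 : Space d → Space d) :=
  ⟨MemLp.zero, MemLp.zero, fun φ _ _ _ i => by simp⟩

theorem SobolevPair.sub (hu : SobolevPair ω u G) (hv : SobolevPair ω v H) :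
    SobolevPair ω (u - v) (G - H) := by
  have := hu.add (hv.smul (-1))
  simpa [sub_eq_add_neg] using this

theorem SobolevPair.congr (hu : SobolevPair ω u G) (h : u =ᵐ[volume.restrict ω] v)
    (h' : G =ᵐ[volume.restrict ω] H) : SobolevPair ω v H := by
  refine ⟨hu.memLp.ae_eq h, hu.memLp_grad.ae_eq h', fun φ hφ hc hs i => ?_⟩
  have e1 : ∫ x in ω, v x * fderiv ℝ φ x (EuclideanSpace.single i 1) =
      ∫ x in ω, u x * fderiv ℝ φ x (EuclideanSpace.single i 1) :=
    integral_congr_ae (h.mono fun x hx => by simp only [hx])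
  have e2 : ∫ x in ω, H x i * φ x = ∫ x in ω, G x i * φ x :=
    integral_congr_ae (h'.mono fun x hx => by simp only [hx])
  rw [e1, e2, hu.weak φ hφ hc hs i]

theorem setIntegral_eq_of_support_subset {F : Space d → ℝ} (h : ω ⊆ ω')
    (hF : ∀ x, x ∉ ω → F x = 0) : ∫ x in ω', F x = ∫ x in ω, F x := by
  rw [setIntegral_eq_integral_of_forall_compl_eq_zero (fun x hx => hF x fun h' => hx (h h')),
    setIntegral_eq_integral_of_forall_compl_eq_zero hF]

theorem test_eq_zero {φ : Space d → ℝ} (hs : tsupport φ ⊆ ω) {x : Space d} (hx : x ∉ ω) :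
    φ x = 0 :=
  image_eq_zero_of_notMem_tsupport fun h => hx (hs h)

theorem fderiv_test_eq_zero {φ : Space d → ℝ} (hs : tsupport φ ⊆ ω) {x : Space d} (hx : x ∉ ω) :
    fderiv ℝ φ x = 0 :=
  image_eq_zero_of_notMem_tsupport fun h => hx (hs (tsupport_fderiv_subset ℝ h))

theorem SobolevPair.mono (hu : SobolevPair ω' u G) (h : ω ⊆ ω') : SobolevPair ω u G := by
  refine ⟨hu.memLp.mono_measure (Measure.restrict_mono h le_rfl),
    hu.memLp_grad.mono_measure (Measure.restrict_mono h le_rfl), fun φ hφ hc hs i => ?_⟩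
  have := hu.weak φ hφ hc (hs.trans h) i
  rwa [setIntegral_eq_of_support_subset h fun x hx => ?_,
    setIntegral_eq_of_support_subset h fun x hx => ?_] at this
  · simp [test_eq_zero hs hx]
  · simp [fderiv_test_eq_zero hs hx]

/-- The difference of the two gradients integrates to zero against every test function, so the
fundamental lemma of the calculus of variations applies coordinatewise. -/
theorem SobolevPair.unique (hω : IsOpen ω) (hG : SobolevPair ω u G) (hH : SobolevPair ω u H) :
    G =ᵐ[volume.restrict ω] H := by
  have key : ∀ i, ∀ᵐ x, x ∈ ω → (G x - H x) i = 0 := by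
    intro i
    have hm : MemLp (fun x => (G x - H x) i) 2 (volume.restrict ω) :=
      memLp_coord (hG.memLp_grad.sub hH.memLp_grad) i
    refine hω.ae_eq_zero_of_integral_contDiff_smul_eq_zero (f := fun x => (G x - H x) i)
      ?_ fun φ hφ hc hs => ?_
    · rw [locallyIntegrableOn_iff hω.isLocallyClosed]
      intro k hk hkc
      have : IsFiniteMeasure (volume.restrict k : Measure (Space d)) := ⟨by
        simpa using hkc.measure_lt_top⟩
      exact (hm.mono_measure (Measure.restrict_mono hk le_rfl)).integrable (by norm_num)
    · have h1 := hG.weak φ hφ hc hs i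
      have h2 := hH.weak φ hφ hc hs i
      have hl := memLp_test hφ.continuous hc 2 (volume.restrict ω)
      have e : ∫ x in ω, φ x • (G x - H x) i =
          (∫ x in ω, G x i * φ x) - ∫ x in ω, H x i * φ x := by
        rw [← integral_sub (integrable_mul_of_memLp_two (memLp_coord hG.memLp_grad i) hl)
          (integrable_mul_of_memLp_two (memLp_coord hH.memLp_grad i) hl)]
        congr 1
        ext x
        simp
        ring
      rw [← setIntegral_eq_integral_of_forall_compl_eq_zero (s := ω), e]
      · linarith
      · intro x hx
        simp [test_eq_zero hs hx]
  have := (ae_restrict_iff' hω.measurableSet).2 (ae_all_iff.2 key |>.mono fun x hx hxω i => hx i hxω)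
  filter_upwards [this] with x hx
  ext i
  simpa [sub_eq_zero] using hx i

theorem SobolevPair.wgrad_ae_eq (hω : IsOpen ω) (h : SobolevPair ω u G) :
    wgrad ω u =ᵐ[volume.restrict ω] G :=
  h.memH1.sobolevPair.unique hω h

theorem wgrad_congr (hω : IsOpen ω) (hu : MemH1 ω u) (h : u =ᵐ[volume.restrict ω] v) :
    wgrad ω v =ᵐ[volume.restrict ω] wgrad ω u :=
  (hu.sobolevPair.congr h (ae_eq_refl _)).wgrad_ae_eq hω

theorem MemH1.congr (hu : MemH1 ω u) (h : u =ᵐ[volume.restrict ω] v) : MemH1 ω v :=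
  (hu.sobolevPair.congr h (ae_eq_refl _)).memH1

theorem MemH1.mono (hu : MemH1 ω' u) (h : ω ⊆ ω') : MemH1 ω u := (hu.sobolevPair.mono h).memH1

/-- The space `H¹(ω)` as a space of functions. -/
def H1 (ω : Set (Space d)) : Submodule ℝ (Space d → ℝ) where
  carrier := {u | MemH1 ω u}
  add_mem' hu hv := (hu.sobolevPair.add hv.sobolevPair).memH1
  zero_mem' := SobolevPair.zero.memH1
  smul_mem' c _ hu := (hu.sobolevPair.smul c).memH1

theorem mem_H1 : u ∈ H1 ω ↔ MemH1 ω u := Iff.rfl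

theorem MemH1.add (hu : MemH1 ω u) (hv : MemH1 ω v) : MemH1 ω (u + v) := (H1 ω).add_mem hu hv

theorem MemH1.sub (hu : MemH1 ω u) (hv : MemH1 ω v) : MemH1 ω (u - v) := (H1 ω).sub_mem hu hv

theorem MemH1.smul (c : ℝ) (hu : MemH1 ω u) : MemH1 ω (c • u) := (H1 ω).smul_mem c hu

theorem wgrad_add (hω : IsOpen ω) (hu : MemH1 ω u) (hv : MemH1 ω v) :
    wgrad ω (u + v) =ᵐ[volume.restrict ω] wgrad ω u + wgrad ω v :=
  (hu.sobolevPair.add hv.sobolevPair).wgrad_ae_eq hω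

theorem wgrad_smul (hω : IsOpen ω) (c : ℝ) (hu : MemH1 ω u) :
    wgrad ω (c • u) =ᵐ[volume.restrict ω] c • wgrad ω u :=
  (hu.sobolevPair.smul c).wgrad_ae_eq hω

/-! ### Completeness of the Sobolev space -/

/-- The Hilbert space `L²(ω) × L²(ω; ℝ^d)`. -/
abbrev L2Pair (ω : Set (Space d)) :=
  WithLp 2 (Lp ℝ 2 (volume.restrict ω : Measure (Space d)) ×
    Lp (Space d) 2 (volume.restrict ω : Measure (Space d)))

/-- The map `u ↦ u` from `H¹(ω)` to `L²(ω)`. -/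
noncomputable def jetFst (ω : Set (Space d)) :
    H1 ω →ₗ[ℝ] Lp ℝ 2 (volume.restrict ω : Measure (Space d)) where
  toFun u := (mem_H1.1 u.2).sobolevPair.memLp.toLp u.1
  map_add' u v := MemLp.toLp_add (mem_H1.1 u.2).sobolevPair.memLp (mem_H1.1 v.2).sobolevPair.memLp
  map_smul' c u := MemLp.toLp_const_smul c (mem_H1.1 u.2).sobolevPair.memLp

/-- The map `u ↦ ∇u` from `H¹(ω)` to `L²(ω; ℝ^d)`. -/
noncomputable def jetSnd (hω : IsOpen ω) :
    H1 ω →ₗ[ℝ] Lp (Space d) 2 (volume.restrict ω : Measure (Space d)) where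
  toFun u := (mem_H1.1 u.2).sobolevPair.memLp_grad.toLp (wgrad ω u.1)
  map_add' u v := (MemLp.toLp_congr _ _ (wgrad_add hω u.2 v.2)).trans
    (MemLp.toLp_add (mem_H1.1 u.2).sobolevPair.memLp_grad (mem_H1.1 v.2).sobolevPair.memLp_grad)
  map_smul' c u := (MemLp.toLp_congr _ _ (wgrad_smul hω c u.2)).trans
    (MemLp.toLp_const_smul c (mem_H1.1 u.2).sobolevPair.memLp_grad)

/-- The map `u ↦ (u, ∇u)` from `H¹(ω)` to `L²(ω) × L²(ω; ℝ^d)`. -/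
noncomputable def jet (hω : IsOpen ω) : H1 ω →ₗ[ℝ] L2Pair ω :=
  (WithLp.linearEquiv 2 ℝ _).symm.toLinearMap ∘ₗ (jetFst ω).prod (jetSnd hω)

theorem jet_fst (hω : IsOpen ω) (u : H1 ω) :
    (jet hω u).fst = (mem_H1.1 u.2).sobolevPair.memLp.toLp u.1 := rfl

theorem jet_snd (hω : IsOpen ω) (u : H1 ω) :
    (jet hω u).snd = (mem_H1.1 u.2).sobolevPair.memLp_grad.toLp (wgrad ω u.1) := rfl

theorem norm_toLp_sq {α F : Type*} [MeasurableSpace α] {μ : Measure α} [NormedAddCommGroup F]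
    [InnerProductSpace ℝ F] {f : α → F} (hf : MemLp f 2 μ) : ‖hf.toLp f‖ ^ 2 = ∫ x, ‖f x‖ ^ 2 ∂μ := by
  rw [← real_inner_self_eq_norm_sq, L2.inner_def]
  refine integral_congr_ae ?_
  filter_upwards [hf.coeFn_toLp] with x hx
  simp [hx]

theorem norm_jet_sq (hω : IsOpen ω) (u : H1 ω) :
    ‖jet hω u‖ ^ 2 = (∫ x in ω, u.1 x ^ 2) + ∫ x in ω, ‖wgrad ω u.1 x‖ ^ 2 := by
  rw [WithLp.prod_norm_sq_eq_of_L2]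
  rw [jet_fst, jet_snd, norm_toLp_sq, norm_toLp_sq]
  simp

/-- The embedding `jet` into a Hilbert space supplies the triangle inequality, homogeneity and,
since its range is closed, completeness. -/
theorem normH1_eq_norm_jet (hω : IsOpen ω) (hu : MemH1 ω u) :
    normH1 ω u = ‖jet hω ⟨u, hu⟩‖ := by
  rw [normH1, ← norm_jet_sq hω ⟨u, hu⟩, Real.sqrt_sq (norm_nonneg _)]

theorem normH1_nonneg : 0 ≤ normH1 ω u := Real.sqrt_nonneg _

theorem normH1_sq (u : Space d → ℝ) :
    normH1 ω u ^ 2 = (∫ x in ω, u x ^ 2) + ∫ x in ω, ‖wgrad ω u x‖ ^ 2 :=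
  Real.sq_sqrt (add_nonneg (integral_nonneg fun _ => sq_nonneg _)
    (integral_nonneg fun _ => sq_nonneg _))

theorem SobolevPair.normH1_sq (hω : IsOpen ω) (h : SobolevPair ω u G) :
    normH1 ω u ^ 2 = (∫ x in ω, u x ^ 2) + ∫ x in ω, ‖G x‖ ^ 2 := by
  rw [MSGFEM.normH1_sq]
  congr 1
  refine integral_congr_ae ?_
  filter_upwards [h.wgrad_ae_eq hω] with x hx
  rw [hx]

theorem normH1_add_le (hω : IsOpen ω) (hu : MemH1 ω u) (hv : MemH1 ω v) :
    normH1 ω (u + v) ≤ normH1 ω u + normH1 ω v := by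
  rw [normH1_eq_norm_jet hω hu, normH1_eq_norm_jet hω hv, normH1_eq_norm_jet hω (hu.add hv)]
  have : jet hω ⟨u + v, hu.add hv⟩ = jet hω ⟨u, hu⟩ + jet hω ⟨v, hv⟩ := by
    rw [← map_add]; rfl
  rw [this]
  exact norm_add_le _ _

theorem normH1_smul (hω : IsOpen ω) (c : ℝ) (hu : MemH1 ω u) :
    normH1 ω (c • u) = |c| * normH1 ω u := by
  rw [normH1_eq_norm_jet hω hu, normH1_eq_norm_jet hω (hu.smul c)]
  have : jet hω ⟨c • u, hu.smul c⟩ = c • jet hω ⟨u, hu⟩ := by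
    rw [← map_smul]; rfl
  rw [this, norm_smul, Real.norm_eq_abs]

theorem normH1_sub_le (hω : IsOpen ω) (hu : MemH1 ω u) (hv : MemH1 ω v) :
    normH1 ω (u - v) ≤ normH1 ω u + normH1 ω v := by
  have := normH1_add_le hω hu (hv.smul (-1))
  rw [normH1_smul hω _ hv] at this
  simpa [sub_eq_add_neg] using this

theorem normH1_congr (hω : IsOpen ω) (hu : MemH1 ω u) (h : u =ᵐ[volume.restrict ω] v) :
    normH1 ω v = normH1 ω u := by
  have h' := wgrad_congr hω hu h
  rw [normH1, normH1]
  congr 2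
  · refine integral_congr_ae ?_
    filter_upwards [h] with x hx
    rw [hx]
  · refine integral_congr_ae ?_
    filter_upwards [h'] with x hx
    rw [hx]

theorem normH1_mono (hω : IsOpen ω) (h : ω ⊆ ω') (hu : MemH1 ω' u) :
    normH1 ω u ≤ normH1 ω' u := by
  refine le_of_sq_le_sq ?_ normH1_nonneg
  rw [(hu.sobolevPair.mono h).normH1_sq hω, MSGFEM.normH1_sq]
  refine add_le_add ?_ ?_
  · exact setIntegral_mono_set hu.1.integrable_sq (ae_of_all _ fun _ => sq_nonneg _)
      (Eventually.of_forall h)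
  · exact setIntegral_mono_set hu.sobolevPair.memLp_grad.norm.integrable_sq
      (ae_of_all _ fun _ => sq_nonneg _) (Eventually.of_forall h)

theorem integral_sq_le_normH1_sq : ∫ x in ω, u x ^ 2 ≤ normH1 ω u ^ 2 := by
  rw [MSGFEM.normH1_sq]
  exact le_add_of_nonneg_right (integral_nonneg fun _ => sq_nonneg _)

theorem integral_wgrad_sq_le_normH1_sq : ∫ x in ω, ‖wgrad ω u x‖ ^ 2 ≤ normH1 ω u ^ 2 := by
  rw [MSGFEM.normH1_sq]
  exact le_add_of_nonneg_left (integral_nonneg fun _ => sq_nonneg _)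

/-- The set of pairs `(u, ∇u)` is closed in `L²(ω) × L²(ω; ℝ^d)`. -/
theorem sobolevPair_of_tendsto (hω : IsOpen ω) {ι : Type*} {l : Filter ι} [l.NeBot]
    {w : ι → H1 ω} {z : L2Pair ω} (h : Tendsto (fun j => jet hω (w j)) l (𝓝 z)) :
    SobolevPair ω z.fst z.snd := by
  refine ⟨Lp.memLp _, Lp.memLp _, fun φ hφ hc hs i => ?_⟩
  have hd := memLp_fderiv_single hφ hc i 2 (volume.restrict ω)
  have hl : MemLp (fun x => φ x • (EuclideanSpace.single i 1 : Space d)) 2 (volume.restrict ω) :=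
    (hφ.continuous.smul continuous_const).memLp_of_hasCompactSupport
      (hc.smul_right (f' := fun _ => (EuclideanSpace.single i 1 : Space d)))
  have h1 : Tendsto (fun j => (jet hω (w j)).fst) l (𝓝 z.fst) :=
    ((WithLp.continuous_fst 2 _ _).tendsto z).comp h
  have h2 : Tendsto (fun j => (jet hω (w j)).snd) l (𝓝 z.snd) :=
    ((WithLp.continuous_snd 2 _ _).tendsto z).comp h
  -- Both sides of the weak gradient identity are inner products with fixed elements of L², so the
  -- identity survives the limit.
  have t1 := (tendsto_const_nhds (x := hd.toLp _)).inner (𝕜 := ℝ) h1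
  have t2 := (tendsto_const_nhds (x := hl.toLp _)).inner (𝕜 := ℝ) h2
  have e1 : ∀ U : Lp ℝ 2 (volume.restrict ω : Measure (Space d)), inner ℝ (hd.toLp _) U =
      ∫ x in ω, U x * fderiv ℝ φ x (EuclideanSpace.single i 1) := by
    intro U
    rw [L2.inner_def]
    refine integral_congr_ae ?_
    filter_upwards [hd.coeFn_toLp] with x hx
    simp [hx]
  have e2 : ∀ U : Lp (Space d) 2 (volume.restrict ω : Measure (Space d)), inner ℝ (hl.toLp _) U =
      ∫ x in ω, U x i * φ x := by
    intro U
    rw [L2.inner_def]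
    refine integral_congr_ae ?_
    filter_upwards [hl.coeFn_toLp] with x hx
    rw [hx, inner_smul_left, EuclideanSpace.inner_single_left]
    simp [mul_comm]
  have e3 : ∀ j, inner ℝ (hd.toLp _) (jet hω (w j)).fst = -inner ℝ (hl.toLp _) (jet hω (w j)).snd := by
    intro j
    have hp : SobolevPair ω (jet hω (w j)).fst (jet hω (w j)).snd :=
      (mem_H1.1 (w j).2).sobolevPair.congr
        (MemLp.coeFn_toLp (mem_H1.1 (w j).2).sobolevPair.memLp).symm
        (MemLp.coeFn_toLp (mem_H1.1 (w j).2).sobolevPair.memLp_grad).symm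
    rw [e1, e2, hp.weak φ hφ hc hs i]
  have := tendsto_nhds_unique t1 ((t2.neg).congr fun j => (e3 j).symm)
  rwa [e1, e2] at this

/-- `H¹(ω)` is complete. -/
theorem exists_tendsto_of_cauchy (hω : IsOpen ω) {ι : Type*} {l : Filter ι} [l.NeBot]
    {w : ι → Space d → ℝ} (hw : ∀ j, MemH1 ω (w j))
    (h : Tendsto (fun p : ι × ι => normH1 ω (w p.1 - w p.2)) (l ×ˢ l) (𝓝 0)) :
    ∃ u, MemH1 ω u ∧ Tendsto (fun j => normH1 ω (w j - u)) l (𝓝 0) := by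
  have hcau : Cauchy (map (fun j => jet hω ⟨w j, hw j⟩) l) := by
    rw [cauchy_map_iff, Metric.uniformity_eq_comap_nhds_zero, tendsto_comap_iff]
    refine ⟨‹_›, h.congr fun p => ?_⟩
    rw [normH1_eq_norm_jet hω ((hw _).sub (hw _))]
    simp only [Function.comp, dist_eq_norm, ← map_sub]
    rfl
  obtain ⟨z, hz⟩ := cauchy_iff_exists_le_nhds.1 hcau
  have hz' : Tendsto (fun j => jet hω ⟨w j, hw j⟩) l (𝓝 z) := hz
  have hp := sobolevPair_of_tendsto hω hz'
  refine ⟨z.fst, hp.memH1, ?_⟩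
  -- The second component of the limit is a weak gradient of the first, hence equals the chosen one
  -- almost everywhere.
  have hj : jet hω ⟨z.fst, hp.memH1⟩ = z := by
    apply (WithLp.equiv 2 _).injective
    refine Prod.ext ?_ ?_
    · exact Lp.toLp_coeFn _ hp.memLp
    · have : (jet hω ⟨z.fst, hp.memH1⟩).snd = hp.memLp_grad.toLp _ :=
        MemLp.toLp_congr hp.memH1.sobolevPair.memLp_grad hp.memLp_grad (hp.wgrad_ae_eq hω)
      exact this.trans (Lp.toLp_coeFn _ hp.memLp_grad)
  have := (tendsto_iff_norm_sub_tendsto_zero.1 hz')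
  refine this.congr fun j => ?_
  rw [normH1_eq_norm_jet hω ((hw _).sub hp.memH1)]
  nth_rw 1 [← hj]
  rw [← map_sub]
  rfl

end MSGFEM

namespace MSGFEM

variable {d : ℕ} {ω ω' : Set (Space d)} {u v f : Space d → ℝ} {G H : Space d → Space d}

/-! ### Mollification -/

/-- Translation is continuous in `L²`. -/
theorem exists_eLpNorm_translate_lt (hf : MemLp f 2 volume) {η : ℝ≥0∞} (hη : 0 < η) :
    ∃ δ > 0, ∀ t : Space d, ‖t‖ < δ → eLpNorm (fun x => f (x - t) - f x) 2 volume < η := by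
  -- Translations form a continuous family of measure preserving maps, and composition with such a
  -- family is continuous in L².
  let g : C(Space d, C(Space d, Space d)) := (ContinuousMap.mk (fun a : Space d × Space d =>
    a.2 - a.1) (continuous_snd.sub continuous_fst)).curry
  have hg : ∀ t, MeasurePreserving (g t) volume volume := fun t =>
    measurePreserving_sub_right volume t
  have hc : Continuous fun t => Lp.compMeasurePreserving (g t) (hg t) (hf.toLp f) :=
    continuous_const.compMeasurePreservingLp g.continuous hg (by norm_num)
  have h0 : Tendsto (fun t => Lp.compMeasurePreserving (g t) (hg t) (hf.toLp f)) (𝓝 0)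
      (𝓝 (hf.toLp f)) := by
    have := hc.tendsto 0
    have e : Lp.compMeasurePreserving (g 0) (hg 0) (hf.toLp f) = hf.toLp f := by
      apply Lp.ext
      refine (Lp.coeFn_compMeasurePreserving _ _).trans ?_
      have : (g 0 : Space d → Space d) = id := by ext1 x; simp [g]
      rw [this]
      rfl
    rwa [e] at this
  have h1 := EMetric.tendsto_nhds.1 h0 η hη
  obtain ⟨δ, hδ, h2⟩ := Metric.eventually_nhds_iff.1 h1
  refine ⟨δ, hδ, fun t ht => ?_⟩
  have h3 := h2 (y := t) (by simpa using ht)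
  rw [Lp.toLp_compMeasurePreserving hf (hg t), Lp.edist_toLp_toLp] at h3
  exact h3

/-- The convolution of `f` with a normalized bump function. -/
noncomputable def mollify {c : Space d} (b : ContDiffBump c) (f : Space d → ℝ) (x : Space d) : ℝ :=
  ∫ t, b.normed volume t * f (x - t)

variable {c : Space d} (b : ContDiffBump c)

theorem mollify_eq_convolution (f : Space d → ℝ) :
    mollify b f = convolution (b.normed volume) f (ContinuousLinearMap.lsmul ℝ ℝ) volume := rfl

theorem contDiff_mollify (hf : LocallyIntegrable f) :
    ContDiff ℝ ((⊤ : ℕ∞) : WithTop ℕ∞) (mollify b f) := by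
  rw [mollify_eq_convolution]
  exact b.hasCompactSupport_normed.contDiff_convolution_left _ b.contDiff_normed hf

theorem hasCompactSupport_mollify (hf : HasCompactSupport f) :
    HasCompactSupport (mollify b f) := by
  rw [mollify_eq_convolution]
  exact (b.hasCompactSupport_normed (μ := volume)).convolution _ hf

theorem normed_eq_zero {t : Space d} (ht : t ∉ Metric.closedBall c b.rOut) :
    b.normed volume t = 0 := by
  rw [← b.tsupport_normed_eq (μ := volume)] at ht
  exact image_eq_zero_of_notMem_tsupport ht

theorem fderiv_normed_eq_zero {t : Space d} (ht : t ∉ Metric.closedBall c b.rOut) :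
    fderiv ℝ (b.normed volume) t = 0 := by
  rw [← b.tsupport_normed_eq (μ := volume)] at ht
  exact image_eq_zero_of_notMem_tsupport fun h => ht (tsupport_fderiv_subset ℝ h)

theorem mollify_eq_swap (f : Space d → ℝ) (x : Space d) :
    mollify b f x = ∫ y, b.normed volume (x - y) * f y := by
  rw [mollify_eq_convolution, convolution_eq_swap]
  rfl

theorem fderiv_mollify_eq_swap (hf : LocallyIntegrable f) (x e : Space d) :
    fderiv ℝ (mollify b f) x e = ∫ y, fderiv ℝ (b.normed volume) (x - y) e * f y := by
  have h := (b.hasCompactSupport_normed (μ := volume)).hasFDerivAt_convolution_left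
    (ContinuousLinearMap.lsmul ℝ ℝ) (b.contDiff_normed (n := 1)) hf x (μ := volume)
  rw [mollify_eq_convolution, h.fderiv, convolution_eq_swap, ContinuousLinearMap.integral_apply]
  · rfl
  · have hc : HasCompactSupport (fderiv ℝ (b.normed volume)) :=
      (b.hasCompactSupport_normed (μ := volume)).fderiv ℝ
    have := hc.convolutionExists_left (L := (ContinuousLinearMap.lsmul ℝ ℝ).precompL (Space d))
      ((b.contDiff_normed (n := 1)).continuous_fderiv (by simp)) hf x
    exact this.integrable_swap

theorem mollify_eq_zero {x : Space d} (h : ∀ t ∈ Metric.closedBall c b.rOut, f (x - t) = 0) :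
    mollify b f x = 0 := by
  refine integral_eq_zero_of_ae (ae_of_all _ fun t => ?_)
  by_cases ht : t ∈ Metric.closedBall c b.rOut
  · simp [h t ht]
  · simp [normed_eq_zero b ht]

theorem fderiv_mollify_eq_zero (hf : LocallyIntegrable f) {x : Space d}
    (h : ∀ t ∈ Metric.closedBall c b.rOut, f (x - t) = 0) (e : Space d) :
    fderiv ℝ (mollify b f) x e = 0 := by
  rw [fderiv_mollify_eq_swap b hf]
  refine integral_eq_zero_of_ae (ae_of_all _ fun y => ?_)
  by_cases ht : x - y ∈ Metric.closedBall c b.rOut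
  · have := h _ ht
    rw [sub_sub_cancel] at this
    simp [this]
  · simp [fderiv_normed_eq_zero b ht]

/-- Mollification commutes with weak differentiation. -/
theorem SobolevPair.fderiv_mollify (hω : IsOpen ω) (h : SobolevPair ω u G)
    (hu : LocallyIntegrable (ω.indicator u)) {x : Space d}
    (hx : ∀ t ∈ Metric.closedBall c b.rOut, x - t ∈ ω) (i : Fin d) :
    fderiv ℝ (mollify b (ω.indicator u)) x (EuclideanSpace.single i 1) =
      mollify b (ω.indicator fun y => G y i) x := by
  -- The reflected kernel is itself an admissible test function on ω by `hx`. The sign from the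
  -- chain rule cancels the one in the definition of a weak gradient.
  set φ : Space d → ℝ := fun y => b.normed volume (x - y) with hφ
  have hφs : ContDiff ℝ ((⊤ : ℕ∞) : WithTop ℕ∞) φ :=
    b.contDiff_normed.comp (contDiff_const.sub contDiff_id)
  have hts : tsupport φ ⊆ (fun y => x - y) ⁻¹' Metric.closedBall c b.rOut := by
    rw [← b.tsupport_normed_eq (μ := volume)]
    exact tsupport_comp_subset_preimage (b.normed volume) (f := fun y => x - y)
      (continuous_const.sub continuous_id)
  have hφc : HasCompactSupport φ :=
    b.hasCompactSupport_normed.comp_homeomorph (Homeomorph.subLeft x)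
  have hφω : tsupport φ ⊆ ω := fun y hy => by
    have := hx _ (hts hy)
    rwa [sub_sub_cancel] at this
  have hd : ∀ y, fderiv ℝ φ y (EuclideanSpace.single i 1) =
      -fderiv ℝ (b.normed volume) (x - y) (EuclideanSpace.single i 1) := by
    intro y
    have h1 : HasFDerivAt (b.normed volume) (fderiv ℝ (b.normed volume) (x - y)) (x - y) :=
      (((b.contDiff_normed (n := 1)).differentiable (by simp)) _).hasFDerivAt
    have h2 : HasFDerivAt (fun y : Space d => x - y) (-(ContinuousLinearMap.id ℝ (Space d))) y :=
      (hasFDerivAt_id y).const_sub x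
    have h3 : HasFDerivAt φ ((fderiv ℝ (b.normed volume) (x - y)).comp
      (-(ContinuousLinearMap.id ℝ (Space d)))) y := h1.comp y h2
    rw [h3.fderiv]
    simp
  have hw := h.weak φ hφs hφc hφω i
  rw [fderiv_mollify_eq_swap b hu, mollify_eq_swap]
  have e1 : ∫ y, fderiv ℝ (b.normed volume) (x - y) (EuclideanSpace.single i 1) *
      ω.indicator u y = -∫ y in ω, u y * fderiv ℝ φ y (EuclideanSpace.single i 1) := by
    rw [← integral_indicator hω.measurableSet, ← integral_neg]
    congr 1
    ext y
    by_cases hy : y ∈ ω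
    · simp [hy, hd, mul_comm]
    · simp [hy]
  have e2 : ∫ y, b.normed volume (x - y) * ω.indicator (fun y => G y i) y =
      ∫ y in ω, G y i * φ y := by
    rw [← integral_indicator hω.measurableSet]
    congr 1
    ext y
    by_cases hy : y ∈ ω
    · simp [hy, hφ, mul_comm]
    · simp [hy]
  rw [e1, e2, hw, neg_neg]

theorem eLpNorm_two_sq {α F : Type*} [MeasurableSpace α] {μ : Measure α} [NormedAddCommGroup F]
    (f : α → F) : eLpNorm f 2 μ ^ 2 = ∫⁻ x, ‖f x‖ₑ ^ 2 ∂μ := by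
  rw [eLpNorm_eq_lintegral_rpow_enorm_toReal (by norm_num) (by norm_num), ← ENNReal.rpow_natCast,
    ← ENNReal.rpow_mul]
  norm_num

/-- The `L²` error of mollification is bounded by the `L²` modulus of continuity. -/
theorem eLpNorm_mollify_sub_le (hf : MemLp f 2 volume) {η : ℝ≥0∞}
    (h : ∀ t ∈ Metric.closedBall c b.rOut, eLpNorm (fun x => f (x - t) - f x) 2 volume ≤ η) :
    eLpNorm (mollify b f - f) 2 volume ≤ η := by
  -- A strongly measurable representative makes the integrand jointly measurable, as Tonelli
  -- requires.
  obtain ⟨g, hg, hfg⟩ := hf.1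
  have hk : Measurable (b.normed volume) := b.continuous_normed.measurable
  have hkint : ∫⁻ t, ENNReal.ofReal (b.normed volume t) = 1 := by
    rw [← ofReal_integral_eq_lintegral_ofReal b.integrable_normed
      (ae_of_all _ fun t => b.nonneg_normed t), b.integral_normed, ENNReal.ofReal_one]
  -- Mollification averages translates with respect to the probability measure P. Jensen's
  -- inequality, obtained from Hölder's with the constant 1, bounds the squared error by the
  -- averaged squared translation error; Tonelli finishes.
  set P : Measure (Space d) := volume.withDensity fun t => ENNReal.ofReal (b.normed volume t)
    with hP
  have hPp : IsProbabilityMeasure P := ⟨by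
    rw [hP, withDensity_apply _ MeasurableSet.univ, Measure.restrict_univ, hkint]⟩
  have hlP : ∀ F : Space d → ℝ≥0∞, Measurable F →
      ∫⁻ t, F t ∂P = ∫⁻ t, ENNReal.ofReal (b.normed volume t) * F t := by
    intro F hF
    rw [hP, lintegral_withDensity_eq_lintegral_mul _ hk.ennreal_ofReal hF]
    rfl
  have hgm : Measurable g := hg.measurable
  have hmol : mollify b f = mollify b g := by
    ext x
    rw [mollify_eq_swap, mollify_eq_swap]
    refine integral_congr_ae (hfg.mono fun y hy => ?_)
    simp only [hy]
  have hg2 : MemLp g 2 volume := hf.ae_eq hfg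
  have hgη : ∀ t ∈ Metric.closedBall c b.rOut,
      ∫⁻ x, ‖g (x - t) - g x‖ₑ ^ 2 ≤ η ^ 2 := by
    intro t ht
    rw [← eLpNorm_two_sq]
    refine pow_le_pow_left' ((le_of_eq ?_).trans (h t ht)) 2
    refine eLpNorm_congr_ae ?_
    have := (measurePreserving_sub_right volume t).quasiMeasurePreserving.ae_eq hfg
    filter_upwards [hfg, this] with x h1 h2
    simp only [Function.comp] at h2
    rw [h1, h2]
  have hpt : ∀ x, ‖mollify b g x - g x‖ₑ ^ 2 ≤ ∫⁻ t, ‖g (x - t) - g x‖ₑ ^ 2 ∂P := by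
    intro x
    have hm : Measurable fun t => ‖g (x - t) - g x‖ₑ := by fun_prop
    have hli : LocallyIntegrable g := hg2.locallyIntegrable (by norm_num)
    have hint : Integrable fun t => b.normed volume t * g (x - t) :=
      b.hasCompactSupport_normed.convolutionExists_left (ContinuousLinearMap.lsmul ℝ ℝ)
        b.continuous_normed hli x
    have e1 : mollify b g x - g x = ∫ t, b.normed volume t * (g (x - t) - g x) := by
      simp only [mul_sub]
      rw [integral_sub hint (b.integrable_normed.mul_const _), integral_mul_const,
        b.integral_normed, one_mul]
      rfl
    have e2 : ‖mollify b g x - g x‖ₑ ≤ ∫⁻ t, ‖g (x - t) - g x‖ₑ ∂P := by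
      rw [e1, hlP _ hm]
      refine (enorm_integral_le_lintegral_enorm _).trans (le_of_eq ?_)
      congr 1
      ext t
      rw [enorm_mul, Real.enorm_of_nonneg (b.nonneg_normed t)]
    have e3 : (∫⁻ t, ‖g (x - t) - g x‖ₑ ∂P) ≤ (∫⁻ t, ‖g (x - t) - g x‖ₑ ^ 2 ∂P) ^ (1 / 2 : ℝ) := by
      have := ENNReal.lintegral_mul_le_Lp_mul_Lq P
        (Real.HolderConjugate.two_two) hm.aemeasurable (aemeasurable_const (b := (1 : ℝ≥0∞)))
      simpa using this
    calc ‖mollify b g x - g x‖ₑ ^ 2 ≤ ((∫⁻ t, ‖g (x - t) - g x‖ₑ ^ 2 ∂P) ^ (1 / 2 : ℝ)) ^ 2 :=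
          pow_le_pow_left' (e2.trans e3) 2
      _ = _ := by
          rw [← ENNReal.rpow_natCast, ← ENNReal.rpow_mul]
          norm_num
  have key : eLpNorm (mollify b f - f) 2 volume ^ 2 ≤ η ^ 2 := by
    rw [eLpNorm_congr_ae (g := mollify b g - g) (by rw [hmol]; exact (ae_eq_refl _).sub hfg),
      eLpNorm_two_sq]
    calc ∫⁻ x, ‖(mollify b g - g) x‖ₑ ^ 2 ≤ ∫⁻ x, ∫⁻ t, ‖g (x - t) - g x‖ₑ ^ 2 ∂P :=
          lintegral_mono hpt
      _ = ∫⁻ t, ∫⁻ x, ‖g (x - t) - g x‖ₑ ^ 2 ∂volume ∂P := by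
          refine lintegral_lintegral_swap (Measurable.aemeasurable ?_)
          simp only [Function.uncurry_def]
          fun_prop
      _ = ∫⁻ t, ENNReal.ofReal (b.normed volume t) * ∫⁻ x, ‖g (x - t) - g x‖ₑ ^ 2 := by
          refine hlP _ ?_
          exact Measurable.lintegral_prod_right' (f := fun p : Space d × Space d =>
            ‖g (p.2 - p.1) - g p.2‖ₑ ^ 2) (by fun_prop)
      _ ≤ ∫⁻ t, ENNReal.ofReal (b.normed volume t) * η ^ 2 := by
          refine lintegral_mono fun t => ?_
          by_cases ht : t ∈ Metric.closedBall c b.rOut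
          · exact mul_le_mul_right (hgη t ht) _
          · simp [normed_eq_zero b ht]
      _ = η ^ 2 := by
          rw [lintegral_mul_const _ hk.ennreal_ofReal, hkint, one_mul]
  exact (ENNReal.pow_right_strictMono two_ne_zero).le_iff_le.1 key

end MSGFEM

namespace MSGFEM

variable {d : ℕ} {ω ω' : Set (Space d)} {u v f : Space d → ℝ} {G H : Space d → Space d}
  {ψ φ F : Space d → ℝ} {K K' : ℝ≥0}

/-! ### Lipschitz functions -/

theorem gradient_coord (ψ : Space d → ℝ) (x : Space d) (i : Fin d) :
    gradient ψ x i = fderiv ℝ ψ x (EuclideanSpace.single i 1) := by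
  rw [← inner_gradient_left, EuclideanSpace.inner_single_right]
  simp

theorem norm_gradient_le (hψ : LipschitzWith K ψ) (x : Space d) : ‖gradient ψ x‖ ≤ K := by
  rw [gradient, LinearIsometryEquiv.norm_map]
  exact norm_fderiv_le_of_lipschitz ℝ hψ

theorem measurable_gradient (ψ : Space d → ℝ) : Measurable (gradient ψ) :=
  ((InnerProductSpace.toDual ℝ (Space d)).symm.continuous.measurable).comp (measurable_fderiv ℝ ψ)

/-- By Rademacher's theorem the line derivatives, for which the integration by parts formula is
known, are almost everywhere values of the Fréchet derivative. -/
theorem integral_mul_fderiv_of_lipschitz (hφ : LipschitzWith K φ) (hψ : LipschitzWith K' ψ)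
    (hc : HasCompactSupport ψ) (e : Space d) :
    ∫ x, φ x * fderiv ℝ ψ x e = -∫ x, fderiv ℝ φ x e * ψ x := by
  have h := hφ.integral_lineDeriv_mul_eq (μ := volume) hψ hc e
  have e1 : ∫ x, fderiv ℝ φ x e * ψ x = ∫ x, lineDeriv ℝ φ x e * ψ x :=
    integral_congr_ae (hφ.ae_differentiableAt.mono fun x hx => by
      simp only [hx.lineDeriv_eq_fderiv])
  have e2 : ∫ x, φ x * fderiv ℝ ψ x e = -∫ x, lineDeriv ℝ ψ x (-e) * φ x := by
    rw [← integral_neg]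
    refine integral_congr_ae (hψ.ae_differentiableAt.mono fun x hx => ?_)
    simp only [hx.lineDeriv_eq_fderiv, map_neg]
    ring
  rw [e1, e2, h]

theorem abs_sub_le_of_lipschitz (hψ : LipschitzWith K ψ) (x y : Space d) :
    |ψ x - ψ y| ≤ K * ‖x - y‖ := by
  have := hψ.dist_le_mul x y
  rwa [Real.dist_eq, dist_eq_norm] at this

theorem exists_lipschitzWith_of_abs_sub_le {C : ℝ} (h : ∀ x y, |ψ x - ψ y| ≤ C * ‖x - y‖) :
    ∃ K : ℝ≥0, LipschitzWith K ψ := by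
  refine ⟨C.toNNReal, LipschitzWith.of_dist_le_mul fun x y => ?_⟩
  rw [Real.dist_eq, dist_eq_norm]
  exact (h x y).trans (mul_le_mul_of_nonneg_right (Real.le_coe_toNNReal C) (norm_nonneg _))

theorem exists_lipschitzWith_mul_of_bounded {M M' : ℝ} (hφ : LipschitzWith K φ)
    (hψ : LipschitzWith K' ψ) (hM : ∀ x, |φ x| ≤ M) (hM' : ∀ x, |ψ x| ≤ M') :
    ∃ L : ℝ≥0, LipschitzWith L (φ * ψ) := by
  refine exists_lipschitzWith_of_abs_sub_le (C := M * K' + M' * K) fun x y => ?_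
  have e : (φ * ψ) x - (φ * ψ) y = φ x * (ψ x - ψ y) + ψ y * (φ x - φ y) := by
    simp only [Pi.mul_apply]; ring
  rw [e]
  refine (abs_add_le _ _).trans ?_
  rw [abs_mul, abs_mul]
  have h1 := mul_le_mul (hM x) (abs_sub_le_of_lipschitz hψ x y) (abs_nonneg _)
    ((abs_nonneg _).trans (hM x))
  have h2 := mul_le_mul (hM' y) (abs_sub_le_of_lipschitz hφ x y) (abs_nonneg _)
    ((abs_nonneg _).trans (hM' y))
  linarith

theorem exists_bound_of_hasCompactSupport (hψ : Continuous ψ) (hc : HasCompactSupport ψ) :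
    ∃ M : ℝ, 0 ≤ M ∧ ∀ x, |ψ x| ≤ M := by
  obtain ⟨M, hM⟩ := hc.exists_bound_of_continuous hψ
  exact ⟨M, (norm_nonneg _).trans (hM 0), hM⟩

/-- Truncating φ at its bound on the support of ψ does not change the product, so both factors may
be taken bounded. -/
theorem exists_lipschitzWith_mul (hφ : LipschitzWith K φ) (hψ : LipschitzWith K' ψ)
    (hc : HasCompactSupport ψ) : ∃ L : ℝ≥0, LipschitzWith L (φ * ψ) := by
  obtain ⟨M', -, hM'⟩ := exists_bound_of_hasCompactSupport hψ.continuous hc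
  obtain ⟨M, hM⟩ := hc.isCompact.exists_bound_of_continuousOn hφ.continuous.continuousOn
  set M₁ := max M 0
  have hφ₁ : LipschitzWith K fun x => max (-M₁) (min M₁ (φ x)) :=
    (hφ.const_min M₁).const_max (-M₁)
  have e : φ * ψ = (fun x => max (-M₁) (min M₁ (φ x))) * ψ := by
    ext x
    by_cases hx : x ∈ tsupport ψ
    · have h1 := abs_le.1 ((hM x hx).trans (le_max_left M 0))
      simp only [Pi.mul_apply]
      rw [min_eq_right h1.2, max_eq_right h1.1]
    · simp [image_eq_zero_of_notMem_tsupport hx]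
  rw [e]
  refine exists_lipschitzWith_mul_of_bounded hφ₁ hψ (M := M₁) (M' := M') (fun x => ?_) hM'
  have h0 : 0 ≤ M₁ := le_max_right _ _
  exact abs_le.2 ⟨le_max_left _ _, max_le (by linarith) (min_le_left _ _)⟩

theorem memLp_of_lipschitz (hω : IsOpen ω) (hb : Bornology.IsBounded ω) (hψ : LipschitzWith K ψ)
    (p : ℝ≥0∞) : MemLp ψ p (volume.restrict ω) := by
  have : IsFiniteMeasure (volume.restrict ω : Measure (Space d)) := ⟨by
    simpa using hb.measure_lt_top⟩
  obtain ⟨M, hM⟩ := hb.isCompact_closure.exists_bound_of_continuousOn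
    hψ.continuous.continuousOn
  exact MemLp.of_bound hψ.continuous.aestronglyMeasurable M
    (ae_restrict_of_forall_mem hω.measurableSet fun x hx => hM x (subset_closure hx))

theorem memLp_gradient_of_lipschitz (hb : Bornology.IsBounded ω) (hψ : LipschitzWith K ψ)
    (p : ℝ≥0∞) : MemLp (gradient ψ) p (volume.restrict ω) := by
  have : IsFiniteMeasure (volume.restrict ω : Measure (Space d)) := ⟨by
    simpa using hb.measure_lt_top⟩
  exact MemLp.of_bound (measurable_gradient ψ).aestronglyMeasurable K
    (ae_of_all _ fun x => norm_gradient_le hψ x)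

/-- A Lipschitz function belongs to `H¹(ω)`. -/
theorem sobolevPair_of_lipschitz (hω : IsOpen ω) (hb : Bornology.IsBounded ω)
    (hψ : LipschitzWith K ψ) : SobolevPair ω ψ (gradient ψ) := by
  refine ⟨memLp_of_lipschitz hω hb hψ 2, memLp_gradient_of_lipschitz hb hψ 2,
    fun φ hφ hc hs i => ?_⟩
  obtain ⟨C, hC⟩ := hφ.lipschitzWith_of_hasCompactSupport hc (by simp)
  rw [setIntegral_eq_integral_of_forall_compl_eq_zero fun x hx => ?_,
    setIntegral_eq_integral_of_forall_compl_eq_zero fun x hx => ?_,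
    integral_mul_fderiv_of_lipschitz hψ hC hc]
  · simp only [gradient_coord]
  · simp [test_eq_zero hs hx]
  · simp [fderiv_test_eq_zero hs hx]

theorem memH1_of_lipschitz (hω : IsOpen ω) (hb : Bornology.IsBounded ω)
    (hψ : LipschitzWith K ψ) : MemH1 ω ψ := (sobolevPair_of_lipschitz hω hb hψ).memH1

theorem integral_sq_eq_toReal {α F : Type*} [MeasurableSpace α] {μ : Measure α}
    [NormedAddCommGroup F] [InnerProductSpace ℝ F] {f : α → F} (hf : MemLp f 2 μ) :
    ∫ x, ‖f x‖ ^ 2 ∂μ = (eLpNorm f 2 μ).toReal ^ 2 := by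
  rw [← norm_toLp_sq hf, Lp.norm_toLp]

theorem integral_sq_le_of_eLpNorm_le {α : Type*} [MeasurableSpace α] {μ : Measure α}
    {f : α → ℝ} (hf : MemLp f 2 μ) {κ : ℝ} (hκ : 0 ≤ κ) (h : eLpNorm f 2 μ ≤ ENNReal.ofReal κ) :
    ∫ x, f x ^ 2 ∂μ ≤ κ ^ 2 := by
  have := integral_sq_eq_toReal hf
  simp only [Real.norm_eq_abs, sq_abs] at this
  rw [this]
  refine pow_le_pow_left₀ ENNReal.toReal_nonneg ?_ 2
  exact ENNReal.toReal_le_of_le_ofReal hκ h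

/-- The Cauchy-Schwarz inequality in `L²`. -/
theorem abs_integral_mul_le {α : Type*} [MeasurableSpace α] {μ : Measure α} {f g : α → ℝ}
    (hf : MemLp f 2 μ) (hg : MemLp g 2 μ) :
    |∫ x, f x * g x ∂μ| ≤ √(∫ x, f x ^ 2 ∂μ) * √(∫ x, g x ^ 2 ∂μ) := by
  have h := norm_inner_le_norm (𝕜 := ℝ) (hf.toLp f) (hg.toLp g)
  have e : inner ℝ (hf.toLp f) (hg.toLp g) = ∫ x, f x * g x ∂μ := by
    rw [L2.inner_def]
    refine integral_congr_ae ?_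
    filter_upwards [hf.coeFn_toLp, hg.coeFn_toLp] with x h1 h2
    simp [h1, h2, mul_comm]
  have n : ∀ {k : α → ℝ} (hk : MemLp k 2 μ), ‖hk.toLp k‖ = √(∫ x, k x ^ 2 ∂μ) := by
    intro k hk
    rw [← Real.sqrt_sq (norm_nonneg (hk.toLp k)), norm_toLp_sq]
    simp
  rwa [e, n hf, n hg, Real.norm_eq_abs] at h

theorem SobolevPair.memLp_indicator (hω : IsOpen ω) (h : SobolevPair ω u G) :
    MemLp (ω.indicator u) 2 volume := (memLp_indicator_iff_restrict hω.measurableSet).2 h.memLp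

theorem SobolevPair.memLp_indicator_coord (hω : IsOpen ω) (h : SobolevPair ω u G) (i : Fin d) :
    MemLp (ω.indicator fun x => G x i) 2 volume :=
  (memLp_indicator_iff_restrict hω.measurableSet).2 (memLp_coord h.memLp_grad i)

theorem hasCompactSupport_indicator (hb : Bornology.IsBounded ω) (u : Space d → ℝ) :
    HasCompactSupport (ω.indicator u) :=
  HasCompactSupport.intro hb.isCompact_closure fun _ hx =>
    Set.indicator_of_notMem (fun h => hx (subset_closure h)) _

/-- Mollification with a small bump approximates `u` and its weak gradient in `L²`. -/
theorem SobolevPair.exists_mollify (hω : IsOpen ω) (h : SobolevPair ω u G) {κ : ℝ} (hκ : 0 < κ) :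
    ∃ δ > 0, ∀ (c : Space d) (b : ContDiffBump c), ‖c‖ + b.rOut < δ →
      eLpNorm (mollify b (ω.indicator u) - ω.indicator u) 2 volume ≤ ENNReal.ofReal κ ∧
      ∀ i, eLpNorm (mollify b (ω.indicator fun x => G x i) - ω.indicator fun x => G x i) 2
        volume ≤ ENNReal.ofReal κ := by
  have hκ' : 0 < ENNReal.ofReal κ := ENNReal.ofReal_pos.2 hκ
  obtain ⟨δ₀, hδ₀, h₀⟩ := exists_eLpNorm_translate_lt (h.memLp_indicator hω) hκ'
  choose δ₁ hδ₁ h₁ using fun i => exists_eLpNorm_translate_lt (h.memLp_indicator_coord hω i) hκ'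
  obtain ⟨δ, hδ, hδ0, hδi⟩ : ∃ δ > 0, δ ≤ δ₀ ∧ ∀ i, δ ≤ δ₁ i := by
    rcases isEmpty_or_nonempty (Fin d) with hd | hd
    · exact ⟨δ₀, hδ₀, le_rfl, fun i => (hd.false i).elim⟩
    · refine ⟨min δ₀ (Finset.univ.inf' Finset.univ_nonempty δ₁), lt_min hδ₀ ?_, min_le_left _ _,
        fun i => (min_le_right _ _).trans (Finset.inf'_le _ (Finset.mem_univ i))⟩
      exact (Finset.lt_inf'_iff _).2 fun i _ => hδ₁ i
  have hn : ∀ (c : Space d) (b : ContDiffBump c), ‖c‖ + b.rOut < δ →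
      ∀ t ∈ Metric.closedBall c b.rOut, ‖t‖ < δ := by
    intro c b hb t ht
    have h1 : ‖t - c‖ ≤ b.rOut := mem_closedBall_iff_norm.1 ht
    have h2 : ‖t‖ ≤ ‖t - c‖ + ‖c‖ := by simpa using norm_add_le (t - c) c
    linarith
  refine ⟨δ, hδ, fun c b hb => ⟨?_, fun i => ?_⟩⟩
  · exact eLpNorm_mollify_sub_le b (h.memLp_indicator hω) fun t ht =>
      (h₀ t ((hn c b hb t ht).trans_le hδ0)).le
  · exact eLpNorm_mollify_sub_le b (h.memLp_indicator_coord hω i) fun t ht =>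
      (h₁ i t ((hn c b hb t ht).trans_le (hδi i))).le

theorem lipschitz_mollify {c : Space d} (b : ContDiffBump c) (hb : Bornology.IsBounded ω)
    (h : LocallyIntegrable (ω.indicator u)) :
    ∃ K : ℝ≥0, LipschitzWith K (mollify b (ω.indicator u)) :=
  (contDiff_mollify b h).lipschitzWith_of_hasCompactSupport
    (hasCompactSupport_mollify b (hasCompactSupport_indicator hb u)) (by simp)

theorem memLp_fderiv_of_lipschitz (hψ : LipschitzWith K ψ) (hc : HasCompactSupport ψ)
    (e : Space d) : MemLp (fun x => fderiv ℝ ψ x e) 2 volume := by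
  have h1 : MemLp (fun x => fderiv ℝ ψ x e) 2 (volume.restrict (tsupport ψ)) := by
    have : IsFiniteMeasure (volume.restrict (tsupport ψ) : Measure (Space d)) := ⟨by
      simpa using hc.isCompact.measure_lt_top⟩
    refine MemLp.of_bound (measurable_fderiv_apply_const ℝ ψ e).aestronglyMeasurable (K * ‖e‖)
      (ae_of_all _ fun x => ?_)
    exact (fderiv ℝ ψ x).le_of_opNorm_le (norm_fderiv_le_of_lipschitz ℝ hψ) e
  have h2 := (memLp_indicator_iff_restrict (isClosed_tsupport ψ).measurableSet).2 h1
  refine h2.ae_eq (ae_of_all _ fun x => ?_)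
  by_cases hx : x ∈ tsupport ψ
  · simp [hx]
  · have : fderiv ℝ ψ x = 0 :=
      image_eq_zero_of_notMem_tsupport fun h => hx (tsupport_fderiv_subset ℝ h)
    simp [hx, this]

/-- Lipschitz functions with compact support may be used as test functions. -/
theorem SobolevPair.integral_mul_fderiv (hω : IsOpen ω) (hb : Bornology.IsBounded ω)
    (h : SobolevPair ω u G) (hψ : LipschitzWith K ψ) (hc : HasCompactSupport ψ)
    (hs : tsupport ψ ⊆ ω) (i : Fin d) :
    ∫ x in ω, u x * fderiv ℝ ψ x (EuclideanSpace.single i 1) = -∫ x in ω, G x i * ψ x := by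
  set ũ := ω.indicator u with hũ
  set g := ω.indicator fun x => G x i with hg
  set D : Space d → ℝ := fun x => fderiv ℝ ψ x (EuclideanSpace.single i 1) with hD
  have e1 : ∫ x in ω, u x * D x = ∫ x, ũ x * D x := by
    rw [← integral_indicator hω.measurableSet]
    congr 1; ext x
    by_cases hx : x ∈ ω <;> simp [hũ, hx]
  have e2 : ∫ x in ω, G x i * ψ x = ∫ x, g x * ψ x := by
    rw [← integral_indicator hω.measurableSet]
    congr 1; ext x
    by_cases hx : x ∈ ω <;> simp [hg, hx]
  rw [e1, e2, eq_neg_iff_add_eq_zero]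
  have hD2 : MemLp D 2 volume := memLp_fderiv_of_lipschitz hψ hc _
  have hψ2 : MemLp ψ 2 volume := hψ.continuous.memLp_of_hasCompactSupport hc
  have hu2 := h.memLp_indicator hω
  have hg2 := h.memLp_indicator_coord hω i
  have hul : LocallyIntegrable ũ := hu2.locallyIntegrable (by norm_num)
  have hgl : LocallyIntegrable g := hg2.locallyIntegrable (by norm_num)
  obtain ⟨r, hr, hrω⟩ := hc.isCompact.exists_cthickening_subset_open hω hs
  set C := √(∫ x, D x ^ 2) + √(∫ x, ψ x ^ 2) with hC
  have hC0 : 0 ≤ C := by positivity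
  -- For the mollified u the identity is integration by parts of Lipschitz functions. A kernel of
  -- radius below the distance r from the support of ψ to the complement lets mollification commute
  -- with the gradient there; the two replacement errors are at most κ in L².
  have key : ∀ κ > 0, |(∫ x, ũ x * D x) + ∫ x, g x * ψ x| ≤ κ * C := by
    intro κ hκ
    obtain ⟨δ, hδ, hmol⟩ := h.exists_mollify hω hκ
    have hm : 0 < min δ r := lt_min hδ hr
    let b : ContDiffBump (0 : Space d) := ⟨min δ r / 4, min δ r / 2, by linarith, by linarith⟩
    have hbo : b.rOut = min δ r / 2 := rfl
    obtain ⟨h1, h2⟩ := hmol 0 b (by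
      rw [norm_zero, zero_add, hbo]; linarith [min_le_left δ r])
    have h2 := h2 i
    obtain ⟨L, hL⟩ := lipschitz_mollify b hb hul
    have hJ2 : MemLp (mollify b ũ) 2 volume := hL.continuous.memLp_of_hasCompactSupport
      (hasCompactSupport_mollify b (hasCompactSupport_indicator hb u))
    have hJg2 : MemLp (mollify b g) 2 volume :=
      (contDiff_mollify b hgl).continuous.memLp_of_hasCompactSupport
        (hasCompactSupport_mollify b (hasCompactSupport_indicator hb _))
    have hibp := integral_mul_fderiv_of_lipschitz hL hψ hc (EuclideanSpace.single i 1)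
    have e3 : ∫ x, fderiv ℝ (mollify b ũ) x (EuclideanSpace.single i 1) * ψ x =
        ∫ x, mollify b g x * ψ x := by
      congr 1; ext x
      by_cases hx : x ∈ tsupport ψ
      · rw [h.fderiv_mollify b hω hul (fun t ht => hrω ?_) i]
        refine Metric.mem_cthickening_of_dist_le _ x _ _ hx ?_
        rw [mem_closedBall_zero_iff, hbo] at ht
        rw [dist_eq_norm, sub_sub_cancel_left, norm_neg]
        linarith [min_le_right δ r]
      · simp [image_eq_zero_of_notMem_tsupport hx]
    have e4 : (∫ x, ũ x * D x) + ∫ x, g x * ψ x =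
        -(∫ x, (mollify b ũ - ũ) x * D x) - ∫ x, (mollify b g - g) x * ψ x := by
      simp only [Pi.sub_apply, sub_mul]
      rw [integral_sub (integrable_mul_of_memLp_two hJ2 hD2) (integrable_mul_of_memLp_two hu2 hD2),
        integral_sub (integrable_mul_of_memLp_two hJg2 hψ2)
          (integrable_mul_of_memLp_two hg2 hψ2), ← e3, hibp]
      ring
    have b1 := abs_integral_mul_le (hJ2.sub hu2) hD2
    have b2 := abs_integral_mul_le (hJg2.sub hg2) hψ2
    have s1 : √(∫ x, (mollify b ũ - ũ) x ^ 2) ≤ κ :=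
      Real.sqrt_le_iff.2 ⟨hκ.le, integral_sq_le_of_eLpNorm_le (hJ2.sub hu2) hκ.le h1⟩
    have s2 : √(∫ x, (mollify b g - g) x ^ 2) ≤ κ :=
      Real.sqrt_le_iff.2 ⟨hκ.le, integral_sq_le_of_eLpNorm_le (hJg2.sub hg2) hκ.le h2⟩
    rw [e4]
    calc |-(∫ x, (mollify b ũ - ũ) x * D x) - ∫ x, (mollify b g - g) x * ψ x| ≤
        |∫ x, (mollify b ũ - ũ) x * D x| + |∫ x, (mollify b g - g) x * ψ x| := by
          refine (abs_sub _ _).trans (le_of_eq ?_)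
          rw [abs_neg]
      _ ≤ κ * √(∫ x, D x ^ 2) + κ * √(∫ x, ψ x ^ 2) :=
          add_le_add (b1.trans (mul_le_mul_of_nonneg_right s1 (Real.sqrt_nonneg _)))
            (b2.trans (mul_le_mul_of_nonneg_right s2 (Real.sqrt_nonneg _)))
      _ = κ * C := by rw [hC]; ring
  have h0 : Tendsto (fun κ : ℝ => κ * C) (𝓝[>] 0) (𝓝 0) := by
    have : Tendsto (fun κ : ℝ => κ * C) (𝓝 0) (𝓝 (0 * C)) := tendsto_id.mul_const C
    rw [zero_mul] at this
    exact this.mono_left nhdsWithin_le_nhds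
  have := ge_of_tendsto h0 (eventually_nhdsWithin_of_forall fun κ hκ => key κ hκ)
  exact abs_nonpos_iff.1 this

/-- The product rule for a bounded Lipschitz function and an `H¹` function. -/
theorem SobolevPair.mul_lipschitz (hω : IsOpen ω) (hb : Bornology.IsBounded ω)
    (h : SobolevPair ω u G) (hψ : LipschitzWith K ψ) {M : ℝ} (hM : ∀ x, |ψ x| ≤ M) :
    SobolevPair ω (ψ * u) (fun x => ψ x • G x + u x • gradient ψ x) := by
  have hψm : AEStronglyMeasurable ψ (volume.restrict ω) := hψ.continuous.aestronglyMeasurable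
  have hψi : MemLp ψ ∞ (volume.restrict ω) := memLp_top_of_bound hψm M (ae_of_all _ hM)
  have hgi : MemLp (gradient ψ) ∞ (volume.restrict ω) :=
    memLp_top_of_bound (measurable_gradient ψ).aestronglyMeasurable K
      (ae_of_all _ fun x => norm_gradient_le hψ x)
  have m1 : MemLp (fun x => ψ x • G x) 2 (volume.restrict ω) := h.memLp_grad.smul hψi
  have m2 : MemLp (fun x => u x • gradient ψ x) 2 (volume.restrict ω) := hgi.smul h.memLp
  refine ⟨h.memLp.mul hψi, m1.add m2, fun φ hφ hc hs i => ?_⟩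
  obtain ⟨C, hC⟩ := hφ.lipschitzWith_of_hasCompactSupport hc (by simp)
  -- The product rule results from testing u against ψφ, which is only Lipschitz; for this reason
  -- test functions were extended beyond the smooth ones.
  obtain ⟨L, hL⟩ := exists_lipschitzWith_mul hψ hC hc
  have hc' : HasCompactSupport (ψ * φ) := hc.mul_left
  have hs' : tsupport (ψ * φ) ⊆ ω := (tsupport_mul_subset_right).trans hs
  have key := h.integral_mul_fderiv hω hb hL hc' hs' i
  have hφ2 : MemLp φ 2 (volume.restrict ω) := memLp_test hφ.continuous hc _ _
  have hd2 : MemLp (fun x => ψ x * u x) 2 (volume.restrict ω) := h.memLp.mul hψi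
  have hdφ := memLp_fderiv_single hφ hc i 2 (volume.restrict ω)
  have hdi : ∀ᵐ x ∂(volume.restrict ω), u x * fderiv ℝ (ψ * φ) x (EuclideanSpace.single i 1) =
      ψ x * u x * fderiv ℝ φ x (EuclideanSpace.single i 1) + (u x • gradient ψ x) i * φ x := by
    filter_upwards [ae_restrict_of_ae hψ.ae_differentiableAt] with x hx
    have hx' : DifferentiableAt ℝ φ x := (hφ.differentiable (by simp)) x
    rw [fderiv_mul hx hx']
    simp only [_root_.add_apply, _root_.smul_apply, smul_eq_mul,
      PiLp.smul_apply, gradient_coord]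
    ring
  rw [integral_congr_ae hdi, integral_add (integrable_mul_of_memLp_two hd2 hdφ)
    (integrable_mul_of_memLp_two (memLp_coord m2 i) hφ2)] at key
  have e : ∫ x in ω, (ψ x • G x + u x • gradient ψ x) i * φ x =
      (∫ x in ω, G x i * (ψ * φ) x) + ∫ x in ω, (u x • gradient ψ x) i * φ x := by
    rw [← integral_add _ (integrable_mul_of_memLp_two (memLp_coord m2 i) hφ2)]
    · congr 1; ext x
      simp only [PiLp.add_apply, PiLp.smul_apply, smul_eq_mul, Pi.mul_apply]
      ring
    · have := integrable_mul_of_memLp_two (memLp_coord m1 i) hφ2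
      refine this.congr (ae_of_all _ fun x => ?_)
      simp only [PiLp.smul_apply, smul_eq_mul, Pi.mul_apply]
      ring
  rw [e]
  simp only [Pi.mul_apply]
  simp only [Pi.mul_apply] at key
  linarith

end MSGFEM

namespace MSGFEM

variable {d : ℕ} {ω ω' : Set (Space d)} {u v f : Space d → ℝ} {G H : Space d → Space d}
  {ψ φ F : Space d → ℝ} {K K' : ℝ≥0}

/-! ### Approximation by smooth functions -/

theorem integral_norm_sq_eq_sum {μ : Measure (Space d)} (hG : MemLp G 2 μ) :
    ∫ x, ‖G x‖ ^ 2 ∂μ = ∑ i, ∫ x, G x i ^ 2 ∂μ := by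
  rw [← integral_finsetSum _ fun i _ => (memLp_coord hG i).integrable_sq]
  congr 1; ext x
  rw [EuclideanSpace.norm_sq_eq]
  simp

/-- An `H¹(ω)` function that vanishes outside `S` is a limit in `H¹(ω)` of smooth functions, if
small translates of `ω ∩ S` keep inside `ω`. -/
theorem SobolevPair.exists_contDiff_of_translate (hω : IsOpen ω) (hb : Bornology.IsBounded ω)
    (h : SobolevPair ω u G) {S : Set (Space d)} (huS : ∀ x ∈ ω, x ∉ S → u x = 0)
    (hGS : ∀ x ∈ ω, x ∉ S → G x = 0)
    (htr : ∀ η > 0, ∃ (c : Space d) (r : ℝ), 0 < r ∧ ‖c‖ + r < η ∧ ∀ x ∈ ω,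
      (∀ t ∈ Metric.closedBall c r, x - t ∈ ω) ∨
      ∀ t ∈ Metric.closedBall c r, x - t ∈ ω → x - t ∉ S)
    {ε : ℝ} (hε : 0 < ε) :
    ∃ φ : Space d → ℝ, ContDiff ℝ ((⊤ : ℕ∞) : WithTop ℕ∞) φ ∧ HasCompactSupport φ ∧
      normH1 ω (φ - u) < ε := by
  -- The function and its d partial derivatives each contribute at most κ², and d + 1 < (d + 2)².
  set κ := ε / (d + 2) with hκdef
  have hd0 : (0 : ℝ) < d + 2 := by positivity
  have hκ : 0 < κ := by positivity
  obtain ⟨δ, hδ, hmol⟩ := h.exists_mollify hω hκ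
  obtain ⟨c, r, hr, hcr, hx⟩ := htr δ hδ
  let b : ContDiffBump c := ⟨r / 2, r, by linarith, by linarith⟩
  obtain ⟨h1, h2⟩ := hmol c b hcr
  have hu2 := h.memLp_indicator hω
  have hul : LocallyIntegrable (ω.indicator u) := hu2.locallyIntegrable (by norm_num)
  set J := mollify b (ω.indicator u) with hJ
  have hJs : ContDiff ℝ ((⊤ : ℕ∞) : WithTop ℕ∞) J := contDiff_mollify b hul
  have hJc : HasCompactSupport J := hasCompactSupport_mollify b (hasCompactSupport_indicator hb u)
  obtain ⟨L, hL⟩ := lipschitz_mollify b hb hul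
  refine ⟨J, hJs, hJc, ?_⟩
  have hp := (sobolevPair_of_lipschitz hω hb hL).sub h
  have hgrad : ∀ x ∈ ω, ∀ i, gradient J x i = mollify b (ω.indicator fun y => G y i) x := by
    intro x hxω i
    rw [gradient_coord]
    -- Either the kernel stays inside ω and mollification commutes with the gradient, or it only
    -- sees points where u and G vanish and both sides are zero.
    rcases hx x hxω with h' | h'
    · exact h.fderiv_mollify b hω hul h' i
    · rw [fderiv_mollify_eq_zero b hul, mollify_eq_zero]
      · intro t ht
        by_cases hm : x - t ∈ ω
        · simp [hm, hGS _ hm (h' t ht hm)]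
        · simp [hm]
      · intro t ht
        by_cases hm : x - t ∈ ω
        · simp [hm, huS _ hm (h' t ht hm)]
        · simp [hm]
  have hbound : ∀ (g k : Space d → ℝ), MemLp (fun x => g x - k x) 2 (volume.restrict ω) →
      eLpNorm (g - ω.indicator k) 2 volume ≤ ENNReal.ofReal κ →
      ∫ x in ω, (g x - k x) ^ 2 ≤ κ ^ 2 := by
    intro g k hm he
    refine integral_sq_le_of_eLpNorm_le hm hκ.le (le_trans ?_ he)
    refine (le_of_eq (eLpNorm_congr_ae ?_)).trans (eLpNorm_restrict_le (g - ω.indicator k) 2 volume ω)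
    filter_upwards [ae_restrict_mem hω.measurableSet] with x hxω
    simp [hxω]
  have b1 : ∫ x in ω, (J - u) x ^ 2 ≤ κ ^ 2 := hbound J u hp.memLp h1
  have b2 : ∀ i, ∫ x in ω, (gradient J - G) x i ^ 2 ≤ κ ^ 2 := by
    intro i
    have e : (fun x => (gradient J - G) x i) =ᵐ[volume.restrict ω]
        fun x => mollify b (ω.indicator fun y => G y i) x - G x i := by
      filter_upwards [ae_restrict_mem hω.measurableSet] with x hxω
      simp [hgrad x hxω i]
    rw [integral_congr_ae (g := fun x => (mollify b (ω.indicator fun y => G y i) x - G x i) ^ 2)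
      (e.mono fun x hx => congrArg (· ^ 2) hx)]
    exact hbound _ _ ((memLp_coord hp.memLp_grad i).ae_eq e) (h2 i)
  have hsq : normH1 ω (J - u) ^ 2 ≤ (d + 1) * κ ^ 2 := by
    rw [hp.normH1_sq hω, integral_norm_sq_eq_sum hp.memLp_grad]
    calc _ ≤ κ ^ 2 + ∑ _i : Fin d, κ ^ 2 := add_le_add b1 (Finset.sum_le_sum fun i _ => b2 i)
      _ = _ := by simp; ring
  have hκε : (d + 1) * κ ^ 2 < ε ^ 2 := by
    have : ε = κ * (d + 2) := by rw [hκdef]; field_simp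
    rw [this, mul_pow]
    have : (0 : ℝ) ≤ d := by positivity
    nlinarith [sq_nonneg κ, pow_pos hκ 2]
  exact lt_of_pow_lt_pow_left₀ 2 hε.le (hsq.trans_lt hκε)

/-- A version of a weak gradient that vanishes where the function does. -/
theorem SobolevPair.indicator_grad (hω : IsOpen ω) (h : SobolevPair ω u G) {S : Set (Space d)}
    (hS : IsClosed S) (huS : ∀ x ∈ ω, x ∉ S → u x = 0) : SobolevPair ω u (S.indicator G) := by
  refine h.congr (ae_eq_refl _) ?_
  have h0 : SobolevPair (ω \ S) u G := h.mono Set.sdiff_subset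
  -- On the open set ω \ S the function is zero, so 0 is a weak gradient there and uniqueness gives
  -- G = 0.
  have hop : IsOpen (ω \ S) := hω.sdiff hS
  have hz : (0 : Space d → ℝ) =ᵐ[volume.restrict (ω \ S)] u := by
    filter_upwards [ae_restrict_mem hop.measurableSet] with x hx
    simp [huS x hx.1 hx.2]
  have h1 : SobolevPair (ω \ S) u 0 := SobolevPair.zero.congr hz (ae_eq_refl _)
  have h2 := (ae_restrict_iff' hop.measurableSet).1 (h0.unique hop h1)
  refine (ae_restrict_iff' hω.measurableSet).2 (h2.mono fun x hx hxω => ?_)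
  by_cases hxS : x ∈ S
  · simp [hxS]
  · simpa [hxS] using hx ⟨hxω, hxS⟩

/-- A Lipschitz function with values in `[0, 1]` that equals `1` near `x` and vanishes away
from `x`. -/
noncomputable def bump (x : Space d) (r : ℝ) (y : Space d) : ℝ :=
  max 0 (min 1 (3 - 4 * dist y x / r))

theorem lipschitz_bump (x : Space d) {r : ℝ} (hr : 0 < r) :
    ∃ K : ℝ≥0, LipschitzWith K (bump x r) := by
  have h1 : LipschitzWith (4 / r).toNNReal fun y : Space d => 3 - 4 * dist y x / r := by
    refine LipschitzWith.of_dist_le_mul fun y z => ?_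
    rw [Real.dist_eq, Real.coe_toNNReal _ (by positivity)]
    have : 3 - 4 * dist y x / r - (3 - 4 * dist z x / r) = 4 / r * (dist z x - dist y x) := by ring
    rw [this, abs_mul, abs_of_nonneg (by positivity : 0 ≤ 4 / r), dist_comm y z]
    exact mul_le_mul_of_nonneg_left (abs_dist_sub_le z y x) (by positivity)
  exact ⟨_, (h1.const_min 1).const_max 0⟩

theorem bump_nonneg (x : Space d) (r : ℝ) (y : Space d) : 0 ≤ bump x r y := le_max_left _ _

theorem bump_le_one (x : Space d) (r : ℝ) (y : Space d) : bump x r y ≤ 1 :=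
  max_le zero_le_one (min_le_left _ _)

theorem abs_bump_le_one (x : Space d) (r : ℝ) (y : Space d) : |bump x r y| ≤ 1 := by
  rw [abs_of_nonneg (bump_nonneg x r y)]
  exact bump_le_one x r y

theorem bump_eq_one {x : Space d} {r : ℝ} (hr : 0 < r) {y : Space d} (h : dist y x ≤ r / 2) :
    bump x r y = 1 := by
  have : 1 ≤ 3 - 4 * dist y x / r := by
    have : 4 * dist y x / r ≤ 2 := by rw [div_le_iff₀ hr]; linarith
    linarith
  rw [bump, min_eq_left this, max_eq_right zero_le_one]

theorem bump_eq_zero {x : Space d} {r : ℝ} (hr : 0 < r) {y : Space d} (h : 3 * r / 4 ≤ dist y x) :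
    bump x r y = 0 := by
  have : 3 - 4 * dist y x / r ≤ 0 := by
    have : 3 ≤ 4 * dist y x / r := by rw [le_div_iff₀ hr]; linarith
    linarith
  rw [bump, max_eq_left ((min_le_right _ _).trans this)]

theorem tsupport_bump_subset (x : Space d) {r : ℝ} (hr : 0 < r) :
    tsupport (bump x r) ⊆ Metric.closedBall x (3 * r / 4) := by
  refine closure_minimal (fun y hy => ?_) Metric.isClosed_closedBall
  by_contra h
  exact hy (bump_eq_zero hr (le_of_lt (by simpa using h)))

theorem hasCompactSupport_bump (x : Space d) {r : ℝ} (hr : 0 < r) : HasCompactSupport (bump x r) :=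
  (isCompact_closedBall x (3 * r / 4)).of_isClosed_subset (isClosed_tsupport _)
    (tsupport_bump_subset x hr)

/-! ### Lipschitz charts -/

/-- The height above the graph of `γ` in the direction `e`. -/
noncomputable def height (e : Space d) (γ : Space d → ℝ) (y : Space d) : ℝ :=
  inner ℝ e y - γ (y - inner ℝ e y • e)

/-- `(e, γ, r)` is a chart of `Ω` near `x`. -/
structure IsChart (Ω : Set (Space d)) (x e : Space d) (γ : Space d → ℝ) (K : ℝ≥0) (r : ℝ) :
    Prop where
  norm_dir : ‖e‖ = 1
  lipschitz : LipschitzWith K γ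
  pos : 0 < r
  mem_iff : ∀ y ∈ Metric.ball x r, y ∈ Ω ↔ 0 < height e γ y

theorem IsLipschitzDomain.exists_isChart {Ω : Set (Space d)} (hΩ : IsLipschitzDomain Ω)
    {x : Space d} (hx : x ∈ frontier Ω) :
    ∃ (e : Space d) (γ : Space d → ℝ) (K : ℝ≥0) (r : ℝ), IsChart Ω x e γ K r := by
  obtain ⟨e, γ, K, r, he, hγ, hr, h⟩ := hΩ.localGraph x hx
  exact ⟨e, γ, K, r, he, hγ, hr, fun y hy => by rw [h y hy, height, sub_pos]⟩

section Chart

variable {Ω : Set (Space d)} {x e : Space d} {γ : Space d → ℝ} {r : ℝ}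

/-- Moving along `e` leaves the argument of γ unchanged. Everything transversal to the boundary
below uses this direction. -/
theorem height_add_smul (he : ‖e‖ = 1) (γ : Space d → ℝ) (y : Space d) (t : ℝ) :
    height e γ (y + t • e) = height e γ y + t := by
  have h1 : inner ℝ e (y + t • e) = inner ℝ e y + t := by
    rw [inner_add_right, inner_smul_right, real_inner_self_eq_norm_sq, he]; ring
  have h2 : y + t • e - (inner ℝ e y + t) • e = y - inner ℝ e y • e := by
    rw [add_smul]; abel
  rw [height, h1, h2, height]
  ring

theorem norm_sub_inner_smul_le (he : ‖e‖ = 1) (y : Space d) : ‖y - inner ℝ e y • e‖ ≤ ‖y‖ := by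
  have h : ‖y - inner ℝ e y • e‖ ^ 2 = ‖y‖ ^ 2 - inner ℝ e y ^ 2 := by
    rw [norm_sub_sq_real, inner_smul_right, norm_smul, he, real_inner_comm, Real.norm_eq_abs,
      mul_one, sq_abs]
    ring
  exact le_of_sq_le_sq (by rw [h]; nlinarith [sq_nonneg (inner ℝ e y)]) (norm_nonneg _)

theorem abs_height_sub_le (he : ‖e‖ = 1) (hγ : LipschitzWith K γ) (y z : Space d) :
    |height e γ y - height e γ z| ≤ (1 + K) * ‖y - z‖ := by
  have h1 : |inner ℝ e y - inner ℝ e z| ≤ ‖y - z‖ := by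
    rw [← inner_sub_right]
    have := abs_real_inner_le_norm e (y - z)
    rwa [he, one_mul] at this
  have h2 : |γ (y - inner ℝ e y • e) - γ (z - inner ℝ e z • e)| ≤ K * ‖y - z‖ := by
    refine (abs_sub_le_of_lipschitz hγ _ _).trans (mul_le_mul_of_nonneg_left ?_ K.2)
    have : y - inner ℝ e y • e - (z - inner ℝ e z • e) =
        (y - z) - inner ℝ e (y - z) • e := by
      rw [inner_sub_right, sub_smul]; abel
    rw [this]
    exact norm_sub_inner_smul_le he _
  have e1 : height e γ y - height e γ z = (inner ℝ e y - inner ℝ e z) -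
      (γ (y - inner ℝ e y • e) - γ (z - inner ℝ e z • e)) := by
    rw [height, height]; ring
  rw [e1]
  refine (abs_sub _ _).trans ?_
  linarith

theorem lipschitz_height (he : ‖e‖ = 1) (hγ : LipschitzWith K γ) :
    LipschitzWith (1 + K) (height e γ) :=
  LipschitzWith.of_dist_le_mul fun y z => by
    rw [Real.dist_eq, dist_eq_norm]
    exact_mod_cast abs_height_sub_le he hγ y z

/-- Points of negative height have a neighbourhood that misses Ω, while a point of height zero is
the limit of the points y + te of Ω as t decreases to 0. -/
theorem IsChart.mem_frontier_iff (h : IsChart Ω x e γ K r) (hΩ : IsOpen Ω) {y : Space d}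
    (hy : y ∈ Metric.ball x r) : y ∈ frontier Ω ↔ height e γ y = 0 := by
  have hcont := (lipschitz_height h.norm_dir h.lipschitz).continuous
  rw [hΩ.frontier_eq, Set.mem_sdiff, h.mem_iff y hy, not_lt]
  constructor
  · rintro ⟨hc, hle⟩
    by_contra hne
    have hlt : height e γ y < 0 := lt_of_le_of_ne hle hne
    have hnb : Metric.ball x r ∩ height e γ ⁻¹' Set.Iio 0 ∈ 𝓝 y :=
      inter_mem (Metric.isOpen_ball.mem_nhds hy)
        ((isOpen_Iio.preimage hcont).mem_nhds hlt)
    obtain ⟨z, ⟨hz1, hz2⟩, hzΩ⟩ := mem_closure_iff_nhds.1 hc _ hnb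
    have := (h.mem_iff z hz1).1 hzΩ
    exact absurd hz2 (not_lt.2 this.le)
  · intro h0
    refine ⟨?_, h0.le⟩
    have ht : Tendsto (fun t : ℝ => y + t • e) (𝓝[>] 0) (𝓝 y) := by
      have : Tendsto (fun t : ℝ => y + t • e) (𝓝 0) (𝓝 (y + (0 : ℝ) • e)) :=
        (continuous_const.add (continuous_id.smul continuous_const)).tendsto 0
      rw [zero_smul, add_zero] at this
      exact this.mono_left nhdsWithin_le_nhds
    refine mem_closure_of_tendsto ht ?_
    filter_upwards [ht (Metric.isOpen_ball.mem_nhds hy), self_mem_nhdsWithin] with t h1 h2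
    rw [h.mem_iff _ h1, height_add_smul h.norm_dir, h0, zero_add]
    exact h2

/-- Near a boundary point, small translates in the direction `e` stay inside. -/
theorem IsChart.exists_translate (h : IsChart Ω x e γ K r) {η : ℝ} (hη : 0 < η) :
    ∃ (c : Space d) (s : ℝ), 0 < s ∧ ‖c‖ + s < η ∧ ∀ y ∈ Ω,
      (∀ t ∈ Metric.closedBall c s, y - t ∈ Ω) ∨
      ∀ t ∈ Metric.closedBall c s, y - t ∈ Ω → y - t ∉ Metric.closedBall x (3 * r / 4) := by
  have hr := h.pos
  -- The shift has length τ and points upward after subtraction. The radius s satisfies (1 + K)s =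
  -- τ/2, so the height still grows by at least τ/2. Displacements are at most 3τ/2 ≤ 3r/32 < r/8:
  -- points within 7r/8 of x stay in the chart, and all others stay away from the ball of radius
  -- 3r/4.
  set τ := min η (r / 4) / 4 with hτ
  have hτ0 : 0 < τ := by have : 0 < min η (r / 4) := lt_min hη (by linarith); positivity
  have hτη : 4 * τ ≤ η := by rw [hτ]; linarith [min_le_left η (r / 4)]
  have hτr : 16 * τ ≤ r := by rw [hτ]; linarith [min_le_right η (r / 4)]
  have hK : (0 : ℝ) ≤ K := K.2
  set s := τ / (2 * (1 + K)) with hs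
  have hs0 : 0 < s := by positivity
  have hsτ : (1 + K) * s = τ / 2 := by rw [hs]; field_simp
  have hsτ' : s ≤ τ / 2 := by nlinarith
  have hc : ‖-(τ • e)‖ = τ := by rw [norm_neg, norm_smul, h.norm_dir, Real.norm_of_nonneg hτ0.le, mul_one]
  refine ⟨-(τ • e), s, hs0, by rw [hc]; linarith, fun y hy => ?_⟩
  have ht2 : ∀ t ∈ Metric.closedBall (-(τ • e)) s, ‖t‖ ≤ 3 / 2 * τ := by
    intro t ht
    have h1 : ‖t - -(τ • e)‖ ≤ s := mem_closedBall_iff_norm.1 ht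
    have h2 : ‖t‖ ≤ ‖t - -(τ • e)‖ + ‖-(τ • e)‖ := by simpa using norm_add_le (t - -(τ • e)) (-(τ • e))
    linarith
  by_cases hyr : dist y x < 7 * r / 8
  · left
    intro t ht
    have hb1 : y ∈ Metric.ball x r := by rw [Metric.mem_ball]; linarith
    have hb2 : y - t ∈ Metric.ball x r := by
      rw [Metric.mem_ball]
      have : dist (y - t) y = ‖t‖ := by rw [dist_eq_norm, sub_sub_cancel_left, norm_neg]
      linarith [dist_triangle (y - t) y x, ht2 t ht]
    rw [h.mem_iff _ hb2]
    have hpos := (h.mem_iff _ hb1).1 hy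
    have h1 : ‖t - -(τ • e)‖ ≤ s := mem_closedBall_iff_norm.1 ht
    have h2 := abs_height_sub_le h.norm_dir h.lipschitz (y - t) (y + τ • e)
    have h3 : y - t - (y + τ • e) = -(t - -(τ • e)) := by abel
    rw [h3, norm_neg, height_add_smul h.norm_dir] at h2
    have h4 := (abs_le.1 (h2.trans (mul_le_mul_of_nonneg_left h1 (by positivity)))).1
    linarith
  · right
    intro t ht _ hmem
    have : dist y (y - t) = ‖t‖ := by rw [dist_eq_norm, sub_sub_cancel]
    have h1 := dist_triangle y (y - t) x
    have h2 : dist (y - t) x ≤ 3 * r / 4 := hmem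
    linarith [ht2 t ht, not_lt.1 hyr]

end Chart

end MSGFEM

/-! ### Density of smooth functions on Lipschitz domains -/

namespace MSGFEM

variable {d : ℕ} {ω ω' Ω : Set (Space d)} {u v f : Space d → ℝ} {G H : Space d → Space d}
  {ψ φ F : Space d → ℝ} {K K' : ℝ≥0}

theorem MemH1.mul_lipschitz (hω : IsOpen ω) (hb : Bornology.IsBounded ω)
    (h : MemH1 ω u) (hψ : LipschitzWith K ψ) {M : ℝ} (hM : ∀ x, |ψ x| ≤ M) : MemH1 ω (ψ * u) :=
  (h.sobolevPair.mul_lipschitz hω hb hψ hM).memH1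

/-- If a ball around a point of `Ω` leaves `Ω`, then it meets the boundary. -/
theorem exists_mem_frontier_dist_lt {y z : Space d} {δ : ℝ} (hy : y ∈ Ω) (hz : z ∉ Ω)
    (h : dist z y < δ) : ∃ p ∈ frontier Ω, dist y p < δ := by
  have hδ : 0 < δ := dist_nonneg.trans_lt h
  have hc : IsPreconnected (Metric.ball y δ) := (convex_ball y δ).isPreconnected
  by_contra hcon
  push Not at hcon
  have hf : ∀ p ∈ Metric.ball y δ, p ∉ frontier Ω := fun p hp hpf =>
    absurd (by rw [dist_comm]; exact hp) (not_lt.2 (hcon p hpf))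
  have hcover : ∀ p ∈ Metric.ball y δ, p ∈ interior Ω ∨ p ∈ (closure Ω)ᶜ := by
    intro p hp
    by_contra hn
    rw [not_or, Set.notMem_compl_iff] at hn
    exact hf p hp ⟨hn.2, hn.1⟩
  have hyi : y ∈ interior Ω := (hcover y (Metric.mem_ball_self hδ)).resolve_right
    fun h' => h' (subset_closure hy)
  have hzi : z ∈ (closure Ω)ᶜ := (hcover z h).resolve_left fun h' => hz (interior_subset h')
  obtain ⟨p, -, hp1, hp2⟩ := hc (interior Ω) (closure Ω)ᶜ isOpen_interior
    isClosed_closure.isOpen_compl hcover ⟨y, Metric.mem_ball_self hδ, hyi⟩ ⟨z, h, hzi⟩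
  exact hp2 (subset_closure (interior_subset hp1))

/-- The boundary of a Lipschitz domain is covered by finitely many charts. -/
theorem IsLipschitzDomain.exists_atlas (hΩ : IsLipschitzDomain Ω) :
    ∃ (s : Finset (Space d)) (e : Space d → Space d) (γ : Space d → Space d → ℝ)
      (K : Space d → ℝ≥0) (r : Space d → ℝ) (δ : ℝ), 0 < δ ∧
      (∀ x ∈ s, IsChart Ω x (e x) (γ x) (K x) (r x)) ∧
      ∀ y, ∀ z ∈ frontier Ω, dist y z < δ → ∃ x ∈ s, dist y x < r x / 2 := by
  choose! e γ K r h using fun x (hx : x ∈ frontier Ω) => hΩ.exists_isChart hx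
  have hcpt : IsCompact (frontier Ω) :=
    hΩ.isBounded.isCompact_closure.of_isClosed_subset isClosed_frontier frontier_subset_closure
  -- Half radii are used because `bump x (r x)` equals one exactly where this cover needs it.
  obtain ⟨s, hs, hcov⟩ := hcpt.elim_nhds_subcover (fun x => Metric.ball x (r x / 2))
    fun x hx => Metric.ball_mem_nhds x (by linarith [(h x hx).pos])
  obtain ⟨δ, hδ, hsub⟩ := hcpt.exists_cthickening_subset_open
    (isOpen_biUnion fun x _ => Metric.isOpen_ball) hcov
  refine ⟨s, e, γ, K, r, δ, hδ, fun x hx => h x (hs x hx), fun y z hz hyz => ?_⟩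
  have := hsub (Metric.mem_cthickening_of_dist_le y z δ _ hz hyz.le)
  simpa using this

/-- `u` is a limit in `H¹(ω)` of smooth functions. -/
def IsSmoothLimit (ω : Set (Space d)) (u : Space d → ℝ) : Prop :=
  ∀ ε > 0, ∃ φ : Space d → ℝ, ContDiff ℝ ((⊤ : ℕ∞) : WithTop ℕ∞) φ ∧ HasCompactSupport φ ∧
    normH1 ω (φ - u) < ε

theorem memH1_of_contDiff (hω : IsOpen ω) (hb : Bornology.IsBounded ω)
    (hφ : ContDiff ℝ ((⊤ : ℕ∞) : WithTop ℕ∞) φ) (hc : HasCompactSupport φ) : MemH1 ω φ := by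
  obtain ⟨L, hL⟩ := hφ.lipschitzWith_of_hasCompactSupport hc (by simp)
  exact memH1_of_lipschitz hω hb hL

theorem IsSmoothLimit.add (hω : IsOpen ω) (hb : Bornology.IsBounded ω) (hu : MemH1 ω u)
    (hv : MemH1 ω v) (h : IsSmoothLimit ω u) (h' : IsSmoothLimit ω v) :
    IsSmoothLimit ω (u + v) := by
  intro ε hε
  obtain ⟨φ, h1, h2, h3⟩ := h (ε / 2) (by linarith)
  obtain ⟨ψ, k1, k2, k3⟩ := h' (ε / 2) (by linarith)
  refine ⟨φ + ψ, h1.add k1, h2.add k2, ?_⟩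
  have e : φ + ψ - (u + v) = (φ - u) + (ψ - v) := by abel
  rw [e]
  refine (normH1_add_le hω ((memH1_of_contDiff hω hb h1 h2).sub hu)
    ((memH1_of_contDiff hω hb k1 k2).sub hv)).trans_lt (by linarith)

/-- Smooth functions are dense in `H¹(Ω)` for a Lipschitz domain `Ω`. -/
theorem IsLipschitzDomain.isSmoothLimit (hΩ : IsLipschitzDomain Ω) (hu : MemH1 Ω u) :
    IsSmoothLimit Ω u := by
  obtain ⟨s, e, γ, K, r, δ, hδ, hchart, hcov⟩ := hΩ.exists_atlas
  have hop := hΩ.isOpen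
  have hb := hΩ.isBounded
  -- Induction on the set t of charts still to be treated; u vanishes on the half balls of all
  -- others. Splitting off `bump x (r x) * u`, which is approximated by shifted mollification in one
  -- chart, leaves a remainder that vanishes on the half ball of x as well.
  have key : ∀ t : Finset (Space d), t ⊆ s → ∀ u, MemH1 Ω u →
      (∀ y ∈ Ω, ∀ x ∈ s, x ∉ t → dist y x < r x / 2 → u y = 0) → IsSmoothLimit Ω u := by
    classical
    intro t
    induction t using Finset.induction_on with
    | empty =>
      intro _ u hu hz ε hε
      set S : Set (Space d) := {y | ∀ z ∈ frontier Ω, δ ≤ dist y z} with hS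
      have hScl : IsClosed S := by
        rw [hS]
        simp only [Set.ofPred_forall]
        exact isClosed_biInter fun z _ =>
          isClosed_le continuous_const (continuous_id.dist continuous_const)
      have huS : ∀ x ∈ Ω, x ∉ S → u x = 0 := by
        intro y hy hyS
        simp only [hS, Set.mem_ofPred_eq, not_forall, not_le] at hyS
        obtain ⟨z, hz', hyz⟩ := hyS
        obtain ⟨x, hx, hyx⟩ := hcov y z hz' hyz
        exact hz y hy x hx (by simp) hyx
      refine (hu.sobolevPair.indicator_grad hop hScl huS).exists_contDiff_of_translate hop hb huS
        (fun x _ hx => by simp [hx]) (fun η hη => ?_) hε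
      have hm : 0 < min η δ := lt_min hη hδ
      refine ⟨0, min η δ / 4, by linarith, by rw [norm_zero]; linarith [min_le_left η δ],
        fun y _ => ?_⟩
      -- With no charts left, u is supported in S, at distance at least δ from the boundary. A small
      -- ball that meets S lies in Ω, since otherwise the boundary would come too close.
      by_cases hex : ∃ t ∈ Metric.closedBall (0 : Space d) (min η δ / 4), y - t ∈ Ω ∧ y - t ∈ S
      · obtain ⟨t, ht, htΩ, htS⟩ := hex
        left
        intro t' ht'
        by_contra hn
        rw [mem_closedBall_zero_iff] at ht ht'
        have : dist (y - t') (y - t) < δ := by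
          rw [dist_eq_norm, sub_sub_sub_cancel_left]
          linarith [norm_sub_le t t', min_le_right η δ]
        obtain ⟨p, hp, hpd⟩ := exists_mem_frontier_dist_lt htΩ hn this
        exact absurd hpd (not_lt.2 (htS p hp))
      · right
        push Not at hex
        exact hex
    | insert x t hxt ih =>
      intro hts u hu hz
      have hxs : x ∈ s := hts (Finset.mem_insert_self x t)
      have hc := hchart x hxs
      obtain ⟨L, hL⟩ := lipschitz_bump x hc.pos
      have h1 : MemH1 Ω (bump x (r x) * u) := hu.mul_lipschitz hop hb hL (abs_bump_le_one x (r x))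
      have h2 : MemH1 Ω (u - bump x (r x) * u) := hu.sub h1
      have a1 : IsSmoothLimit Ω (bump x (r x) * u) := by
        intro ε hε
        have hS : ∀ y ∈ Ω, y ∉ Metric.closedBall x (3 * r x / 4) → (bump x (r x) * u) y = 0 := by
          intro y _ hy
          have : 3 * r x / 4 ≤ dist y x := by
            rw [Metric.mem_closedBall, not_le] at hy
            exact hy.le
          simp [bump_eq_zero hc.pos this]
        exact (h1.sobolevPair.indicator_grad hop Metric.isClosed_closedBall
          hS).exists_contDiff_of_translate hop hb hS (fun y _ hy => by simp only [Set.indicator_of_notMem hy])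
          (fun η hη => hc.exists_translate hη) hε
      have a2 : IsSmoothLimit Ω (u - bump x (r x) * u) := by
        refine ih ((Finset.subset_insert x t).trans hts) _ h2 fun y hy z hzs hzt hd => ?_
        by_cases hzx : z = x
        · subst hzx
          simp [bump_eq_one hc.pos hd.le]
        · have : u y = 0 := hz y hy z hzs (by simp [hzx, hzt]) hd
          simp [this]
      have := a1.add hop hb h1 h2 a2
      rwa [add_sub_cancel] at this
  exact key s subset_rfl u hu fun y _ x hx hxs => absurd hx hxs

end MSGFEM

namespace MSGFEM

/-! ### Surface integrals in a chart -/

/-- Orthonormal coordinates with last axis `e`. -/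
structure IsAxisParam {m : ℕ} (e : Space (m + 1)) (P : (Fin m → ℝ) →L[ℝ] Space (m + 1))
    (π : Space (m + 1) → (Fin m → ℝ)) : Prop where
  lipschitz : LipschitzWith 1 π
  proj : ∀ y (s : ℝ), π (P y + s • e) = y
  inner_dir : ∀ y (s : ℝ), inner ℝ e (P y + s • e) = s
  param : ∀ x, P (π x) = x - inner ℝ e x • e
  preserving : MeasurePreserving (fun p : ℝ × (Fin m → ℝ) => P p.2 + p.1 • e)

/-- Complete `e` to an orthonormal basis, where it gets index 0. The parameter space carries the sup
norm, for which Hausdorff measure of dimension m is Lebesgue measure on the nose and π is still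
1-Lipschitz. -/
theorem exists_isAxisParam {m : ℕ} {e : Space (m + 1)} (he : ‖e‖ = 1) :
    ∃ P π, IsAxisParam e P π := by
  have hv : Orthonormal ℝ (({0} : Set (Fin (m + 1))).domRestrict fun _ => e) := by
    refine ⟨fun _ => he, fun i j hij => absurd (Subtype.ext ?_) hij⟩
    rw [Set.mem_singleton_iff.1 i.2, Set.mem_singleton_iff.1 j.2]
  obtain ⟨b, hb⟩ := hv.exists_orthonormalBasis_extension_of_card_eq (by simp)
  have hb0 : b 0 = e := hb 0 rfl
  have hin : ∀ i j, inner ℝ (b i) (b j) = if i = j then (1 : ℝ) else 0 :=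
    orthonormal_iff_ite.1 b.orthonormal
  let P₀ : (Fin m → ℝ) →ₗ[ℝ] Space (m + 1) :=
    ∑ j : Fin m, (LinearMap.proj j).smulRight (b j.succ)
  let P : (Fin m → ℝ) →L[ℝ] Space (m + 1) := LinearMap.toContinuousLinearMap P₀
  have hP : ∀ y, P y = ∑ j : Fin m, y j • b j.succ := fun y => by
    simp [P, P₀]
  let π : Space (m + 1) → (Fin m → ℝ) := fun x j => inner ℝ (b j.succ) x
  have hT : ∀ y (s : ℝ), P y + s • e = b.repr.symm (WithLp.toLp 2 (Fin.cons s y)) := by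
    intro y s
    rw [← b.sum_repr_symm, Fin.sum_univ_succ, hP, hb0]
    simp [add_comm (s • e)]
  refine ⟨P, π, ?_, ?_, ?_, ?_, ?_⟩
  · refine LipschitzWith.of_dist_le_mul fun x z => ?_
    rw [dist_pi_le_iff (by positivity)]
    intro j
    rw [Real.dist_eq, dist_eq_norm, ← inner_sub_right]
    have := abs_real_inner_le_norm (b j.succ) (x - z)
    rwa [b.norm_eq_one] at this
  · intro y s
    ext j
    simp only [π, hP, inner_add_right, inner_sum, inner_smul_right, hin]
    rw [← hb0, hin]
    simp [Fin.succ_ne_zero]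
  · intro y s
    rw [hP, ← hb0]
    simp only [inner_add_right, inner_sum, inner_smul_right, hin]
    simp [(Fin.succ_ne_zero _).symm]
  · intro x
    have h1 := b.sum_repr' x
    rw [Fin.sum_univ_succ, hb0] at h1
    rw [hP]
    nth_rw 2 [← h1]
    simp [π]
  · have h1 := (volume_preserving_piFinSuccAbove (fun _ : Fin (m + 1) => ℝ) 0).symm
    have h2 := (b.measurePreserving_repr_symm.comp
      (PiLp.volume_preserving_toLp (Fin (m + 1)))).comp h1
    have e1 : (fun p : ℝ × (Fin m → ℝ) => P p.2 + p.1 • e) = (b.repr.symm ∘ WithLp.toLp 2) ∘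
        (MeasurableEquiv.piFinSuccAbove (fun _ : Fin (m + 1) => ℝ) 0).symm := by
      ext1 p
      rw [hT]
      simp [MeasurableEquiv.piFinSuccAbove]
      rfl
    rw [e1]
    exact h2

variable {m : ℕ} {e : Space (m + 1)} {P : (Fin m → ℝ) →L[ℝ] Space (m + 1)}
  {π : Space (m + 1) → (Fin m → ℝ)} {γ : Space (m + 1) → ℝ} {K L : ℝ≥0}

/-- The parametrization of the graph of `γ`. -/
noncomputable def graphMap (e : Space (m + 1)) (P : (Fin m → ℝ) →L[ℝ] Space (m + 1))
    (γ : Space (m + 1) → ℝ) (y : Fin m → ℝ) : Space (m + 1) := P y + γ (P y) • e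

theorem IsAxisParam.height_eq (h : IsAxisParam e P π) (γ : Space (m + 1) → ℝ) (y : Fin m → ℝ)
    (s : ℝ) : height e γ (P y + s • e) = s - γ (P y) := by
  rw [height, h.inner_dir, add_sub_cancel_right]

theorem IsAxisParam.height_graphMap_add (h : IsAxisParam e P π) (γ : Space (m + 1) → ℝ)
    (y : Fin m → ℝ) (s : ℝ) : height e γ (graphMap e P γ y + s • e) = s := by
  rw [graphMap, add_assoc, ← add_smul, h.height_eq]
  ring

theorem IsAxisParam.proj_graphMap_add (h : IsAxisParam e P π) (γ : Space (m + 1) → ℝ)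
    (y : Fin m → ℝ) (s : ℝ) : π (graphMap e P γ y + s • e) = y := by
  rw [graphMap, add_assoc, ← add_smul, h.proj]

theorem IsAxisParam.proj_graphMap (h : IsAxisParam e P π) (γ : Space (m + 1) → ℝ)
    (y : Fin m → ℝ) : π (graphMap e P γ y) = y := h.proj _ _

theorem IsAxisParam.graphMap_proj (h : IsAxisParam e P π) {x : Space (m + 1)}
    (hx : height e γ x = 0) : graphMap e P γ (π x) = x := by
  rw [height, sub_eq_zero] at hx
  rw [graphMap, h.param, ← hx, sub_add_cancel]

theorem exists_lipschitz_graphMap (hγ : LipschitzWith K γ) :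
    ∃ C : ℝ≥0, LipschitzWith C (graphMap e P γ) := by
  have h1 : LipschitzWith (K * ‖P‖₊) fun y => γ (P y) := hγ.comp P.lipschitz
  have h2 : LipschitzWith (‖(ContinuousLinearMap.toSpanSingleton ℝ e)‖₊ * (K * ‖P‖₊))
      fun y => γ (P y) • e := (ContinuousLinearMap.toSpanSingleton ℝ e).lipschitz.comp h1
  exact ⟨_, P.lipschitz.add h2⟩

theorem surface_eq (m : ℕ) : surface (m + 1) = Measure.hausdorffMeasure (m : ℝ) := by
  rw [surface]
  congr 1
  push_cast
  ring

theorem hausdorffMeasure_fin_pi (m : ℕ) :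
    (Measure.hausdorffMeasure (m : ℝ) : Measure (Fin m → ℝ)) = volume := by
  have := hausdorffMeasure_pi_real (ι := Fin m)
  rwa [Fintype.card_fin] at this

/-- On the graph, the surface measure is bounded by Lebesgue measure in the parameter domain. -/
theorem IsAxisParam.lintegral_surface_le (h : IsAxisParam e P π) (hγ : LipschitzWith K γ) :
    ∃ C : ℝ≥0, ∀ F : Space (m + 1) → ℝ≥0∞, Measurable F →
      ∫⁻ x in {x | height e γ x = 0}, F x ∂(surface (m + 1)) ≤
        C * ∫⁻ y, F (graphMap e P γ y) := by
  obtain ⟨C, hC⟩ := exists_lipschitz_graphMap (e := e) (P := P) hγ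
  refine ⟨C ^ m, fun F hF => ?_⟩
  have hm : Measurable (graphMap e P γ) := hC.continuous.measurable
  -- The graph is the image of the graph map, and a C-Lipschitz map enlarges m-dimensional Hausdorff
  -- measure by at most C^m.
  have hle : (surface (m + 1)).restrict {x | height e γ x = 0} ≤
      ((C ^ m : ℝ≥0) : ℝ≥0∞) • Measure.map (graphMap e P γ) volume := by
    refine Measure.le_iff.2 fun M hM => ?_
    rw [Measure.restrict_apply hM, Measure.smul_apply, Measure.map_apply hm hM, smul_eq_mul]
    have hsub : M ∩ {x | height e γ x = 0} ⊆ graphMap e P γ '' (graphMap e P γ ⁻¹' M) := by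
      rintro x ⟨hxM, hx⟩
      refine ⟨π x, ?_, h.graphMap_proj hx⟩
      rw [Set.mem_preimage, h.graphMap_proj hx]
      exact hxM
    refine (measure_mono hsub).trans ?_
    rw [surface_eq]
    refine (hC.hausdorffMeasure_image_le (by positivity) _).trans (le_of_eq ?_)
    rw [hausdorffMeasure_fin_pi]
    simp
  calc _ ≤ ∫⁻ x, F x ∂(((C ^ m : ℝ≥0) : ℝ≥0∞) • Measure.map (graphMap e P γ) volume) :=
        lintegral_mono' hle le_rfl
    _ = _ := by rw [lintegral_smul_measure, lintegral_map hF hm, smul_eq_mul]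

/-- The projection π inverts the graph map and is 1-Lipschitz, so it does not increase Hausdorff
measure; this is the counterpart of `lintegral_surface_le`, without a constant. -/
theorem IsAxisParam.lintegral_param_le (h : IsAxisParam e P π)
    (hγ : LipschitzWith K γ) {F : Space (m + 1) → ℝ≥0∞} (hF : Measurable F) :
    ∫⁻ y, F (graphMap e P γ y) ≤
      ∫⁻ x in {x | height e γ x = 0}, F x ∂(surface (m + 1)) := by
  obtain ⟨C, hC⟩ := exists_lipschitz_graphMap (e := e) (P := P) hγ
  have hm : Measurable (graphMap e P γ) := hC.continuous.measurable
  rw [← lintegral_map hF hm]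
  refine lintegral_mono' (Measure.le_iff.2 fun M hM => ?_) le_rfl
  rw [Measure.restrict_apply hM, Measure.map_apply hm hM]
  have hsub : graphMap e P γ ⁻¹' M ⊆ π '' (M ∩ {x | height e γ x = 0}) := by
    intro y hy
    refine ⟨graphMap e P γ y, ⟨hy, ?_⟩, h.proj_graphMap γ y⟩
    have := h.height_graphMap_add γ y 0
    rwa [zero_smul, add_zero] at this
  refine (measure_mono hsub).trans ?_
  rw [surface_eq, ← hausdorffMeasure_fin_pi]
  refine (h.lipschitz.hausdorffMeasure_image_le (by positivity) _).trans (le_of_eq ?_)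
  simp

/-- Fubini in the strip above the graph. -/
theorem IsAxisParam.lintegral_strip (h : IsAxisParam e P π) (he : ‖e‖ = 1)
    (hγ : LipschitzWith K γ) {F : Space (m + 1) → ℝ≥0∞} (hF : Measurable F) (ε : ℝ) :
    ∫⁻ x in {x | height e γ x ∈ Set.Ioo 0 ε}, F x =
      ∫⁻ y, ∫⁻ s in Set.Ioo 0 ε, F (graphMap e P γ y + s • e) := by
  have hh : Measurable (height e γ) := (lipschitz_height he hγ).continuous.measurable
  have hS : MeasurableSet {x | height e γ x ∈ Set.Ioo 0 ε} := hh measurableSet_Ioo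
  have hFi : Measurable ({x | height e γ x ∈ Set.Ioo 0 ε}.indicator F) := hF.indicator hS
  rw [← lintegral_indicator hS, ← h.preserving.lintegral_comp hFi, Measure.volume_eq_prod,
    lintegral_prod_symm (fun p : ℝ × (Fin m → ℝ) =>
      {x | height e γ x ∈ Set.Ioo 0 ε}.indicator F (P p.2 + p.1 • e)) (hFi.comp h.preserving.measurable).aemeasurable]
  refine lintegral_congr fun y => ?_
  -- Translating the fibre variable by γ(P y) flattens the strip.
  rw [← lintegral_indicator measurableSet_Ioo,
    ← lintegral_add_right_eq_self (μ := volume) _ (γ (P y))]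
  refine lintegral_congr fun s => ?_
  have e1 : P y + (s + γ (P y)) • e = graphMap e P γ y + s • e := by
    rw [graphMap, add_smul]; abel
  simp only [e1, Set.indicator_apply, Set.mem_ofPred_eq, h.height_graphMap_add]

/-- On each fibre F differs from its value on the graph by at most Lε, and integrating over a fibre
of length ε gives an error Lε². Only parameters in the projection of the ball containing the support
of F matter, a set of finite volume. -/
theorem IsAxisParam.strip_bounds (h : IsAxisParam e P π) (he : ‖e‖ = 1)
    (hγ : LipschitzWith K γ) {F : Space (m + 1) → ℝ} (hF : LipschitzWith L F)
    {x : Space (m + 1)} {R : ℝ} (hR : ∀ z, z ∉ Metric.closedBall x R → F z = 0) {ε : ℝ}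
    (hε : 0 < ε) :
    ENNReal.ofReal ε * ∫⁻ y, ENNReal.ofReal (F (graphMap e P γ y)) ≤
      (∫⁻ z in {z | height e γ z ∈ Set.Ioo 0 ε}, ENNReal.ofReal (F z)) +
        ENNReal.ofReal (L * ε ^ 2) * volume (Metric.closedBall (π x) R) ∧
    ∫⁻ z in {z | height e γ z ∈ Set.Ioo 0 ε}, ENNReal.ofReal (F z) ≤
      (ENNReal.ofReal ε * ∫⁻ y, ENNReal.ofReal (F (graphMap e P γ y))) +
        ENNReal.ofReal (L * ε ^ 2) * volume (Metric.closedBall (π x) R) := by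
  obtain ⟨C, hC⟩ := exists_lipschitz_graphMap (e := e) (P := P) hγ
  have hm : Measurable (graphMap e P γ) := hC.continuous.measurable
  have hFm : Measurable fun z => ENNReal.ofReal (F z) := hF.continuous.measurable.ennreal_ofReal
  set B := Metric.closedBall (π x) R with hB
  have hBm : MeasurableSet B := measurableSet_closedBall
  set a : (Fin m → ℝ) → ℝ≥0∞ := fun y => ENNReal.ofReal (F (graphMap e P γ y)) with ha
  have ham : Measurable a := hFm.comp hm
  set c : (Fin m → ℝ) → ℝ≥0∞ := B.indicator fun _ => ENNReal.ofReal (L * ε) with hc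
  have hcm : Measurable c := measurable_const.indicator hBm
  have hcint : ∫⁻ y, ENNReal.ofReal ε * c y = ENNReal.ofReal (L * ε ^ 2) * volume B := by
    rw [lintegral_const_mul _ hcm, hc, lintegral_indicator_const hBm, ← mul_assoc,
      ← ENNReal.ofReal_mul hε.le]
    congr 2
    ring
  have hmemB : ∀ y (s : ℝ), F (graphMap e P γ y + s • e) ≠ 0 → y ∈ B := by
    intro y s hne
    have h1 : graphMap e P γ y + s • e ∈ Metric.closedBall x R := by
      by_contra hn
      exact hne (hR _ hn)
    have h2 := h.lipschitz.dist_le_mul (graphMap e P γ y + s • e) x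
    rw [h.proj_graphMap_add] at h2
    simp only [NNReal.coe_one, one_mul] at h2
    exact h2.trans h1
  have hdiff : ∀ y, ∀ s ∈ Set.Ioo (0 : ℝ) ε,
      |F (graphMap e P γ y) - F (graphMap e P γ y + s • e)| ≤ L * ε := by
    intro y s hs
    refine (abs_sub_le_of_lipschitz hF _ _).trans (mul_le_mul_of_nonneg_left ?_ L.2)
    rw [sub_add_cancel_left, norm_neg, norm_smul, he, mul_one, Real.norm_of_nonneg hs.1.le]
    exact hs.2.le
  have hp1 : ∀ y, ∀ s ∈ Set.Ioo (0 : ℝ) ε,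
      a y ≤ ENNReal.ofReal (F (graphMap e P γ y + s • e)) + c y := by
    intro y s hs
    by_cases h0 : F (graphMap e P γ y) = 0
    · simp [ha, h0]
    · have hy : y ∈ B := hmemB y 0 (by simpa using h0)
      simp only [ha, hc, Set.indicator_of_mem hy]
      refine le_trans (ENNReal.ofReal_le_ofReal ?_) ENNReal.ofReal_add_le
      linarith [(abs_le.1 (hdiff y s hs)).2]
  have hp2 : ∀ y, ∀ s ∈ Set.Ioo (0 : ℝ) ε,
      ENNReal.ofReal (F (graphMap e P γ y + s • e)) ≤ a y + c y := by
    intro y s hs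
    by_cases h0 : F (graphMap e P γ y + s • e) = 0
    · simp [h0]
    · have hy : y ∈ B := hmemB y s h0
      simp only [ha, hc, Set.indicator_of_mem hy]
      refine le_trans (ENNReal.ofReal_le_ofReal ?_) ENNReal.ofReal_add_le
      linarith [(abs_le.1 (hdiff y s hs)).1]
  have hvol : (volume : Measure ℝ) (Set.Ioo 0 ε) = ENNReal.ofReal ε := by simp
  rw [h.lintegral_strip he hγ hFm]
  have hFs : ∀ y, Measurable fun s : ℝ => ENNReal.ofReal (F (graphMap e P γ y + s • e)) :=
    fun y => hFm.comp (measurable_const.add (measurable_id.smul_const e))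
  constructor
  · calc ENNReal.ofReal ε * ∫⁻ y, a y = ∫⁻ y, ∫⁻ _s in Set.Ioo 0 ε, a y := by
          rw [← lintegral_const_mul _ ham]
          refine lintegral_congr fun y => ?_
          rw [setLIntegral_const, hvol, mul_comm]
      _ ≤ ∫⁻ y, ((∫⁻ s in Set.Ioo 0 ε, ENNReal.ofReal (F (graphMap e P γ y + s • e))) +
            ENNReal.ofReal ε * c y) := by
          refine lintegral_mono fun y => ?_
          calc _ ≤ ∫⁻ s in Set.Ioo 0 ε, (ENNReal.ofReal (F (graphMap e P γ y + s • e)) + c y) :=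
                setLIntegral_mono' measurableSet_Ioo (hp1 y)
            _ = _ := by
                rw [lintegral_add_right _ measurable_const, setLIntegral_const, hvol, mul_comm (c y)]
      _ = _ := by
          rw [lintegral_add_right _ (hcm.const_mul _), hcint]
  · calc _ ≤ ∫⁻ y, ∫⁻ _s in Set.Ioo 0 ε, (a y + c y) :=
          lintegral_mono fun y => setLIntegral_mono' measurableSet_Ioo (hp2 y)
      _ = ∫⁻ y, (ENNReal.ofReal ε * a y + ENNReal.ofReal ε * c y) := by
          refine lintegral_congr fun y => ?_
          rw [setLIntegral_const, hvol, mul_comm, mul_add]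
      _ = _ := by
          rw [lintegral_add_right _ (hcm.const_mul _), hcint, lintegral_const_mul _ ham]

end MSGFEM

/-! ### Thin strips along the boundary -/

namespace MSGFEM

/-- Divide by ε and let ε tend to 0. In this way strip estimates turn into surface estimates in
which second order errors disappear. -/
theorem le_of_forall_pos_mul_le {X Y Z : ℝ≥0∞} (hZ : Z ≠ ∞)
    (h : ∀ ε : ℝ, 0 < ε → ENNReal.ofReal ε * X ≤ ENNReal.ofReal ε * Y + ENNReal.ofReal (ε ^ 2) * Z) :
    X ≤ Y := by
  have h1 : ∀ ε : ℝ, 0 < ε → X ≤ Y + ENNReal.ofReal ε * Z := by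
    intro ε hε
    have h2 := h ε hε
    rw [sq, ENNReal.ofReal_mul hε.le, mul_assoc, ← mul_add] at h2
    exact (ENNReal.mul_le_mul_iff_right (ENNReal.ofReal_pos.2 hε).ne' ENNReal.ofReal_ne_top).1 h2
  have h3 : Tendsto (fun ε : ℝ => Y + ENNReal.ofReal ε * Z) (𝓝[>] 0) (𝓝 (Y + 0 * Z)) := by
    refine Tendsto.const_add Y (ENNReal.Tendsto.mul_const ?_ (Or.inr hZ))
    have := (ENNReal.continuous_ofReal.tendsto 0).mono_left (nhdsWithin_le_nhds (s := Set.Ioi 0))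
    rwa [ENNReal.ofReal_zero] at this
  rw [zero_mul, add_zero] at h3
  exact ge_of_tendsto h3 (eventually_nhdsWithin_of_forall fun ε hε => h1 ε hε)

/-- Comparison of surface integrals with integrals over thin strips. -/
theorem IsChart.surface_bounds {m : ℕ} {Ω : Set (Space (m + 1))} {x e : Space (m + 1)}
    {γ : Space (m + 1) → ℝ} {K : ℝ≥0} {r : ℝ} (h : IsChart Ω x e γ K r) (hΩ : IsOpen Ω) :
    ∃ C V : ℝ≥0, ∀ (F : Space (m + 1) → ℝ) (L : ℝ≥0), LipschitzWith L F →
      (∀ z, z ∉ Metric.closedBall x (3 * r / 4) → F z = 0) → ∀ ε : ℝ, 0 < ε →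
      ENNReal.ofReal ε * (∫⁻ z in frontier Ω, ENNReal.ofReal (F z) ∂surface (m + 1)) ≤
        C * ((∫⁻ z in {z | height e γ z ∈ Set.Ioo 0 ε}, ENNReal.ofReal (F z)) +
          ENNReal.ofReal (L * ε ^ 2) * V) ∧
      ∫⁻ z in {z | height e γ z ∈ Set.Ioo 0 ε}, ENNReal.ofReal (F z) ≤
        ENNReal.ofReal ε * (∫⁻ z in frontier Ω, ENNReal.ofReal (F z) ∂surface (m + 1)) +
          ENNReal.ofReal (L * ε ^ 2) * V := by
  obtain ⟨P, π, hp⟩ := exists_isAxisParam h.norm_dir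
  obtain ⟨C, hC⟩ := hp.lintegral_surface_le h.lipschitz
  have hV : volume (Metric.closedBall (π x) (3 * r / 4)) ≠ ∞ := measure_closedBall_lt_top.ne
  refine ⟨C, (volume (Metric.closedBall (π x) (3 * r / 4))).toNNReal, fun F L hF hR ε hε => ?_⟩
  rw [ENNReal.coe_toNNReal hV]
  obtain ⟨b1, b2⟩ := hp.strip_bounds h.norm_dir h.lipschitz hF hR hε
  have hFm : Measurable fun z => ENNReal.ofReal (F z) := hF.continuous.measurable.ennreal_ofReal
  have hh : Measurable (height e γ) := (lipschitz_height h.norm_dir h.lipschitz).continuous.measurable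
  have hS0 : MeasurableSet {x | height e γ x = 0} := hh (measurableSet_singleton 0)
  -- F lives in a ball inside the chart, where the boundary is the graph; elsewhere the two sets may
  -- differ but F is zero.
  have hset : ∫⁻ z in frontier Ω, ENNReal.ofReal (F z) ∂surface (m + 1) =
      ∫⁻ z in {z | height e γ z = 0}, ENNReal.ofReal (F z) ∂surface (m + 1) := by
    rw [← lintegral_indicator isClosed_frontier.measurableSet,
      ← lintegral_indicator hS0]
    refine lintegral_congr fun z => ?_
    by_cases hz : z ∈ Metric.closedBall x (3 * r / 4)
    · have hzr : z ∈ Metric.ball x r :=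
        Metric.closedBall_subset_ball (by linarith [h.pos]) hz
      by_cases h0 : height e γ z = 0
      · rw [Set.indicator_of_mem ((h.mem_frontier_iff hΩ hzr).2 h0), Set.indicator_of_mem (s := {x | height e γ x = 0}) h0]
      · rw [Set.indicator_of_notMem fun h' => h0 ((h.mem_frontier_iff hΩ hzr).1 h'),
          Set.indicator_of_notMem (s := {x | height e γ x = 0}) h0]
    · simp [Set.indicator_apply, hR z hz]
  rw [hset]
  constructor
  · calc _ ≤ ENNReal.ofReal ε * (C * ∫⁻ y, ENNReal.ofReal (F (graphMap e P γ y))) :=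
          mul_le_mul_right (hC _ hFm) _
      _ = C * (ENNReal.ofReal ε * ∫⁻ y, ENNReal.ofReal (F (graphMap e P γ y))) := by ring
      _ ≤ _ := mul_le_mul_right b1 _
  · refine b2.trans (add_le_add_left (mul_le_mul_right ?_ _) _)
    exact hp.lintegral_param_le h.lipschitz hFm

variable {d : ℕ} {ω ω' Ω : Set (Space d)} {u v f : Space d → ℝ} {G H : Space d → Space d}
  {ψ φ F : Space d → ℝ} {K K' : ℝ≥0} {x e : Space d} {γ : Space d → ℝ} {r : ℝ}

/-- The cutoff function of height `ε` above the graph of `γ`. -/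
noncomputable def heightCutoff (e : Space d) (γ : Space d → ℝ) (ε : ℝ) (y : Space d) : ℝ :=
  max 0 (min 1 (height e γ y / ε))

theorem lipschitz_heightCutoff (he : ‖e‖ = 1) (hγ : LipschitzWith K γ) {ε : ℝ} (hε : 0 < ε) :
    ∃ L : ℝ≥0, LipschitzWith L (heightCutoff e γ ε) := by
  have h1 : LipschitzWith ((1 + K) / ε).toNNReal fun y => height e γ y / ε := by
    refine LipschitzWith.of_dist_le_mul fun y z => ?_
    rw [Real.dist_eq, Real.coe_toNNReal _ (by positivity), ← sub_div, abs_div, abs_of_pos hε,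
      dist_eq_norm, div_mul_eq_mul_div]
    exact div_le_div_of_nonneg_right (abs_height_sub_le he hγ y z) hε.le
  exact ⟨_, (h1.const_min 1).const_max 0⟩

theorem heightCutoff_nonneg (e : Space d) (γ : Space d → ℝ) (ε : ℝ) (y : Space d) :
    0 ≤ heightCutoff e γ ε y := le_max_left _ _

theorem heightCutoff_le_one (e : Space d) (γ : Space d → ℝ) (ε : ℝ) (y : Space d) :
    heightCutoff e γ ε y ≤ 1 := max_le zero_le_one (min_le_left _ _)

/-- The cutoff is monotone along `e`. Thanks to the sign, ε times this derivative dominates the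
indicator of the strip almost everywhere; where the derivative does not exist, its default value 0
is harmless. -/
theorem fderiv_heightCutoff_nonneg (he : ‖e‖ = 1) {ε : ℝ} (hε : 0 < ε) (y : Space d) :
    0 ≤ fderiv ℝ (heightCutoff e γ ε) y e := by
  by_cases hd : DifferentiableAt ℝ (heightCutoff e γ ε) y
  · rw [← hd.lineDeriv_eq_fderiv, lineDeriv]
    have hmono : Monotone fun t : ℝ => heightCutoff e γ ε (y + t • e) := by
      intro s t hst
      simp only [heightCutoff, height_add_smul he]
      gcongr
    exact hmono.deriv_nonneg
  · rw [fderiv_zero_of_not_differentiableAt hd]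
    simp

theorem fderiv_heightCutoff_eq (he : ‖e‖ = 1) {ε : ℝ} (hε : 0 < ε) {y : Space d}
    (hd : DifferentiableAt ℝ (heightCutoff e γ ε) y) (hy : height e γ y ∈ Set.Ioo 0 ε) :
    fderiv ℝ (heightCutoff e γ ε) y e = 1 / ε := by
  rw [← hd.lineDeriv_eq_fderiv, lineDeriv]
  have hev : (fun t : ℝ => heightCutoff e γ ε (y + t • e)) =ᶠ[𝓝 0]
      fun t => (height e γ y + t) / ε := by
    have hcont : Tendsto (fun t : ℝ => height e γ y + t) (𝓝 0) (𝓝 (height e γ y + 0)) :=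
      (continuous_const.add continuous_id).tendsto 0
    rw [add_zero] at hcont
    filter_upwards [hcont (isOpen_Ioo.mem_nhds hy)] with t ht
    have h1 : (height e γ y + t) / ε ≤ 1 := (div_le_one hε).2 ht.2.le
    have h2 : 0 ≤ (height e γ y + t) / ε := div_nonneg ht.1.le hε.le
    simp only [heightCutoff, height_add_smul he]
    rw [min_eq_right h1, max_eq_right h2]
  rw [hev.deriv_eq]
  have : HasDerivAt (fun t : ℝ => (height e γ y + t) / ε) (1 / ε) 0 :=
    ((hasDerivAt_id (0 : ℝ)).const_add _).div_const ε
  exact this.deriv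

theorem abs_fderiv_le (hψ : LipschitzWith K ψ) (he : ‖e‖ = 1) (y : Space d) :
    |fderiv ℝ ψ y e| ≤ K := by
  have := (fderiv ℝ ψ y).le_of_opNorm_le (norm_fderiv_le_of_lipschitz ℝ hψ) e
  rwa [he, mul_one] at this

theorem abs_fderiv_le_norm_gradient (he : ‖e‖ = 1) (y : Space d) :
    |fderiv ℝ ψ y e| ≤ ‖gradient ψ y‖ := by
  rw [← inner_gradient_left]
  have := abs_real_inner_le_norm (gradient ψ y) e
  rwa [he, mul_one] at this

theorem integrable_of_lipschitz (hψ : LipschitzWith K ψ) (hc : HasCompactSupport ψ) :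
    Integrable ψ := hψ.continuous.integrable_of_hasCompactSupport hc

theorem integrable_fderiv_of_lipschitz (hψ : LipschitzWith K ψ) (hc : HasCompactSupport ψ)
    (e : Space d) : Integrable fun y => fderiv ℝ ψ y e := by
  have h1 := memLp_fderiv_of_lipschitz hψ hc e
  have hs : IntegrableOn (fun y => fderiv ℝ ψ y e) (tsupport ψ) := by
    have : IsFiniteMeasure (volume.restrict (tsupport ψ) : Measure (Space d)) := ⟨by
      simpa using hc.isCompact.measure_lt_top⟩
    exact (h1.mono_measure Measure.restrict_le_self).integrable (by norm_num)
  refine (integrableOn_iff_integrable_of_support_subset fun y hy => ?_).1 hs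
  by_contra hn
  have : fderiv ℝ ψ y = 0 :=
    image_eq_zero_of_notMem_tsupport fun h => hn (tsupport_fderiv_subset ℝ h)
  exact hy (by simp [this])

/-- The integral of `φ²` over a strip of height `ε` is `O(ε)`. -/
theorem IsChart.strip_le (h : IsChart Ω x e γ K r) (hΩ : IsOpen Ω) (hb : Bornology.IsBounded Ω) :
    ∃ C : ℝ≥0, ∀ (φ : Space d → ℝ) (L : ℝ≥0), LipschitzWith L φ → ∀ ε : ℝ, 0 < ε →
      ∫⁻ z in {z | height e γ z ∈ Set.Ioo 0 ε}, ENNReal.ofReal (φ z ^ 2 * bump x r z) ≤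
        ENNReal.ofReal (C * ε * normH1 Ω φ ^ 2) := by
  obtain ⟨L₀, hL₀⟩ := lipschitz_bump x h.pos
  have he := h.norm_dir
  refine ⟨1 + L₀, fun φ L hφ ε hε => ?_⟩
  set ζ := bump x r with hζ
  set F : Space d → ℝ := fun y => φ y ^ 2 * ζ y with hFdef
  have hζc : HasCompactSupport ζ := hasCompactSupport_bump x h.pos
  have hFeq : F = φ * (φ * ζ) := by ext y; simp only [hFdef, Pi.mul_apply]; ring
  have hF0 : ∀ y, 0 ≤ F y := fun y => mul_nonneg (sq_nonneg _) (bump_nonneg x r y)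
  obtain ⟨L₁, hL₁⟩ := exists_lipschitzWith_mul hφ hL₀ hζc
  have hc₁ : HasCompactSupport (φ * ζ) := hζc.mul_left
  obtain ⟨L₂, hL₂⟩ := exists_lipschitzWith_mul hφ hL₁ hc₁
  rw [← hFeq] at hL₂
  have hFc : HasCompactSupport F := by rw [hFeq]; exact hc₁.mul_left
  have hFs : tsupport F ⊆ Metric.closedBall x (3 * r / 4) := by
    rw [hFeq]
    exact (tsupport_mul_subset_right.trans tsupport_mul_subset_right).trans
      (tsupport_bump_subset x h.pos)
  obtain ⟨Lη, hLη⟩ := lipschitz_heightCutoff he h.lipschitz hε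
  set η := heightCutoff e γ ε with hη
  -- The indicator of the strip is at most ε times the derivative of the cutoff η along e.
  -- Integration by parts moves this derivative to F = φ²ζ, and η vanishes below the graph, so that
  -- only an integral over Ω remains, bounded by the norm of H¹(Ω).
  have hibp := integral_mul_fderiv_of_lipschitz hLη hL₂ hFc e
  have hFi := integrable_of_lipschitz hL₂ hFc
  have hdFi := integrable_fderiv_of_lipschitz hL₂ hFc e
  have hdη : Integrable fun y => fderiv ℝ η y e * F y := by
    refine hFi.bdd_mul (c := Lη) (measurable_fderiv_apply_const ℝ η e).aestronglyMeasurable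
      (ae_of_all _ fun y => abs_fderiv_le hLη he y)
  have hηdF : Integrable fun y => η y * fderiv ℝ F y e := by
    refine hdFi.bdd_mul (c := 1) hLη.continuous.aestronglyMeasurable (ae_of_all _ fun y => ?_)
    rw [Real.norm_of_nonneg (heightCutoff_nonneg _ _ _ _)]
    exact heightCutoff_le_one _ _ _ _
  have hh : Measurable (height e γ) := (lipschitz_height he h.lipschitz).continuous.measurable
  have hS : MeasurableSet {z | height e γ z ∈ Set.Ioo 0 ε} := hh measurableSet_Ioo
  have step1 : ∫ z in {z | height e γ z ∈ Set.Ioo 0 ε}, F z ≤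
      ε * ∫ y, fderiv ℝ η y e * F y := by
    rw [← integral_indicator hS, ← integral_const_mul]
    refine integral_mono_ae (hFi.indicator hS) (hdη.const_mul ε) ?_
    filter_upwards [hLη.ae_differentiableAt] with y hy
    by_cases hyS : y ∈ {z | height e γ z ∈ Set.Ioo 0 ε}
    · rw [Set.indicator_of_mem hyS, fderiv_heightCutoff_eq he hε hy hyS]
      field_simp
      exact le_rfl
    · rw [Set.indicator_of_notMem hyS]
      exact mul_nonneg hε.le (mul_nonneg (fderiv_heightCutoff_nonneg he hε y) (hF0 y))
  have hp := sobolevPair_of_lipschitz hΩ hb hφ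
  have hi1 : IntegrableOn (fun y => φ y ^ 2) Ω := hp.memLp.integrable_sq
  have hi2 : IntegrableOn (fun y => ‖gradient φ y‖ ^ 2) Ω := hp.memLp_grad.norm.integrable_sq
  have hi3 : IntegrableOn (fun y => (1 + L₀) * φ y ^ 2 + ‖gradient φ y‖ ^ 2) Ω :=
    (hi1.const_mul _).add hi2
  have step2 : ∫ y, fderiv ℝ η y e * F y ≤
      ∫ y in Ω, ((1 + L₀) * φ y ^ 2 + ‖gradient φ y‖ ^ 2) := by
    have : ∫ y, fderiv ℝ η y e * F y = ∫ y, -(η y * fderiv ℝ F y e) := by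
      rw [integral_neg, hibp, neg_neg]
    rw [this, ← integral_indicator hΩ.measurableSet]
    refine integral_mono_ae hηdF.neg (hi3.integrable_indicator hΩ.measurableSet) ?_
    filter_upwards [hφ.ae_differentiableAt, hL₀.ae_differentiableAt] with y hy1 hy2
    have hnn : 0 ≤ (1 + L₀) * φ y ^ 2 + ‖gradient φ y‖ ^ 2 := by positivity
    by_cases hyb : y ∈ Metric.closedBall x (3 * r / 4)
    · by_cases hyΩ : y ∈ Ω
      · rw [Set.indicator_of_mem hyΩ]
        have hd : fderiv ℝ F y e = 2 * φ y * ζ y * fderiv ℝ φ y e + φ y ^ 2 * fderiv ℝ ζ y e := by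
          have h1 := (hy1.hasFDerivAt.pow 2).mul hy2.hasFDerivAt
          have h2 : HasFDerivAt F _ y := h1
          rw [h2.fderiv]
          simp
          ring
        have a1 := abs_fderiv_le_norm_gradient (ψ := φ) he y
        have a2 := abs_fderiv_le hL₀ he y
        have a3 := bump_nonneg x r y
        have a4 := bump_le_one x r y
        have a5 := heightCutoff_nonneg e γ ε y
        have a6 := heightCutoff_le_one e γ ε y
        have b1 : |2 * φ y * ζ y * fderiv ℝ φ y e| ≤ φ y ^ 2 + ‖gradient φ y‖ ^ 2 := by
          have : |2 * φ y * ζ y * fderiv ℝ φ y e| = ζ y * (2 * |φ y| * |fderiv ℝ φ y e|) := by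
            rw [abs_mul, abs_mul, abs_mul, abs_of_nonneg a3, abs_two]; ring
          rw [this]
          have c1 : 2 * |φ y| * |fderiv ℝ φ y e| ≤ φ y ^ 2 + ‖gradient φ y‖ ^ 2 := by
            have := two_mul_le_add_sq |φ y| ‖gradient φ y‖
            rw [sq_abs] at this
            nlinarith [abs_nonneg (φ y)]
          have c0 : 0 ≤ 2 * |φ y| * |fderiv ℝ φ y e| := by positivity
          nlinarith
        have b2 : |φ y ^ 2 * fderiv ℝ ζ y e| ≤ L₀ * φ y ^ 2 := by
          rw [abs_mul, abs_of_nonneg (sq_nonneg _), mul_comm]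
          exact mul_le_mul_of_nonneg_right a2 (sq_nonneg _)
        have b3 : |fderiv ℝ F y e| ≤ (1 + L₀) * φ y ^ 2 + ‖gradient φ y‖ ^ 2 := by
          rw [hd]
          refine (abs_add_le _ _).trans ?_
          linarith
        have b4 := abs_nonneg (fderiv ℝ F y e)
        have b5 := neg_abs_le (fderiv ℝ F y e)
        change -(η y * fderiv ℝ F y e) ≤ _
        nlinarith
      · rw [Set.indicator_of_notMem hyΩ]
        have hle : height e γ y ≤ 0 := by
          rw [h.mem_iff y (Metric.closedBall_subset_ball (by linarith [h.pos]) hyb)] at hyΩ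
          exact not_lt.1 hyΩ
        have : η y = 0 := by
          rw [hη, heightCutoff]
          exact max_eq_left ((min_le_right _ _).trans (div_nonpos_of_nonpos_of_nonneg hle hε.le))
        simp [this]
    · have : fderiv ℝ F y = 0 :=
        image_eq_zero_of_notMem_tsupport fun h' => hyb (hFs (tsupport_fderiv_subset ℝ h'))
      simp only [this, zero_apply, mul_zero, neg_zero]
      exact Set.indicator_nonneg (fun z _ => by positivity) y
  have step3 : ∫ y in Ω, ((1 + L₀) * φ y ^ 2 + ‖gradient φ y‖ ^ 2) ≤
      (1 + L₀) * normH1 Ω φ ^ 2 := by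
    rw [hp.normH1_sq hΩ, integral_add (hi1.const_mul _) hi2, integral_const_mul, mul_add]
    have : 0 ≤ ∫ y in Ω, ‖gradient φ y‖ ^ 2 := integral_nonneg fun _ => sq_nonneg _
    have hL0 : (0 : ℝ) ≤ L₀ := L₀.2
    nlinarith
  rw [← ofReal_integral_eq_lintegral_ofReal hFi.integrableOn (ae_of_all _ hF0)]
  refine ENNReal.ofReal_le_ofReal (step1.trans ?_)
  have := mul_le_mul_of_nonneg_left (step2.trans step3) hε.le
  push_cast
  linarith

end MSGFEM

/-! ### Collars of the boundary and the trace inequality -/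

namespace MSGFEM

variable {d : ℕ} {ω ω' Ω : Set (Space d)} {u v f : Space d → ℝ} {G H : Space d → Space d}
  {ψ φ F : Space d → ℝ} {K K' : ℝ≥0} {x e : Space d} {γ : Space d → ℝ} {r : ℝ}

/-- The part of `Ω` at distance less than `δ` from the boundary. -/
def collar (Ω : Set (Space d)) (δ : ℝ) : Set (Space d) := Ω ∩ Metric.thickening δ (frontier Ω)

theorem isOpen_collar (hΩ : IsOpen Ω) (δ : ℝ) : IsOpen (collar Ω δ) :=
  hΩ.inter Metric.isOpen_thickening

/-- A finite set of charts, such that thin collars are covered by thin strips. -/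
theorem IsLipschitzDomain.exists_strip_atlas (hΩ : IsLipschitzDomain Ω) :
    ∃ (s : Finset (Space d)) (e : Space d → Space d) (γ : Space d → Space d → ℝ)
      (K : Space d → ℝ≥0) (r : Space d → ℝ) (δ : ℝ), 0 < δ ∧
      (∀ x ∈ s, IsChart Ω x (e x) (γ x) (K x) (r x)) ∧
      (∀ y ∈ frontier Ω, ∃ x ∈ s, dist y x < r x / 2) ∧
      ∀ τ, 0 < τ → τ < δ → ∀ y ∈ collar Ω τ, ∃ x ∈ s, dist y x < r x / 2 ∧
        height (e x) (γ x) y ∈ Set.Ioo 0 ((1 + K x) * τ) := by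
  obtain ⟨s, e, γ, K, r, δ₁, hδ₁, hchart, hcov⟩ := hΩ.exists_atlas
  -- With δ at most r/2, a boundary point z within δ of y lies in the same chart ball, where its
  -- height is zero; the height of y is then less than (1 + K)τ.
  obtain ⟨δ, hδ, hδ1, hδ2⟩ : ∃ δ > 0, δ ≤ δ₁ ∧ ∀ x ∈ s, δ ≤ r x / 2 := by
    rcases s.eq_empty_or_nonempty with rfl | hs
    · exact ⟨δ₁, hδ₁, le_rfl, by simp⟩
    · refine ⟨min δ₁ (s.inf' hs fun x => r x / 2), lt_min hδ₁ ?_, min_le_left _ _,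
        fun x hx => (min_le_right _ _).trans (Finset.inf'_le _ hx)⟩
      exact (Finset.lt_inf'_iff _).2 fun x hx => by linarith [(hchart x hx).pos]
  refine ⟨s, e, γ, K, r, δ, hδ, hchart, fun y hy => hcov y y hy (by rwa [dist_self]), ?_⟩
  rintro τ hτ hτδ y ⟨hyΩ, hy⟩
  obtain ⟨z, hz, hyz⟩ := Metric.mem_thickening_iff.1 hy
  obtain ⟨x, hx, hyx⟩ := hcov y z hz (hyz.trans (hτδ.trans_le hδ1))
  have hc := hchart x hx
  refine ⟨x, hx, hyx, ?_, ?_⟩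
  · exact (hc.mem_iff y (by rw [Metric.mem_ball]; linarith [hc.pos])).1 hyΩ
  · have hzb : z ∈ Metric.ball x (r x) := by
      rw [Metric.mem_ball]
      have := dist_triangle z y x
      rw [dist_comm z y] at this
      linarith [hδ2 x hx]
    have h0 := (hc.mem_frontier_iff hΩ.isOpen hzb).1 hz
    have h1 := abs_height_sub_le hc.norm_dir hc.lipschitz y z
    rw [h0, sub_zero, ← dist_eq_norm] at h1
    refine (le_abs_self _).trans_lt (h1.trans_lt ?_)
    exact mul_lt_mul_of_pos_left hyz (by positivity)

theorem measurableSet_strip (he : ‖e‖ = 1) (hγ : LipschitzWith K γ) (ε : ℝ) :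
    MeasurableSet {z | height e γ z ∈ Set.Ioo 0 ε} := by
  have hh : Measurable (height e γ) := (lipschitz_height he hγ).continuous.measurable
  exact hh measurableSet_Ioo

theorem measurable_bump (x : Space d) {r : ℝ} (hr : 0 < r) : Measurable (bump x r) := by
  obtain ⟨L, hL⟩ := lipschitz_bump x hr
  exact hL.continuous.measurable

/-- An integral over a collar is bounded by integrals over strips. -/
theorem lintegral_collar_le (hΩ : IsOpen Ω) {s : Finset (Space d)} {e : Space d → Space d}
    {γ : Space d → Space d → ℝ} {K : Space d → ℝ≥0} {r : Space d → ℝ} {τ : ℝ}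
    (hchart : ∀ x ∈ s, IsChart Ω x (e x) (γ x) (K x) (r x))
    (hcov : ∀ y ∈ collar Ω τ, ∃ x ∈ s, dist y x < r x / 2 ∧
        height (e x) (γ x) y ∈ Set.Ioo 0 ((1 + K x) * τ)) (hF : Measurable F) :
    ∫⁻ y in collar Ω τ, ENNReal.ofReal (F y) ≤
      ∑ x ∈ s, ∫⁻ y in {z | height (e x) (γ x) z ∈ Set.Ioo 0 ((1 + K x) * τ)},
        ENNReal.ofReal (F y * bump x (r x) y) := by
  have hS : ∀ x ∈ s, MeasurableSet {z | height (e x) (γ x) z ∈ Set.Ioo 0 ((1 + K x) * τ)} :=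
    fun x hx => measurableSet_strip (hchart x hx).norm_dir (hchart x hx).lipschitz _
  rw [← lintegral_indicator (isOpen_collar hΩ τ).measurableSet,
    Finset.sum_congr rfl fun x hx => (lintegral_indicator (hS x hx) _).symm,
    ← lintegral_finsetSum']
  · refine lintegral_mono fun y => ?_
    by_cases hy : y ∈ collar Ω τ
    · obtain ⟨x, hx, hyx, hyS⟩ := hcov y hy
      rw [Set.indicator_of_mem hy]
      refine le_trans (le_of_eq ?_) (Finset.single_le_sum
        (f := fun x => {z | height (e x) (γ x) z ∈ Set.Ioo 0 ((1 + K x) * τ)}.indicator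
          (fun y => ENNReal.ofReal (F y * bump x (r x) y)) y) (fun _ _ => zero_le) hx)
      simp only
      rw [Set.indicator_of_mem (s := {z | height (e x) (γ x) z ∈ Set.Ioo 0 ((1 + K x) * τ)}) hyS,
        bump_eq_one (hchart x hx).pos hyx.le, mul_one]
    · rw [Set.indicator_of_notMem hy]
      exact zero_le
  · intro x hx
    exact ((hF.mul (measurable_bump x (hchart x hx).pos)).ennreal_ofReal.indicator
      (hS x hx)).aemeasurable

/-- `φ²` integrates to `O(δ)` over the collar of width `δ`. -/
theorem IsLipschitzDomain.collar_le (hΩ : IsLipschitzDomain Ω) :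
    ∃ (C : ℝ≥0) (δ : ℝ), 0 < δ ∧ ∀ τ, 0 < τ → τ < δ → ∀ (φ : Space d → ℝ) (L : ℝ≥0),
      LipschitzWith L φ → ∫⁻ y in collar Ω τ, ENNReal.ofReal (φ y ^ 2) ≤
        ENNReal.ofReal (C * τ * normH1 Ω φ ^ 2) := by
  obtain ⟨s, e, γ, K, r, δ, hδ, hchart, -, hcov⟩ := hΩ.exists_strip_atlas
  choose! C hC using fun x hx => (hchart x hx).strip_le hΩ.isOpen hΩ.isBounded
  refine ⟨∑ x ∈ s, C x * (1 + K x), δ, hδ, fun τ hτ hτδ φ L hφ => ?_⟩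
  refine (lintegral_collar_le hΩ.isOpen hchart (hcov τ hτ hτδ)
    (hφ.continuous.measurable.pow_const 2)).trans ?_
  calc _ ≤ ∑ x ∈ s, ENNReal.ofReal (C x * ((1 + K x) * τ) * normH1 Ω φ ^ 2) :=
        Finset.sum_le_sum fun x hx => hC x hx φ L hφ _ (by positivity)
    _ = _ := by
        rw [← ENNReal.ofReal_sum_of_nonneg fun x _ => by positivity]
        congr 1
        push_cast
        rw [Finset.sum_mul, Finset.sum_mul]
        exact Finset.sum_congr rfl fun x _ => by ring

theorem exists_lipschitzWith_mul_bump (hF : LipschitzWith K F) (x : Space d) {r : ℝ}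
    (hr : 0 < r) : ∃ L : ℝ≥0, LipschitzWith L fun y => F y * bump x r y := by
  obtain ⟨L, hL⟩ := lipschitz_bump x hr
  exact exists_lipschitzWith_mul hF hL (hasCompactSupport_bump x hr)

theorem mul_bump_eq_zero (F : Space d → ℝ) {r : ℝ} (hr : 0 < r) {z : Space d}
    (hz : z ∉ Metric.closedBall x (3 * r / 4)) : F z * bump x r z = 0 := by
  rw [Metric.mem_closedBall, not_le] at hz
  rw [bump_eq_zero hr hz.le, mul_zero]

/-- The mean over thin collars is asymptotically bounded by the surface integral. -/
theorem IsLipschitzDomain.collar_le_surface {m : ℕ} {Ω : Set (Space (m + 1))}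
    (hΩ : IsLipschitzDomain Ω) :
    ∃ (C : ℝ≥0) (δ : ℝ), 0 < δ ∧ ∀ (F : Space (m + 1) → ℝ) (L : ℝ≥0), LipschitzWith L F →
      (∀ y, 0 ≤ F y) → ∃ A : ℝ≥0, ∀ τ, 0 < τ → τ < δ →
      ∫⁻ y in collar Ω τ, ENNReal.ofReal (F y) ≤ ENNReal.ofReal τ *
        (C * ∫⁻ z in frontier Ω, ENNReal.ofReal (F z) ∂surface (m + 1)) +
        ENNReal.ofReal (τ ^ 2) * A := by
  obtain ⟨s, e, γ, K, r, δ, hδ, hchart, -, hcov⟩ := hΩ.exists_strip_atlas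
  choose! C V hCV using fun x hx => (hchart x hx).surface_bounds hΩ.isOpen
  refine ⟨∑ x ∈ s, (1 + K x), δ, hδ, fun F L hF hF0 => ?_⟩
  choose! L' hL' using fun x hx => exists_lipschitzWith_mul_bump hF x (hchart x hx).pos
  refine ⟨∑ x ∈ s, L' x * (1 + K x) ^ 2 * V x, fun τ hτ hτδ => ?_⟩
  refine (lintegral_collar_le hΩ.isOpen hchart (hcov τ hτ hτδ) hF.continuous.measurable).trans ?_
  set I := ∫⁻ z in frontier Ω, ENNReal.ofReal (F z) ∂surface (m + 1) with hI
  calc _ ≤ ∑ x ∈ s, (ENNReal.ofReal τ * ((1 + K x : ℝ≥0) * I) +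
        ENNReal.ofReal (τ ^ 2) * (L' x * (1 + K x) ^ 2 * V x : ℝ≥0)) := by
        refine Finset.sum_le_sum fun x hx => ?_
        refine ((hCV x hx _ (L' x) (hL' x hx) (fun z hz => mul_bump_eq_zero F (hchart x hx).pos hz)
          ((1 + K x) * τ) (by positivity)).2).trans (add_le_add ?_ (le_of_eq ?_))
        · rw [ENNReal.ofReal_mul (by positivity), mul_comm (ENNReal.ofReal (1 + (K x : ℝ))),
            mul_assoc]
          refine mul_le_mul_right (mul_le_mul' (le_of_eq ?_) (lintegral_mono fun z => ?_)) _
          · rw [← ENNReal.ofReal_coe_nnreal]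
            push_cast
            rfl
          · refine ENNReal.ofReal_le_ofReal ?_
            exact mul_le_of_le_one_right (hF0 z) (bump_le_one _ _ _)
        · rw [← ENNReal.ofReal_coe_nnreal (p := L' x * (1 + K x) ^ 2 * V x),
            ← ENNReal.ofReal_coe_nnreal (p := V x),
            ← ENNReal.ofReal_mul (by positivity), ← ENNReal.ofReal_mul (by positivity)]
          congr 1
          push_cast
          ring
    _ = _ := by
        rw [Finset.sum_add_distrib, ← Finset.mul_sum, ← Finset.mul_sum, ← Finset.sum_mul]
        push_cast
        rfl

/-- The trace inequality on a Lipschitz domain. -/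
theorem IsLipschitzDomain.trace_sq_le {m : ℕ} {Ω : Set (Space (m + 1))}
    (hΩ : IsLipschitzDomain Ω) :
    ∃ C : ℝ≥0, ∀ (φ : Space (m + 1) → ℝ) (L : ℝ≥0), LipschitzWith L φ →
      ∫⁻ z in frontier Ω, ENNReal.ofReal (φ z ^ 2) ∂surface (m + 1) ≤
        ENNReal.ofReal (C * normH1 Ω φ ^ 2) := by
  obtain ⟨s, e, γ, K, r, δ, hδ, hchart, hfr, -⟩ := hΩ.exists_strip_atlas
  choose! C V hCV using fun x hx => (hchart x hx).surface_bounds hΩ.isOpen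
  choose! D hD using fun x hx => (hchart x hx).strip_le hΩ.isOpen hΩ.isBounded
  refine ⟨∑ x ∈ s, C x * D x, fun φ L hφ => ?_⟩
  have hloc : ∀ x ∈ s, ∫⁻ z in frontier Ω, ENNReal.ofReal (φ z ^ 2 * bump x (r x) z)
      ∂surface (m + 1) ≤ ENNReal.ofReal (C x * D x * normH1 Ω φ ^ 2) := by
    intro x hx
    have hr := (hchart x hx).pos
    obtain ⟨L₁, hL₁⟩ := exists_lipschitzWith_mul_bump hφ x hr
    obtain ⟨L₂, hL₂⟩ := exists_lipschitzWith_mul hφ hL₁ (hasCompactSupport_bump x hr).mul_left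
    have hL₃ : LipschitzWith L₂ fun z => φ z ^ 2 * bump x (r x) z := by
      convert hL₂ using 1
      ext z
      simp only [Pi.mul_apply]
      ring
    -- The strip integral is O(ε) with a constant involving only the norm of H¹(Ω). The Lipschitz
    -- constant of φ enters only the ε² term and is lost in the limit, which is what makes the bound
    -- extend to H¹.
    refine le_of_forall_pos_mul_le (Z := (C x * (L₂ * V x) : ℝ≥0)) ENNReal.coe_ne_top
      fun ε hε => ?_
    refine ((hCV x hx _ L₂ hL₃ (fun z hz => mul_bump_eq_zero (fun z => φ z ^ 2) hr hz) ε hε).1).trans ?_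
    rw [mul_add]
    refine add_le_add ?_ (le_of_eq ?_)
    · refine (mul_le_mul_right (hD x hx φ L hφ ε hε) _).trans (le_of_eq ?_)
      rw [← ENNReal.ofReal_coe_nnreal, ← ENNReal.ofReal_mul (by positivity),
        ← ENNReal.ofReal_mul hε.le]
      congr 1
      ring
    · rw [← ENNReal.ofReal_coe_nnreal, ← ENNReal.ofReal_coe_nnreal (p := V x),
        ← ENNReal.ofReal_coe_nnreal (p := C x * (L₂ * V x)), ← ENNReal.ofReal_mul (by positivity),
        ← ENNReal.ofReal_mul (by positivity), ← ENNReal.ofReal_mul (by positivity)]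
      congr 1
      push_cast
      ring
  calc _ ≤ ∫⁻ z in frontier Ω, ∑ x ∈ s, ENNReal.ofReal (φ z ^ 2 * bump x (r x) z)
        ∂surface (m + 1) := by
        refine setLIntegral_mono' isClosed_frontier.measurableSet fun z hz => ?_
        obtain ⟨x, hx, hzx⟩ := hfr z hz
        refine le_trans (le_of_eq ?_) (Finset.single_le_sum
          (f := fun x => ENNReal.ofReal (φ z ^ 2 * bump x (r x) z)) (fun _ _ => zero_le) hx)
        rw [bump_eq_one (hchart x hx).pos hzx.le, mul_one]
    _ = ∑ x ∈ s, ∫⁻ z in frontier Ω, ENNReal.ofReal (φ z ^ 2 * bump x (r x) z)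
        ∂surface (m + 1) := by
        refine lintegral_finsetSum' _ fun x hx => ?_
        exact (((hφ.continuous.measurable.pow_const 2).mul
          (measurable_bump x (hchart x hx).pos)).ennreal_ofReal).aemeasurable
    _ ≤ ∑ x ∈ s, ENNReal.ofReal (C x * D x * normH1 Ω φ ^ 2) := Finset.sum_le_sum hloc
    _ = _ := by
        rw [← ENNReal.ofReal_sum_of_nonneg fun x _ => by positivity]
        congr 1
        push_cast
        rw [Finset.sum_mul]

end MSGFEM

/-! ### Extension by zero -/

namespace MSGFEM

variable {d : ℕ} {ω ω' Ω Γ Γ' : Set (Space d)} {u v f q : Space d → ℝ} {G H : Space d → Space d}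
  {ψ φ F : Space d → ℝ} {K K' : ℝ≥0}

/-- A Lipschitz cutoff function that vanishes outside `ω` and equals one away from `∂ω`. -/
noncomputable def innerCutoff (ω : Set (Space d)) (δ : ℝ) (x : Space d) : ℝ :=
  min 1 (Metric.infDist x ωᶜ / δ)

theorem lipschitz_innerCutoff (ω : Set (Space d)) {δ : ℝ} (hδ : 0 < δ) :
    LipschitzWith (1 / δ).toNNReal (innerCutoff ω δ) := by
  refine LipschitzWith.const_min (LipschitzWith.of_dist_le_mul fun y z => ?_) 1
  have h := (Metric.lipschitz_infDist_pt (s := ωᶜ)).dist_le_mul y z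
  rw [Real.dist_eq, NNReal.coe_one, one_mul] at h
  rw [Real.dist_eq, Real.coe_toNNReal _ (by positivity), ← sub_div, abs_div, abs_of_pos hδ,
    div_mul_eq_mul_div, one_mul]
  exact div_le_div_of_nonneg_right h hδ.le

theorem innerCutoff_nonneg (ω : Set (Space d)) {δ : ℝ} (hδ : 0 < δ) (x : Space d) :
    0 ≤ innerCutoff ω δ x := le_min zero_le_one (div_nonneg Metric.infDist_nonneg hδ.le)

theorem innerCutoff_le_one (ω : Set (Space d)) (δ : ℝ) (x : Space d) :
    innerCutoff ω δ x ≤ 1 := min_le_left _ _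

theorem innerCutoff_eq_zero {δ : ℝ} {x : Space d} (hx : x ∉ ω) : innerCutoff ω δ x = 0 := by
  rw [innerCutoff, Metric.infDist_zero_of_mem (Set.mem_compl hx), zero_div]
  exact min_eq_right zero_le_one

theorem innerCutoff_eq_one {δ : ℝ} (hδ : 0 < δ) {x : Space d} (hx : δ ≤ Metric.infDist x ωᶜ) :
    innerCutoff ω δ x = 1 := min_eq_left ((one_le_div hδ).2 hx)

/-- Off the collar the cutoff takes its maximal value 1 or its minimal value 0, and the derivative
vanishes at an extremum even without differentiability. A point of ω closer than δ to the complement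
is in the collar because the ball around it must meet the boundary. -/
theorem fderiv_innerCutoff_eq_zero {δ : ℝ} (hδ : 0 < δ) (hne : ωᶜ.Nonempty) {x : Space d}
    (hx : x ∉ collar ω δ) : fderiv ℝ (innerCutoff ω δ) x = 0 := by
  by_cases hxω : x ∈ ω
  · have h1 : innerCutoff ω δ x = 1 := by
      refine innerCutoff_eq_one hδ (le_of_not_gt fun hlt => hx ⟨hxω, ?_⟩)
      obtain ⟨z, hz, hzx⟩ := (Metric.infDist_lt_iff hne).1 hlt
      rw [dist_comm] at hzx
      obtain ⟨p, hp, hpx⟩ := exists_mem_frontier_dist_lt hxω hz hzx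
      exact Metric.mem_thickening_iff.2 ⟨p, hp, hpx⟩
    refine IsLocalMax.fderiv_eq_zero (Eventually.of_forall fun y => ?_)
    simp only [h1]
    exact innerCutoff_le_one ω δ y
  · refine IsLocalMin.fderiv_eq_zero (Eventually.of_forall fun y => ?_)
    simp only [innerCutoff_eq_zero hxω]
    exact innerCutoff_nonneg ω hδ y

theorem tendsto_innerCutoff (hω : IsOpen ω) (hne : ωᶜ.Nonempty) (x : Space d) :
    Tendsto (fun n : ℕ => innerCutoff ω (1 / ((n : ℝ) + 1)) x) atTop
      (𝓝 (ω.indicator (fun _ => (1 : ℝ)) x)) := by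
  by_cases hx : x ∈ ω
  · rw [Set.indicator_of_mem hx]
    have hpos : 0 < Metric.infDist x ωᶜ :=
      (hω.isClosed_compl.notMem_iff_infDist_pos hne).1 fun h => h hx
    refine tendsto_const_nhds.congr' ?_
    filter_upwards [tendsto_one_div_add_atTop_nhds_zero_nat.eventually (gt_mem_nhds hpos)]
      with n hn
    rw [innerCutoff_eq_one (by positivity) hn.le]
  · rw [Set.indicator_of_notMem hx]
    exact tendsto_const_nhds.congr fun n => (innerCutoff_eq_zero hx).symm

theorem nonempty_compl_of_isBounded {m : ℕ} {ω : Set (Space (m + 1))}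
    (hb : Bornology.IsBounded ω) : ωᶜ.Nonempty := by
  rw [Set.nonempty_compl]
  rintro rfl
  exact NormedSpace.unbounded_univ ℝ (Space (m + 1)) hb

/-- The integral of a derivative over a Lipschitz domain is bounded by a surface integral. -/
theorem IsLipschitzDomain.abs_setIntegral_fderiv_le {m : ℕ} {ω : Set (Space (m + 1))}
    (hω : IsLipschitzDomain ω) :
    ∃ C : ℝ≥0, ∀ (F : Space (m + 1) → ℝ) (L : ℝ≥0), LipschitzWith L F → HasCompactSupport F →
      ∀ i, ENNReal.ofReal |∫ x in ω, fderiv ℝ F x (EuclideanSpace.single i 1)| ≤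
        C * ∫⁻ z in frontier ω, ENNReal.ofReal |F z| ∂surface (m + 1) := by
  obtain ⟨C, δ₀, hδ₀, hC⟩ := hω.collar_le_surface
  have hne := nonempty_compl_of_isBounded hω.isBounded
  refine ⟨C, fun F L hF hc i => ?_⟩
  have he : ‖(EuclideanSpace.single i 1 : Space (m + 1))‖ = 1 := by simp
  have hF' : LipschitzWith L fun x => |F x| := by
    have := (lipschitzWith_one_norm (E := ℝ)).comp hF
    rwa [one_mul] at this
  obtain ⟨A, hA⟩ := hC (fun x => |F x|) L hF' fun y => abs_nonneg _
  have hint := integrable_fderiv_of_lipschitz hF hc (EuclideanSpace.single i 1)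
  -- A substitute for the divergence theorem. The indicator of ω is replaced by a cutoff of width δ,
  -- and integration by parts leaves F times a derivative of size 1/δ on the collar, where the
  -- integral of |F| is δ times a surface integral up to O(δ²). An inequality suffices because it is
  -- only used to show that something vanishes.
  have hlim : Tendsto (fun n : ℕ => ∫ x, innerCutoff ω (1 / ((n : ℝ) + 1)) x *
      fderiv ℝ F x (EuclideanSpace.single i 1)) atTop
      (𝓝 (∫ x in ω, fderiv ℝ F x (EuclideanSpace.single i 1))) := by
    rw [← integral_indicator hω.isOpen.measurableSet]
    refine tendsto_integral_of_dominated_convergence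
      (fun x => ‖fderiv ℝ F x (EuclideanSpace.single i 1)‖) (fun n => ?_) hint.norm
      (fun n => Eventually.of_forall fun x => ?_) (Eventually.of_forall fun x => ?_)
    · exact (lipschitz_innerCutoff ω (by positivity)).continuous.aestronglyMeasurable.mul
        hint.aestronglyMeasurable
    · rw [norm_mul]
      refine mul_le_of_le_one_left (norm_nonneg _) ?_
      rw [Real.norm_eq_abs, abs_of_nonneg (innerCutoff_nonneg ω (by positivity) x)]
      exact innerCutoff_le_one _ _ _
    · have := (tendsto_innerCutoff hω.isOpen hne x).mul_const
        (fderiv ℝ F x (EuclideanSpace.single i 1))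
      convert this using 2
      by_cases hx : x ∈ ω <;> simp [hx]
  have hzero := tendsto_one_div_add_atTop_nhds_zero_nat (𝕜 := ℝ)
  have hbound : Tendsto (fun n : ℕ => C * (∫⁻ z in frontier ω, ENNReal.ofReal |F z|
      ∂surface (m + 1)) + ENNReal.ofReal (1 / ((n : ℝ) + 1)) * A) atTop
      (𝓝 (C * (∫⁻ z in frontier ω, ENNReal.ofReal |F z| ∂surface (m + 1)) +
        ENNReal.ofReal 0 * A)) :=
    tendsto_const_nhds.add (ENNReal.Tendsto.mul_const
      ((ENNReal.continuous_ofReal.tendsto 0).comp hzero) (Or.inr ENNReal.coe_ne_top))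
  rw [ENNReal.ofReal_zero, zero_mul, add_zero] at hbound
  refine le_of_tendsto_of_tendsto ((ENNReal.continuous_ofReal.tendsto _).comp hlim.abs) hbound ?_
  filter_upwards [hzero.eventually (gt_mem_nhds hδ₀)] with n hn
  set δ : ℝ := 1 / ((n : ℝ) + 1) with hδ
  have hδp : 0 < δ := by positivity
  have hη := lipschitz_innerCutoff ω hδp
  simp only [Function.comp]
  rw [integral_mul_fderiv_of_lipschitz hη hF hc, abs_neg, ← Real.enorm_eq_ofReal_abs]
  refine (enorm_integral_le_lintegral_enorm _).trans ?_
  calc _ ≤ ∫⁻ x, (collar ω δ).indicator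
        (fun x => ENNReal.ofReal (1 / δ) * ENNReal.ofReal |F x|) x := by
        refine lintegral_mono fun x => ?_
        by_cases hx : x ∈ collar ω δ
        · rw [Set.indicator_of_mem hx, Real.enorm_eq_ofReal_abs, abs_mul,
            ← ENNReal.ofReal_mul (by positivity)]
          refine ENNReal.ofReal_le_ofReal (mul_le_mul_of_nonneg_right ?_ (abs_nonneg _))
          have := abs_fderiv_le hη he x
          rwa [Real.coe_toNNReal _ (by positivity)] at this
        · rw [Set.indicator_of_notMem hx, fderiv_innerCutoff_eq_zero hδp hne hx]
          simp
    _ = ENNReal.ofReal (1 / δ) * ∫⁻ x in collar ω δ, ENNReal.ofReal |F x| := by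
        rw [lintegral_indicator (isOpen_collar hω.isOpen δ).measurableSet,
          lintegral_const_mul _ hF'.continuous.measurable.ennreal_ofReal]
    _ ≤ ENNReal.ofReal (1 / δ) * (ENNReal.ofReal δ *
        (C * ∫⁻ z in frontier ω, ENNReal.ofReal |F z| ∂surface (m + 1)) +
          ENNReal.ofReal (δ ^ 2) * A) := mul_le_mul_right (hA δ hδp hn) _
    _ = _ := by
        have h1 : 1 / δ * δ ^ 2 = δ := by field_simp
        rw [mul_add, ← mul_assoc, ← ENNReal.ofReal_mul (by positivity), one_div_mul_cancel hδp.ne',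
          ENNReal.ofReal_one, one_mul, ← mul_assoc, ← ENNReal.ofReal_mul (by positivity), h1]

theorem HasTrace.mono (h : HasTrace ω Γ u q) (hΓ : Γ' ⊆ Γ) : HasTrace ω Γ' u q := by
  obtain ⟨h1, h2, φ, h3, h4, h5⟩ := h
  have hle := Measure.restrict_mono_set (surface d) hΓ
  exact ⟨h1, h2.mono_measure hle, φ, h3, h4, tendsto_of_tendsto_of_tendsto_of_le_of_le
    tendsto_const_nhds h5 (fun _ => zero_le) fun n => eLpNorm_mono_measure _ hle⟩

theorem sqrt_integral_sq_le_normH1 : √(∫ x in ω, u x ^ 2) ≤ normH1 ω u :=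
  Real.sqrt_le_iff.2 ⟨normH1_nonneg, integral_sq_le_normH1_sq⟩

theorem SobolevPair.integral_coord_sq_le (hω : IsOpen ω) (h : SobolevPair ω u G) (i : Fin d) :
    ∫ x in ω, G x i ^ 2 ≤ normH1 ω u ^ 2 := by
  rw [h.normH1_sq hω]
  have h1 : ∫ x in ω, G x i ^ 2 ≤ ∫ x in ω, ‖G x‖ ^ 2 := by
    rw [integral_norm_sq_eq_sum h.memLp_grad]
    exact Finset.single_le_sum (f := fun i => ∫ x in ω, G x i ^ 2)
      (fun i _ => integral_nonneg fun x => sq_nonneg _) (Finset.mem_univ i)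
  have h2 : 0 ≤ ∫ x in ω, u x ^ 2 := integral_nonneg fun x => sq_nonneg _
  linarith

/-- The defect in the integration by parts formula is bounded by the norm of `H¹(ω)`. -/
theorem SobolevPair.abs_defect_le (hω : IsOpen ω) (h : SobolevPair ω u G) {f g : Space d → ℝ}
    (hf : MemLp f 2 (volume.restrict ω)) (hg : MemLp g 2 (volume.restrict ω)) (i : Fin d) :
    |(∫ x in ω, u x * f x) + ∫ x in ω, G x i * g x| ≤
      normH1 ω u * (√(∫ x in ω, f x ^ 2) + √(∫ x in ω, g x ^ 2)) := by
  refine (abs_add_le _ _).trans ?_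
  rw [mul_add]
  refine add_le_add ((abs_integral_mul_le h.memLp hf).trans ?_)
    ((abs_integral_mul_le (memLp_coord h.memLp_grad i) hg).trans ?_)
  · exact mul_le_mul_of_nonneg_right sqrt_integral_sq_le_normH1 (Real.sqrt_nonneg _)
  · exact mul_le_mul_of_nonneg_right (Real.sqrt_le_iff.2
      ⟨normH1_nonneg, h.integral_coord_sq_le hω i⟩) (Real.sqrt_nonneg _)

theorem exists_lipschitzWith_of_contDiff (hφ : ContDiff ℝ ((⊤ : ℕ∞) : WithTop ℕ∞) φ)
    (hc : HasCompactSupport φ) : ∃ K : ℝ≥0, LipschitzWith K φ :=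
  hφ.lipschitzWith_of_hasCompactSupport hc (by simp)

theorem IsLipschitzDomain.eLpNorm_surface_lt_top {m : ℕ} {ω : Set (Space (m + 1))}
    (hω : IsLipschitzDomain ω) {φ : Space (m + 1) → ℝ} {K : ℝ≥0} (hφ : LipschitzWith K φ) :
    eLpNorm φ 2 ((surface (m + 1)).restrict (frontier ω)) < ∞ := by
  obtain ⟨C, hC⟩ := hω.trace_sq_le
  have h := (hC φ K hφ).trans_lt ENNReal.ofReal_lt_top
  refine (((ENNReal.pow_lt_top_iff (n := 2)).1 ?_).resolve_right two_ne_zero :)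
  rw [eLpNorm_two_sq]
  refine lt_of_eq_of_lt (lintegral_congr fun x => ?_) h
  rw [Real.enorm_eq_ofReal_abs, ← ENNReal.ofReal_pow (abs_nonneg _), sq_abs]

theorem lintegral_abs_mul_le {α : Type*} [MeasurableSpace α] {μ : Measure α} {f g : α → ℝ}
    (hf : AEStronglyMeasurable f μ) (hg : AEStronglyMeasurable g μ) :
    ∫⁻ x, ENNReal.ofReal |f x * g x| ∂μ ≤ eLpNorm f 2 μ * eLpNorm g 2 μ := by
  have := eLpNorm_le_eLpNorm_mul_eLpNorm_of_nnnorm (p := 2) (q := 2) (r := 1) hf hg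
    (fun a b => a * b) 1 (Eventually.of_forall fun x => by simp)
  rw [eLpNorm_one_eq_lintegral_enorm, ENNReal.coe_one, one_mul] at this
  refine le_trans (le_of_eq (lintegral_congr fun x => ?_)) this
  rw [Real.enorm_eq_ofReal_abs]

/-- Extension by zero across the part of the boundary where the trace vanishes. -/
theorem HasTrace.sobolevPair_indicator {m : ℕ} {ω Ω : Set (Space (m + 1))}
    {v : Space (m + 1) → ℝ} (hω : IsLipschitzDomain ω) (hΩ : IsOpen Ω) (h : ω ⊆ Ω)
    (hv : HasTrace ω (frontier ω ∩ Ω) v 0) :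
    SobolevPair Ω (ω.indicator v) (ω.indicator (wgrad ω v)) := by
  obtain ⟨hv1, -, φ, hφL, hφ1, hφ2⟩ := hv
  have hp := hv1.sobolevPair
  have hres : (volume.restrict Ω).restrict ω = (volume.restrict ω : Measure (Space (m + 1))) := by
    rw [Measure.restrict_restrict hω.isOpen.measurableSet, Set.inter_eq_left.2 h]
  refine ⟨(memLp_indicator_iff_restrict hω.isOpen.measurableSet).2 (by rw [hres]; exact hp.memLp),
    (memLp_indicator_iff_restrict hω.isOpen.measurableSet).2 (by rw [hres]; exact hp.memLp_grad),
    fun ζ hζ hc hs i => ?_⟩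
  have e1 : ∫ x in Ω, ω.indicator v x * fderiv ℝ ζ x (EuclideanSpace.single i 1) =
      ∫ x in ω, v x * fderiv ℝ ζ x (EuclideanSpace.single i 1) := by
    rw [setIntegral_eq_of_support_subset h fun x hx => by rw [Set.indicator_of_notMem hx, zero_mul]]
    exact setIntegral_congr_fun hω.isOpen.measurableSet fun x hx => by
      simp only [Set.indicator_of_mem hx]
  have e2 : ∫ x in Ω, ω.indicator (wgrad ω v) x i * ζ x = ∫ x in ω, wgrad ω v x i * ζ x := by
    rw [setIntegral_eq_of_support_subset h fun x hx => by
      rw [Set.indicator_of_notMem hx]; simp]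
    exact setIntegral_congr_fun hω.isOpen.measurableSet fun x hx => by
      simp only [Set.indicator_of_mem hx]
  rw [e1, e2, ← add_eq_zero_iff_eq_neg]
  obtain ⟨Kζ, hKζ⟩ := exists_lipschitzWith_of_contDiff hζ hc
  have hζd := memLp_fderiv_single hζ hc i 2 (volume.restrict ω)
  have hζ2 := memLp_test hζ.continuous hc 2 (volume.restrict ω)
  obtain ⟨C, hC⟩ := hω.abs_setIntegral_fderiv_le
  set B : ℝ := √(∫ x in ω, (fderiv ℝ ζ x (EuclideanSpace.single i 1)) ^ 2) + √(∫ x in ω, ζ x ^ 2)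
  -- I is the defect to be shown zero. For the Lipschitz approximants φ n it is the integral over ω
  -- of a derivative of φ n * ζ, hence bounded by a surface integral; since ζ vanishes off Ω, only
  -- the boundary part inside Ω counts, where φ n tends to 0.
  set I : ℝ := (∫ x in ω, v x * fderiv ℝ ζ x (EuclideanSpace.single i 1)) +
    ∫ x in ω, wgrad ω v x i * ζ x
  set μ := (surface (m + 1)).restrict (frontier ω ∩ Ω)
  have hζμ : eLpNorm ζ 2 μ ≠ ∞ := ((eLpNorm_mono_measure _ (Measure.restrict_mono_set _
    Set.inter_subset_left)).trans_lt (hω.eLpNorm_surface_lt_top hKζ)).ne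
  have hbound : ∀ n, ENNReal.ofReal |I| ≤ ENNReal.ofReal (normH1 ω (φ n - v) * B) +
      C * (eLpNorm (φ n - 0) 2 μ * eLpNorm ζ 2 μ) := by
    intro n
    obtain ⟨L, hL⟩ := hφL n
    have hpn := sobolevPair_of_lipschitz hω.isOpen hω.isBounded hL
    obtain ⟨L', hL'⟩ := exists_lipschitzWith_mul hL hKζ hc
    have hdefect := (hpn.sub hp).abs_defect_le hω.isOpen hζd hζ2 i
    have hprod : ∫ x in ω, fderiv ℝ (φ n * ζ) x (EuclideanSpace.single i 1) =
        (∫ x in ω, φ n x * fderiv ℝ ζ x (EuclideanSpace.single i 1)) +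
          ∫ x in ω, gradient (φ n) x i * ζ x := by
      rw [← integral_add (integrable_mul_of_memLp_two hpn.memLp hζd)
        (integrable_mul_of_memLp_two (memLp_coord hpn.memLp_grad i) hζ2)]
      refine integral_congr_ae (ae_restrict_of_ae ?_)
      filter_upwards [hL.ae_differentiableAt] with x hx
      rw [fderiv_mul hx (hζ.differentiable (by simp) x), gradient_coord]
      simp only [_root_.add_apply, _root_.smul_apply, smul_eq_mul]
      ring
    have hI : I = (∫ x in ω, fderiv ℝ (φ n * ζ) x (EuclideanSpace.single i 1)) -
        ((∫ x in ω, (φ n - v) x * fderiv ℝ ζ x (EuclideanSpace.single i 1)) +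
          ∫ x in ω, (gradient (φ n) - wgrad ω v) x i * ζ x) := by
      rw [hprod]
      have t1 : ∫ x in ω, (φ n - v) x * fderiv ℝ ζ x (EuclideanSpace.single i 1) =
          (∫ x in ω, φ n x * fderiv ℝ ζ x (EuclideanSpace.single i 1)) -
            ∫ x in ω, v x * fderiv ℝ ζ x (EuclideanSpace.single i 1) := by
        rw [← integral_sub (integrable_mul_of_memLp_two hpn.memLp hζd)
          (integrable_mul_of_memLp_two hp.memLp hζd)]
        exact integral_congr_ae (Eventually.of_forall fun x => by
          simp only [Pi.sub_apply]; ring)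
      have t2 : ∫ x in ω, (gradient (φ n) - wgrad ω v) x i * ζ x =
          (∫ x in ω, gradient (φ n) x i * ζ x) - ∫ x in ω, wgrad ω v x i * ζ x := by
        rw [← integral_sub (integrable_mul_of_memLp_two (memLp_coord hpn.memLp_grad i) hζ2)
          (integrable_mul_of_memLp_two (memLp_coord hp.memLp_grad i) hζ2)]
        exact integral_congr_ae (Eventually.of_forall fun x => by
          simp only [Pi.sub_apply, PiLp.sub_apply]; ring)
      rw [t1, t2]
      ring
    have hsurf : ENNReal.ofReal |∫ x in ω, fderiv ℝ (φ n * ζ) x (EuclideanSpace.single i 1)| ≤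
        C * (eLpNorm (φ n - 0) 2 μ * eLpNorm ζ 2 μ) := by
      refine (hC _ L' hL' hc.mul_left i).trans (mul_le_mul_right ?_ _)
      rw [sub_zero]
      refine le_trans (le_of_eq ?_) (lintegral_abs_mul_le
        hL.continuous.aestronglyMeasurable hζ.continuous.aestronglyMeasurable)
      rw [show μ = ((surface (m + 1)).restrict (frontier ω)).restrict Ω by
        rw [Measure.restrict_restrict hΩ.measurableSet, Set.inter_comm],
        ← lintegral_indicator hΩ.measurableSet]
      refine lintegral_congr fun x => ?_
      by_cases hx : x ∈ Ω
      · rw [Set.indicator_of_mem hx]; rfl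
      · rw [Set.indicator_of_notMem hx, Pi.mul_apply, test_eq_zero hs hx]
        simp
    rw [hI]
    calc _ ≤ ENNReal.ofReal (|∫ x in ω, fderiv ℝ (φ n * ζ) x (EuclideanSpace.single i 1)| +
          normH1 ω (φ n - v) * B) :=
          ENNReal.ofReal_le_ofReal ((abs_sub _ _).trans (by gcongr))
      _ ≤ _ := by
          rw [add_comm]
          exact ENNReal.ofReal_add_le.trans (add_le_add_right hsurf _)
  have hlim : Tendsto (fun n => ENNReal.ofReal (normH1 ω (φ n - v) * B) +
      C * (eLpNorm (φ n - 0) 2 μ * eLpNorm ζ 2 μ)) atTop (𝓝 (ENNReal.ofReal (0 * B) +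
        C * (0 * eLpNorm ζ 2 μ))) :=
    ((ENNReal.continuous_ofReal.tendsto _).comp (hφ1.mul_const B)).add
      (ENNReal.Tendsto.const_mul (ENNReal.Tendsto.mul_const hφ2 (Or.inr hζμ))
        (Or.inr ENNReal.coe_ne_top))
  simp only [zero_mul, ENNReal.ofReal_zero, mul_zero, add_zero] at hlim
  have h0 := ge_of_tendsto' hlim hbound
  rw [nonpos_iff_eq_zero, ENNReal.ofReal_eq_zero] at h0
  exact abs_eq_zero.1 (le_antisymm h0 (abs_nonneg _))

end MSGFEM

/-! ### Calculus of traces -/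

namespace MSGFEM

section

variable {d : ℕ} {ω ω' Ω Γ Γ' : Set (Space d)} {u v f q p : Space d → ℝ} {G H : Space d → Space d}
  {ψ φ F : Space d → ℝ} {K K' : ℝ≥0}

theorem norm_add_sq_le {F : Type*} [NormedAddCommGroup F] (a b : F) :
    ‖a + b‖ ^ 2 ≤ 2 * (‖a‖ ^ 2 + ‖b‖ ^ 2) := by
  nlinarith [norm_add_le a b, norm_nonneg (a + b), sq_nonneg (‖a‖ - ‖b‖), norm_nonneg a,
    norm_nonneg b]

theorem integrable_norm_sq {α F : Type*} [MeasurableSpace α] {μ : Measure α}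
    [NormedAddCommGroup F] {f : α → F} (hf : MemLp f 2 μ) : Integrable (fun x => ‖f x‖ ^ 2) μ :=
  hf.integrable_norm_pow two_ne_zero

theorem integrable_sq {α : Type*} [MeasurableSpace α] {μ : Measure α}
    {f : α → ℝ} (hf : MemLp f 2 μ) : Integrable (fun x => f x ^ 2) μ := by
  simpa using integrable_norm_sq hf

/-- Multiplication by a bounded Lipschitz function is bounded on `H¹(ω)`. -/
theorem normH1_mul_lipschitz_le (hω : IsOpen ω) (hb : Bornology.IsBounded ω)
    (hψ : LipschitzWith K ψ) {M : ℝ} (hM : ∀ x, |ψ x| ≤ M) :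
    ∃ C : ℝ, ∀ u, MemH1 ω u → normH1 ω (ψ * u) ≤ C * normH1 ω u := by
  have hM0 : 0 ≤ M := (abs_nonneg _).trans (hM 0)
  refine ⟨√(3 * M ^ 2 + 2 * K ^ 2), fun u hu => ?_⟩
  have hp := hu.sobolevPair
  have hm := hp.mul_lipschitz hω hb hψ hM
  refine abs_le_of_sq_le_sq' ?_ (by have := normH1_nonneg (ω := ω) (u := u); positivity) |>.2
  rw [mul_pow, Real.sq_sqrt (by positivity), hm.normH1_sq hω, hp.normH1_sq hω]
  have iu := integrable_sq hp.memLp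
  have iG := integrable_norm_sq hp.memLp_grad
  have hψ2 : ∀ x, ψ x ^ 2 ≤ M ^ 2 := fun x => sq_le_sq' (abs_le.1 (hM x)).1 (abs_le.1 (hM x)).2
  have h1 : ∫ x in ω, (ψ * u) x ^ 2 ≤ M ^ 2 * ∫ x in ω, u x ^ 2 := by
    rw [← integral_const_mul]
    refine integral_mono (integrable_sq hm.memLp) (iu.const_mul _) fun x => ?_
    simp only [Pi.mul_apply, mul_pow]
    exact mul_le_mul_of_nonneg_right (hψ2 x) (sq_nonneg _)
  have h2 : ∫ x in ω, ‖ψ x • wgrad ω u x + u x • gradient ψ x‖ ^ 2 ≤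
      2 * (M ^ 2 * (∫ x in ω, ‖wgrad ω u x‖ ^ 2) + K ^ 2 * ∫ x in ω, u x ^ 2) := by
    rw [← integral_const_mul, ← integral_const_mul, ← integral_add (iG.const_mul _) (iu.const_mul _),
      ← integral_const_mul]
    refine integral_mono (integrable_norm_sq hm.memLp_grad)
      (((iG.const_mul _).add (iu.const_mul _)).const_mul _) fun x => ?_
    refine (norm_add_sq_le _ _).trans (mul_le_mul_of_nonneg_left (add_le_add ?_ ?_) zero_le_two)
    · rw [norm_smul, mul_pow, Real.norm_eq_abs, sq_abs]
      exact mul_le_mul_of_nonneg_right (hψ2 x) (sq_nonneg _)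
    · rw [norm_smul, mul_pow, Real.norm_eq_abs, sq_abs, mul_comm]
      exact mul_le_mul_of_nonneg_right
        (pow_le_pow_left₀ (norm_nonneg _) (norm_gradient_le hψ x) 2) (sq_nonneg _)
  have h3 : 0 ≤ ∫ x in ω, ‖wgrad ω u x‖ ^ 2 := integral_nonneg fun x => sq_nonneg _
  have h4 : 0 ≤ ∫ x in ω, u x ^ 2 := integral_nonneg fun x => sq_nonneg _
  nlinarith [mul_nonneg (sq_nonneg M) h3, mul_nonneg (sq_nonneg (K : ℝ)) h3]

theorem HasTrace.memH1 (h : HasTrace ω Γ u q) : MemH1 ω u := h.1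

theorem HasTrace.congr_right (h : HasTrace ω Γ u q) (hq : q =ᵐ[(surface d).restrict Γ] p) :
    HasTrace ω Γ u p := by
  obtain ⟨h1, h2, φ, h3, h4, h5⟩ := h
  refine ⟨h1, h2.ae_eq hq, φ, h3, h4, h5.congr fun n => eLpNorm_congr_ae ?_⟩
  exact EventuallyEq.rfl.sub hq

theorem HasTrace.congr_left (hω : IsOpen ω) (hb : Bornology.IsBounded ω) (h : HasTrace ω Γ u q)
    (hu : u =ᵐ[volume.restrict ω] v) : HasTrace ω Γ v q := by
  obtain ⟨h1, h2, φ, h3, h4, h5⟩ := h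
  refine ⟨h1.congr hu, h2, φ, h3, h4.congr fun n => ?_, h5⟩
  obtain ⟨L, hL⟩ := h3 n
  exact (normH1_congr hω ((memH1_of_lipschitz hω hb hL).sub h1) (EventuallyEq.rfl.sub hu)).symm

theorem aestronglyMeasurable_of_lipschitz (hφ : LipschitzWith K φ) (μ : Measure (Space d)) :
    AEStronglyMeasurable φ μ := hφ.continuous.aestronglyMeasurable

theorem HasTrace.sub (hω : IsOpen ω) (hb : Bornology.IsBounded ω) (h : HasTrace ω Γ u q)
    (h' : HasTrace ω Γ v p) : HasTrace ω Γ (u - v) (q - p) := by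
  obtain ⟨h1, h2, φ, h3, h4, h5⟩ := h
  obtain ⟨k1, k2, ψ, k3, k4, k5⟩ := h'
  refine ⟨h1.sub k1, h2.sub k2, fun n => φ n - ψ n, fun n => ?_, ?_, ?_⟩
  · obtain ⟨L, hL⟩ := h3 n
    obtain ⟨L', hL'⟩ := k3 n
    exact ⟨_, hL.sub hL'⟩
  · refine squeeze_zero (fun n => normH1_nonneg) (fun n => ?_) (by simpa using h4.add k4)
    obtain ⟨L, hL⟩ := h3 n
    obtain ⟨L', hL'⟩ := k3 n
    rw [show φ n - ψ n - (u - v) = (φ n - u) - (ψ n - v) by abel]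
    exact normH1_sub_le hω ((memH1_of_lipschitz hω hb hL).sub h1)
      ((memH1_of_lipschitz hω hb hL').sub k1)
  · refine tendsto_of_tendsto_of_tendsto_of_le_of_le tendsto_const_nhds
      (by simpa using h5.add k5) (fun _ => zero_le) fun n => ?_
    obtain ⟨L, hL⟩ := h3 n
    obtain ⟨L', hL'⟩ := k3 n
    simp only
    rw [show φ n - ψ n - (q - p) = (φ n - q) - (ψ n - p) by abel]
    exact eLpNorm_sub_le ((aestronglyMeasurable_of_lipschitz hL _).sub h2.1)
      ((aestronglyMeasurable_of_lipschitz hL' _).sub k2.1) one_le_two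

theorem HasTrace.smul (hω : IsOpen ω) (hb : Bornology.IsBounded ω) (c : ℝ)
    (h : HasTrace ω Γ u q) : HasTrace ω Γ (c • u) (c • q) := by
  obtain ⟨h1, h2, φ, h3, h4, h5⟩ := h
  refine ⟨h1.smul c, h2.const_smul c, fun n => c • φ n, fun n => ?_, ?_, ?_⟩
  · obtain ⟨L, hL⟩ := h3 n
    exact ⟨_, (lipschitzWith_smul c).comp hL⟩
  · refine (by simpa using h4.const_mul |c| : Tendsto (fun n => |c| * normH1 ω (φ n - u)) atTop
      (𝓝 0)).congr fun n => ?_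
    obtain ⟨L, hL⟩ := h3 n
    rw [← smul_sub, normH1_smul hω c ((memH1_of_lipschitz hω hb hL).sub h1)]
  · refine (by simpa using ENNReal.Tendsto.const_mul (a := ‖c‖ₑ) h5 (Or.inr enorm_ne_top) :
      Tendsto (fun n => ‖c‖ₑ * eLpNorm (φ n - q) 2 ((surface d).restrict Γ)) atTop
      (𝓝 0)).congr fun n => ?_
    rw [← smul_sub, eLpNorm_const_smul]

theorem HasTrace.zero (hω : IsOpen ω) : HasTrace ω Γ (0 : Space d → ℝ) 0 := by
  have h0 : MemH1 ω (0 : Space d → ℝ) := SobolevPair.zero.memH1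
  refine ⟨h0, MemLp.zero, fun _ => 0, fun n => ⟨0, LipschitzWith.const 0⟩, ?_, ?_⟩
  · have : normH1 ω ((0 : Space d → ℝ) - 0) = 0 := by
      have := normH1_smul hω 0 h0
      simpa using this
    simp only [this]
    exact tendsto_const_nhds
  · simp

theorem HasTrace.add (hω : IsOpen ω) (hb : Bornology.IsBounded ω) (h : HasTrace ω Γ u q)
    (h' : HasTrace ω Γ v p) : HasTrace ω Γ (u + v) (q + p) := by
  have h1 := (HasTrace.zero hω).sub hω hb h'
  have h2 := h.sub hω hb h1
  rwa [zero_sub, zero_sub, sub_neg_eq_add, sub_neg_eq_add] at h2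

theorem HasTrace.restrict (hω : IsOpen ω) (hb : Bornology.IsBounded ω) (hω' : IsOpen ω')
    (h : ω' ⊆ ω) (hu : HasTrace ω Γ u q) : HasTrace ω' Γ u q := by
  obtain ⟨h1, h2, φ, h3, h4, h5⟩ := hu
  refine ⟨h1.mono h, h2, φ, h3, squeeze_zero (fun n => normH1_nonneg) (fun n => ?_) h4, h5⟩
  obtain ⟨L, hL⟩ := h3 n
  exact normH1_mono hω' h ((memH1_of_lipschitz hω hb hL).sub h1)

theorem HasTrace.mul_lipschitz (hω : IsOpen ω) (hb : Bornology.IsBounded ω)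
    (h : HasTrace ω Γ u q) (hψ : LipschitzWith K ψ) (hc : HasCompactSupport ψ) :
    HasTrace ω Γ (ψ * u) (ψ * q) := by
  obtain ⟨h1, h2, φ, h3, h4, h5⟩ := h
  obtain ⟨M, hM0, hM⟩ := exists_bound_of_hasCompactSupport hψ.continuous hc
  obtain ⟨C, hC⟩ := normH1_mul_lipschitz_le hω hb hψ hM
  have hle : ∀ w : Space d → ℝ, ∀ x, ‖(ψ * w) x‖ ≤ M * ‖w x‖ := fun w x => by
    rw [Pi.mul_apply, norm_mul]
    exact mul_le_mul_of_nonneg_right (hM x) (norm_nonneg _)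
  have hψm := hψ.continuous.aestronglyMeasurable (μ := (surface d).restrict Γ)
  refine ⟨h1.mul_lipschitz hω hb hψ hM, h2.of_le_mul (hψm.mul h2.1)
    (Eventually.of_forall (hle q)), fun n => ψ * φ n, fun n => ?_, ?_, ?_⟩
  · obtain ⟨L, hL⟩ := h3 n
    obtain ⟨L', hL'⟩ := exists_lipschitzWith_mul hL hψ hc
    refine ⟨L', ?_⟩
    simp only
    rwa [mul_comm]
  · refine squeeze_zero (fun n => normH1_nonneg) (fun n => ?_) (by simpa using h4.const_mul C)
    obtain ⟨L, hL⟩ := h3 n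
    rw [← mul_sub]
    exact hC _ ((memH1_of_lipschitz hω hb hL).sub h1)
  · have h6 := ENNReal.Tendsto.const_mul (a := ENNReal.ofReal M) h5 (Or.inr ENNReal.ofReal_ne_top)
    rw [mul_zero] at h6
    refine tendsto_of_tendsto_of_tendsto_of_le_of_le tendsto_const_nhds h6 (fun _ => zero_le)
      fun n => ?_
    simp only
    rw [← mul_sub]
    exact eLpNorm_le_mul_eLpNorm_of_ae_le_mul (Eventually.of_forall (hle _)) 2

theorem frontier_inter_eq_of_isOpen (hΩ : IsOpen Ω) : frontier Ω ∩ Ω = ∅ := by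
  rw [hΩ.frontier_eq]
  exact Set.sdiff_inter_self

end

section

variable {m : ℕ} {ω ω' Ω Γ Γ' D N : Set (Space (m + 1))} {u v f q p : Space (m + 1) → ℝ}

/-- The trace inequality for Lipschitz functions, in terms of norms. -/
theorem IsLipschitzDomain.eLpNorm_le_normH1 (hω : IsLipschitzDomain ω) :
    ∃ C : ℝ≥0, ∀ (φ : Space (m + 1) → ℝ) (L : ℝ≥0), LipschitzWith L φ →
      eLpNorm φ 2 ((surface (m + 1)).restrict (frontier ω)) ≤ ENNReal.ofReal (C * normH1 ω φ) := by
  obtain ⟨C, hC⟩ := hω.trace_sq_le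
  refine ⟨NNReal.sqrt C, fun φ L hL => ?_⟩
  refine (ENNReal.pow_right_strictMono two_ne_zero).le_iff_le.1 ?_
  rw [eLpNorm_two_sq, ← ENNReal.ofReal_pow (mul_nonneg (NNReal.coe_nonneg _) normH1_nonneg), mul_pow,
    Real.coe_sqrt, Real.sq_sqrt C.coe_nonneg]
  refine le_trans (le_of_eq (lintegral_congr fun x => ?_)) (hC φ L hL)
  rw [Real.enorm_eq_ofReal_abs, ← ENNReal.ofReal_pow (abs_nonneg _), sq_abs]

/-- The trace inequality on a Lipschitz domain. -/
theorem IsLipschitzDomain.eLpNorm_trace_le (hω : IsLipschitzDomain ω) :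
    ∃ C : ℝ≥0, ∀ (Γ : Set (Space (m + 1))) (u q : Space (m + 1) → ℝ), Γ ⊆ frontier ω →
      HasTrace ω Γ u q →
      eLpNorm q 2 ((surface (m + 1)).restrict Γ) ≤ ENNReal.ofReal (C * normH1 ω u) := by
  obtain ⟨C, hC⟩ := hω.eLpNorm_le_normH1
  refine ⟨C, fun Γ u q hΓ ⟨h1, h2, φ, h3, h4, h5⟩ => ?_⟩
  have hlim : Tendsto (fun n => ENNReal.ofReal (C * (normH1 ω (φ n - u) + normH1 ω u)) +
      eLpNorm (φ n - q) 2 ((surface (m + 1)).restrict Γ)) atTop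
      (𝓝 (ENNReal.ofReal (C * (0 + normH1 ω u)) + 0)) :=
    ((ENNReal.continuous_ofReal.tendsto _).comp ((h4.add_const _).const_mul _)).add h5
  rw [zero_add, add_zero] at hlim
  refine ge_of_tendsto' hlim fun n => ?_
  obtain ⟨L, hL⟩ := h3 n
  have hφ := memH1_of_lipschitz hω.isOpen hω.isBounded hL
  have hm := aestronglyMeasurable_of_lipschitz hL ((surface (m + 1)).restrict Γ)
  calc eLpNorm q 2 ((surface (m + 1)).restrict Γ)
      = eLpNorm (φ n - (φ n - q)) 2 ((surface (m + 1)).restrict Γ) := by rw [sub_sub_cancel]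
    _ ≤ _ := eLpNorm_sub_le hm (hm.sub h2.1) one_le_two
    _ ≤ _ := add_le_add_left (((eLpNorm_mono_measure _ (Measure.restrict_mono_set _ hΓ)).trans
          (hC _ L hL)).trans (ENNReal.ofReal_le_ofReal (mul_le_mul_of_nonneg_left ?_ C.2))) _
  calc normH1 ω (φ n) = normH1 ω ((φ n - u) + u) := by rw [sub_add_cancel]
    _ ≤ _ := normH1_add_le hω.isOpen (hφ.sub h1) h1

theorem normH1_zero (hω : IsOpen ω) : normH1 ω (0 : Space (m + 1) → ℝ) = 0 := by
  simpa using normH1_smul hω 0 (SobolevPair.zero (ω := ω)).memH1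

/-- The difference of two traces of u is a trace of 0, which the trace inequality forces to vanish.
Thus the choice made in `trace` is immaterial. -/
theorem HasTrace.ae_eq (hω : IsLipschitzDomain ω) (hΓ : Γ ⊆ frontier ω) (h : HasTrace ω Γ u q)
    (h' : HasTrace ω Γ u p) : q =ᵐ[(surface (m + 1)).restrict Γ] p := by
  obtain ⟨C, hC⟩ := hω.eLpNorm_trace_le
  have h1 := hC Γ _ _ hΓ (h.sub hω.isOpen hω.isBounded h')
  rw [sub_self, normH1_zero hω.isOpen, mul_zero, ENNReal.ofReal_zero, nonpos_iff_eq_zero,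
    eLpNorm_eq_zero_iff (h.2.1.sub h'.2.1).1 two_ne_zero] at h1
  filter_upwards [h1] with x hx
  exact sub_eq_zero.1 hx

/-- Existence of traces on a Lipschitz domain. -/
theorem IsLipschitzDomain.exists_hasTrace (hω : IsLipschitzDomain ω) (hu : MemH1 ω u) :
    ∃ q, HasTrace ω (frontier ω) u q := by
  obtain ⟨C, hC⟩ := hω.eLpNorm_le_normH1
  have h : ∀ n : ℕ, ∃ φ : Space (m + 1) → ℝ, (∃ L : ℝ≥0, LipschitzWith L φ) ∧
      normH1 ω (φ - u) < 1 / ((n : ℝ) + 1) := by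
    intro n
    obtain ⟨φ, h1, h2, h3⟩ := hω.isSmoothLimit hu (1 / ((n : ℝ) + 1)) (by positivity)
    exact ⟨φ, exists_lipschitzWith_of_contDiff h1 h2, h3⟩
  choose φ hL hφ using h
  have hφ1 : Tendsto (fun n => normH1 ω (φ n - u)) atTop (𝓝 0) :=
    squeeze_zero (fun n => normH1_nonneg) (fun n => (hφ n).le)
      tendsto_one_div_add_atTop_nhds_zero_nat
  set μ := (surface (m + 1)).restrict (frontier ω)
  have hmem : ∀ n, MemH1 ω (φ n) := fun n => by
    obtain ⟨L, hL⟩ := hL n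
    exact memH1_of_lipschitz hω.isOpen hω.isBounded hL
  have hLp : ∀ n, MemLp (φ n) 2 μ := fun n => by
    obtain ⟨L, hL⟩ := hL n
    exact ⟨aestronglyMeasurable_of_lipschitz hL _, hω.eLpNorm_surface_lt_top hL⟩
  -- The trace inequality turns convergence in H¹(ω) into the Cauchy property of the boundary
  -- values.
  have hcauchy : CauchySeq fun n => (hLp n).toLp (φ n) := by
    refine cauchySeq_of_le_tendsto_0' (fun n => C * (1 / ((n : ℝ) + 1) + 1 / ((n : ℝ) + 1)))
      (fun n k hnk => ?_) ?_
    · rw [dist_edist, Lp.edist_toLp_toLp]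
      obtain ⟨L, hL1⟩ := hL n
      obtain ⟨L', hL2⟩ := hL k
      refine ENNReal.toReal_le_of_le_ofReal (by positivity)
        ((hC _ _ (hL1.sub hL2)).trans (ENNReal.ofReal_le_ofReal
          (mul_le_mul_of_nonneg_left ?_ C.2)))
      rw [show (fun x => φ n x - φ k x) = (φ n - u) - (φ k - u) by ext x; simp]
      refine (normH1_sub_le hω.isOpen ((hmem n).sub hu) ((hmem k).sub hu)).trans
        (add_le_add (hφ n).le ((hφ k).le.trans ?_))
      gcongr
    · have := tendsto_one_div_add_atTop_nhds_zero_nat (𝕜 := ℝ)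
      simpa using (this.add this).const_mul (C : ℝ)
  obtain ⟨q, hq⟩ := cauchySeq_tendsto_of_complete hcauchy
  refine ⟨q, hu, Lp.memLp q, φ, hL, hφ1, ?_⟩
  have h1 := (Lp.tendsto_Lp_iff_tendsto_eLpNorm' _ q).1 hq
  refine h1.congr fun n => eLpNorm_congr_ae ?_
  filter_upwards [(hLp n).coeFn_toLp] with x hx
  simp [hx]

theorem hasTrace_trace (hω : IsLipschitzDomain ω) (hu : MemH1 ω u) (hΓ : Γ ⊆ frontier ω) :
    HasTrace ω Γ u (trace ω Γ u) := by
  obtain ⟨q, hq⟩ := hω.exists_hasTrace hu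
  have h : ∃ q, HasTrace ω Γ u q := ⟨q, hq.mono hΓ⟩
  rw [trace, dif_pos h]
  exact h.choose_spec

/-- The functions with vanishing trace are closed in `H¹(ω)`. -/
theorem HasTrace.of_tendsto (hω : IsLipschitzDomain ω) (hΓ : Γ ⊆ frontier ω) {ι : Type*}
    {l : Filter ι} [l.NeBot] {w : ι → Space (m + 1) → ℝ} (hw : ∀ j, HasTrace ω Γ (w j) 0)
    (hu : MemH1 ω u) (h : Tendsto (fun j => normH1 ω (w j - u)) l (𝓝 0)) :
    HasTrace ω Γ u 0 := by
  obtain ⟨C, hC⟩ := hω.eLpNorm_trace_le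
  have ht := hasTrace_trace hω hu hΓ
  refine ht.congr_right ?_
  have hlim : Tendsto (fun j => ENNReal.ofReal (C * normH1 ω (w j - u))) l
      (𝓝 (ENNReal.ofReal (C * 0))) := (ENNReal.continuous_ofReal.tendsto _).comp (h.const_mul _)
  rw [mul_zero, ENNReal.ofReal_zero] at hlim
  -- The function w j - u has trace 0 - `trace ω Γ u`, independent of j, and tends to 0 in H¹(ω).
  have h0 := ge_of_tendsto' hlim fun j => hC Γ _ _ hΓ ((hw j).sub hω.isOpen hω.isBounded ht)
  rw [zero_sub, eLpNorm_neg, nonpos_iff_eq_zero, eLpNorm_eq_zero_iff ht.2.1.1 two_ne_zero] at h0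
  exact h0

/-- A Lipschitz function with compact support that equals one on `ω`. -/
theorem exists_lipschitz_eq_one {d : ℕ} {ω : Set (Space d)} (hb : Bornology.IsBounded ω) :
    ∃ (θ : Space d → ℝ) (K : ℝ≥0), LipschitzWith K θ ∧ HasCompactSupport θ ∧
      (∀ x, θ x ∈ Set.Icc (0 : ℝ) 1) ∧ ∀ x ∈ closure ω, θ x = 1 := by
  obtain ⟨R, hR⟩ := (Metric.isBounded_iff_subset_closedBall (0 : Space d)).1 hb
  have hr : 0 < 2 * (|R| + 1) := by positivity
  obtain ⟨K, hK⟩ := lipschitz_bump (0 : Space d) hr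
  refine ⟨bump 0 (2 * (|R| + 1)), K, hK, hasCompactSupport_bump 0 hr,
    fun x => ⟨bump_nonneg _ _ _, bump_le_one _ _ _⟩, fun x hx => bump_eq_one hr ?_⟩
  have h1 : x ∈ Metric.closedBall (0 : Space d) R :=
    Metric.isClosed_closedBall.closure_subset_iff.2 hR hx
  rw [Metric.mem_closedBall] at h1
  linarith [le_abs_self R]

/-- The trace of the extension by zero. -/
theorem HasTrace.hasTrace_indicator (hω : IsLipschitzDomain ω) (hΩ : IsLipschitzDomain Ω)
    (h : ω ⊆ Ω) (hv : HasTrace ω (frontier ω ∩ Ω) v 0) (hp : HasTrace ω (frontier ω ∩ Γ) v p)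
    (hΓ : MeasurableSet Γ) (hΓΩ : Γ ⊆ frontier Ω) :
    HasTrace Ω Γ (ω.indicator v) ((frontier ω).indicator p) := by
  have hext := (hv.sobolevPair_indicator hω hΩ.isOpen h).memH1
  have ht := hasTrace_trace hΩ hext hΓΩ
  set q := trace Ω Γ (ω.indicator v)
  have hbd : frontier ω ∩ Γ ⊆ frontier ω := Set.inter_subset_left
  have hmeas : MeasurableSet (frontier ω) := isClosed_frontier.measurableSet
  -- On the common boundary the trace can be computed from inside ω, where the extension is v.
  have h1 : HasTrace ω (frontier ω ∩ Γ) v q := by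
    refine ((ht.mono Set.inter_subset_right).restrict hΩ.isOpen hΩ.isBounded hω.isOpen h).congr_left
      hω.isOpen hω.isBounded ?_
    filter_upwards [ae_restrict_mem hω.isOpen.measurableSet] with x hx
    exact Set.indicator_of_mem hx v
  have h2 := h1.ae_eq hω hbd hp
  rw [EventuallyEq, ae_restrict_iff' (hmeas.inter hΓ)] at h2
  obtain ⟨θ, K, hθ, hθc, hθI, hθ1⟩ := exists_lipschitz_eq_one hΩ.isBounded
  have hd : LipschitzWith 1 fun x => Metric.infDist x ω := Metric.lipschitz_infDist_pt ω
  -- Multiplied by the distance to ω, the extension becomes identically zero, so distance times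
  -- trace is zero almost everywhere on Γ. At points of Γ off the boundary of ω the distance is
  -- positive and the trace must vanish. The cutoff θ only provides compact support.
  obtain ⟨K', hK'⟩ := exists_lipschitzWith_mul hd hθ hθc
  have h3 := ht.mul_lipschitz hΩ.isOpen hΩ.isBounded hK' hθc.mul_left
  have hz : HasTrace Ω Γ (0 : Space (m + 1) → ℝ) (((fun x => Metric.infDist x ω) * θ) * q) := by
    convert h3 using 1
    ext x
    by_cases hx : x ∈ ω
    · simp [Metric.infDist_zero_of_mem hx]
    · simp [hx]
  have h4 := hz.ae_eq hΩ hΓΩ (HasTrace.zero hΩ.isOpen)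
  rw [EventuallyEq, ae_restrict_iff' hΓ] at h4
  refine ht.congr_right ?_
  rw [EventuallyEq, ae_restrict_iff' hΓ]
  filter_upwards [h2, h4] with x hx2 hx4 hxΓ
  by_cases hx : x ∈ frontier ω
  · rw [Set.indicator_of_mem hx, hx2 ⟨hx, hxΓ⟩]
  · rw [Set.indicator_of_notMem hx]
    have h5 := hx4 hxΓ
    have hxΩ : x ∉ Ω := fun hxΩ =>
      Set.notMem_empty x (frontier_inter_eq_of_isOpen hΩ.isOpen ▸ ⟨hΓΩ hxΓ, hxΩ⟩)
    have hxcl : x ∉ closure ω := fun hxc => hx (by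
      rw [hω.isOpen.frontier_eq]; exact ⟨hxc, fun hxω => hxΩ (h hxω)⟩)
    have h6 : 0 < Metric.infDist x ω := by
      rw [← Metric.infDist_closure]
      exact (isClosed_closure.notMem_iff_infDist_pos hω.isConnected.nonempty.closure).1 hxcl
    rw [Pi.mul_apply, Pi.mul_apply, hθ1 x (frontier_subset_closure (hΓΩ hxΓ)), mul_one,
      Pi.zero_apply, mul_eq_zero] at h5
    exact h5.resolve_left h6.ne'

/-- The approximating sequences for the two parts need not agree, so they cannot be combined
directly; instead the trace on the union exists and is identified on each part by uniqueness. -/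
theorem hasTrace_zero_union_iff (hω : IsLipschitzDomain ω) (hΓ : Γ ⊆ frontier ω)
    (hΓ' : Γ' ⊆ frontier ω) :
    HasTrace ω (Γ ∪ Γ') u 0 ↔ HasTrace ω Γ u 0 ∧ HasTrace ω Γ' u 0 := by
  refine ⟨fun h => ⟨h.mono Set.subset_union_left, h.mono Set.subset_union_right⟩, fun h => ?_⟩
  have ht := hasTrace_trace hω h.1.memH1 (Set.union_subset hΓ hΓ')
  have h1 := (ht.mono Set.subset_union_left).ae_eq hω hΓ h.1
  have h2 := (ht.mono Set.subset_union_right).ae_eq hω hΓ' h.2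
  exact ht.congr_right (ae_restrict_union_iff _ _ _ |>.2 ⟨h1, h2⟩)

end

end MSGFEM

/-! ### The energy form and the load functional -/

namespace MSGFEM

section

variable {d : ℕ} {ω ω' Ω Γ D N : Set (Space d)} {u v w : Space d → ℝ} {G H : Space d → Space d}
  {A : Space d → Matrix (Fin d) (Fin d) ℝ} {α β : ℝ} {ψ : Space d → ℝ} {K : ℝ≥0}

/-- The bilinear form `M ξ · η`. -/
def matForm (M : Matrix (Fin d) (Fin d) ℝ) (ξ η : Space d) : ℝ := ∑ i, ∑ j, M i j * ξ j * η i

variable {M : Matrix (Fin d) (Fin d) ℝ} {ξ ζ η : Space d}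

theorem matForm_add_left : matForm M (ξ + ζ) η = matForm M ξ η + matForm M ζ η := by
  simp only [matForm, PiLp.add_apply, ← Finset.sum_add_distrib]
  exact Finset.sum_congr rfl fun i _ => Finset.sum_congr rfl fun j _ => by ring

theorem matForm_smul_left (c : ℝ) : matForm M (c • ξ) η = c * matForm M ξ η := by
  simp only [matForm, PiLp.smul_apply, smul_eq_mul, Finset.mul_sum]
  exact Finset.sum_congr rfl fun i _ => Finset.sum_congr rfl fun j _ => by ring

theorem matForm_add_right : matForm M η (ξ + ζ) = matForm M η ξ + matForm M η ζ := by
  simp only [matForm, PiLp.add_apply, ← Finset.sum_add_distrib]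
  exact Finset.sum_congr rfl fun i _ => Finset.sum_congr rfl fun j _ => by ring

theorem matForm_smul_right (c : ℝ) : matForm M η (c • ξ) = c * matForm M η ξ := by
  simp only [matForm, PiLp.smul_apply, smul_eq_mul, Finset.mul_sum]
  exact Finset.sum_congr rfl fun i _ => Finset.sum_congr rfl fun j _ => by ring

theorem matForm_comm (hM : M.IsSymm) : matForm M ξ η = matForm M η ξ := by
  rw [matForm, Finset.sum_comm]
  exact Finset.sum_congr rfl fun i _ => Finset.sum_congr rfl fun j _ => by
    rw [hM.apply i j]; ring

theorem matForm_self : matForm M ξ ξ = ∑ i, ∑ j, M i j * ξ i * ξ j :=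
  Finset.sum_congr rfl fun i _ => Finset.sum_congr rfl fun j _ => by ring

/-- The properties of the coefficient that hold almost everywhere. -/
theorem IsElliptic.ae_bounds (hA : IsElliptic Ω A α β) :
    ∀ᵐ x ∂(volume.restrict Ω), (A x).IsSymm ∧ ∀ ξ : Space d,
      α * ‖ξ‖ ^ 2 ≤ matForm (A x) ξ ξ ∧ matForm (A x) ξ ξ ≤ β * ‖ξ‖ ^ 2 := by
  filter_upwards [hA.symm, hA.bounds] with x h1 h2
  refine ⟨h1, fun ξ => ?_⟩
  rw [matForm_self, EuclideanSpace.norm_sq_eq]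
  simpa using h2 ξ

/-- Expand the form at ξ + η and ξ - η. This crude Cauchy–Schwarz inequality is enough to make
energy densities integrable. -/
theorem abs_matForm_le (hM : M.IsSymm) (h0 : ∀ ξ : Space d, 0 ≤ matForm M ξ ξ)
    (h : ∀ ξ : Space d, matForm M ξ ξ ≤ β * ‖ξ‖ ^ 2) :
    |matForm M ξ η| ≤ β * (‖ξ‖ ^ 2 + ‖η‖ ^ 2) := by
  have h1 := h0 (ξ + η)
  have h2 := h0 (ξ + (-1 : ℝ) • η)
  have h3 := h ξ
  have h4 := h η
  have h5 := h0 ξ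
  have h6 := h0 η
  simp only [matForm_add_left, matForm_add_right, matForm_smul_left, matForm_smul_right] at h1 h2
  rw [matForm_comm (ξ := η) hM] at h1 h2
  rw [abs_le]
  constructor <;> linarith

theorem IsElliptic.mono (hA : IsElliptic Ω A α β) (h : ω ⊆ Ω) : IsElliptic ω A α β :=
  have hle := Measure.restrict_mono_set (volume : Measure (Space d)) h
  ⟨hA.pos, fun i j => (hA.measurable i j).mono_measure hle, ae_mono hle hA.symm,
    ae_mono hle hA.bounds⟩

theorem IsElliptic.integrable_matForm (hA : IsElliptic ω A α β)
    (hG : MemLp G 2 (volume.restrict ω)) (hH : MemLp H 2 (volume.restrict ω)) :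
    Integrable (fun x => matForm (A x) (G x) (H x)) (volume.restrict ω) := by
  refine Integrable.mono' (((integrable_norm_sq hG).add (integrable_norm_sq hH)).const_mul β) ?_ ?_
  · refine AEMeasurable.aestronglyMeasurable ?_
    unfold matForm
    refine Finset.aemeasurable_fun_sum _ fun i _ => Finset.aemeasurable_fun_sum _ fun j _ => ?_
    exact ((hA.measurable i j).mul (memLp_coord hG j).1.aemeasurable).mul
      (memLp_coord hH i).1.aemeasurable
  · filter_upwards [hA.ae_bounds] with x hx
    exact abs_matForm_le hx.1 (fun ξ => (mul_nonneg hA.pos.le (sq_nonneg _)).trans (hx.2 ξ).1)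
      fun ξ => (hx.2 ξ).2

theorem energy_def : energy A ω u v = ∫ x in ω, matForm (A x) (wgrad ω u x) (wgrad ω v x) := rfl

theorem energy_eq (hω : IsOpen ω) (hu : SobolevPair ω u G) (hv : SobolevPair ω v H) :
    energy A ω u v = ∫ x in ω, matForm (A x) (G x) (H x) := by
  rw [energy_def]
  refine integral_congr_ae ?_
  filter_upwards [hu.wgrad_ae_eq hω, hv.wgrad_ae_eq hω] with x h1 h2
  rw [h1, h2]

theorem energy_congr (hω : IsOpen ω) (hu : MemH1 ω u) (hv : MemH1 ω v) {u' v' : Space d → ℝ}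
    (h : u =ᵐ[volume.restrict ω] u') (h' : v =ᵐ[volume.restrict ω] v') :
    energy A ω u' v' = energy A ω u v := by
  rw [energy_eq hω (hu.sobolevPair.congr h .rfl) (hv.sobolevPair.congr h' .rfl), energy_def]

/-- The energy form on `H¹(ω)`. -/
noncomputable def energyForm (hA : IsElliptic ω A α β) (hω : IsOpen ω) :
    H1 ω →ₗ[ℝ] H1 ω →ₗ[ℝ] ℝ :=
  LinearMap.mk₂ ℝ (fun u v => energy A ω u.1 v.1)
    (fun u v w => by
      have hu := (mem_H1.1 u.2).sobolevPair
      have hv := (mem_H1.1 v.2).sobolevPair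
      have hw := (mem_H1.1 w.2).sobolevPair
      rw [Submodule.coe_add, energy_eq hω (hu.add hv) hw, energy_def, energy_def,
        ← integral_add (hA.integrable_matForm hu.memLp_grad hw.memLp_grad)
          (hA.integrable_matForm hv.memLp_grad hw.memLp_grad)]
      exact integral_congr_ae (Eventually.of_forall fun x => matForm_add_left))
    (fun c u v => by
      have hu := (mem_H1.1 u.2).sobolevPair
      have hv := (mem_H1.1 v.2).sobolevPair
      rw [Submodule.coe_smul, energy_eq hω (hu.smul c) hv, energy_def, smul_eq_mul,
        ← integral_const_mul]
      exact integral_congr_ae (Eventually.of_forall fun x => matForm_smul_left c))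
    (fun w u v => by
      have hu := (mem_H1.1 u.2).sobolevPair
      have hv := (mem_H1.1 v.2).sobolevPair
      have hw := (mem_H1.1 w.2).sobolevPair
      rw [Submodule.coe_add, energy_eq hω hw (hu.add hv), energy_def, energy_def,
        ← integral_add (hA.integrable_matForm hw.memLp_grad hu.memLp_grad)
          (hA.integrable_matForm hw.memLp_grad hv.memLp_grad)]
      exact integral_congr_ae (Eventually.of_forall fun x => matForm_add_right))
    (fun c u v => by
      have hu := (mem_H1.1 u.2).sobolevPair
      have hv := (mem_H1.1 v.2).sobolevPair
      rw [Submodule.coe_smul, energy_eq hω hu (hv.smul c), energy_def, smul_eq_mul,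
        ← integral_const_mul]
      exact integral_congr_ae (Eventually.of_forall fun x => matForm_smul_right c))

theorem energy_comm (hA : IsElliptic ω A α β) : energy A ω u v = energy A ω v u := by
  rw [energy_def, energy_def]
  refine integral_congr_ae ?_
  filter_upwards [hA.symm] with x hx
  exact matForm_comm hx

theorem energy_add_left (hA : IsElliptic ω A α β) (hω : IsOpen ω) (hu : MemH1 ω u)
    (hv : MemH1 ω v) (hw : MemH1 ω w) :
    energy A ω (u + v) w = energy A ω u w + energy A ω v w :=
  LinearMap.congr_fun ((energyForm hA hω).map_add ⟨u, hu⟩ ⟨v, hv⟩) ⟨w, hw⟩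

theorem energy_sub_left (hA : IsElliptic ω A α β) (hω : IsOpen ω) (hu : MemH1 ω u)
    (hv : MemH1 ω v) (hw : MemH1 ω w) :
    energy A ω (u - v) w = energy A ω u w - energy A ω v w :=
  LinearMap.congr_fun ((energyForm hA hω).map_sub ⟨u, hu⟩ ⟨v, hv⟩) ⟨w, hw⟩

theorem energy_smul_left (hA : IsElliptic ω A α β) (hω : IsOpen ω) (c : ℝ) (hu : MemH1 ω u)
    (hw : MemH1 ω w) : energy A ω (c • u) w = c * energy A ω u w :=
  LinearMap.congr_fun ((energyForm hA hω).map_smul c ⟨u, hu⟩) ⟨w, hw⟩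

theorem energy_self_bounds (hA : IsElliptic ω A α β) (hu : MemH1 ω u) :
    α * ∫ x in ω, ‖wgrad ω u x‖ ^ 2 ≤ energy A ω u u ∧
      energy A ω u u ≤ β * ∫ x in ω, ‖wgrad ω u x‖ ^ 2 := by
  have hp := hu.sobolevPair
  have hi := integrable_norm_sq hp.memLp_grad
  have hf := hA.integrable_matForm hp.memLp_grad hp.memLp_grad
  rw [energy_def, ← integral_const_mul, ← integral_const_mul]
  constructor
  · refine integral_mono_ae (hi.const_mul _) hf ?_
    filter_upwards [hA.ae_bounds] with x hx
    exact (hx.2 _).1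
  · refine integral_mono_ae hf (hi.const_mul _) ?_
    filter_upwards [hA.ae_bounds] with x hx
    exact (hx.2 _).2

theorem energy_self_nonneg (hA : IsElliptic ω A α β) (hu : MemH1 ω u) : 0 ≤ energy A ω u u :=
  (mul_nonneg hA.pos.le (integral_nonneg fun _ => sq_nonneg _)).trans (energy_self_bounds hA hu).1

/-- The sign of β is not part of `IsElliptic`; it follows from the two bounds at one point and one
unit vector. -/
theorem IsElliptic.upper_nonneg (hA : IsElliptic ω A α β) (hd : 0 < d) (hω : volume ω ≠ 0) :
    0 ≤ β := by
  have hne : (ae (volume.restrict ω : Measure (Space d))).NeBot := by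
    rw [ae_neBot, Ne, Measure.restrict_eq_zero]
    exact hω
  obtain ⟨x, -, hx⟩ := hA.ae_bounds.exists
  have := hx (EuclideanSpace.single ⟨0, hd⟩ 1)
  have h1 : ‖(EuclideanSpace.single ⟨0, hd⟩ 1 : Space d)‖ = 1 := by simp
  rw [h1] at this
  nlinarith [hA.pos]

theorem energy_self_le_normH1_sq (hA : IsElliptic ω A α β) (hβ : 0 ≤ β) (hu : MemH1 ω u) :
    energy A ω u u ≤ β * normH1 ω u ^ 2 :=
  (energy_self_bounds hA hu).2.trans
    (mul_le_mul_of_nonneg_left integral_wgrad_sq_le_normH1_sq hβ)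

theorem normH1_sq_le (hA : IsElliptic ω A α β) (hu : MemH1 ω u) :
    normH1 ω u ^ 2 ≤ (∫ x in ω, u x ^ 2) + α⁻¹ * energy A ω u u := by
  rw [normH1_sq]
  have h := (energy_self_bounds hA hu).1
  have : ∫ x in ω, ‖wgrad ω u x‖ ^ 2 ≤ α⁻¹ * energy A ω u u := by
    rw [inv_mul_eq_div, le_div_iff₀ hA.pos, mul_comm]
    exact h
  linarith

/-- The Cauchy–Schwarz inequality for the energy form. -/
theorem energy_sq_le (hA : IsElliptic ω A α β) (hω : IsOpen ω) (hu : MemH1 ω u)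
    (hv : MemH1 ω v) : energy A ω u v ^ 2 ≤ energy A ω u u * energy A ω v v := by
  have h : ∀ t : ℝ, 0 ≤ energy A ω u u * (t * t) + 2 * energy A ω u v * t + energy A ω v v := by
    intro t
    have h0 := energy_self_nonneg hA ((hu.smul t).add hv)
    rw [energy_add_left hA hω (hu.smul t) hv ((hu.smul t).add hv),
      energy_comm hA (v := t • u + v), energy_comm hA (v := t • u + v),
      energy_add_left hA hω (hu.smul t) hv (hu.smul t), energy_add_left hA hω (hu.smul t) hv hv,
      energy_smul_left hA hω t hu hv, energy_smul_left hA hω t hu (hu.smul t),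
      energy_comm hA (u := u) (v := t • u), energy_comm hA (u := v) (v := t • u),
      energy_smul_left hA hω t hu hu, energy_smul_left hA hω t hu hv] at h0
    linarith
  have := discrim_le_zero h
  rw [discrim] at this
  nlinarith

/-- Convergence in `H¹(ω)` implies convergence of energies. -/
theorem energy_eq_zero_of_tendsto (hA : IsElliptic ω A α β) (hβ : 0 ≤ β) (hω : IsOpen ω)
    {ι : Type*} {l : Filter ι} [l.NeBot] {w : ι → Space d → ℝ} (hw : ∀ j, MemH1 ω (w j))
    (hu : MemH1 ω u) (h : Tendsto (fun j => normH1 ω (w j - u)) l (𝓝 0)) (hv : MemH1 ω v)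
    (h0 : ∀ j, energy A ω (w j) v = 0) : energy A ω u v = 0 := by
  have h1 : ∀ j, energy A ω u v ^ 2 ≤ β * normH1 ω (w j - u) ^ 2 * energy A ω v v := by
    intro j
    have h2 := energy_sub_left hA hω (hw j) hu hv
    rw [h0 j, zero_sub] at h2
    have h3 := energy_sq_le hA hω ((hw j).sub hu) hv
    rw [h2, neg_sq] at h3
    exact h3.trans (mul_le_mul_of_nonneg_right
      (energy_self_le_normH1_sq hA hβ ((hw j).sub hu)) (energy_self_nonneg hA hv))
  have h2 : Tendsto (fun j => β * normH1 ω (w j - u) ^ 2 * energy A ω v v) l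
      (𝓝 (β * 0 ^ 2 * energy A ω v v)) := ((h.pow 2).const_mul β).mul_const _
  have h3 := ge_of_tendsto' h2 h1
  rw [zero_pow two_ne_zero, mul_zero, zero_mul] at h3
  exact pow_eq_zero_iff two_ne_zero |>.1 (le_antisymm h3 (sq_nonneg _))

end

section

variable {m : ℕ} {ω ω' Ω Γ D N : Set (Space (m + 1))} {u v w f : Space (m + 1) → ℝ}
  {A : Space (m + 1) → Matrix (Fin (m + 1)) (Fin (m + 1)) ℝ} {α β : ℝ}
  {g : (Space (m + 1) → ℝ) →ₗ[ℝ] ℝ}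

theorem H10D.indicator (hω : IsLipschitzDomain ω) (hΩ : IsLipschitzDomain Ω) (h : ω ⊆ Ω)
    (hD : MeasurableSet D) (hDΩ : D ⊆ frontier Ω) (hv : v ∈ H10D Ω D ω) :
    ω.indicator v ∈ H10D Ω D Ω := by
  have h1 := HasTrace.hasTrace_indicator hω hΩ h (hv.mono Set.subset_union_left)
    (hv.mono Set.subset_union_right) hD hDΩ
  rw [H10D, Set.mem_ofPred_eq, frontier_inter_eq_of_isOpen hΩ.isOpen, Set.empty_union,
    Set.inter_eq_right.2 hDΩ]
  convert h1 using 1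
  ext x
  by_cases hx : x ∈ frontier ω <;> simp [hx]

/-- The load functional of `ω` is that of `Ω`, applied to the extension by zero. -/
theorem load_indicator (hω : IsLipschitzDomain ω) (hΩ : IsLipschitzDomain Ω) (h : ω ⊆ Ω)
    (hDN : IsBoundaryDecomposition Ω D N) (hg : MemHNegHalf Ω D N g) (hv : v ∈ H10D Ω D ω) :
    load N f g Ω (ω.indicator v) = load N f g ω v := by
  have hext := H10D.indicator hω hΩ h hDN.measurableSet_dirichlet hDN.subset_dirichlet hv
  have hN : frontier Ω ∩ N = N := Set.inter_eq_right.2 hDN.subset_neumann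
  have t1 : HasTrace Ω N (ω.indicator v)
      ((frontier Ω).indicator (trace Ω (frontier Ω ∩ N) (ω.indicator v))) := by
    rw [hN]
    refine (hasTrace_trace hΩ hext.memH1 hDN.subset_neumann).congr_right ?_
    filter_upwards [ae_restrict_mem hDN.measurableSet_neumann] with x hx
    rw [Set.indicator_of_mem (hDN.subset_neumann hx)]
  have t2 : HasTrace Ω N (ω.indicator v) ((frontier ω).indicator (trace ω (frontier ω ∩ N) v)) :=
    HasTrace.hasTrace_indicator hω hΩ h (hv.mono Set.subset_union_left)
      (hasTrace_trace hω hv.memH1 Set.inter_subset_left) hDN.measurableSet_neumann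
      hDN.subset_neumann
  -- The functional g is defined on functions and need not respect equality almost everywhere. The
  -- difference of the two boundary functions is a trace of 0, so the bound of g by the quotient
  -- norm, taken at v = 0, shows that g does not distinguish them.
  have hdiff := t1.sub hΩ.isOpen hΩ.isBounded t2
  rw [sub_self] at hdiff
  obtain ⟨C, hC⟩ := hg
  have h0 := hC 0 _ (HasTrace.zero hΩ.isOpen) hdiff
  rw [normH1_zero hΩ.isOpen, mul_zero] at h0
  have h1 := abs_eq_zero.1 (le_antisymm h0 (abs_nonneg _))
  rw [map_sub, sub_eq_zero] at h1
  rw [load, load, h1]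
  congr 1
  rw [setIntegral_eq_of_support_subset h fun x hx => by rw [Set.indicator_of_notMem hx, mul_zero]]
  exact setIntegral_congr_fun hω.isOpen.measurableSet fun x hx => by
    simp only [Set.indicator_of_mem hx]

theorem energy_indicator (hω : IsLipschitzDomain ω) (hΩ : IsLipschitzDomain Ω) (h : ω ⊆ Ω)
    (hu : MemH1 Ω u) (hv : v ∈ H10D Ω D ω) :
    energy A Ω u (ω.indicator v) = energy A ω u v := by
  have hp := HasTrace.sobolevPair_indicator hω hΩ.isOpen h (hv.mono Set.subset_union_left)
  rw [energy_eq hΩ.isOpen hu.sobolevPair hp, energy_eq hω.isOpen (hu.sobolevPair.mono h)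
    hv.memH1.sobolevPair, setIntegral_eq_of_support_subset h fun x hx => by
      rw [Set.indicator_of_notMem hx]; simp [matForm]]
  exact setIntegral_congr_fun hω.isOpen.measurableSet fun x hx => by
    simp only [Set.indicator_of_mem hx]

end

end MSGFEM

/-! ### The abstract eigenvalue problem -/

namespace MSGFEM

section

variable {V : Type*} [AddCommGroup V] [Module ℝ V]

/-- A symmetric positive semidefinite bilinear form. -/
structure IsSemiInner (b : V →ₗ[ℝ] V →ₗ[ℝ] ℝ) : Prop where
  symm : ∀ x y, b x y = b y x
  nonneg : ∀ x, 0 ≤ b x x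

variable {a b : V →ₗ[ℝ] V →ₗ[ℝ] ℝ}

theorem IsSemiInner.sq_le (hb : IsSemiInner b) (x y : V) : b x y ^ 2 ≤ b x x * b y y := by
  have h : ∀ t : ℝ, 0 ≤ b x x * (t * t) + 2 * b x y * t + b y y := by
    intro t
    have h0 := hb.nonneg (t • x + y)
    simp only [map_add, map_smul, LinearMap.add_apply, LinearMap.smul_apply, smul_eq_mul,
      hb.symm y x] at h0
    linarith
  have := discrim_le_zero h
  rw [discrim] at this
  nlinarith

theorem IsSemiInner.eq_zero_of_self (hb : IsSemiInner b) {x : V} (h : b x x = 0) (y : V) :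
    b x y = 0 := by
  have := hb.sq_le x y
  rw [h, zero_mul] at this
  exact pow_eq_zero_iff two_ne_zero |>.1 (le_antisymm this (sq_nonneg _))

theorem IsSemiInner.add_self_le (hb : IsSemiInner b) (x y : V) :
    b (x + y) (x + y) ≤ 2 * (b x x + b y y) := by
  have h := hb.nonneg (x - y)
  simp only [map_sub, map_add, LinearMap.sub_apply, LinearMap.add_apply, hb.symm y x] at h ⊢
  linarith

theorem orthogonal_of_mem_span {S : Set V} {x : V} (h : ∀ s ∈ S, b x s = 0) {y : V}
    (hy : y ∈ Submodule.span ℝ S) : b x y = 0 := by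
  have : Submodule.span ℝ S ≤ LinearMap.ker (b x) := Submodule.span_le.2 fun s hs => h s hs
  exact this hy

/-- Orthogonal projection onto the span of a finite set. -/
theorem IsSemiInner.exists_projection (hb : IsSemiInner b) (S : Finset V) (x : V) :
    ∃ y ∈ Submodule.span ℝ (S : Set V), ∀ s ∈ S, b (x - y) s = 0 := by
  classical
  induction S using Finset.induction_on generalizing x with
  | empty => exact ⟨0, Submodule.zero_mem _, by simp⟩
  | insert z S _ ih =>
    obtain ⟨x', hx', hx⟩ := ih x
    obtain ⟨z', hz', hz⟩ := ih z
    have hmono : Submodule.span ℝ (S : Set V) ≤ Submodule.span ℝ ((insert z S : Finset V) : Set V) :=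
      Submodule.span_mono (by simp)
    have hzmem : z ∈ Submodule.span ℝ ((insert z S : Finset V) : Set V) :=
      Submodule.subset_span (by simp)
    set e := z - z' with he
    set t := b (x - x') e / b e e with ht
    -- A Gram–Schmidt step for a form that may be degenerate. If b e e = 0, then e is b-orthogonal
    -- to everything, and t = 0, the default value of the quotient, is as good as any other.
    have hte : b (x - x') e - t * b e e = 0 := by
      by_cases h : b e e = 0
      · rw [h, hb.symm, hb.eq_zero_of_self h]
        ring
      · rw [ht, div_mul_cancel₀ _ h, sub_self]
    clear_value t e
    have hS : ∀ s ∈ S, b (x - (x' + t • e)) s = 0 := by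
      intro s hs
      rw [← sub_sub, map_sub, LinearMap.sub_apply, hx s hs, map_smul, LinearMap.smul_apply,
        hz s hs, smul_zero, sub_zero]
    refine ⟨x' + t • e, Submodule.add_mem _ (hmono hx')
      (Submodule.smul_mem _ _ (he ▸ Submodule.sub_mem _ hzmem (hmono hz'))), fun s hs => ?_⟩
    rcases Finset.mem_insert.1 hs with rfl | hs
    · have h1 : b (x - (x' + t • e)) z' = 0 := orthogonal_of_mem_span (fun s hs => hS s hs) hz'
      have h2 : b (x - (x' + t • e)) e = 0 := by
        rw [← sub_sub, map_sub, LinearMap.sub_apply, map_smul, LinearMap.smul_apply, smul_eq_mul,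
          hte]
      have h3 := (b (x - (x' + t • e))).map_sub s z'
      rw [h1, ← he, h2, sub_zero] at h3
      exact h3.symm
    · exact hS s hs

/-- The elements that are `b`-orthogonal to the first `n` members of a family of length `L`. -/
def orthoCompl (b : V →ₗ[ℝ] V →ₗ[ℝ] ℝ) (L : ℕ∞) (v : ℕ → V) (n : ℕ) : Set V :=
  {u | ∀ k < n, (k : ℕ∞) < L → b u (v k) = 0}

theorem IsSemiInner.exists_sub_mem_orthoCompl (hb : IsSemiInner b) (L : ℕ∞) (v : ℕ → V) (n : ℕ)
    (x : V) : ∃ y ∈ Submodule.span ℝ {s | ∃ k < n, (k : ℕ∞) < L ∧ v k = s},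
      x - y ∈ orthoCompl b L v n := by
  classical
  obtain ⟨y, hy, h⟩ := hb.exists_projection
    (((Finset.range n).filter fun k : ℕ => (k : ℕ∞) < L).image v) x
  refine ⟨y, Submodule.span_mono ?_ hy, fun k hk hkL => h _ ?_⟩
  · intro s hs
    obtain ⟨k, hk, rfl⟩ := Finset.mem_image.1 (Finset.mem_coe.1 hs)
    rw [Finset.mem_filter, Finset.mem_range] at hk
    exact ⟨k, hk.1, hk.2, rfl⟩
  · exact Finset.mem_image_of_mem _ (by simp [hk, hkL])

variable {L : ℕ∞} {lam : ℕ → ℝ} {v : ℕ → V} {n : ℕ}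

/-- The orthogonal projection onto the first eigenfunctions decreases the energy. -/
theorem energy_sub_projection_le (ha : IsSemiInner a) (hb : IsSemiInner b)
    (hv : ∀ k : ℕ, (k : ℕ∞) < L → ∀ x, a (v k) x = lam k * b (v k) x) {x y : V}
    (hy : y ∈ Submodule.span ℝ {s | ∃ k < n, (k : ℕ∞) < L ∧ v k = s})
    (h : x - y ∈ orthoCompl b L v n) : a (x - y) (x - y) ≤ a x x := by
  -- By the eigenvalue equation, b-orthogonality to the eigenfunctions is also a-orthogonality, and
  -- Pythagoras applies.
  have h1 : a (x - y) y = 0 := by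
    refine orthogonal_of_mem_span ?_ hy
    rintro s ⟨k, hk, hkL, rfl⟩
    rw [ha.symm, hv k hkL, hb.symm, h k hk hkL, mul_zero]
  have h2 : a x x = a (x - y) (x - y) + 2 * a (x - y) y + a y y := by
    simp only [map_sub, LinearMap.sub_apply, ha.symm y x]
    ring
  rw [h2, h1]
  linarith [ha.nonneg y]

/-- The variational characterization of the eigenvalues: on the orthogonal complement of the first
`n` eigenfunctions of a compact eigenvalue problem, the Rayleigh quotient is at least the next
eigenvalue. -/
theorem rayleigh_le (ha : IsSemiInner a) (hb : IsSemiInner b)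
    (hv : ∀ k : ℕ, (k : ℕ∞) < L → ∀ x, a (v k) x = lam k * b (v k) x)
    (hmono : ∀ j k : ℕ, j ≤ k → (k : ℕ∞) < L → lam j ≤ lam k)
    (hexh : ∀ (μ : ℝ) (w : V), (∀ x, a w x = μ * b w x) → 0 < b w w →
      ∃ u ∈ Submodule.span ℝ {s | ∃ k : ℕ, (k : ℕ∞) < L ∧ lam k = μ ∧ v k = s},
        ∀ x, b (w - u) x = 0)
    {W : Submodule ℝ V} (hW : orthoCompl b L v n ⊆ W) {C : ℝ} (hC : ∀ u ∈ W, b u u ≤ C * a u u)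
    {l : Filter ℕ} [l.NeBot] (hl : l ≤ atTop)
    (hcpt : ∀ u : ℕ → V, (∀ j, u j ∈ W) → (∀ j, a (u j) (u j) ≤ 1) →
      Tendsto (fun p : ℕ × ℕ => b (u p.1 - u p.2) (u p.1 - u p.2)) (l ×ˢ l) (𝓝 0))
    (hcomplete : ∀ u : ℕ → V, (∀ j, u j ∈ W) →
      Tendsto (fun p : ℕ × ℕ => a (u p.1 - u p.2) (u p.1 - u p.2)) (l ×ˢ l) (𝓝 0) →
      ∃ w ∈ W, Tendsto (fun j => a (u j - w) (u j - w)) l (𝓝 0))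
    {u : V} (hu : u ∈ orthoCompl b L v n) :
    b u u = 0 ∨ ((n : ℕ∞) < L ∧ lam n * b u u ≤ a u u) := by
  by_cases hu0 : b u u = 0
  · exact Or.inl hu0
  refine Or.inr ?_
  have hupos : 0 < b u u := lt_of_le_of_ne (hb.nonneg u) (Ne.symm hu0)
  -- `orthoCompl` as a submodule
  let U : Submodule ℝ V :=
    { carrier := orthoCompl b L v n
      add_mem' := fun {x y} hx hy k hk hkL => by
        rw [map_add, LinearMap.add_apply, hx k hk hkL, hy k hk hkL, add_zero]
      zero_mem' := fun k _ _ => by rw [map_zero, LinearMap.zero_apply]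
      smul_mem' := fun c x hx k hk hkL => by
        rw [map_smul, LinearMap.smul_apply, hx k hk hkL, smul_zero] }
  have hUW : ∀ x ∈ U, x ∈ W := fun x hx => hW hx
  have huU : u ∈ U := hu
  -- the supremum of the Rayleigh quotient `b / a`
  set T : Set ℝ := {r | ∃ x ∈ U, a x x ≤ 1 ∧ b x x = r} with hT
  have hC0 : ∀ x ∈ U, a x x ≤ 1 → b x x ≤ |C| := fun x hx hx1 =>
    (hC x (hUW x hx)).trans ((mul_le_mul_of_nonneg_right (le_abs_self C) (ha.nonneg x)).trans
      (mul_le_of_le_one_right (abs_nonneg C) hx1))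
  have hTb : BddAbove T := ⟨|C|, by rintro r ⟨x, hx, hx1, rfl⟩; exact hC0 x hx hx1⟩
  have hTn : T.Nonempty := ⟨b 0 0, 0, U.zero_mem, by simp, rfl⟩
  -- The number 1 / s will turn out to be one of the eigenvalues lam k with k ≥ n.
  set s := sSup T with hs
  have hapos : ∀ x ∈ U, 0 < b x x → 0 < a x x := fun x hx hx0 => by
    refine lt_of_le_of_ne (ha.nonneg x) fun h => ?_
    have := hC x (hUW x hx)
    rw [← h, mul_zero] at this
    exact absurd this (not_le.2 hx0)
  have hsle : ∀ x ∈ U, b x x ≤ s * a x x := by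
    intro x hx
    rcases (hb.nonneg x).eq_or_lt with h0 | h0
    · rw [← h0]
      refine mul_nonneg (le_csSup hTb ⟨0, U.zero_mem, by simp, by simp⟩) (ha.nonneg x)
    have hap := hapos x hx h0
    have hsq : √(a x x) ≠ 0 := (Real.sqrt_pos.2 hap).ne'
    have h1 : b ((√(a x x))⁻¹ • x) ((√(a x x))⁻¹ • x) ≤ s := by
      refine le_csSup hTb ⟨_, U.smul_mem _ hx, ?_, rfl⟩
      simp only [map_smul, LinearMap.smul_apply, smul_eq_mul]
      rw [← mul_assoc, ← mul_inv, Real.mul_self_sqrt hap.le, inv_mul_cancel₀ hap.ne']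
    simp only [map_smul, LinearMap.smul_apply, smul_eq_mul] at h1
    rw [← mul_assoc, ← mul_inv, Real.mul_self_sqrt hap.le, inv_mul_le_iff₀ hap, mul_comm] at h1
    exact h1
  have hspos : 0 < s := by
    by_contra hneg
    have := hsle u huU
    have h2 := mul_nonpos_of_nonpos_of_nonneg (not_lt.1 hneg) (ha.nonneg u)
    linarith
  -- a maximizing sequence
  have hseq : ∀ j : ℕ, ∃ x ∈ U, a x x ≤ 1 ∧ s - 1 / ((j : ℝ) + 1) < b x x := by
    intro j
    obtain ⟨r, ⟨x, hx, hx1, rfl⟩, hr⟩ := exists_lt_of_lt_csSup hTn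
      (show s - 1 / ((j : ℝ) + 1) < sSup T by have : 0 < 1 / ((j : ℝ) + 1) := by positivity
                                              linarith)
    exact ⟨x, hx, hx1, hr⟩
  choose x hxU hx1 hxs using hseq
  -- This quadratic form is nonnegative on U, tends to 0 along the maximizing sequence and obeys the
  -- parallelogram law, so it also tends to 0 on differences.
  set c : V → ℝ := fun y => s * a y y - b y y with hc
  have hcU : ∀ y ∈ U, 0 ≤ c y := fun y hy => sub_nonneg.2 (hsle y hy)
  have hcpar : ∀ y z, c (y - z) + c (y + z) = 2 * (c y + c z) := by
    intro y z
    simp only [hc, map_sub, map_add, LinearMap.sub_apply, LinearMap.add_apply]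
    ring
  have hcsub : ∀ y ∈ U, ∀ z ∈ U, c (y - z) ≤ 2 * (c y + c z) := fun y hy z hz => by
    have := hcU _ (U.add_mem hy hz)
    linarith [hcpar y z]
  have hcadd : ∀ y ∈ U, ∀ z ∈ U, c (y + z) ≤ 2 * (c y + c z) := fun y hy z hz => by
    have := hcU _ (U.sub_mem hy hz)
    linarith [hcpar y z]
  have hinv : Tendsto (fun j : ℕ => 1 / ((j : ℝ) + 1)) l (𝓝 0) :=
    tendsto_one_div_add_atTop_nhds_zero_nat.mono_left hl
  have hcx : Tendsto (fun j => c (x j)) l (𝓝 0) := by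
    refine squeeze_zero (fun j => hcU _ (hxU j)) (fun j => ?_) hinv
    have := mul_le_of_le_one_right hspos.le (hx1 j)
    have := hxs j
    simp only [hc]
    linarith
  -- On differences s * a = c + b; the first term was just controlled and the second is small by
  -- `hcpt`. Thus the maximizers converge strongly, without any weak compactness.
  have hcauchy : Tendsto (fun p : ℕ × ℕ => a (x p.1 - x p.2) (x p.1 - x p.2)) (l ×ˢ l) (𝓝 0) := by
    have hb0 := hcpt x (fun j => hUW _ (hxU j)) hx1
    have h1 : Tendsto (fun p : ℕ × ℕ => s⁻¹ * (2 * (c (x p.1) + c (x p.2)) +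
        b (x p.1 - x p.2) (x p.1 - x p.2))) (l ×ˢ l) (𝓝 (s⁻¹ * (2 * (0 + 0) + 0))) :=
      ((((hcx.comp tendsto_fst).add (hcx.comp tendsto_snd)).const_mul 2).add hb0).const_mul _
    simp only [add_zero, mul_zero] at h1
    refine squeeze_zero (fun p => ha.nonneg _) (fun p => ?_) h1
    rw [le_inv_mul_iff₀ hspos]
    have := hcsub _ (hxU p.1) _ (hxU p.2)
    simp only [hc] at this ⊢
    linarith
  obtain ⟨w, hwW, hw⟩ := hcomplete x (fun j => hUW _ (hxU j)) hcauchy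
  have hbw : Tendsto (fun j => b (x j - w) (x j - w)) l (𝓝 0) := by
    refine squeeze_zero (fun j => hb.nonneg _)
      (fun j => hC _ (W.sub_mem (hUW _ (hxU j)) hwW)) ?_
    simpa using hw.const_mul C
  have hwU : w ∈ U := by
    intro k hk hkL
    have h1 : ∀ j, b w (v k) ^ 2 ≤ b (x j - w) (x j - w) * b (v k) (v k) := by
      intro j
      have h2 := hb.sq_le (x j - w) (v k)
      rw [map_sub, LinearMap.sub_apply, hxU j k hk hkL, zero_sub, neg_sq] at h2
      simpa only [map_sub] using h2
    have h2 := hbw.mul_const (b (v k) (v k))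
    rw [zero_mul] at h2
    have h3 := ge_of_tendsto' h2 h1
    exact pow_eq_zero_iff two_ne_zero |>.1 (le_antisymm h3 (sq_nonneg _))
  have hcw : c w = 0 := by
    have h1 : ∀ j, c w ≤ 2 * (c (x j) + c (x j - w)) := fun j => by
      have := hcsub _ (hxU j) _ (U.sub_mem (hxU j) hwU)
      rwa [sub_sub_cancel] at this
    have h2 : Tendsto (fun j => 2 * (c (x j) + c (x j - w))) l
        (𝓝 (2 * (0 + (s * 0 - 0)))) :=
      (hcx.add ((hw.const_mul s).sub hbw)).const_mul 2
    have h3 := ge_of_tendsto' h2 h1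
    rw [mul_zero, sub_zero, add_zero, mul_zero] at h3
    exact le_antisymm h3 (hcU w hwU)
  have hbwpos : 0 < b w w := by
    have h1 : ∀ j : ℕ, s - 1 / ((j : ℝ) + 1) ≤ 2 * (b (x j - w) (x j - w) + b w w) := fun j => by
      have := hb.add_self_le (x j - w) w
      rw [sub_add_cancel] at this
      exact (hxs j).le.trans this
    have h2 := le_of_tendsto_of_tendsto' (tendsto_const_nhds.sub hinv)
      ((hbw.add_const (b w w)).const_mul 2) h1
    rw [sub_zero, zero_add] at h2
    linarith
  -- `w` is an eigenfunction
  have horth : ∀ y ∈ U, s * a w y = b w y := by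
    intro y hy
    -- Since c is nonnegative on U and zero at w, the polynomial c(w + ty) has no constant term, and
    -- its discriminant forces the linear term to vanish.
    have h : ∀ t : ℝ, 0 ≤ c y * (t * t) + 2 * (s * a w y - b w y) * t + 0 := by
      intro t
      have h0 := hcU _ (U.add_mem hwU (U.smul_mem t hy))
      have h1 : c (w + t • y) = c w + (c y * (t * t) + 2 * (s * a w y - b w y) * t) := by
        simp only [hc, map_add, map_smul, LinearMap.add_apply, LinearMap.smul_apply, smul_eq_mul,
          ha.symm y w, hb.symm y w]
        ring
      rw [h1, hcw] at h0
      linarith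
    have := discrim_le_zero h
    rw [discrim] at this
    nlinarith [sq_nonneg (s * a w y - b w y)]
  -- The equation extends from U to all y, because y differs from an element of U by a combination
  -- of the first eigenfunctions, to which w is both b- and a-orthogonal.
  have heig : ∀ y, a w y = s⁻¹ * b w y := by
    intro y
    obtain ⟨z, hz, hyz⟩ := hb.exists_sub_mem_orthoCompl L v n y
    have h1 : b w z = 0 := orthogonal_of_mem_span
      (by rintro _ ⟨k, hk, hkL, rfl⟩; exact hwU k hk hkL) hz
    have h2 : a w z = 0 := orthogonal_of_mem_span
      (by rintro _ ⟨k, hk, hkL, rfl⟩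
          rw [ha.symm, hv k hkL, hb.symm, hwU k hk hkL, mul_zero]) hz
    have h3 := horth _ hyz
    rw [map_sub, map_sub, h1, h2, sub_zero, sub_zero] at h3
    rw [← h3, inv_mul_cancel_left₀ hspos.ne']
  obtain ⟨z, hz, hwz⟩ := hexh s⁻¹ w heig hbwpos
  -- If every listed eigenfunction for 1 / s had index below n, then w would be b-orthogonal to its
  -- own expansion z, and b w w would be 0.
  obtain ⟨k, hkn, hkL, hk⟩ : ∃ k, n ≤ k ∧ (k : ℕ∞) < L ∧ lam k = s⁻¹ := by
    by_contra hno
    push Not at hno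
    have h1 : b w z = 0 := by
      refine orthogonal_of_mem_span ?_ hz
      rintro _ ⟨k, hkL, hkμ, rfl⟩
      by_cases hkn : k < n
      · exact hwU k hkn hkL
      · exact absurd hkμ (hno k (not_lt.1 hkn) hkL)
    have h2 := hwz w
    rw [map_sub, LinearMap.sub_apply, hb.symm z w, h1, sub_zero] at h2
    exact hbwpos.ne' h2
  refine ⟨lt_of_le_of_lt (by exact_mod_cast hkn) hkL, ?_⟩
  calc lam n * b u u ≤ s⁻¹ * b u u :=
        mul_le_mul_of_nonneg_right (hk ▸ hmono n k hkn hkL) hupos.le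
    _ ≤ a u u := by
        rw [inv_mul_le_iff₀ hspos]
        exact hsle u huU

/-- On the span of the first eigenfunctions, the Rayleigh quotient is at most the last
eigenvalue. -/
theorem rayleigh_ge (ha : IsSemiInner a) (hb : IsSemiInner b)
    (hv : ∀ k : ℕ, (k : ℕ∞) < L → ∀ x, a (v k) x = lam k * b (v k) x)
    (hmono : ∀ j k : ℕ, j ≤ k → (k : ℕ∞) < L → lam j ≤ lam k) (hn : (n : ℕ∞) < L)
    (s : Finset ℕ) (hs : ∀ k ∈ s, k ≤ n) (c : ℕ → ℝ) :
    a (∑ k ∈ s, c k • v k) (∑ k ∈ s, c k • v k) ≤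
      lam n * b (∑ k ∈ s, c k • v k) (∑ k ∈ s, c k • v k) := by
  have hL : ∀ k ∈ s, (k : ℕ∞) < L := fun k hk => lt_of_le_of_lt (by exact_mod_cast hs k hk) hn
  have horth : ∀ j ∈ s, ∀ k ∈ s, lam j ≠ lam k → b (v j) (v k) = 0 := by
    intro j hj k hk hjk
    have h1 := hv j (hL j hj) (v k)
    rw [ha.symm, hv k (hL k hk), hb.symm] at h1
    have h2 : (lam k - lam j) * b (v j) (v k) = 0 := by linarith
    exact (mul_eq_zero.1 h2).resolve_left (sub_ne_zero.2 (Ne.symm hjk))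
  -- Eigenfunctions for distinct eigenvalues are b-orthogonal, so in the expansion the square roots
  -- only meet in equal pairs and give lam n - lam k. The nonnegative number is therefore the
  -- difference of the two sides; no orthogonalization within eigenspaces is needed.
  have h0 := hb.nonneg (∑ k ∈ s, (√(lam n - lam k) * c k) • v k)
  have e1 : ∀ c : ℕ → ℝ, b (∑ k ∈ s, c k • v k) (∑ k ∈ s, c k • v k) =
      ∑ j ∈ s, ∑ k ∈ s, c j * c k * b (v j) (v k) := by
    intro c
    simp only [map_sum, LinearMap.sum_apply, map_smul, LinearMap.smul_apply, smul_eq_mul]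
    rw [Finset.sum_comm]
    refine Finset.sum_congr rfl fun j _ => ?_
    rw [Finset.mul_sum]
    exact Finset.sum_congr rfl fun k _ => by ring
  have e2 : a (∑ k ∈ s, c k • v k) (∑ k ∈ s, c k • v k) =
      ∑ j ∈ s, ∑ k ∈ s, c j * c k * (lam j * b (v j) (v k)) := by
    simp only [map_sum, LinearMap.sum_apply, map_smul, LinearMap.smul_apply, smul_eq_mul]
    rw [Finset.sum_comm]
    refine Finset.sum_congr rfl fun j _ => ?_
    rw [Finset.mul_sum]
    refine Finset.sum_congr rfl fun k hk => ?_
    rw [hv k (hL k hk)]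
    ring
  rw [e1, e2, ← sub_nonneg, Finset.mul_sum, ← Finset.sum_sub_distrib]
  rw [e1] at h0
  refine h0.trans (le_of_eq (Finset.sum_congr rfl fun j hj => ?_))
  rw [Finset.mul_sum, ← Finset.sum_sub_distrib]
  refine Finset.sum_congr rfl fun k hk => ?_
  by_cases hjk : lam j = lam k
  · have h1 : √(lam n - lam k) * √(lam n - lam k) = lam n - lam k :=
      Real.mul_self_sqrt (sub_nonneg.2 (hmono k n (hs k hk) hn))
    rw [hjk]
    linear_combination (c j * c k * b (v j) (v k)) * h1
  · rw [horth j hj k hk hjk]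
    ring

end

end MSGFEM

/-! ### Poincaré's inequality on convex sets -/

namespace MSGFEM

variable {d : ℕ} {ω ω' Ω Γ Q : Set (Space d)} {u v w : Space d → ℝ} {G H : Space d → Space d}
  {φ ψ : Space d → ℝ} {K : ℝ≥0}

theorem lintegral_comp_add_smul {F : Space d → ℝ≥0∞} (hF : Measurable F) (a : Space d) {t : ℝ}
    (ht : 0 < t) : ∫⁻ y, F (a + t • y) = ENNReal.ofReal ((t ^ d)⁻¹) * ∫⁻ y, F y := by
  have h1 := Measure.map_addHaar_smul (volume : Measure (Space d)) ht.ne'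
  rw [finrank_euclideanSpace, Fintype.card_fin, abs_of_pos (by positivity)] at h1
  have h2 : ∫⁻ z, F (a + z) ∂(Measure.map (fun y : Space d => t • y) volume) =
      ∫⁻ y, F (a + t • y) :=
    lintegral_map (hF.comp (measurable_const_add a)) (measurable_const_smul t)
  rw [← h2, h1, lintegral_smul_measure, lintegral_add_left_eq_self, smul_eq_mul]

/-- The integral of a function over all segments in a set. -/
theorem lintegral_segments_le {F : Space d → ℝ≥0∞} (hF : Measurable F) (t : ℝ) :
    ∫⁻ x in Q, ∫⁻ y in Q, F (x + t • (y - x)) ≤ 2 ^ d * volume Q * ∫⁻ y, F y := by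
  -- The change of variables in an endpoint costs s^(-d) ≤ 2^d if that endpoint has weight s ≥ 1/2.
  -- For t ≥ 1/2 the endpoint is y, otherwise it is x.
  have key : ∀ s : ℝ, 1 / 2 ≤ s → ∀ a : Space d,
      ∫⁻ y in Q, F (a + s • y) ≤ 2 ^ d * ∫⁻ y, F y := by
    intro s hs a
    refine (setLIntegral_le_lintegral _ _).trans ?_
    rw [lintegral_comp_add_smul hF a (by linarith)]
    refine mul_le_mul_left ?_ _
    rw [← inv_pow, ENNReal.ofReal_pow (by positivity)]
    refine pow_le_pow_left' (ENNReal.ofReal_le_of_le_toReal ?_) _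
    have : s⁻¹ ≤ (1 / 2)⁻¹ := inv_anti₀ (by norm_num) hs
    simpa using this
  have hmeas : Measurable fun p : Space d × Space d => F (p.1 + t • (p.2 - p.1)) :=
    hF.comp (by fun_prop)
  have fin : ∫⁻ _ in Q, 2 ^ d * ∫⁻ y, F y = 2 ^ d * volume Q * ∫⁻ y, F y := by
    rw [setLIntegral_const]
    ring
  rcases le_total (1 / 2) t with h | h
  · rw [← fin]
    refine lintegral_mono fun x => le_trans (le_of_eq ?_) (key t h ((1 - t) • x))
    refine lintegral_congr fun y => ?_
    congr 1
    module
  · rw [lintegral_lintegral_swap (f := fun x y => F (x + t • (y - x))) hmeas.aemeasurable, ← fin]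
    refine lintegral_mono fun y => le_trans (le_of_eq ?_) (key (1 - t) (by linarith) (t • y))
    refine lintegral_congr fun x => ?_
    congr 1
    module

/-- The fundamental theorem of calculus along the segment, followed by Cauchy–Schwarz in the
parameter. -/
theorem sq_sub_le_lintegral (hφ : ContDiff ℝ 1 φ) {D : ℝ} {x y : Space d} (hD : dist x y ≤ D) :
    ENNReal.ofReal ((φ x - φ y) ^ 2) ≤ ENNReal.ofReal (D ^ 2) *
      ∫⁻ t in Set.Ioo (0 : ℝ) 1, ENNReal.ofReal (‖gradient φ (x + t • (y - x))‖ ^ 2) := by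
  set h : ℝ → ℝ := fun t => fderiv ℝ φ (x + t • (y - x)) (y - x) with hh
  have hline : ∀ t : ℝ, HasDerivAt (fun t : ℝ => x + t • (y - x)) (y - x) t := fun t => by
    simpa using ((hasDerivAt_id t).smul_const (y - x)).const_add x
  have hder : ∀ t : ℝ, HasDerivAt (fun t : ℝ => φ (x + t • (y - x))) (h t) t := fun t =>
    ((hφ.differentiable one_ne_zero _).hasFDerivAt).comp_hasDerivAt t (hline t)
  have hcont : Continuous h := by
    have : Continuous fun t : ℝ => fderiv ℝ φ (x + t • (y - x)) :=
      (hφ.continuous_fderiv one_ne_zero).comp (by fun_prop)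
    exact this.clm_apply continuous_const
  have hftc : ∫ t in (0 : ℝ)..1, h t = φ y - φ x := by
    rw [intervalIntegral.integral_eq_sub_of_hasDerivAt (fun t _ => hder t)
      (hcont.intervalIntegrable _ _)]
    simp
  rw [intervalIntegral.integral_of_le zero_le_one, integral_Ioc_eq_integral_Ioo] at hftc
  have hfin : IsFiniteMeasure (volume.restrict (Set.Ioo (0 : ℝ) 1)) := ⟨by simp⟩
  have hmem : MemLp h 2 (volume.restrict (Set.Ioo (0 : ℝ) 1)) := by
    obtain ⟨M, hM⟩ := (isCompact_Icc (a := (0 : ℝ)) (b := 1)).exists_bound_of_continuousOn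
      hcont.continuousOn
    refine MemLp.of_bound hcont.aestronglyMeasurable M ?_
    filter_upwards [ae_restrict_mem measurableSet_Ioo] with t ht
    exact hM t (Set.Ioo_subset_Icc_self ht)
  have hcs := abs_integral_mul_le hmem (memLp_const (1 : ℝ))
  simp only [mul_one, one_pow, integral_const, smul_eq_mul, MeasurableSet.univ, measureReal_restrict_apply,
    Set.univ_inter, Real.volume_real_Ioo, sub_zero] at hcs
  rw [hftc, max_eq_left zero_le_one, Real.sqrt_one, mul_one] at hcs
  have h1 : (φ x - φ y) ^ 2 ≤ ∫ t in Set.Ioo (0 : ℝ) 1, h t ^ 2 := by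
    have h0 : 0 ≤ ∫ t in Set.Ioo (0 : ℝ) 1, h t ^ 2 := integral_nonneg fun t => sq_nonneg _
    have := pow_le_pow_left₀ (abs_nonneg _) hcs 2
    rw [sq_abs, Real.sq_sqrt h0] at this
    linarith [sub_sq_comm (φ x) (φ y)]
  calc _ ≤ ENNReal.ofReal (∫ t in Set.Ioo (0 : ℝ) 1, h t ^ 2) := ENNReal.ofReal_le_ofReal h1
    _ = ∫⁻ t in Set.Ioo (0 : ℝ) 1, ENNReal.ofReal (h t ^ 2) :=
        ofReal_integral_eq_lintegral_ofReal (integrable_sq hmem)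
          (Eventually.of_forall fun t => sq_nonneg _)
    _ ≤ ∫⁻ t in Set.Ioo (0 : ℝ) 1, ENNReal.ofReal (D ^ 2) *
        ENNReal.ofReal (‖gradient φ (x + t • (y - x))‖ ^ 2) := by
        refine lintegral_mono fun t => ?_
        rw [← ENNReal.ofReal_mul (sq_nonneg _)]
        refine ENNReal.ofReal_le_ofReal ?_
        rw [← mul_pow, ← sq_abs]
        refine pow_le_pow_left₀ (abs_nonneg _) ?_ 2
        simp only [hh]
        rw [← inner_gradient_left, mul_comm]
        refine (abs_real_inner_le_norm _ _).trans (mul_le_mul_of_nonneg_left ?_ (norm_nonneg _))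
        rwa [← dist_eq_norm, dist_comm]
    _ = _ := lintegral_const_mul' _ _ ENNReal.ofReal_ne_top

/-- Convexity keeps the segments in Q, so the gradient may be cut off outside Q. Tonelli moves the
segment parameter outermost, where `lintegral_segments_le` applies for each value. -/
theorem lintegral_sub_sq_le (hQ : Convex ℝ Q) (hQm : MeasurableSet Q) {D : ℝ}
    (hD : ∀ x ∈ Q, ∀ y ∈ Q, dist x y ≤ D) (hφ : ContDiff ℝ 1 φ) :
    ∫⁻ x in Q, ∫⁻ y in Q, ENNReal.ofReal ((φ x - φ y) ^ 2) ≤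
      ENNReal.ofReal (D ^ 2) * (2 ^ d * volume Q *
        ∫⁻ x in Q, ENNReal.ofReal (‖gradient φ x‖ ^ 2)) := by
  set F : Space d → ℝ≥0∞ := Q.indicator fun x => ENNReal.ofReal (‖gradient φ x‖ ^ 2) with hF
  have hFm : Measurable F :=
    ((measurable_gradient φ).norm.pow_const 2).ennreal_ofReal.indicator hQm
  have hFint : ∫⁻ x, F x = ∫⁻ x in Q, ENNReal.ofReal (‖gradient φ x‖ ^ 2) :=
    lintegral_indicator hQm _
  calc _ ≤ ∫⁻ x in Q, ∫⁻ y in Q, ENNReal.ofReal (D ^ 2) *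
        ∫⁻ t in Set.Ioo (0 : ℝ) 1, F (x + t • (y - x)) := by
        refine setLIntegral_mono' hQm fun x hx => setLIntegral_mono' hQm fun y hy => ?_
        refine (sq_sub_le_lintegral hφ (hD x hx y hy)).trans (mul_le_mul_right ?_ _)
        refine setLIntegral_mono' measurableSet_Ioo fun t ht => ?_
        rw [hF, Set.indicator_of_mem]
        exact hQ.add_smul_sub_mem hx hy (Set.Ioo_subset_Icc_self ht)
    _ = ENNReal.ofReal (D ^ 2) * ∫⁻ x in Q, ∫⁻ y in Q,
        ∫⁻ t in Set.Ioo (0 : ℝ) 1, F (x + t • (y - x)) := by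
        simp_rw [lintegral_const_mul' _ _ ENNReal.ofReal_ne_top]
    _ = ENNReal.ofReal (D ^ 2) * ∫⁻ t in Set.Ioo (0 : ℝ) 1, ∫⁻ x in Q, ∫⁻ y in Q,
        F (x + t • (y - x)) := by
        congr 1
        have m3 : Measurable fun p : Space d × (Space d × ℝ) =>
            F (p.1 + p.2.2 • (p.2.1 - p.1)) := hFm.comp (by fun_prop)
        have e1 : ∀ x : Space d, ∫⁻ y in Q, ∫⁻ t in Set.Ioo (0 : ℝ) 1, F (x + t • (y - x)) =
            ∫⁻ t in Set.Ioo (0 : ℝ) 1, ∫⁻ y in Q, F (x + t • (y - x)) := fun x =>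
          lintegral_lintegral_swap (f := fun y t => F (x + t • (y - x)))
            (m3.comp (measurable_prodMk_left (x := x))).aemeasurable
        simp_rw [e1]
        refine lintegral_lintegral_swap
          (f := fun x (t : ℝ) => ∫⁻ y in Q, F (x + t • (y - x))) ?_
        have m4 : Measurable fun p : (Space d × ℝ) × Space d =>
            F (p.1.1 + p.1.2 • (p.2 - p.1.1)) := hFm.comp (by fun_prop)
        exact (Measurable.lintegral_prod_right' m4).aemeasurable
    _ ≤ ENNReal.ofReal (D ^ 2) * ∫⁻ _ in Set.Ioo (0 : ℝ) 1,
        2 ^ d * volume Q * ∫⁻ y, F y := by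
        refine mul_le_mul_right (setLIntegral_mono' measurableSet_Ioo fun t ht => ?_) _
        exact lintegral_segments_le hFm t
    _ = _ := by
        rw [setLIntegral_const, hFint, Real.volume_Ioo]
        simp

/-- The Poincaré inequality on a bounded convex set, for smooth functions. -/
theorem integral_sq_le_of_convex (hQ : Convex ℝ Q) (hQm : MeasurableSet Q)
    (hQb : Bornology.IsBounded Q) {D : ℝ}
    (hD : ∀ x ∈ Q, ∀ y ∈ Q, dist x y ≤ D)
    (hφ : ContDiff ℝ ((⊤ : ℕ∞) : WithTop ℕ∞) φ) (hc : HasCompactSupport φ) :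
    ∫ x in Q, φ x ^ 2 ≤ D ^ 2 * 2 ^ d * (∫ x in Q, ‖gradient φ x‖ ^ 2) +
      (volume Q).toReal⁻¹ * (∫ x in Q, φ x) ^ 2 := by
  by_cases hQ0 : volume Q = 0
  · simp [Measure.restrict_eq_zero.2 hQ0]
  obtain ⟨L, hL⟩ := exists_lipschitzWith_of_contDiff hφ hc
  have hQfin : volume Q ≠ ∞ := hQb.measure_lt_top.ne
  have : IsFiniteMeasure (volume.restrict Q : Measure (Space d)) := ⟨by
    simpa using hQb.measure_lt_top⟩
  have h2 := memLp_test hφ.continuous hc 2 (volume.restrict Q)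
  have i1 : Integrable φ (volume.restrict Q) := h2.integrable one_le_two
  have i2 := integrable_sq h2
  have i3 := integrable_norm_sq (memLp_gradient_of_lipschitz hQb hL 2)
  set V := (volume Q).toReal with hV
  have hVpos : 0 < V := ENNReal.toReal_pos hQ0 hQfin
  set S := ∫ x in Q, φ x
  set T := ∫ x in Q, φ x ^ 2
  set g := ∫ x in Q, ‖gradient φ x‖ ^ 2
  have hg0 : 0 ≤ g := integral_nonneg fun x => sq_nonneg _
  -- With V the volume, S the integral of φ and T that of φ², the double integral of squared
  -- differences is 2VT - 2S², which brings in the square of the integral.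
  have inner_eq : ∀ x, ∫ y in Q, (φ x - φ y) ^ 2 = V * φ x ^ 2 - 2 * S * φ x + T := by
    intro x
    have e : ∀ y, (φ x - φ y) ^ 2 = φ x ^ 2 - 2 * φ x * φ y + φ y ^ 2 := fun y => by ring
    simp_rw [e]
    have j : Integrable (fun y => φ x ^ 2 - 2 * φ x * φ y) (volume.restrict Q) :=
      (integrable_const _).sub (i1.const_mul _)
    rw [integral_add j i2,
      integral_sub (integrable_const _) (i1.const_mul _), integral_const, integral_const_mul]
    simp only [measureReal_restrict_apply MeasurableSet.univ, Set.univ_inter, smul_eq_mul]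
    rw [Measure.real, ← hV]
    ring
  have hint : ∀ x, Integrable (fun y => (φ x - φ y) ^ 2) (volume.restrict Q) := fun x =>
    integrable_sq ((memLp_const (φ x)).sub h2)
  have iout : Integrable (fun x => V * φ x ^ 2 - 2 * S * φ x + T) (volume.restrict Q) :=
    ((i2.const_mul _).sub (i1.const_mul _)).add (integrable_const _)
  have outer_eq : ∫ x in Q, (V * φ x ^ 2 - 2 * S * φ x + T) = 2 * V * T - 2 * S ^ 2 := by
    have j : Integrable (fun x => V * φ x ^ 2 - 2 * S * φ x) (volume.restrict Q) :=
      (i2.const_mul _).sub (i1.const_mul _)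
    rw [integral_add j (integrable_const _),
      integral_sub (i2.const_mul _) (i1.const_mul _), integral_const, integral_const_mul,
      integral_const_mul]
    simp only [measureReal_restrict_apply MeasurableSet.univ, Set.univ_inter, smul_eq_mul]
    rw [Measure.real, ← hV]
    ring
  have hmain := lintegral_sub_sq_le hQ hQm hD (hφ.of_le (by simp) : ContDiff ℝ 1 φ)
  have e1 : ∀ x, ∫⁻ y in Q, ENNReal.ofReal ((φ x - φ y) ^ 2) =
      ENNReal.ofReal (V * φ x ^ 2 - 2 * S * φ x + T) := fun x => by
    rw [← ofReal_integral_eq_lintegral_ofReal (hint x) (Eventually.of_forall fun y => sq_nonneg _),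
      inner_eq]
  have e2 : ∀ x, 0 ≤ V * φ x ^ 2 - 2 * S * φ x + T := fun x => by
    rw [← inner_eq]
    exact integral_nonneg fun y => sq_nonneg _
  simp_rw [e1] at hmain
  rw [← ofReal_integral_eq_lintegral_ofReal iout (Eventually.of_forall e2), outer_eq,
    ← ofReal_integral_eq_lintegral_ofReal i3 (Eventually.of_forall fun y => sq_nonneg _),
    ← ENNReal.ofReal_toReal hQfin, ← hV,
    show (2 : ℝ≥0∞) ^ d = ENNReal.ofReal (2 ^ d) by
      rw [ENNReal.ofReal_pow zero_le_two, ENNReal.ofReal_ofNat],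
    ← ENNReal.ofReal_mul (by positivity), ← ENNReal.ofReal_mul (by positivity),
    ← ENNReal.ofReal_mul (by positivity), ENNReal.ofReal_le_ofReal_iff (by positivity)] at hmain
  have h5 : V * T ≤ V * (D ^ 2 * 2 ^ d * g + V⁻¹ * S ^ 2) := by
    have h6 : V * (V⁻¹ * S ^ 2) = S ^ 2 := mul_inv_cancel_left₀ hVpos.ne' _
    have h7 : 0 ≤ D ^ 2 * 2 ^ d * (V * g) := by positivity
    rw [mul_add, h6]
    nlinarith
  exact le_of_mul_le_mul_left h5 hVpos

end MSGFEM

/-! ### Rellich's theorem -/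

namespace MSGFEM

section

variable {d : ℕ} {ω ω' Ω Γ Q : Set (Space d)} {u v w : Space d → ℝ} {G H : Space d → Space d}
  {φ ψ : Space d → ℝ} {K : ℝ≥0}

theorem collar_subset (Ω : Set (Space d)) (δ : ℝ) : collar Ω δ ⊆ Ω := Set.inter_subset_left

/-- A cell of the cubic grid of mesh size `s`. -/
def gridCell (s : ℝ) (k : Fin d → ℤ) : Set (Space d) :=
  ⋂ i, (fun x : Space d => x i) ⁻¹' Set.Ico (k i * s) ((k i + 1) * s)

theorem mem_gridCell {s : ℝ} {k : Fin d → ℤ} {x : Space d} :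
    x ∈ gridCell s k ↔ ∀ i, k i * s ≤ x i ∧ x i < (k i + 1) * s := by
  simp [gridCell]

theorem measurableSet_gridCell (s : ℝ) (k : Fin d → ℤ) : MeasurableSet (gridCell s k) :=
  MeasurableSet.iInter fun i => (by fun_prop : Measurable fun x : Space d => x i) measurableSet_Ico

theorem convex_gridCell (s : ℝ) (k : Fin d → ℤ) : Convex ℝ (gridCell s k) :=
  convex_iInter fun i => (convex_Ico _ _).linear_preimage (EuclideanSpace.proj (𝕜 := ℝ) i).toLinearMap

theorem gridCell_eq_floor {s : ℝ} (hs : 0 < s) {k : Fin d → ℤ} {x : Space d}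
    (hx : x ∈ gridCell s k) (i : Fin d) : k i = ⌊x i / s⌋ := by
  have := mem_gridCell.1 hx i
  exact (Int.floor_eq_iff.2 ⟨(le_div_iff₀ hs).2 this.1, (div_lt_iff₀ hs).2 this.2⟩).symm

theorem mem_gridCell_floor {s : ℝ} (hs : 0 < s) (x : Space d) :
    x ∈ gridCell s fun i => ⌊x i / s⌋ :=
  mem_gridCell.2 fun _ => ⟨(le_div_iff₀ hs).1 (Int.floor_le _),
    (div_lt_iff₀ hs).1 (Int.lt_floor_add_one _)⟩

theorem dist_le_of_mem_gridCell {s : ℝ} (hs : 0 < s) {k : Fin d → ℤ} {x y : Space d}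
    (hx : x ∈ gridCell s k) (hy : y ∈ gridCell s k) : dist x y ≤ s * √d := by
  rw [EuclideanSpace.dist_eq, Real.sqrt_le_left (by positivity), mul_pow, Real.sq_sqrt (by positivity)]
  calc _ ≤ ∑ _i : Fin d, s ^ 2 := by
        refine Finset.sum_le_sum fun i _ => pow_le_pow_left₀ dist_nonneg ?_ 2
        have h1 := mem_gridCell.1 hx i
        have h2 := mem_gridCell.1 hy i
        rw [Real.dist_eq, abs_le]
        constructor <;> linarith
    _ = _ := by
        rw [Finset.sum_const, Finset.card_univ, Fintype.card_fin, nsmul_eq_mul, mul_comm]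

theorem finite_gridCell {s : ℝ} (hs : 0 < s) (hb : Bornology.IsBounded Ω) :
    {k : Fin d → ℤ | (gridCell s k ∩ Ω).Nonempty}.Finite := by
  obtain ⟨R, hR⟩ := (Metric.isBounded_iff_subset_closedBall (0 : Space d)).1 hb
  refine (Set.finite_Icc (fun _ : Fin d => ⌊-R / s⌋) fun _ => ⌊R / s⌋).subset ?_
  rintro k ⟨x, hx, hxΩ⟩
  have h1 : ‖x‖ ≤ R := by simpa using hR hxΩ
  have h2 : ∀ i, |x i| ≤ R := fun i => (PiLp.norm_apply_le x i).trans h1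
  constructor <;> intro i <;> simp only [gridCell_eq_floor hs hx i] <;>
    refine Int.floor_le_floor (div_le_div_of_nonneg_right ?_ hs.le)
  · exact (abs_le.1 (h2 i)).1
  · exact (abs_le.1 (h2 i)).2

/-- A compactness inequality: up to a small multiple of the norm of `H¹(Ω)`, finitely many
averages control the norm of `L²(Ω)`. -/
theorem IsLipschitzDomain.integral_sq_le_averages (hΩ : IsLipschitzDomain Ω) {ε : ℝ} (hε : 0 < ε) :
    ∃ (J : Finset (Fin d → ℤ)) (Q : (Fin d → ℤ) → Set (Space d)) (C : ℝ),
      (∀ k ∈ J, MeasurableSet (Q k) ∧ Q k ⊆ Ω) ∧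
      ∀ φ : Space d → ℝ, ContDiff ℝ ((⊤ : ℕ∞) : WithTop ℕ∞) φ → HasCompactSupport φ →
        ∫ x in Ω, φ x ^ 2 ≤ ε * normH1 Ω φ ^ 2 + C * ∑ k ∈ J, (∫ x in Q k, φ x) ^ 2 := by
  classical
  obtain ⟨C, δ, hδ, hC⟩ := hΩ.collar_le
  -- The collar of width τ contributes at most ε/2 times the squared norm of H¹(Ω).
  obtain ⟨τ, hτ, hτδ, hτε⟩ : ∃ τ > 0, τ < δ ∧ C * τ ≤ ε / 2 := by
    refine ⟨min (δ / 2) (ε / (2 * (C + 1))), by positivity,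
      (min_le_left _ _).trans_lt (by linarith), ?_⟩
    calc C * min (δ / 2) (ε / (2 * (C + 1))) ≤ (C + 1) * (ε / (2 * (C + 1))) :=
          mul_le_mul (by simp) (min_le_right _ _) (by positivity) (by positivity)
      _ = ε / 2 := by field_simp
  -- Cells have diameter at most s√d < τ, so a point of Ω whose cell leaves Ω lies in the collar.
  -- The second condition makes the Poincaré constant of a cell at most ε/2.
  obtain ⟨s, hs, hsτ, hsε⟩ : ∃ s > 0, s * √d < τ ∧ (s * √d) ^ 2 * 2 ^ d ≤ ε / 2 := by
    have h1 : Tendsto (fun s : ℝ => s * √d) (𝓝[>] 0) (𝓝 (0 * √d)) :=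
      (tendsto_id.mul_const _).mono_left nhdsWithin_le_nhds
    have h2 := (h1.pow 2).mul_const ((2 : ℝ) ^ d)
    rw [zero_mul] at h1
    rw [zero_mul, zero_pow two_ne_zero, zero_mul] at h2
    obtain ⟨s, ⟨h3, h4⟩, h5⟩ := (((h1.eventually (gt_mem_nhds hτ)).and
      (h2.eventually (gt_mem_nhds (half_pos hε)))).and self_mem_nhdsWithin).exists
    exact ⟨s, h5, h3, h4.le⟩
  set J := (finite_gridCell hs hΩ.isBounded).toFinset.filter fun k => gridCell s k ⊆ Ω with hJ
  have hJΩ : ∀ k ∈ J, gridCell s k ⊆ Ω := fun k hk => (Finset.mem_filter.1 hk).2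
  set B : ℝ := ∑ k ∈ J, (volume (gridCell s k)).toReal⁻¹ with hB
  refine ⟨J, gridCell s, B, fun k hk => ⟨measurableSet_gridCell s k, hJΩ k hk⟩, fun φ hφ hc => ?_⟩
  obtain ⟨L, hL⟩ := exists_lipschitzWith_of_contDiff hφ hc
  have hp := sobolevPair_of_lipschitz hΩ.isOpen hΩ.isBounded hL
  have i2 := integrable_sq hp.memLp
  have i3 := integrable_norm_sq hp.memLp_grad
  have hdisj : Set.PairwiseDisjoint (J : Set (Fin d → ℤ)) (gridCell s) := by
    intro k _ k' _ hkk'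
    refine Set.disjoint_left.2 fun x hx hx' => hkk' (funext fun i => ?_)
    rw [gridCell_eq_floor hs hx, gridCell_eq_floor hs hx']
  have hcover : Ω ⊆ collar Ω τ ∪ ⋃ k ∈ J, gridCell s k := by
    intro x hx
    set k : Fin d → ℤ := fun i => ⌊x i / s⌋
    have hxk : x ∈ gridCell s k := mem_gridCell_floor hs x
    by_cases hk : gridCell s k ⊆ Ω
    · refine Or.inr (Set.mem_biUnion (x := k) ?_ hxk)
      rw [Finset.mem_coe, hJ, Finset.mem_filter, Set.Finite.mem_toFinset]
      exact ⟨⟨x, hxk, hx⟩, hk⟩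
    · obtain ⟨z, hz, hzΩ⟩ := Set.not_subset.1 hk
      obtain ⟨p, hp, hpx⟩ := exists_mem_frontier_dist_lt hx hzΩ
        ((dist_le_of_mem_gridCell hs hz hxk).trans_lt hsτ)
      exact Or.inl ⟨hx, Metric.mem_thickening_iff.2 ⟨p, hp, hpx⟩⟩
  have hcollar : ∫ x in collar Ω τ, φ x ^ 2 ≤ C * τ * normH1 Ω φ ^ 2 := by
    have h := hC τ hτ hτδ φ L hL
    rw [← ofReal_integral_eq_lintegral_ofReal (i2.mono_measure (Measure.restrict_mono_set _
      (collar_subset Ω τ))) (Eventually.of_forall fun x => sq_nonneg _),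
      ENNReal.ofReal_le_ofReal_iff (by positivity)] at h
    exact h
  have hcells : ∫ x in ⋃ k ∈ J, gridCell s k, φ x ^ 2 ≤
      (s * √d) ^ 2 * 2 ^ d * (∫ x in Ω, ‖gradient φ x‖ ^ 2) +
        B * ∑ k ∈ J, (∫ x in gridCell s k, φ x) ^ 2 := by
    rw [integral_biUnion_finset J (fun k _ => measurableSet_gridCell s k) hdisj fun k hk =>
      i2.mono_measure (Measure.restrict_mono_set _ (hJΩ k hk))]
    calc _ ≤ ∑ k ∈ J, ((s * √d) ^ 2 * 2 ^ d * (∫ x in gridCell s k, ‖gradient φ x‖ ^ 2) +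
          (volume (gridCell s k)).toReal⁻¹ * (∫ x in gridCell s k, φ x) ^ 2) := by
          refine Finset.sum_le_sum fun k hk => ?_
          exact integral_sq_le_of_convex (convex_gridCell s k) (measurableSet_gridCell s k)
            (hΩ.isBounded.subset (hJΩ k hk))
            (fun x hx y hy => dist_le_of_mem_gridCell hs hx hy) hφ hc
      _ = (s * √d) ^ 2 * 2 ^ d * (∫ x in ⋃ k ∈ J, gridCell s k, ‖gradient φ x‖ ^ 2) +
          ∑ k ∈ J, (volume (gridCell s k)).toReal⁻¹ * (∫ x in gridCell s k, φ x) ^ 2 := by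
          rw [Finset.sum_add_distrib, ← Finset.mul_sum, integral_biUnion_finset J
            (fun k _ => measurableSet_gridCell s k) hdisj fun k hk =>
            i3.mono_measure (Measure.restrict_mono_set _ (hJΩ k hk))]
      _ ≤ _ := by
          refine add_le_add (mul_le_mul_of_nonneg_left ?_ (by positivity)) ?_
          · exact setIntegral_mono_set i3 (Eventually.of_forall fun x => sq_nonneg _)
              (Set.iUnion₂_subset hJΩ).eventuallyLE
          · rw [Finset.mul_sum]
            refine Finset.sum_le_sum fun k hk => mul_le_mul_of_nonneg_right ?_ (sq_nonneg _)
            exact Finset.single_le_sum (f := fun k => (volume (gridCell s k)).toReal⁻¹)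
              (fun k _ => by positivity) hk
  have hgrad : ∫ x in Ω, ‖gradient φ x‖ ^ 2 ≤ normH1 Ω φ ^ 2 := by
    rw [hp.normH1_sq hΩ.isOpen]
    have : 0 ≤ ∫ x in Ω, φ x ^ 2 := integral_nonneg fun x => sq_nonneg _
    linarith
  have hsub : (⋃ k ∈ J, gridCell s k) ⊆ Ω := Set.iUnion₂_subset hJΩ
  have hmeas : MeasurableSet (⋃ k ∈ J, gridCell s k) :=
    J.measurableSet_biUnion fun k _ => measurableSet_gridCell s k
  have hcm := (isOpen_collar hΩ.isOpen τ).measurableSet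
  have hsplit : ∫ x in Ω, φ x ^ 2 ≤
      (∫ x in collar Ω τ, φ x ^ 2) + ∫ x in ⋃ k ∈ J, gridCell s k, φ x ^ 2 := by
    have e1 : ∫ x in collar Ω τ, φ x ^ 2 = ∫ x in Ω, (collar Ω τ).indicator (fun x => φ x ^ 2) x := by
      rw [setIntegral_indicator hcm,
        Set.inter_eq_right.2 (collar_subset Ω τ)]
    have e2 : ∫ x in ⋃ k ∈ J, gridCell s k, φ x ^ 2 =
        ∫ x in Ω, (⋃ k ∈ J, gridCell s k).indicator (fun x => φ x ^ 2) x := by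
      rw [setIntegral_indicator hmeas, Set.inter_eq_right.2 hsub]
    rw [e1, e2, ← integral_add (i2.indicator hcm) (i2.indicator hmeas)]
    refine setIntegral_mono_on i2 ((i2.indicator hcm).add (i2.indicator hmeas))
      hΩ.isOpen.measurableSet fun x hx => ?_
    have hnn : ∀ S : Set (Space d), 0 ≤ S.indicator (fun x => φ x ^ 2) x := fun S =>
      Set.indicator_nonneg (fun _ _ => sq_nonneg _) x
    rcases hcover hx with h | h
    · have := hnn (⋃ k ∈ J, gridCell s k)
      rw [Set.indicator_of_mem h]
      linarith
    · have := hnn (collar Ω τ)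
      rw [Set.indicator_of_mem h]
      linarith
  have h1 : (s * √d) ^ 2 * 2 ^ d * (∫ x in Ω, ‖gradient φ x‖ ^ 2) ≤ ε / 2 * normH1 Ω φ ^ 2 :=
    mul_le_mul hsε hgrad (integral_nonneg fun x => sq_nonneg _) (by positivity)
  have h2 : C * τ * normH1 Ω φ ^ 2 ≤ ε / 2 * normH1 Ω φ ^ 2 :=
    mul_le_mul_of_nonneg_right hτε (sq_nonneg _)
  linarith

theorem integral_add_sq_le {α F : Type*} [MeasurableSpace α] {μ : Measure α}
    [NormedAddCommGroup F] {f g : α → F} (hf : MemLp f 2 μ) (hg : MemLp g 2 μ) :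
    ∫ x, ‖f x + g x‖ ^ 2 ∂μ ≤ 2 * ((∫ x, ‖f x‖ ^ 2 ∂μ) + ∫ x, ‖g x‖ ^ 2 ∂μ) := by
  rw [← integral_add (integrable_norm_sq hf) (integrable_norm_sq hg), ← integral_const_mul]
  exact integral_mono (integrable_norm_sq (hf.add hg))
    (((integrable_norm_sq hf).add (integrable_norm_sq hg)).const_mul 2) fun x => norm_add_sq_le _ _

theorem setIntegral_add_sq_le {f g : Space d → ℝ} (hf : MemLp f 2 (volume.restrict ω))
    (hg : MemLp g 2 (volume.restrict ω)) :
    ∫ x in ω, (f + g) x ^ 2 ≤ 2 * ((∫ x in ω, f x ^ 2) + ∫ x in ω, g x ^ 2) := by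
  simpa using integral_add_sq_le hf hg

theorem abs_setIntegral_le_normH1 (hb : Bornology.IsBounded ω) (hu : MemH1 ω u)
    (hQ : Q ⊆ ω) : |∫ x in Q, u x| ≤ √(volume.real ω) * normH1 ω u := by
  have hp := hu.sobolevPair.mono hQ
  have hfin : IsFiniteMeasure (volume.restrict Q : Measure (Space d)) := ⟨by
    simpa using (hb.subset hQ).measure_lt_top⟩
  have h := abs_integral_mul_le (memLp_const (1 : ℝ)) hp.memLp
  simp only [one_mul, one_pow, integral_const, smul_eq_mul, mul_one,
    measureReal_restrict_apply MeasurableSet.univ, Set.univ_inter] at h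
  refine h.trans (mul_le_mul ?_ ?_ (Real.sqrt_nonneg _) (Real.sqrt_nonneg _))
  · exact Real.sqrt_le_sqrt (measureReal_mono hQ hb.measure_lt_top.ne)
  · refine le_trans (Real.sqrt_le_sqrt ?_) sqrt_integral_sq_le_normH1
    exact setIntegral_mono_set (integrable_sq hu.sobolevPair.memLp)
      (Eventually.of_forall fun x => sq_nonneg _) hQ.eventuallyLE

/-- Limits along one fixed nonprincipal ultrafilter replace the extraction of subsequences in all
compactness arguments. -/
theorem exists_tendsto_of_bounded {a : ℕ → ℝ} {M : ℝ} (ha : ∀ j, |a j| ≤ M) :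
    ∃ t, Tendsto a (hyperfilter ℕ) (𝓝 t) := by
  obtain ⟨t, -, ht⟩ := (isCompact_Icc (a := -M) (b := M)).ultrafilter_le_nhds
    ((hyperfilter ℕ).map a) (by
      rw [Ultrafilter.coe_map, le_principal_iff, mem_map]
      exact univ_mem' fun j => abs_le.1 (ha j))
  exact ⟨t, ht⟩

theorem hyperfilter_nat_le_atTop : (hyperfilter ℕ : Filter ℕ) ≤ atTop := by
  rw [← Nat.cofinite_eq_atTop]
  exact hyperfilter_le_cofinite

/-- Rellich's compactness theorem on a Lipschitz domain. -/
theorem IsLipschitzDomain.rellich (hΩ : IsLipschitzDomain Ω) {w : ℕ → Space d → ℝ}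
    (hw : ∀ j, MemH1 Ω (w j)) {M : ℝ} (hM : ∀ j, normH1 Ω (w j) ≤ M) :
    Tendsto (fun p : ℕ × ℕ => ∫ x in Ω, (w p.1 - w p.2) x ^ 2)
      ((hyperfilter ℕ : Filter ℕ) ×ˢ hyperfilter ℕ) (𝓝 0) := by
  have h : ∀ n : ℕ, ∃ φ : Space d → ℝ, ContDiff ℝ ((⊤ : ℕ∞) : WithTop ℕ∞) φ ∧
      HasCompactSupport φ ∧ normH1 Ω (φ - w n) < 1 / ((n : ℝ) + 1) :=
    fun n => hΩ.isSmoothLimit (hw n) (1 / ((n : ℝ) + 1)) (by positivity)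
  choose φ hφ hc hφw using h
  have hφ1 : ∀ n, MemH1 Ω (φ n) := fun n => memH1_of_contDiff hΩ.isOpen hΩ.isBounded (hφ n) (hc n)
  have hφM : ∀ n, normH1 Ω (φ n) ≤ M + 1 := by
    intro n
    have h1 := normH1_add_le hΩ.isOpen ((hφ1 n).sub (hw n)) (hw n)
    rw [sub_add_cancel] at h1
    have h2 : 1 / ((n : ℝ) + 1) ≤ 1 := by
      rw [div_le_one (by positivity)]
      linarith [n.cast_nonneg (α := ℝ)]
    linarith [hφw n, hM n]
  have hM0 : 0 ≤ M + 1 := normH1_nonneg.trans (hφM 0)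
  have hsmooth : Tendsto (fun p : ℕ × ℕ => ∫ x in Ω, (φ p.1 - φ p.2) x ^ 2)
      ((hyperfilter ℕ : Filter ℕ) ×ˢ hyperfilter ℕ) (𝓝 0) := by
    rw [Metric.tendsto_nhds]
    intro η hη
    -- Differences of the φ n have norm at most 2(M + 1), so this ε leaves at most η/2. The finitely
    -- many averages are bounded, hence converge along the ultrafilter, and their differences
    -- contribute less than η/2 eventually.
    obtain ⟨J, Q, C, hQ, hJ⟩ := hΩ.integral_sq_le_averages
      (ε := η / (2 * ((2 * (M + 1)) ^ 2 + 1))) (by positivity)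
    have hlim : Tendsto (fun p : ℕ × ℕ => C * ∑ k ∈ J, ((∫ x in Q k, φ p.1 x) -
        ∫ x in Q k, φ p.2 x) ^ 2) ((hyperfilter ℕ : Filter ℕ) ×ˢ hyperfilter ℕ) (𝓝 0) := by
      have h0 : ∀ k ∈ J, Tendsto (fun p : ℕ × ℕ => ((∫ x in Q k, φ p.1 x) -
          ∫ x in Q k, φ p.2 x) ^ 2) ((hyperfilter ℕ : Filter ℕ) ×ˢ hyperfilter ℕ) (𝓝 0) := by
        intro k hk
        obtain ⟨t, ht⟩ := exists_tendsto_of_bounded (a := fun j => ∫ x in Q k, φ j x)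
          (M := √(volume.real Ω) * (M + 1)) fun j =>
          (abs_setIntegral_le_normH1 hΩ.isBounded (hφ1 j) (hQ k hk).2).trans
            (mul_le_mul_of_nonneg_left (hφM j) (Real.sqrt_nonneg _))
        have := ((ht.comp tendsto_fst).sub (ht.comp (tendsto_snd (f := (hyperfilter ℕ : Filter ℕ))))).pow 2
        rwa [sub_self, zero_pow two_ne_zero] at this
      have := (tendsto_finsetSum J h0).const_mul C
      simpa using this
    filter_upwards [hlim.eventually (gt_mem_nhds (half_pos hη))] with p hp
    rw [Real.dist_eq, sub_zero, abs_of_nonneg (integral_nonneg fun x => sq_nonneg _)]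
    have hi : ∀ n, ∀ k ∈ J, IntegrableOn (φ n) (Q k) := fun n k _ =>
      ((hφ n).continuous.integrable_of_hasCompactSupport (hc n)).integrableOn
    refine (hJ (φ p.1 - φ p.2) ((hφ p.1).sub (hφ p.2)) ((hc p.1).sub (hc p.2))).trans_lt ?_
    have e : ∑ k ∈ J, (∫ x in Q k, (φ p.1 - φ p.2) x) ^ 2 =
        ∑ k ∈ J, ((∫ x in Q k, φ p.1 x) - ∫ x in Q k, φ p.2 x) ^ 2 :=
      Finset.sum_congr rfl fun k hk => by
        rw [← integral_sub (hi _ k hk) (hi _ k hk)]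
        rfl
    rw [e]
    have h1 : normH1 Ω (φ p.1 - φ p.2) ^ 2 ≤ (2 * (M + 1)) ^ 2 :=
      pow_le_pow_left₀ normH1_nonneg ((normH1_sub_le hΩ.isOpen (hφ1 _) (hφ1 _)).trans
        (by linarith [hφM p.1, hφM p.2])) 2
    have h2 : η / (2 * ((2 * (M + 1)) ^ 2 + 1)) * normH1 Ω (φ p.1 - φ p.2) ^ 2 ≤ η / 2 := by
      rw [div_mul_eq_mul_div, div_le_div_iff₀ (by positivity) two_pos]
      nlinarith
    linarith
  have hinv : Tendsto (fun j : ℕ => (1 / ((j : ℝ) + 1)) ^ 2) (hyperfilter ℕ) (𝓝 0) := by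
    have := (tendsto_one_div_add_atTop_nhds_zero_nat (𝕜 := ℝ)).pow 2
    rw [zero_pow two_ne_zero] at this
    exact this.mono_left hyperfilter_nat_le_atTop
  have hbd : ∀ n, ∫ x in Ω, (φ n - w n) x ^ 2 ≤ (1 / ((n : ℝ) + 1)) ^ 2 := fun n =>
    integral_sq_le_normH1_sq.trans (pow_le_pow_left₀ normH1_nonneg (hφw n).le 2)
  have hlim : Tendsto (fun p : ℕ × ℕ => 2 * (2 * ((1 / ((p.1 : ℝ) + 1)) ^ 2 +
      ∫ x in Ω, (φ p.1 - φ p.2) x ^ 2) + (1 / ((p.2 : ℝ) + 1)) ^ 2))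
      ((hyperfilter ℕ : Filter ℕ) ×ˢ hyperfilter ℕ) (𝓝 (2 * (2 * (0 + 0) + 0))) :=
    ((((hinv.comp tendsto_fst).add hsmooth).const_mul 2).add (hinv.comp tendsto_snd)).const_mul 2
  simp only [add_zero, mul_zero] at hlim
  refine squeeze_zero (fun p => integral_nonneg fun x => sq_nonneg _) (fun p => ?_) hlim
  have m1 := ((hw p.1).sub (hφ1 p.1)).sobolevPair.memLp
  have m2 := ((hφ1 p.1).sub (hφ1 p.2)).sobolevPair.memLp
  have m3 := ((hφ1 p.2).sub (hw p.2)).sobolevPair.memLp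
  have e1 : w p.1 - w p.2 = ((w p.1 - φ p.1) + (φ p.1 - φ p.2)) + (φ p.2 - w p.2) := by abel
  have e2 : ∫ x in Ω, (w p.1 - φ p.1) x ^ 2 = ∫ x in Ω, (φ p.1 - w p.1) x ^ 2 := by
    congr 1
    ext x
    simp only [Pi.sub_apply]
    ring
  rw [e1]
  have h1 := setIntegral_add_sq_le (m1.add m2) m3
  have h2 := setIntegral_add_sq_le m1 m2
  rw [e2] at h2
  linarith [hbd p.1, hbd p.2]

end

end MSGFEM

/-! ### Poincaré's and Friedrichs' inequalities -/

namespace MSGFEM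

section

variable {d : ℕ} {ω ω' Ω Γ Q : Set (Space d)} {u v w : Space d → ℝ} {G H : Space d → Space d}
  {φ ψ : Space d → ℝ} {K : ℝ≥0}

theorem integral_sub_const_sq {α : Type*} [MeasurableSpace α] {μ : Measure α} [IsFiniteMeasure μ]
    {f : α → ℝ} (hf : MemLp f 2 μ) (t : ℝ) :
    ∫ x, (f x - t) ^ 2 ∂μ = (∫ x, f x ^ 2 ∂μ) - 2 * t * (∫ x, f x ∂μ) + t ^ 2 * μ.real Set.univ := by
  have i1 : Integrable f μ := hf.integrable one_le_two
  have i2 := integrable_sq hf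
  have e : ∀ x, (f x - t) ^ 2 = f x ^ 2 - 2 * t * f x + t ^ 2 := fun x => by ring
  simp_rw [e]
  have j : Integrable (fun x => f x ^ 2 - 2 * t * f x) μ := i2.sub (i1.const_mul _)
  rw [integral_add j (integrable_const _), integral_sub i2 (i1.const_mul _), integral_const_mul,
    integral_const, smul_eq_mul]
  ring

/-- The mean is the best approximation by constants. -/
theorem integral_sub_average_sq_le {α : Type*} [MeasurableSpace α] {μ : Measure α}
    [IsFiniteMeasure μ] {f : α → ℝ} (hf : MemLp f 2 μ) (t : ℝ) :
    ∫ x, (f x - (μ.real Set.univ)⁻¹ * ∫ y, f y ∂μ) ^ 2 ∂μ ≤ ∫ x, (f x - t) ^ 2 ∂μ := by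
  rw [integral_sub_const_sq hf, integral_sub_const_sq hf]
  set V := μ.real Set.univ
  set S := ∫ x, f x ∂μ
  rcases (measureReal_nonneg : 0 ≤ V).eq_or_lt with h | h
  · have hμ : μ = 0 := by
      rw [← Measure.measure_univ_eq_zero, ← measureReal_eq_zero_iff]
      exact h.symm
    have hS : S = 0 := by simp only [S, hμ, integral_zero_measure]
    rw [hS, show V = 0 from h.symm]
    simp
  · replace h : 0 < V := h
    have h1 : 0 ≤ (V * t - S) ^ 2 / V := by positivity
    have h2 : -2 * t * S + t ^ 2 * V - (-2 * (V⁻¹ * S) * S + (V⁻¹ * S) ^ 2 * V) =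
        (V * t - S) ^ 2 / V := by
      field_simp
      ring
    linarith

/-- Poincaré's inequality is available for smooth functions only. An approximant φ of u has a small
gradient because that of u vanishes, so φ, and with it u, is close in L²(Q) to a constant. -/
theorem IsLipschitzDomain.ae_eq_const_of_convex (hΩ : IsLipschitzDomain Ω) (hu : MemH1 Ω u)
    (h0 : ∫ x in Ω, ‖wgrad Ω u x‖ ^ 2 = 0) (hQ : Convex ℝ Q) (hQm : MeasurableSet Q)
    (hQΩ : Q ⊆ Ω) : ∃ c : ℝ, u =ᵐ[volume.restrict Q] fun _ => c := by
  have hQb := hΩ.isBounded.subset hQΩ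
  have hfin : IsFiniteMeasure (volume.restrict Q : Measure (Space d)) := ⟨by
    simpa using hQb.measure_lt_top⟩
  obtain ⟨D, hD⟩ := Metric.isBounded_iff.1 hQb
  have hp := hu.sobolevPair
  have hpQ := hp.mono hQΩ
  set c := ((volume.restrict Q).real Set.univ)⁻¹ * ∫ x in Q, u x with hc
  have key : ∀ ε > 0, ∫ x in Q, (u x - c) ^ 2 ≤ (2 + 2 * (D ^ 2 * 2 ^ d)) * ε ^ 2 := by
    intro ε hε
    obtain ⟨φ, hφ, hφc, hφu⟩ := hΩ.isSmoothLimit hu ε hε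
    obtain ⟨L, hL⟩ := exists_lipschitzWith_of_contDiff hφ hφc
    have hpφ := sobolevPair_of_lipschitz hΩ.isOpen hΩ.isBounded hL
    have hφQ := hpφ.mono hQΩ
    set t := ((volume.restrict Q).real Set.univ)⁻¹ * ∫ x in Q, φ x with ht
    have hN : normH1 Ω (φ - u) ^ 2 ≤ ε ^ 2 := pow_le_pow_left₀ normH1_nonneg hφu.le 2
    have h1 : ∫ x in Q, (φ x - t) ^ 2 ≤ D ^ 2 * 2 ^ d * ε ^ 2 := by
      have hle := integral_sq_le_of_convex hQ hQm hQb (fun x hx y hy => hD hx hy) hφ hφc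
      have hvar := integral_sub_const_sq hφQ.memLp t
      have hgrad : ∫ x in Q, ‖gradient φ x‖ ^ 2 ≤ ε ^ 2 := by
        have hz : wgrad Ω u =ᵐ[volume.restrict Ω] 0 := by
          have := (integral_eq_zero_iff_of_nonneg (fun x => sq_nonneg _)
            (integrable_norm_sq hp.memLp_grad)).1 h0
          filter_upwards [this] with x hx
          simpa using hx
        have hpz := (hpφ.sub hp).congr .rfl
          (show gradient φ - wgrad Ω u =ᵐ[volume.restrict Ω] gradient φ by
            filter_upwards [hz] with x hx
            simp [hx])
        have h2 := hpz.normH1_sq hΩ.isOpen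
        have h3 : 0 ≤ ∫ x in Ω, (φ - u) x ^ 2 := integral_nonneg fun x => sq_nonneg _
        have h4 := setIntegral_mono_set (integrable_norm_sq hpφ.memLp_grad)
          (Eventually.of_forall fun x => sq_nonneg _) hQΩ.eventuallyLE
        linarith
      have hV : (volume Q).toReal = (volume.restrict Q).real Set.univ := by
        simp [Measure.real]
      rw [hV] at hle
      set V := (volume.restrict Q).real Set.univ
      have h5 : -(2 * t * ∫ x in Q, φ x) + t ^ 2 * V = -(V⁻¹ * (∫ x in Q, φ x) ^ 2) := by
        rw [ht]
        by_cases hV0 : V = 0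
        · rw [hV0]; simp
        · field_simp
          ring
      have h6 := mul_le_mul_of_nonneg_left hgrad (by positivity : 0 ≤ D ^ 2 * 2 ^ d)
      linarith
    have h2 : ∫ x in Q, (u - φ) x ^ 2 ≤ ε ^ 2 := by
      refine le_trans ?_ ((integral_sq_le_normH1_sq (ω := Ω) (u := φ - u)).trans hN)
      have e : ∀ x, (u - φ) x ^ 2 = (φ - u) x ^ 2 := fun x => by simp only [Pi.sub_apply]; ring
      simp_rw [e]
      exact setIntegral_mono_set (integrable_sq (hpφ.sub hp).memLp)
        (Eventually.of_forall fun x => sq_nonneg _) hQΩ.eventuallyLE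
    have h3 := setIntegral_add_sq_le (hpQ.memLp.sub hφQ.memLp)
      (hφQ.memLp.sub (memLp_const (μ := volume.restrict Q) t))
    have h4 := integral_sub_average_sq_le hpQ.memLp t
    simp only [Pi.add_apply, Pi.sub_apply, sub_add_sub_cancel] at h3 h2
    linarith
  have hle : ∫ x in Q, (u x - c) ^ 2 ≤ 0 := by
    refine ge_of_tendsto (f := fun ε : ℝ => (2 + 2 * (D ^ 2 * 2 ^ d)) * ε ^ 2) (x := 𝓝[>] (0 : ℝ))
      ?_ (by filter_upwards [self_mem_nhdsWithin] with ε hε using key ε hε)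
    have := (((tendsto_id (x := 𝓝 (0 : ℝ))).pow 2).const_mul (2 + 2 * (D ^ 2 * 2 ^ d))).mono_left
      (nhdsWithin_le_nhds (s := Set.Ioi (0 : ℝ)))
    simpa using this
  have h1 := (integral_eq_zero_iff_of_nonneg (fun x => sq_nonneg _)
    (integrable_sq (hpQ.memLp.sub (memLp_const c)))).1
    (le_antisymm hle (integral_nonneg fun x => sq_nonneg _))
  refine ⟨c, ?_⟩
  filter_upwards [h1] with x hx
  simpa [sub_eq_zero] using hx

/-- On a domain, functions with vanishing gradient are constant. -/
theorem IsLipschitzDomain.ae_eq_const (hΩ : IsLipschitzDomain Ω) (hu : MemH1 Ω u)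
    (h0 : ∫ x in Ω, ‖wgrad Ω u x‖ ^ 2 = 0) : ∃ c : ℝ, u =ᵐ[volume.restrict Ω] fun _ => c := by
  have h : ∀ x : Ω, ∃ (c r : ℝ), 0 < r ∧ u =ᵐ[volume.restrict (Metric.ball x.1 r)] fun _ => c := by
    intro x
    obtain ⟨r, hr, hrΩ⟩ := Metric.isOpen_iff.1 hΩ.isOpen x.1 x.2
    obtain ⟨c, hc⟩ := hΩ.ae_eq_const_of_convex hu h0 (convex_ball x.1 r)
      Metric.isOpen_ball.measurableSet hrΩ
    exact ⟨c, r, hr, hc⟩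
  choose c r hr hc using h
  -- The constants belonging to two balls agree when one ball contains the centre of the other, as
  -- the overlap is open and nonempty. Connectedness then gives a single constant, and a locally
  -- null exceptional set is null.
  have hloc : IsLocallyConstant c := by
    rw [IsLocallyConstant.iff_eventually_eq]
    intro x
    have hx : ∀ᶠ y : Ω in 𝓝 x, y.1 ∈ Metric.ball x.1 (r x) :=
      continuous_subtype_val.tendsto x (Metric.ball_mem_nhds _ (hr x))
    filter_upwards [hx] with y hy
    set U := Metric.ball x.1 (r x) ∩ Metric.ball y.1 (r y)
    have hU : IsOpen U := Metric.isOpen_ball.inter Metric.isOpen_ball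
    have hUn : U.Nonempty := ⟨y.1, hy, Metric.mem_ball_self (hr y)⟩
    have hne : (ae (volume.restrict U)).NeBot := by
      rw [ae_neBot, Ne, Measure.restrict_eq_zero]
      exact (hU.measure_pos _ hUn).ne'
    have h1 := ae_restrict_of_ae_restrict_of_subset (Set.inter_subset_left : U ⊆ _) (hc x)
    have h2 := ae_restrict_of_ae_restrict_of_subset (Set.inter_subset_right : U ⊆ _) (hc y)
    obtain ⟨z, hz1, hz2⟩ := (h1.and h2 : ∀ᵐ z ∂(volume.restrict U), _).exists
    exact hz2.symm.trans hz1
  have : PreconnectedSpace Ω := isPreconnected_iff_preconnectedSpace.1 hΩ.isConnected.isPreconnected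
  obtain ⟨x₀, hx₀⟩ := hΩ.isConnected.nonempty
  refine ⟨c ⟨x₀, hx₀⟩, ?_⟩
  rw [EventuallyEq, ae_restrict_iff' hΩ.isOpen.measurableSet, ae_iff]
  refine measure_null_of_locally_null _ fun x hx => ?_
  have hx' : x ∈ Ω := by
    by_contra hn
    exact hx fun h => absurd h hn
  have hcx := hc ⟨x, hx'⟩
  rw [hloc.apply_eq_of_preconnectedSpace ⟨x, hx'⟩ ⟨x₀, hx₀⟩, EventuallyEq,
    ae_restrict_iff' Metric.isOpen_ball.measurableSet, ae_iff] at hcx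
  refine ⟨_, ?_, hcx⟩
  filter_upwards [self_mem_nhdsWithin, nhdsWithin_le_nhds (Metric.ball_mem_nhds x (hr ⟨x, hx'⟩))]
    with y hy hyb hn
  exact hy fun _ => hn hyb

theorem gradient_const_zero (c : ℝ) : gradient (fun _ : Space d => c) = 0 := by
  ext x i
  rw [gradient_coord]
  simp

theorem sobolevPair_const (hω : IsOpen ω) (hb : Bornology.IsBounded ω) (c : ℝ) :
    SobolevPair ω (fun _ => c) 0 := by
  have := sobolevPair_of_lipschitz hω hb (LipschitzWith.const (β := ℝ) (α := Space d) c)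
  rwa [gradient_const_zero] at this

theorem integral_wgrad_add_sq_le (hω : IsOpen ω) (hu : MemH1 ω u) (hv : MemH1 ω v) :
    ∫ x in ω, ‖wgrad ω (u + v) x‖ ^ 2 ≤
      2 * ((∫ x in ω, ‖wgrad ω u x‖ ^ 2) + ∫ x in ω, ‖wgrad ω v x‖ ^ 2) := by
  refine le_trans (le_of_eq (integral_congr_ae ?_))
    (integral_add_sq_le hu.sobolevPair.memLp_grad hv.sobolevPair.memLp_grad)
  filter_upwards [wgrad_add hω hu hv] with x hx
  rw [hx, Pi.add_apply]

theorem integral_wgrad_smul_sq (hω : IsOpen ω) (c : ℝ) (hu : MemH1 ω u) :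
    ∫ x in ω, ‖wgrad ω (c • u) x‖ ^ 2 = c ^ 2 * ∫ x in ω, ‖wgrad ω u x‖ ^ 2 := by
  rw [← integral_const_mul]
  refine integral_congr_ae ?_
  filter_upwards [wgrad_smul hω c hu] with x hx
  rw [hx, Pi.smul_apply, norm_smul, mul_pow, Real.norm_eq_abs, sq_abs]

theorem integral_wgrad_sub_sq_le (hω : IsOpen ω) (hu : MemH1 ω u) (hv : MemH1 ω v) :
    ∫ x in ω, ‖wgrad ω (u - v) x‖ ^ 2 ≤
      2 * ((∫ x in ω, ‖wgrad ω u x‖ ^ 2) + ∫ x in ω, ‖wgrad ω v x‖ ^ 2) := by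
  have h := integral_wgrad_add_sq_le hω hu (hv.smul (-1))
  rw [integral_wgrad_smul_sq hω (-1) hv, neg_one_smul, ← sub_eq_add_neg] at h
  simpa using h

/-- An abstract Poincaré inequality, for closed cones that contain no constant functions. -/
theorem IsLipschitzDomain.exists_poincare (hΩ : IsLipschitzDomain Ω) {S : Set (Space d → ℝ)}
    (hS : ∀ u ∈ S, MemH1 Ω u) (hsmul : ∀ (c : ℝ), ∀ u ∈ S, c • u ∈ S)
    (hclosed : ∀ (w : ℕ → Space d → ℝ) (u : Space d → ℝ), (∀ j, w j ∈ S) → MemH1 Ω u →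
      Tendsto (fun j => normH1 Ω (w j - u)) (hyperfilter ℕ) (𝓝 0) → u ∈ S)
    (hconst : ∀ u ∈ S, ∀ c : ℝ, u =ᵐ[volume.restrict Ω] (fun _ => c) → c = 0) :
    ∃ C : ℝ, ∀ u ∈ S, ∫ x in Ω, u x ^ 2 ≤ C * ∫ x in Ω, ‖wgrad Ω u x‖ ^ 2 := by
  by_contra! hcon
  -- Counterexamples normalized in L² have gradients tending to 0. By Rellich they are Cauchy in
  -- H¹(Ω), and their limit in S has zero gradient, so it is a constant and hence 0, which
  -- contradicts the normalization.
  choose u hu hlt using fun n : ℕ => hcon ((n : ℝ) + 1)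
  have hpos : ∀ n, 0 < ∫ x in Ω, u n x ^ 2 := fun n =>
    lt_of_le_of_lt (mul_nonneg (by positivity) (integral_nonneg fun x => sq_nonneg _)) (hlt n)
  set w : ℕ → Space d → ℝ := fun n => (√(∫ x in Ω, u n x ^ 2))⁻¹ • u n with hw
  have hwS : ∀ n, w n ∈ S := fun n => hsmul _ _ (hu n)
  have hwH : ∀ n, MemH1 Ω (w n) := fun n => hS _ (hwS n)
  have hsq : ∀ n, ((√(∫ x in Ω, u n x ^ 2))⁻¹) ^ 2 = (∫ x in Ω, u n x ^ 2)⁻¹ := fun n => by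
    rw [inv_pow, Real.sq_sqrt (hpos n).le]
  have hw1 : ∀ n, ∫ x in Ω, w n x ^ 2 = 1 := by
    intro n
    have e : ∀ x, w n x ^ 2 = (∫ x in Ω, u n x ^ 2)⁻¹ * u n x ^ 2 := fun x => by
      rw [← hsq, ← mul_pow]; rfl
    simp_rw [e]
    rw [integral_const_mul, inv_mul_cancel₀ (hpos n).ne']
  have hwg : ∀ n : ℕ, ∫ x in Ω, ‖wgrad Ω (w n) x‖ ^ 2 ≤ 1 / ((n : ℝ) + 1) := by
    intro n
    simp only [hw]
    rw [integral_wgrad_smul_sq hΩ.isOpen _ (hS _ (hu n)), hsq, inv_mul_le_iff₀ (hpos n),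
      ← mul_div_assoc, mul_one, le_div_iff₀ (by positivity), mul_comm]
    exact (hlt n).le
  have hwM : ∀ n, normH1 Ω (w n) ≤ √2 := by
    intro n
    refine Real.le_sqrt_of_sq_le ?_
    rw [normH1_sq, hw1]
    have : 1 / ((n : ℝ) + 1) ≤ 1 := by
      rw [div_le_one (by positivity)]
      linarith [n.cast_nonneg (α := ℝ)]
    linarith [hwg n]
  have hinv : Tendsto (fun j : ℕ => 1 / ((j : ℝ) + 1)) (hyperfilter ℕ) (𝓝 0) :=
    tendsto_one_div_add_atTop_nhds_zero_nat.mono_left hyperfilter_nat_le_atTop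
  have hrel := hΩ.rellich hwH hwM
  have hcauchy : Tendsto (fun p : ℕ × ℕ => normH1 Ω (w p.1 - w p.2))
      ((hyperfilter ℕ : Filter ℕ) ×ˢ hyperfilter ℕ) (𝓝 0) := by
    have h1 : Tendsto (fun p : ℕ × ℕ => √((∫ x in Ω, (w p.1 - w p.2) x ^ 2) +
        2 * (1 / ((p.1 : ℝ) + 1) + 1 / ((p.2 : ℝ) + 1))))
        ((hyperfilter ℕ : Filter ℕ) ×ˢ hyperfilter ℕ) (𝓝 (√(0 + 2 * (0 + 0)))) :=
      (hrel.add (((hinv.comp tendsto_fst).add (hinv.comp tendsto_snd)).const_mul 2)).sqrt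
    simp only [add_zero, mul_zero, Real.sqrt_zero] at h1
    refine squeeze_zero (fun p => normH1_nonneg) (fun p => Real.sqrt_le_sqrt ?_) h1
    have := integral_wgrad_sub_sq_le hΩ.isOpen (hwH p.1) (hwH p.2)
    linarith [hwg p.1, hwg p.2]
  obtain ⟨z, hz, hlim⟩ := exists_tendsto_of_cauchy hΩ.isOpen hwH hcauchy
  have hzS := hclosed w z hwS hz hlim
  have hlim2 := hlim.pow 2
  rw [zero_pow two_ne_zero] at hlim2
  have hzg : ∫ x in Ω, ‖wgrad Ω z x‖ ^ 2 = 0 := by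
    refine le_antisymm ?_ (integral_nonneg fun x => sq_nonneg _)
    have h1 := (hinv.add hlim2).const_mul 2
    rw [add_zero, mul_zero] at h1
    refine ge_of_tendsto' h1 fun j => ?_
    have h2 := integral_wgrad_sub_sq_le hΩ.isOpen (hwH j) ((hwH j).sub hz)
    rw [sub_sub_cancel] at h2
    linarith [hwg j, integral_wgrad_sq_le_normH1_sq (ω := Ω) (u := w j - z)]
  obtain ⟨c, hc⟩ := hΩ.ae_eq_const hz hzg
  have hc0 := hconst z hzS c hc
  have hz0 : ∫ x in Ω, z x ^ 2 = 0 := by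
    rw [integral_congr_ae (g := fun _ => (0 : ℝ)), integral_zero]
    filter_upwards [hc] with x hx
    rw [hx, hc0, zero_pow two_ne_zero]
  have h1 := ge_of_tendsto' (hlim2.const_mul 2) (b := (1 : ℝ)) fun j => by
    have h2 := setIntegral_add_sq_le ((hwH j).sub hz).sobolevPair.memLp hz.sobolevPair.memLp
    rw [sub_add_cancel, hw1, hz0, add_zero] at h2
    linarith [integral_sq_le_normH1_sq (ω := Ω) (u := w j - z)]
  linarith

/-- The Poincaré inequality for functions of mean zero. -/
theorem IsLipschitzDomain.poincare_mean_zero (hΩ : IsLipschitzDomain Ω) :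
    ∃ C : ℝ, ∀ u, MemH1 Ω u → ∫ x in Ω, u x = 0 →
      ∫ x in Ω, u x ^ 2 ≤ C * ∫ x in Ω, ‖wgrad Ω u x‖ ^ 2 := by
  have hb := hΩ.isBounded
  obtain ⟨C, hC⟩ := hΩ.exists_poincare (S := {u | MemH1 Ω u ∧ ∫ x in Ω, u x = 0})
    (fun u hu => hu.1)
    (fun c u hu => ⟨hu.1.smul c, by
      simp only [Pi.smul_apply, smul_eq_mul]
      rw [integral_const_mul, hu.2, mul_zero]⟩)
    (fun w u hw hu hlim => ⟨hu, by
      have hfin : IsFiniteMeasure (volume.restrict Ω : Measure (Space d)) := ⟨by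
        simpa using hb.measure_lt_top⟩
      have h1 : ∀ j, |∫ x in Ω, u x| ≤ √(volume.real Ω) * normH1 Ω (w j - u) := fun j => by
        have h2 := abs_setIntegral_le_normH1 hb ((hw j).1.sub hu) subset_rfl
        have h3 : ∫ x in Ω, (w j - u) x = (∫ x in Ω, w j x) - ∫ x in Ω, u x :=
          integral_sub ((hw j).1.1.integrable one_le_two) (hu.1.integrable one_le_two)
        rwa [h3, (hw j).2, zero_sub, abs_neg] at h2
      have h2 := ge_of_tendsto' (hlim.const_mul (√(volume.real Ω))) h1
      rw [mul_zero] at h2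
      exact abs_eq_zero.1 (le_antisymm h2 (abs_nonneg _))⟩)
    (fun u hu c hc => by
      have h1 := hu.2
      rw [integral_congr_ae hc, integral_const, smul_eq_mul, mul_eq_zero] at h1
      refine h1.resolve_left ?_
      rw [measureReal_restrict_apply MeasurableSet.univ, Set.univ_inter, Measure.real]
      exact (ENNReal.toReal_pos (hΩ.isOpen.measure_pos _ hΩ.isConnected.nonempty).ne'
        hb.measure_lt_top.ne).ne')
  exact ⟨C, fun u hu h0 => hC u ⟨hu, h0⟩⟩

theorem hasTrace_const (hω : IsOpen ω) (hb : Bornology.IsBounded ω) (c : ℝ)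
    (hΓ : surface d Γ ≠ ∞) : HasTrace ω Γ (fun _ => c) fun _ => c := by
  have hfin : IsFiniteMeasure ((surface d).restrict Γ) := ⟨by simpa using hΓ.lt_top⟩
  refine ⟨(sobolevPair_const hω hb c).memH1, memLp_const c, fun _ _ => c,
    fun n => ⟨0, LipschitzWith.const c⟩, ?_, ?_⟩
  · have h0 := normH1_smul hω 0 (sobolevPair_const hω hb c).memH1
    have h1 : normH1 ω ((fun _ => c) - fun _ => c) = 0 := by
      rw [sub_self]
      simpa using h0
    simp only [h1]
    exact tendsto_const_nhds
  · simp

end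

section

variable {m : ℕ} {Ω Γ : Set (Space (m + 1))}

/-- The trace inequality for the constant 1, which makes constants have traces in L². -/
theorem IsLipschitzDomain.surface_frontier_ne_top (hΩ : IsLipschitzDomain Ω) :
    surface (m + 1) (frontier Ω) ≠ ∞ := by
  have h := hΩ.eLpNorm_surface_lt_top (LipschitzWith.const (α := Space (m + 1)) (1 : ℝ))
  intro htop
  rw [eLpNorm_const _ two_ne_zero (by
    rw [Ne, Measure.restrict_eq_zero, htop]; exact ENNReal.top_ne_zero)] at h
  simp [htop] at h

/-- The Friedrichs inequality for functions that vanish on a part of the boundary of positive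
surface measure. -/
theorem IsLipschitzDomain.friedrichs (hΩ : IsLipschitzDomain Ω) (hΓ : Γ ⊆ frontier Ω)
    (h0 : surface (m + 1) Γ ≠ 0) :
    ∃ C : ℝ, ∀ u, HasTrace Ω Γ u 0 →
      ∫ x in Ω, u x ^ 2 ≤ C * ∫ x in Ω, ‖wgrad Ω u x‖ ^ 2 := by
  refine hΩ.exists_poincare (S := {u | HasTrace Ω Γ u 0}) (fun u hu => hu.memH1)
    (fun c u hu => ?_) (fun w u hw hu hlim => HasTrace.of_tendsto hΩ hΓ hw hu hlim)
    (fun u hu c hc => ?_)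
  · have := HasTrace.smul hΩ.isOpen hΩ.isBounded c hu
    rwa [smul_zero] at this
  · have h1 := hasTrace_const hΩ.isOpen hΩ.isBounded c
      (ne_top_of_le_ne_top hΩ.surface_frontier_ne_top (measure_mono hΓ))
    have h2 := h1.ae_eq hΩ hΓ (HasTrace.congr_left hΩ.isOpen hΩ.isBounded hu hc)
    have hne : (ae ((surface (m + 1)).restrict Γ)).NeBot := by
      rw [ae_neBot, Ne, Measure.restrict_eq_zero]
      exact h0
    exact h2.exists.choose_spec

end

end MSGFEM

/-! ### The local problem: Caccioppoli's inequality and compactness -/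

namespace MSGFEM

variable {m : ℕ} {Ω D N ω ω' : Set (Space (m + 1))} {u v w : Space (m + 1) → ℝ}
  {A : Space (m + 1) → Matrix (Fin (m + 1)) (Fin (m + 1)) ℝ} {α β : ℝ} {χ : Space (m + 1) → ℝ}

/-- The domains, the coefficient and the partition of unity function of the local problems. -/
structure LocalSetting (Ω D ω ω' : Set (Space (m + 1)))
    (A : Space (m + 1) → Matrix (Fin (m + 1)) (Fin (m + 1)) ℝ) (α β : ℝ)
    (χ : Space (m + 1) → ℝ) : Prop where
  domain : IsLipschitzDomain Ω
  coeff : IsElliptic Ω A α β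
  isOpen : IsOpen ω
  oversampling : IsLipschitzDomain ω'
  subset : ω ⊆ ω'
  subset_domain : ω' ⊆ Ω
  partition : IsPartitionFunction Ω ω χ

namespace LocalSetting

theorem elliptic (h : LocalSetting Ω D ω ω' A α β χ) : IsElliptic ω' A α β :=
  h.coeff.mono h.subset_domain

theorem elliptic_inner (h : LocalSetting Ω D ω ω' A α β χ) : IsElliptic ω A α β :=
  h.elliptic.mono h.subset

theorem isOpen_oversampling (h : LocalSetting Ω D ω ω' A α β χ) : IsOpen ω' :=
  h.oversampling.isOpen

theorem isBounded (h : LocalSetting Ω D ω ω' A α β χ) : Bornology.IsBounded ω' :=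
  h.oversampling.isBounded

theorem upper_nonneg (h : LocalSetting Ω D ω ω' A α β χ) : 0 ≤ β :=
  h.elliptic.upper_nonneg m.succ_pos
    (h.isOpen_oversampling.measure_pos _ h.oversampling.isConnected.nonempty).ne'

/-- The partition of unity function extends to a Lipschitz function with compact support. -/
theorem exists_extension (h : LocalSetting Ω D ω ω' A α β χ) :
    ∃ (ψ : Space (m + 1) → ℝ) (K : ℝ≥0), LipschitzWith K ψ ∧ HasCompactSupport ψ ∧
      ∀ x ∈ Ω, ψ x = χ x := by
  obtain ⟨K, hK⟩ := h.partition.lipschitz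
  -- The product rule needs a globally Lipschitz factor, while χ is prescribed on Ω only; hence a
  -- Lipschitz extension, cut off far away.
  obtain ⟨g, hg, hgχ⟩ := hK.extend_real
  obtain ⟨θ, K', hθ, hθc, -, hθ1⟩ := exists_lipschitz_eq_one h.domain.isBounded
  obtain ⟨L, hL⟩ := exists_lipschitzWith_mul hg hθ hθc
  refine ⟨g * θ, L, hL, hθc.mul_left, fun x hx => ?_⟩
  rw [Pi.mul_apply, hθ1 x (subset_closure hx), mul_one, hgχ hx]

theorem ae_eq_of_eqOn {ψ : Space (m + 1) → ℝ} (h : LocalSetting Ω D ω ω' A α β χ)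
    (hψ : ∀ x ∈ Ω, ψ x = χ x) (u : Space (m + 1) → ℝ) :
    ψ * u =ᵐ[volume.restrict ω] χ * u := by
  filter_upwards [ae_restrict_mem h.isOpen.measurableSet] with x hx
  rw [Pi.mul_apply, Pi.mul_apply, hψ x (h.subset_domain (h.subset hx))]

theorem memH1_mul (h : LocalSetting Ω D ω ω' A α β χ) (hu : MemH1 ω' u) : MemH1 ω (χ * u) := by
  obtain ⟨ψ, K, hψ, hc, hψχ⟩ := h.exists_extension
  obtain ⟨M, -, hM⟩ := exists_bound_of_hasCompactSupport hψ.continuous hc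
  exact ((hu.mul_lipschitz h.isOpen_oversampling h.isBounded hψ hM).mono h.subset).congr
    (h.ae_eq_of_eqOn hψχ u)

/-- Multiplication by the partition of unity function, from `H¹(ω')` to `H¹(ω)`. -/
def mulMap (h : LocalSetting Ω D ω ω' A α β χ) : H1 ω' →ₗ[ℝ] H1 ω where
  toFun u := ⟨χ * u.1, h.memH1_mul u.2⟩
  map_add' u v := Subtype.ext (mul_add χ u.1 v.1)
  map_smul' c u := Subtype.ext (mul_smul_comm c χ u.1)

/-- The space `H⁰_{A,D}(ω')`. -/
def harmonic (h : LocalSetting Ω D ω ω' A α β χ) : Submodule ℝ (Space (m + 1) → ℝ) where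
  carrier := HAD0 Ω D A ω'
  add_mem' {u v} hu hv := ⟨⟨hu.1.1.add hv.1.1, fun w hw => by
    rw [energy_add_left h.elliptic h.isOpen_oversampling hu.1.1 hv.1.1 hw.memH1, hu.1.2 w hw,
      hv.1.2 w hw, add_zero]⟩, by
    have := hu.2.add h.isOpen_oversampling h.isBounded hv.2
    rwa [add_zero] at this⟩
  zero_mem' := ⟨⟨SobolevPair.zero.memH1, fun w hw => by
    have h0 := energy_smul_left h.elliptic h.isOpen_oversampling 0
      (SobolevPair.zero (ω := ω')).memH1 hw.memH1
    rwa [zero_mul, zero_smul] at h0⟩, HasTrace.zero h.isOpen_oversampling⟩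
  smul_mem' c u hu := ⟨⟨hu.1.1.smul c, fun w hw => by
    rw [energy_smul_left h.elliptic h.isOpen_oversampling c hu.1.1 hw.memH1, hu.1.2 w hw,
      mul_zero]⟩, by
    have := hu.2.smul h.isOpen_oversampling h.isBounded c
    rwa [smul_zero] at this⟩

theorem memH1_coe (h : LocalSetting Ω D ω ω' A α β χ) (u : h.harmonic) : MemH1 ω' u.1 := u.2.1.1

theorem harmonic_le (h : LocalSetting Ω D ω ω' A α β χ) : h.harmonic ≤ H1 ω' :=
  fun _ hu => hu.1.1

/-- The energy form `a_{ω'}(u, v)` on `H⁰_{A,D}(ω')`. -/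
noncomputable def aForm (h : LocalSetting Ω D ω ω' A α β χ) : h.harmonic →ₗ[ℝ] h.harmonic →ₗ[ℝ] ℝ :=
  (energyForm h.elliptic h.isOpen_oversampling).compl₁₂ (Submodule.inclusion h.harmonic_le)
    (Submodule.inclusion h.harmonic_le)

/-- The form `a_ω(χ u, χ v)` on `H⁰_{A,D}(ω')`. -/
noncomputable def bForm (h : LocalSetting Ω D ω ω' A α β χ) : h.harmonic →ₗ[ℝ] h.harmonic →ₗ[ℝ] ℝ :=
  (energyForm h.elliptic_inner h.isOpen).compl₁₂
    (h.mulMap ∘ₗ Submodule.inclusion h.harmonic_le) (h.mulMap ∘ₗ Submodule.inclusion h.harmonic_le)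

theorem aForm_apply (h : LocalSetting Ω D ω ω' A α β χ) (u v : h.harmonic) :
    h.aForm u v = energy A ω' u.1 v.1 := rfl

theorem bForm_apply (h : LocalSetting Ω D ω ω' A α β χ) (u v : h.harmonic) :
    h.bForm u v = energy A ω (χ * u.1) (χ * v.1) := rfl

theorem isSemiInner_aForm (h : LocalSetting Ω D ω ω' A α β χ) : IsSemiInner h.aForm :=
  ⟨fun _ _ => energy_comm h.elliptic, fun u => energy_self_nonneg h.elliptic (h.memH1_coe u)⟩

theorem isSemiInner_bForm (h : LocalSetting Ω D ω ω' A α β χ) : IsSemiInner h.bForm :=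
  ⟨fun _ _ => energy_comm h.elliptic_inner,
    fun u => energy_self_nonneg h.elliptic_inner (h.memH1_mul (h.memH1_coe u))⟩

/-- Multiplication by the square of the partition of unity function yields a test function. -/
theorem mul_mul_mem_H10D (h : LocalSetting Ω D ω ω' A α β χ) {ψ : Space (m + 1) → ℝ} {K : ℝ≥0}
    (hψ : LipschitzWith K ψ) (hc : HasCompactSupport ψ) (hψχ : ∀ x ∈ Ω, ψ x = χ x)
    (hu : MemH1 ω' u) (htr : HasTrace ω' (frontier ω' ∩ D) u 0) :
    ψ * (ψ * u) ∈ H10D Ω D ω' := by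
  have ho := h.isOpen_oversampling
  refine (hasTrace_zero_union_iff h.oversampling Set.inter_subset_left
    Set.inter_subset_left).2 ⟨?_, ?_⟩
  -- On the boundary of ω' inside Ω the factor χ is zero, because such points are not in ω. On the
  -- Dirichlet part it is u that has zero trace.
  · refine (((hasTrace_trace h.oversampling hu Set.inter_subset_left).mul_lipschitz ho h.isBounded
      hψ hc).mul_lipschitz ho h.isBounded hψ hc).congr_right ?_
    filter_upwards [ae_restrict_mem (isClosed_frontier.measurableSet.inter
      h.domain.isOpen.measurableSet)] with x hx
    have hxω : x ∉ ω := fun hxω => Set.notMem_empty x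
      (frontier_inter_eq_of_isOpen ho ▸ ⟨hx.1, h.subset hxω⟩)
    rw [Pi.mul_apply, hψχ x hx.2, h.partition.eq_zero x ⟨hx.2, hxω⟩, zero_mul, Pi.zero_apply]
  · have := (htr.mul_lipschitz ho h.isBounded hψ hc).mul_lipschitz ho h.isBounded hψ hc
    rwa [mul_zero, mul_zero] at this

/-- The Caccioppoli inequality. -/
theorem caccioppoli (h : LocalSetting Ω D ω ω' A α β χ) :
    ∃ C : ℝ, 0 ≤ C ∧ ∀ u : h.harmonic, h.bForm u u ≤ C * ∫ x in ω', u.1 x ^ 2 := by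
  obtain ⟨ψ, K, hψ, hc, hψχ⟩ := h.exists_extension
  obtain ⟨M, -, hM⟩ := exists_bound_of_hasCompactSupport hψ.continuous hc
  have hβ := h.upper_nonneg
  have ho := h.isOpen_oversampling
  refine ⟨β * K ^ 2, by positivity, fun ⟨u, hu⟩ => ?_⟩
  have hp := hu.1.1.sobolevPair
  have hp1 := hp.mul_lipschitz ho h.isBounded hψ hM
  have hp2 := hp1.mul_lipschitz ho h.isBounded hψ hM
  have hpω := (hp1.mono h.subset).congr (h.ae_eq_of_eqOn hψχ u) .rfl
  -- A harmonic u is tested with ψ²u. Below, E is the gradient of ψu and R that of ψ²u.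
  have hzero := hu.1.2 _ (h.mul_mul_mem_H10D hψ hc hψχ hu.1.1 hu.2)
  set G := wgrad ω' u
  set E : Space (m + 1) → Space (m + 1) := fun x => ψ x • G x + u x • gradient ψ x
  set R : Space (m + 1) → Space (m + 1) := fun x => ψ x • E x + (ψ * u) x • gradient ψ x
  -- Every term of R carries a factor ψ, so the orthogonality relation on ω' is one on ω.
  have hR : ∀ x ∈ ω' \ ω, matForm (A x) (G x) (R x) = 0 := by
    intro x hx
    have hx0 : ψ x = 0 := by
      rw [hψχ x (h.subset_domain hx.1)]
      exact h.partition.eq_zero x ⟨h.subset_domain hx.1, hx.2⟩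
    have : R x = (0 : ℝ) • G x := by simp only [R, Pi.mul_apply, hx0, zero_mul, zero_smul, add_zero]
    rw [this, matForm_smul_right, zero_mul]
  rw [energy_eq ho hp hp2, setIntegral_eq_of_subset_of_forall_sdiff_eq_zero ho.measurableSet
    h.subset hR] at hzero
  have iE := h.elliptic_inner.integrable_matForm (hp1.mono h.subset).memLp_grad
    (hp1.mono h.subset).memLp_grad
  have iR := h.elliptic_inner.integrable_matForm (hp.mono h.subset).memLp_grad
    (hp2.mono h.subset).memLp_grad
  have iu := integrable_sq hp.memLp
  have iuω := integrable_sq (hp.mono h.subset).memLp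
  rw [bForm_apply, energy_eq h.isOpen hpω hpω]
  calc ∫ x in ω, matForm (A x) (E x) (E x)
      = ∫ x in ω, (matForm (A x) (E x) (E x) - matForm (A x) (G x) (R x)) := by
        rw [integral_sub iE iR, hzero, sub_zero]
    _ ≤ ∫ x in ω, β * K ^ 2 * u x ^ 2 := by
        refine integral_mono_ae (iE.sub iR) (iuω.const_mul _) ?_
        filter_upwards [h.elliptic_inner.ae_bounds] with x hx
        -- By symmetry of A all terms containing the gradient of u cancel, and what remains is
        -- bounded by βK²u².
        have e1 : matForm (A x) (E x) (E x) - matForm (A x) (G x) (R x) =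
            u x ^ 2 * matForm (A x) (gradient ψ x) (gradient ψ x) := by
          simp only [E, R, Pi.mul_apply, matForm_add_left, matForm_add_right, matForm_smul_left,
            matForm_smul_right, matForm_comm (ξ := gradient ψ x) (η := G x) hx.1]
          ring
        have e2 := (hx.2 (gradient ψ x)).2
        have e3 : β * ‖gradient ψ x‖ ^ 2 ≤ β * K ^ 2 := mul_le_mul_of_nonneg_left
          (pow_le_pow_left₀ (norm_nonneg _) (norm_gradient_le hψ x) 2) hβ
        rw [e1, mul_comm]
        exact mul_le_mul_of_nonneg_right (e2.trans e3) (sq_nonneg _)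
    _ = β * K ^ 2 * ∫ x in ω, u x ^ 2 := integral_const_mul _ _
    _ ≤ β * K ^ 2 * ∫ x in ω', u x ^ 2 := mul_le_mul_of_nonneg_left
        (setIntegral_mono_set iu (Eventually.of_forall fun x => sq_nonneg _)
          h.subset.eventuallyLE) (by positivity)

/-- `H⁰_{A,D}(ω')` is closed in `H¹(ω')`. -/
theorem mem_harmonic_of_tendsto (h : LocalSetting Ω D ω ω' A α β χ) {ι : Type*} {l : Filter ι}
    [l.NeBot] {w : ι → Space (m + 1) → ℝ} (hw : ∀ j, w j ∈ h.harmonic) (hu : MemH1 ω' u)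
    (hlim : Tendsto (fun j => normH1 ω' (w j - u)) l (𝓝 0)) : u ∈ h.harmonic :=
  ⟨⟨hu, fun v hv => energy_eq_zero_of_tendsto h.elliptic h.upper_nonneg h.isOpen_oversampling
    (fun j => (hw j).1.1) hu hlim hv.memH1 fun j => (hw j).1.2 v hv⟩,
    HasTrace.of_tendsto h.oversampling Set.inter_subset_left (fun j => (hw j).2) hu hlim⟩

/-- Elements of `harmonic` are functions, not classes; equalities almost everywhere enter the
algebra through this lemma. -/
theorem bForm_eq_zero_of_ae (h : LocalSetting Ω D ω ω' A α β χ) {u : h.harmonic}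
    (hu : u.1 =ᵐ[volume.restrict ω'] 0) (v : h.harmonic) : h.bForm u v = 0 := by
  have h1 : (0 : Space (m + 1) → ℝ) =ᵐ[volume.restrict ω] χ * u.1 := by
    filter_upwards [ae_restrict_of_ae_restrict_of_subset h.subset hu] with x hx
    rw [Pi.mul_apply, hx, Pi.zero_apply, mul_zero]
  have hv := h.memH1_mul (h.memH1_coe v)
  have h2 := energy_smul_left h.elliptic_inner h.isOpen 0 (SobolevPair.zero (ω := ω)).memH1 hv
  rw [zero_smul, zero_mul] at h2
  rw [bForm_apply, energy_congr h.isOpen (SobolevPair.zero (ω := ω)).memH1 hv h1 .rfl, h2]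

/-- A reduction of a subspace `W` of `H⁰_{A,D}(ω')` to functions whose norm in `L²(ω')` is
controlled by the energy. -/
structure Reduction (h : LocalSetting Ω D ω ω' A α β χ) (W : Submodule ℝ h.harmonic)
    (T : h.harmonic →ₗ[ℝ] h.harmonic) (C : ℝ) : Prop where
  energy_eq : ∀ u, h.aForm (T u) (T u) = h.aForm u u
  integral_le : ∀ u, ∫ x in ω', (T u).1 x ^ 2 ≤ C * h.aForm u u
  bForm_le : ∀ u ∈ W, h.bForm u u ≤ h.bForm (T u) (T u)
  exists_limit : ∀ z, ∃ w ∈ W, ∀ u ∈ W, h.aForm (u - w) (u - w) = h.aForm (T u - z) (T u - z)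

namespace Reduction

variable {h : LocalSetting Ω D ω ω' A α β χ} {W : Submodule ℝ h.harmonic}
  {T : h.harmonic →ₗ[ℝ] h.harmonic} {C : ℝ}

theorem normH1_sq_le (hT : Reduction h W T C) (u : h.harmonic) :
    normH1 ω' (T u).1 ^ 2 ≤ (C + α⁻¹) * h.aForm u u := by
  have h1 := MSGFEM.normH1_sq_le h.elliptic (h.memH1_coe (T u))
  have h2 := hT.energy_eq u
  rw [aForm_apply] at h2
  rw [h2] at h1
  have h3 := hT.integral_le u
  linarith

/-- Caccioppoli's inequality is applied to T u, whose L² norm the energy of u controls; on W passing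
to T u does not decrease b. -/
theorem exists_coercive (hT : Reduction h W T C) :
    ∃ C' : ℝ, 0 ≤ C' ∧ ∀ u ∈ W, h.bForm u u ≤ C' * h.aForm u u := by
  obtain ⟨C₀, hC₀, hcac⟩ := h.caccioppoli
  refine ⟨C₀ * |C|, by positivity, fun u hu => (hT.bForm_le u hu).trans ((hcac _).trans ?_)⟩
  rw [mul_assoc]
  refine mul_le_mul_of_nonneg_left ((hT.integral_le u).trans ?_) hC₀
  exact mul_le_mul_of_nonneg_right (le_abs_self C) (h.isSemiInner_aForm.nonneg u)

/-- The T (u j) are bounded in H¹(ω'), so Rellich makes them Cauchy in L²(ω'), and Caccioppoli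
passes this on to b. -/
theorem compact (hT : Reduction h W T C) (u : ℕ → h.harmonic) (hu : ∀ j, u j ∈ W)
    (hu1 : ∀ j, h.aForm (u j) (u j) ≤ 1) :
    Tendsto (fun p : ℕ × ℕ => h.bForm (u p.1 - u p.2) (u p.1 - u p.2))
      ((hyperfilter ℕ : Filter ℕ) ×ˢ hyperfilter ℕ) (𝓝 0) := by
  obtain ⟨C₀, hC₀, hcac⟩ := h.caccioppoli
  have hM : ∀ j, normH1 ω' (T (u j)).1 ≤ √|C + α⁻¹| := fun j => by
    refine Real.le_sqrt_of_sq_le ((hT.normH1_sq_le (u j)).trans ?_)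
    exact (mul_le_mul_of_nonneg_right (le_abs_self _) (h.isSemiInner_aForm.nonneg _)).trans
      (mul_le_of_le_one_right (abs_nonneg _) (hu1 j))
  have hrel := (h.oversampling.rellich (fun j => h.memH1_coe (T (u j))) hM).const_mul C₀
  rw [mul_zero] at hrel
  refine squeeze_zero (fun p => h.isSemiInner_bForm.nonneg _) (fun p => ?_) hrel
  refine (hT.bForm_le _ (W.sub_mem (hu _) (hu _))).trans ((hcac _).trans (le_of_eq ?_))
  rw [map_sub]
  rfl

/-- The energy dominates the H¹(ω') norm only after applying T. The T (u j) converge to some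
harmonic z, and `exists_limit` brings z back to W without changing energy distances. -/
theorem complete (hT : Reduction h W T C) (u : ℕ → h.harmonic) (hu : ∀ j, u j ∈ W)
    (hc : Tendsto (fun p : ℕ × ℕ => h.aForm (u p.1 - u p.2) (u p.1 - u p.2))
      ((hyperfilter ℕ : Filter ℕ) ×ˢ hyperfilter ℕ) (𝓝 0)) :
    ∃ w ∈ W, Tendsto (fun j => h.aForm (u j - w) (u j - w)) (hyperfilter ℕ) (𝓝 0) := by
  have h1 := (hc.const_mul (C + α⁻¹)).sqrt
  rw [mul_zero, Real.sqrt_zero] at h1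
  have h2 : Tendsto (fun p : ℕ × ℕ => normH1 ω' ((T (u p.1)).1 - (T (u p.2)).1))
      ((hyperfilter ℕ : Filter ℕ) ×ˢ hyperfilter ℕ) (𝓝 0) := by
    refine squeeze_zero (fun p => normH1_nonneg) (fun p => ?_) h1
    refine Real.le_sqrt_of_sq_le ?_
    have := hT.normH1_sq_le (u p.1 - u p.2)
    rw [map_sub] at this
    exact this
  obtain ⟨z, hz, hlim⟩ := exists_tendsto_of_cauchy h.isOpen_oversampling
    (fun j => h.memH1_coe (T (u j))) h2
  have hzV := h.mem_harmonic_of_tendsto (fun j => (T (u j)).2) hz hlim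
  obtain ⟨w, hw, hwz⟩ := hT.exists_limit ⟨z, hzV⟩
  refine ⟨w, hw, ?_⟩
  have h3 := (hlim.pow 2).const_mul β
  rw [zero_pow two_ne_zero, mul_zero] at h3
  refine squeeze_zero (fun j => h.isSemiInner_aForm.nonneg _) (fun j => ?_) h3
  rw [hwz _ (hu j)]
  exact energy_self_le_normH1_sq h.elliptic h.upper_nonneg ((h.memH1_coe (T (u j))).sub hz)

end Reduction

end LocalSetting

end MSGFEM

/-! ### The width and the eigenvalues -/

namespace MSGFEM

section Width

variable {d : ℕ} {ω ω' : Set (Space d)} {A : Space d → Matrix (Fin d) (Fin d) ℝ} {α β : ℝ}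
  {χ : Space d → ℝ} {V S : Set (Space d → ℝ)} {n : ℕ}

/-- The `n`-width is at least `√κ` if `V` contains an `n + 1`-dimensional space on which the
quotient of the energies of `χ u` and `u` is at least `κ`. -/
theorem sqrt_le_nWidth (hA : IsElliptic ω A α β) (hω : IsOpen ω) (hS : ∀ v ∈ S, MemH1 ω v)
    {e : Fin (n + 1) → Space d → ℝ} (he : ∀ i, MemH1 ω (χ * e i)) {κ : ℝ} (hκ : 0 ≤ κ)
    (h : ∀ c : Fin (n + 1) → ℝ, c ≠ 0 → ∑ i, c i • e i ∈ V ∧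
      0 < energy A ω' (∑ i, c i • e i) (∑ i, c i • e i) ∧
      κ * energy A ω' (∑ i, c i • e i) (∑ i, c i • e i) ≤
        energy A ω (χ * ∑ i, c i • e i) (χ * ∑ i, c i • e i)) :
    ENNReal.ofReal √κ ≤ nWidth A ω ω' χ V S n := by
  refine le_iInf₂ fun Q hQ => ?_
  have hQ1 : Q ≤ H1 ω := fun v hv => hS v (hQ.1 hv)
  have : Module.Finite ℝ Q := Module.rank_lt_aleph0_iff.1
    (hQ.2.trans_lt (Cardinal.natCast_lt_aleph0))
  have hfin : Module.finrank ℝ Q ≤ n := Module.finrank_le_of_rank_le hQ.2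
  set B := energyForm hA hω
  set E : Fin (n + 1) → H1 ω := fun i => ⟨χ * e i, he i⟩
  -- F sends c to the functional v ↦ energy of χu against v, where u has coefficients c. Its source
  -- has larger dimension than its target, so some nonzero c gives χu orthogonal to Q; subtracting
  -- elements of Q then never lowers the energy.
  let F : (Fin (n + 1) → ℝ) →ₗ[ℝ] Module.Dual ℝ Q :=
    B.compl₁₂ (Fintype.linearCombination ℝ E) (Submodule.inclusion hQ1)
  have hker : LinearMap.ker F ≠ ⊥ := LinearMap.ker_ne_bot_of_finrank_lt (by
    rw [Subspace.dual_finrank_eq, Module.finrank_fin_fun]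
    omega)
  obtain ⟨c, hc, hc0⟩ := Submodule.exists_mem_ne_zero_of_ne_bot hker
  obtain ⟨hu, hpos, hle⟩ := h c hc0
  set u := ∑ i, c i • e i
  set x : H1 ω := Fintype.linearCombination ℝ E c
  have hx : x.1 = χ * u := by
    simp only [x, u, Fintype.linearCombination_apply, Submodule.coe_sum, Submodule.coe_smul, E,
      Finset.mul_sum, mul_smul_comm]
  refine le_iSup₂_of_le u hu (le_iInf₂ fun v hv => ?_)
  have horth : B x ⟨v, hQ1 hv⟩ = 0 := LinearMap.congr_fun (LinearMap.mem_ker.1 hc) ⟨v, hv⟩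
  have hsymm : ∀ y z : H1 ω, B y z = B z y := fun y z => energy_comm hA
  have hexp : B (x - ⟨v, hQ1 hv⟩) (x - ⟨v, hQ1 hv⟩) = B x x + B ⟨v, hQ1 hv⟩ ⟨v, hQ1 hv⟩ := by
    simp only [map_sub, LinearMap.sub_apply]
    rw [hsymm ⟨v, hQ1 hv⟩ x, horth]
    ring
  have hge : energy A ω (χ * u) (χ * u) ≤ energy A ω (χ * u - v) (χ * u - v) := by
    have h1 : energy A ω (x.1 - v) (x.1 - v) = energy A ω x.1 x.1 + energy A ω v v := hexp
    rw [hx] at h1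
    have := energy_self_nonneg hA (hQ1 hv)
    linarith
  have hpos' : 0 < energyNorm A ω' u := Real.sqrt_pos.2 hpos
  rw [ENNReal.le_div_iff_mul_le (Or.inl (ENNReal.ofReal_pos.2 hpos').ne')
    (Or.inl ENNReal.ofReal_ne_top), ← ENNReal.ofReal_mul (Real.sqrt_nonneg _)]
  refine ENNReal.ofReal_le_ofReal ?_
  rw [energyNorm, energyNorm, ← Real.sqrt_mul hκ]
  exact Real.sqrt_le_sqrt (hle.trans hge)

/-- Already the zero subspace gives the bound √C, whatever n is. -/
theorem nWidth_ne_top (h0 : (0 : Space d → ℝ) ∈ S) {C : ℝ} (hC : 0 ≤ C)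
    (hV : ∀ u ∈ V, energy A ω (χ * u) (χ * u) ≤ C * energy A ω' u u) :
    nWidth A ω ω' χ V S n ≠ ∞ := by
  refine ne_top_of_le_ne_top (ENNReal.ofReal_ne_top (r := √C)) ?_
  refine iInf₂_le_of_le ⊥ ⟨?_, by simp⟩ (iSup₂_le fun u hu => ?_)
  · rintro x hx
    rw [SetLike.mem_coe, Submodule.mem_bot] at hx
    rwa [hx]
  refine iInf₂_le_of_le 0 (Submodule.zero_mem _) (ENNReal.div_le_of_le_mul ?_)
  rw [sub_zero, ← ENNReal.ofReal_mul (Real.sqrt_nonneg _)]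
  refine ENNReal.ofReal_le_ofReal ?_
  rw [energyNorm, energyNorm, ← Real.sqrt_mul hC]
  exact Real.sqrt_le_sqrt (hV u hu)

end Width

variable {m : ℕ} {Ω D N ω ω' : Set (Space (m + 1))} {u v w : Space (m + 1) → ℝ}
  {A : Space (m + 1) → Matrix (Fin (m + 1)) (Fin (m + 1)) ℝ} {α β : ℝ} {χ : Space (m + 1) → ℝ}
  {L : ℕ∞} {lam : ℕ → ℝ} {e : ℕ → Space (m + 1) → ℝ} {n : ℕ}

namespace LocalSetting

open Classical in
/-- The eigenfunctions as elements of `H⁰_{A,D}(ω')`. -/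
noncomputable def eigenvector (h : LocalSetting Ω D ω ω' A α β χ)
    (he : IsEigensystem A ω ω' χ (HAD0 Ω D A ω') L lam e) (k : ℕ) : h.harmonic :=
  if hk : (k : ℕ∞) < L then ⟨e k, (he.eigenpair k hk).1⟩ else 0

variable (h : LocalSetting Ω D ω ω' A α β χ)
  (he : IsEigensystem A ω ω' χ (HAD0 Ω D A ω') L lam e)

theorem eigenvector_eq {k : ℕ} (hk : (k : ℕ∞) < L) :
    h.eigenvector he k = ⟨e k, (he.eigenpair k hk).1⟩ := dif_pos hk

theorem aForm_eigenvector (k : ℕ) (hk : (k : ℕ∞) < L) (x : h.harmonic) :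
    h.aForm (h.eigenvector he k) x = lam k * h.bForm (h.eigenvector he k) x := by
  rw [h.eigenvector_eq he hk]
  exact (he.eigenpair k hk).2.2 x.1 x.2

theorem exists_mem_span_ae_eq {μ : ℝ} {w : h.harmonic} (hw : ∀ x, h.aForm w x = μ * h.bForm w x)
    (h0 : ¬ w.1 =ᵐ[volume.restrict ω'] 0) :
    ∃ u ∈ Submodule.span ℝ {s | ∃ k : ℕ, (k : ℕ∞) < L ∧ lam k = μ ∧ h.eigenvector he k = s},
      w.1 =ᵐ[volume.restrict ω'] u.1 := by
  obtain ⟨u, hu, hwu⟩ := he.exhaustive μ w.1 ⟨w.2, h0, fun φ hφ => hw ⟨φ, hφ⟩⟩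
  have hle : Submodule.span ℝ {s | ∃ k : ℕ, (k : ℕ∞) < L ∧ lam k = μ ∧ e k = s} ≤
      (Submodule.span ℝ {s | ∃ k : ℕ, (k : ℕ∞) < L ∧ lam k = μ ∧ h.eigenvector he k = s}).map
        h.harmonic.subtype := by
    rw [Submodule.span_le]
    rintro s ⟨k, hk, hlam, rfl⟩
    exact ⟨h.eigenvector he k, Submodule.subset_span ⟨k, hk, hlam, rfl⟩,
      congrArg Subtype.val (h.eigenvector_eq he hk)⟩
  obtain ⟨u', hu', rfl⟩ := hle hu
  exact ⟨u', hu', hwu⟩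

/-- Positivity of b at w excludes the null function, and a null difference is b-orthogonal to
everything. This is exhaustiveness in the form that the abstract `rayleigh_le` takes as hypothesis.
-/
theorem exists_mem_span_bForm_eq {μ : ℝ} {w : h.harmonic}
    (hw : ∀ x, h.aForm w x = μ * h.bForm w x) (h0 : 0 < h.bForm w w) :
    ∃ u ∈ Submodule.span ℝ {s | ∃ k : ℕ, (k : ℕ∞) < L ∧ lam k = μ ∧ h.eigenvector he k = s},
      ∀ x, h.bForm (w - u) x = 0 := by
  obtain ⟨u, hu, hwu⟩ := h.exists_mem_span_ae_eq he hw
    fun hae => h0.ne' (h.bForm_eq_zero_of_ae hae w)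
  refine ⟨u, hu, h.bForm_eq_zero_of_ae ?_⟩
  filter_upwards [hwu] with x hx
  exact sub_eq_zero.2 hx

theorem coe_mem_localSpace {y : h.harmonic}
    (hy : y ∈ Submodule.span ℝ {s | ∃ k < n, (k : ℕ∞) < L ∧ h.eigenvector he k = s}) :
    y.1 ∈ localSpace L e n := by
  have hle : Submodule.span ℝ {s | ∃ k < n, (k : ℕ∞) < L ∧ h.eigenvector he k = s} ≤
      (localSpace L e n).comap h.harmonic.subtype := by
    rw [Submodule.span_le]
    rintro s ⟨k, hk, hkL, rfl⟩
    exact Submodule.subset_span ⟨k, hk, hkL, (congrArg Subtype.val (h.eigenvector_eq he hkL)).symm⟩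
  exact hle hy

/-- A lower bound of the `n`-width by means of the eigenvalues. -/
theorem sqrt_inv_le_nWidth {W : Submodule ℝ h.harmonic} {k₀ : ℕ} (hk₀ : k₀ ≤ n)
    (hWe : ∀ k : ℕ, k₀ ≤ k → (k : ℕ∞) < L → h.eigenvector he k ∈ W)
    (hpos : ∀ u ∈ W, h.aForm u u = 0 → u.1 =ᵐ[volume.restrict ω'] 0)
    {V : Set (Space (m + 1) → ℝ)}
    (hV : ∀ u, u ∈ V ↔ ∃ hu : u ∈ h.harmonic, (⟨u, hu⟩ : h.harmonic) ∈ W)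
    (hn : (n : ℕ∞) < L) (hlam : 0 < lam n) :
    ENNReal.ofReal √(lam n)⁻¹ ≤ nWidth A ω ω' χ V (H10D Ω D ω) (n - k₀) := by
  have ha := h.isSemiInner_aForm
  have hb := h.isSemiInner_bForm
  have hev := h.aForm_eigenvector he
  have hlt : ∀ i : Fin (n - k₀ + 1), k₀ + i.1 ≤ n := fun i => by omega
  have hltL : ∀ i : Fin (n - k₀ + 1), ((k₀ + i.1 : ℕ) : ℕ∞) < L := fun i =>
    lt_of_le_of_lt (by exact_mod_cast hlt i) hn
  -- The eigenfunctions with indices k₀, ..., n are n - k₀ + 1 in number, one more than the index of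
  -- the width.
  let ι : Fin (n - k₀ + 1) ↪ ℕ := ⟨fun i => k₀ + i.1, fun i j hij => Fin.ext (by simpa using hij)⟩
  refine sqrt_le_nWidth (e := fun i => (h.eigenvector he (ι i)).1) h.elliptic_inner h.isOpen
    (fun v hv => hv.memH1) (fun i => h.memH1_mul (h.memH1_coe _)) (inv_nonneg.2 hlam.le)
    fun c hc => ?_
  -- Independence and `rayleigh_ge` are stated for coefficients indexed by ℕ, so c is extended by
  -- zero.
  let c' : ℕ → ℝ := Function.extend ι c 0
  have hc' : ∀ i, c' (ι i) = c i := fun i => ι.injective.extend_apply c 0 i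
  set U : h.harmonic := ∑ i, c i • h.eigenvector he (ι i) with hU
  have hUcoe : (∑ i, c i • (h.eigenvector he (ι i)).1) = U.1 := by
    rw [hU]
    simp only [Submodule.coe_sum, Submodule.coe_smul]
  have hUmap : U = ∑ k ∈ Finset.univ.map ι, c' k • h.eigenvector he k := by
    rw [Finset.sum_map]
    simp only [hc']
    exact hU
  have hUW : U ∈ W := W.sum_mem fun i _ => W.smul_mem _ (hWe _ (Nat.le_add_right _ _) (hltL i))
  have hUrange : U.1 = ∑ k ∈ Finset.range (n + 1), c' k • e k := by
    have hsub : Finset.univ.map ι ⊆ Finset.range (n + 1) := fun k hk => by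
      obtain ⟨i, -, rfl⟩ := Finset.mem_map.1 hk
      exact Finset.mem_range.2 (Nat.lt_succ_of_le (hlt i))
    rw [← Finset.sum_subset hsub, Finset.sum_map, hU]
    · simp only [Submodule.coe_sum, Submodule.coe_smul, hc']
      refine Finset.sum_congr rfl fun i _ => ?_
      rw [show h.eigenvector he (ι i) = _ from h.eigenvector_eq he (hltL i)]
      rfl
    · intro k _ hk
      have : c' k = 0 := Function.extend_apply' c (0 : ℕ → ℝ) k fun ⟨i, hi⟩ =>
        hk (Finset.mem_map.2 ⟨i, Finset.mem_univ i, hi⟩)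
      rw [this, zero_smul]
  have hUpos : 0 < h.aForm U U := by
    refine lt_of_le_of_ne (ha.nonneg _) fun h0 => hc ?_
    have hae := hpos U hUW h0.symm
    rw [hUrange] at hae
    have hz := he.independent (n + 1) (by exact_mod_cast Order.add_one_le_of_lt hn) c' hae
    ext i
    rw [← hc' i]
    exact hz _ (Nat.lt_succ_of_le (hlt i))
  rw [hUcoe]
  refine ⟨(hV _).2 ⟨U.2, hUW⟩, hUpos, ?_⟩
  have hray := rayleigh_ge ha hb hev he.mono hn (Finset.univ.map ι) (fun k hk => by
    obtain ⟨i, -, rfl⟩ := Finset.mem_map.1 hk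
    exact hlt i) c'
  rw [← hUmap] at hray
  exact (inv_mul_le_iff₀ hlam).2 hray

/-- The variational characterization of the eigenvalues of the local problem. -/
theorem rayleigh_le {W : Submodule ℝ h.harmonic} {T : h.harmonic →ₗ[ℝ] h.harmonic}
    {C : ℝ} (hT : Reduction h W T C) (hW : orthoCompl h.bForm L (h.eigenvector he) n ⊆ W)
    {u : h.harmonic} (hu : u ∈ orthoCompl h.bForm L (h.eigenvector he) n) :
    h.bForm u u = 0 ∨ ((n : ℕ∞) < L ∧ lam n * h.bForm u u ≤ h.aForm u u) := by
  obtain ⟨C', -, hcoer⟩ := hT.exists_coercive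
  exact MSGFEM.rayleigh_le h.isSemiInner_aForm h.isSemiInner_bForm (h.aForm_eigenvector he) he.mono
    (fun _ _ hw h0 => h.exists_mem_span_bForm_eq he hw h0) hW hcoer hyperfilter_nat_le_atTop
    hT.compact hT.complete hu

/-- The approximation estimate, for a reduction with the following properties: `W` contains the
orthogonal complement of the first `n` eigenfunctions and all but the first `k₀` eigenfunctions,
and the energy is definite on `W`. -/
theorem exists_approximation {W : Submodule ℝ h.harmonic} {T : h.harmonic →ₗ[ℝ] h.harmonic}
    {C : ℝ} (hT : Reduction h W T C) {k₀ : ℕ} (hk₀ : k₀ ≤ n)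
    (hW : orthoCompl h.bForm L (h.eigenvector he) n ⊆ W)
    (hWe : ∀ k : ℕ, k₀ ≤ k → (k : ℕ∞) < L → h.eigenvector he k ∈ W)
    (hpos : ∀ u ∈ W, h.aForm u u = 0 → u.1 =ᵐ[volume.restrict ω'] 0)
    {V : Set (Space (m + 1) → ℝ)}
    (hV : ∀ u, u ∈ V ↔ ∃ hu : u ∈ h.harmonic, (⟨u, hu⟩ : h.harmonic) ∈ W)
    (w : h.harmonic) :
    nWidth A ω ω' χ V (H10D Ω D ω) (n - k₀) ≠ ∞ ∧
      ∃ φ ∈ localSpace L e n, energyNorm A ω (χ * (w.1 - φ)) ≤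
        (nWidth A ω ω' χ V (H10D Ω D ω) (n - k₀)).toReal * energyNorm A ω' w.1 := by
  obtain ⟨C', hC', hcoer⟩ := hT.exists_coercive
  have hne : nWidth A ω ω' χ V (H10D Ω D ω) (n - k₀) ≠ ∞ :=
    nWidth_ne_top (HasTrace.zero h.isOpen) hC' fun u hu => by
      obtain ⟨hu', huW⟩ := (hV u).1 hu
      have := hcoer ⟨u, hu'⟩ huW
      rwa [bForm_apply, aForm_apply] at this
  refine ⟨hne, ?_⟩
  have ha := h.isSemiInner_aForm
  have hb := h.isSemiInner_bForm
  have hev := h.aForm_eigenvector he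
  obtain ⟨y, hy, hwy⟩ := hb.exists_sub_mem_orthoCompl L (h.eigenvector he) n w
  refine ⟨y.1, h.coe_mem_localSpace he hy, ?_⟩
  have ha_le := energy_sub_projection_le ha hb hev hy hwy
  have hE : energyNorm A ω (χ * (w.1 - y.1)) = √(h.bForm (w - y) (w - y)) := by
    rw [energyNorm, bForm_apply, Submodule.coe_sub]
  have hE' : energyNorm A ω' w.1 = √(h.aForm w w) := by
    rw [energyNorm, aForm_apply]
  rw [hE, hE']
  -- If b vanishes on w - y, the error is zero and the estimate is trivial. This includes the case
  -- of at most n eigenfunctions.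
  rcases h.rayleigh_le he hT hW hwy with h0 | ⟨hn, hle⟩
  · rw [h0, Real.sqrt_zero]
    exact mul_nonneg ENNReal.toReal_nonneg (Real.sqrt_nonneg _)
  -- The eigenfunction of index n lies in W since n ≥ k₀, and the energy is definite there; hence
  -- lam n > 0 and division by it is legitimate.
  have hanz : 0 < h.aForm (h.eigenvector he n) (h.eigenvector he n) := by
    refine lt_of_le_of_ne (ha.nonneg _) fun h0 => (he.eigenpair n hn).2.1 ?_
    have := hpos _ (hWe n hk₀ hn) h0.symm
    rwa [h.eigenvector_eq he hn] at this
  have hlam : 0 < lam n := by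
    rw [hev n hn] at hanz
    exact pos_of_mul_pos_left hanz (hb.nonneg _)
  have hlow := h.sqrt_inv_le_nWidth he hk₀ hWe hpos hV hn hlam
  have hd := (ENNReal.ofReal_le_iff_le_toReal hne).1 hlow
  refine le_trans ?_ (mul_le_mul_of_nonneg_right hd (Real.sqrt_nonneg _))
  rw [← Real.sqrt_mul (inv_nonneg.2 hlam.le)]
  refine Real.sqrt_le_sqrt ?_
  rw [le_inv_mul_iff₀ hlam]
  exact hle.trans ha_le

end LocalSetting

end MSGFEM

/-! ### The particular function, and the case of a null Dirichlet part -/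

namespace MSGFEM

variable {m : ℕ} {Ω D N ω ω' : Set (Space (m + 1))} {u v w : Space (m + 1) → ℝ}
  {A : Space (m + 1) → Matrix (Fin (m + 1)) (Fin (m + 1)) ℝ} {α β : ℝ} {χ : Space (m + 1) → ℝ}

namespace LocalSetting

/-- The error of the local particular function is harmonic, and its energy is bounded by that of the
exact solution. -/
theorem sub_particular_mem (h : LocalSetting Ω D ω ω' A α β χ) (hDN : IsBoundaryDecomposition Ω D N)
    {f : Space (m + 1) → ℝ} {g : (Space (m + 1) → ℝ) →ₗ[ℝ] ℝ} (hg : MemHNegHalf Ω D N g)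
    {q u₀ ψr ψd : Space (m + 1) → ℝ} (hu₀ : IsWeakSolution Ω D N A f g q u₀)
    (hψr : IsLocalLoadSolution Ω D N A f g ω' ψr) (hψd : IsLocalDirichletSolution D A q ω' ψd) :
    u₀ - (ψr + ψd) ∈ h.harmonic ∧
      energy A ω' (u₀ - (ψr + ψd)) (u₀ - (ψr + ψd)) ≤ energy A ω' u₀ u₀ := by
  have ho := h.isOpen_oversampling
  have hA := h.elliptic
  have hu := hu₀.1.memH1.mono h.subset_domain
  have hr := hψr.1.memH1
  have hd := hψd.1.memH1
  have htr : ∀ v ∈ H10D Ω D ω', HasTrace ω' (frontier ω' ∩ D) v 0 := fun v hv =>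
    ((hasTrace_zero_union_iff h.oversampling Set.inter_subset_left Set.inter_subset_left).1 hv).2
  -- The global equation is tested with the extension of v by zero, under which energy and load keep
  -- their values.
  have hload : ∀ v ∈ H10D Ω D ω', energy A ω' u₀ v = load N f g ω' v := fun v hv => by
    rw [← energy_indicator h.oversampling h.domain h.subset_domain hu₀.1.memH1 hv,
      ← load_indicator h.oversampling h.domain h.subset_domain hDN hg hv]
    exact hu₀.2 _ (H10D.indicator h.oversampling h.domain h.subset_domain
      hDN.measurableSet_dirichlet hDN.subset_dirichlet hv)
  have horth : ∀ v ∈ H10D Ω D ω', energy A ω' (u₀ - (ψr + ψd)) v = 0 := fun v hv => by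
    rw [energy_sub_left hA ho hu (hr.add hd) hv.memH1, energy_add_left hA ho hr hd hv.memH1,
      hload v hv, hψr.2 v hv, hψd.2 v (htr v hv)]
    ring
  have htw : HasTrace ω' (frontier ω' ∩ D) (u₀ - (ψr + ψd)) 0 := by
    have := ((hu₀.1.mono Set.inter_subset_right).restrict h.domain.isOpen h.domain.isBounded ho
      h.subset_domain).sub ho h.isBounded ((htr _ hψr.1).add ho h.isBounded hψd.1)
    rwa [zero_add, sub_self] at this
  have hw := hu.sub (hr.add hd)
  refine ⟨⟨⟨hw, horth⟩, htw⟩, ?_⟩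
  -- Here ψr is a test function for the harmonic w, while w and ψr, both zero on the Dirichlet part,
  -- are test functions for ψd. So u₀ = w + ψr + ψd is an orthogonal decomposition.
  have e1 := horth ψr hψr.1
  have e2 := hψd.2 _ htw
  have e3 := hψd.2 _ (htr _ hψr.1)
  have e4 := energy_self_nonneg hA hr
  have e5 := energy_self_nonneg hA hd
  set w := u₀ - (ψr + ψd) with hwdef
  have hsum : u₀ = w + (ψr + ψd) := by rw [hwdef, sub_add_cancel]
  have key : energy A ω' u₀ u₀ = energy A ω' w w + energy A ω' ψr ψr + energy A ω' ψd ψd := by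
    have c1 : energy A ω' ψr w = 0 := (energy_comm hA).trans e1
    have c2 : energy A ω' w ψd = 0 := (energy_comm hA).trans e2
    have c3 : energy A ω' ψr ψd = 0 := (energy_comm hA).trans e3
    have f1 : ∀ v, MemH1 ω' v →
        energy A ω' u₀ v = energy A ω' w v + (energy A ω' ψr v + energy A ω' ψd v) := fun v hv => by
      rw [← energy_add_left hA ho hr hd hv, ← energy_add_left hA ho hw (hr.add hd) hv, ← hsum]
    rw [f1 _ hu, energy_comm hA (u := w), energy_comm hA (u := ψr), energy_comm hA (u := ψd),
      f1 _ hw, f1 _ hr, f1 _ hd, e1, e2, e3, c1, c2, c3]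
    ring
  linarith

theorem ae_eq_zero_of_integral_sq_le (h : LocalSetting Ω D ω ω' A α β χ) (u : h.harmonic)
    (hu : ∫ x in ω', u.1 x ^ 2 ≤ 0) : u.1 =ᵐ[volume.restrict ω'] 0 := by
  have h1 := (integral_eq_zero_iff_of_nonneg (fun x => sq_nonneg (u.1 x))
    (integrable_sq (h.memH1_coe u).1)).1 (le_antisymm hu (integral_nonneg fun x => sq_nonneg _))
  filter_upwards [h1] with x hx
  exact pow_eq_zero_iff two_ne_zero |>.1 hx

/-- A bound of the `L²` norm by the norm of the gradient bounds it by the energy. -/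
theorem integral_sq_le_aForm (h : LocalSetting Ω D ω ω' A α β χ) {C : ℝ} (u : h.harmonic)
    (hC : ∫ x in ω', u.1 x ^ 2 ≤ C * ∫ x in ω', ‖wgrad ω' u.1 x‖ ^ 2) :
    ∫ x in ω', u.1 x ^ 2 ≤ |C| * α⁻¹ * h.aForm u u := by
  have h1 := (energy_self_bounds h.elliptic (h.memH1_coe u)).1
  have h2 : 0 ≤ ∫ x in ω', ‖wgrad ω' u.1 x‖ ^ 2 := integral_nonneg fun x => sq_nonneg _
  have h3 := h.elliptic.pos
  rw [mul_assoc]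
  refine hC.trans ((mul_le_mul_of_nonneg_right (le_abs_self C) h2).trans
    (mul_le_mul_of_nonneg_left ?_ (abs_nonneg C)))
  rwa [le_inv_mul_iff₀ h3, aForm_apply]

/-- If the Dirichlet part of the boundary has positive measure, no reduction is needed. -/
theorem exists_reduction_id (h : LocalSetting Ω D ω ω' A α β χ)
    (h0 : surface (m + 1) (frontier ω' ∩ D) ≠ 0) :
    ∃ C, Reduction h ⊤ LinearMap.id C := by
  obtain ⟨C, hC⟩ := h.oversampling.friedrichs Set.inter_subset_left h0
  exact ⟨|C| * α⁻¹, fun _ => rfl, fun u => h.integral_sq_le_aForm u (hC _ u.2.2), fun _ _ => le_rfl,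
    fun z => ⟨z, trivial, fun _ _ => rfl⟩⟩

section Null

theorem hasTrace_of_null (h : LocalSetting Ω D ω ω' A α β χ) {Γ : Set (Space (m + 1))}
    (hΓ : Γ ⊆ frontier ω') (h0 : surface (m + 1) Γ = 0) (hu : MemH1 ω' u) :
    HasTrace ω' Γ u 0 :=
  (hasTrace_trace h.oversampling hu hΓ).congr_right (by
    rw [Measure.restrict_eq_zero.2 h0]
    exact ae_zero.le trivial)

theorem mem_H10D_iff_of_null (h : LocalSetting Ω D ω ω' A α β χ)
    (h0 : surface (m + 1) (frontier ω' ∩ D) = 0) :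
    v ∈ H10D Ω D ω' ↔ HasTrace ω' (frontier ω' ∩ Ω) v 0 :=
  (hasTrace_zero_union_iff h.oversampling Set.inter_subset_left Set.inter_subset_left).trans
    (and_iff_left_of_imp fun hv => h.hasTrace_of_null Set.inter_subset_left h0 hv.memH1)

/-- A trace condition on a null set is void. This links `harmonic`, which depends on D, with `HAN0`,
which is defined by the empty Dirichlet part. -/
theorem H10D_eq_of_null (h : LocalSetting Ω D ω ω' A α β χ)
    (h0 : surface (m + 1) (frontier ω' ∩ D) = 0) : H10D Ω D ω' = H10D Ω ∅ ω' := by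
  have h' : LocalSetting Ω ∅ ω ω' A α β χ :=
    ⟨h.domain, h.coeff, h.isOpen, h.oversampling, h.subset, h.subset_domain, h.partition⟩
  ext v
  rw [h.mem_H10D_iff_of_null h0, h'.mem_H10D_iff_of_null (by rw [Set.inter_empty, measure_empty])]

theorem mem_harmonic_iff_of_null (h : LocalSetting Ω D ω ω' A α β χ)
    (h0 : surface (m + 1) (frontier ω' ∩ D) = 0) : u ∈ h.harmonic ↔ u ∈ HAD Ω ∅ A ω' := by
  have hH : HAD Ω D A ω' = HAD Ω ∅ A ω' := by rw [HAD, HAD, h.H10D_eq_of_null h0]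
  rw [← hH]
  exact and_iff_left_of_imp fun hu => h.hasTrace_of_null Set.inter_subset_left h0 hu.1

theorem energy_one (h : LocalSetting Ω D ω ω' A α β χ) (hv : MemH1 ω' v) :
    energy A ω' (fun _ => 1) v = 0 := by
  have ho := h.isOpen_oversampling
  rw [energy_eq ho (sobolevPair_const ho h.isBounded 1) hv.sobolevPair]
  simp [matForm]

/-- The constant function one, if the Dirichlet part of the boundary is a null set. -/
def one (h : LocalSetting Ω D ω ω' A α β χ) (h0 : surface (m + 1) (frontier ω' ∩ D) = 0) :
    h.harmonic :=
  ⟨fun _ => 1, (h.mem_harmonic_iff_of_null h0).2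
    ⟨(sobolevPair_const h.isOpen_oversampling h.isBounded 1).memH1,
      fun _ hv => h.energy_one hv.memH1⟩⟩

/-- The mean of a function in `H⁰_{A,D}(ω')`. -/
noncomputable def mean (h : LocalSetting Ω D ω ω' A α β χ) : h.harmonic →ₗ[ℝ] ℝ where
  toFun u := (volume.real ω')⁻¹ * ∫ x in ω', u.1 x
  map_add' u v := by
    have : IsFiniteMeasure (volume.restrict ω') :=
      isFiniteMeasure_restrict.2 h.isBounded.measure_lt_top.ne
    rw [← mul_add, ← integral_add ((h.memH1_coe u).1.integrable one_le_two)
      ((h.memH1_coe v).1.integrable one_le_two)]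
    rfl
  map_smul' c u := by
    rw [RingHom.id_apply, smul_eq_mul, mul_left_comm, ← integral_const_mul c]
    rfl

variable (h : LocalSetting Ω D ω ω' A α β χ) (h0 : surface (m + 1) (frontier ω' ∩ D) = 0)

/-- Subtraction of the mean. -/
noncomputable def subMean : h.harmonic →ₗ[ℝ] h.harmonic :=
  LinearMap.id - h.mean.smulRight (h.one h0)

theorem subMean_apply (u : h.harmonic) : h.subMean h0 u = u - h.mean u • h.one h0 := rfl

theorem aForm_one (u : h.harmonic) : h.aForm (h.one h0) u = 0 := h.energy_one (h.memH1_coe u)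

theorem aForm_add_smul_one (u : h.harmonic) (s : ℝ) :
    h.aForm (u + s • h.one h0) (u + s • h.one h0) = h.aForm u u := by
  rw [map_add, map_add, LinearMap.add_apply, LinearMap.add_apply, map_smul, map_smul,
    LinearMap.smul_apply, LinearMap.smul_apply, h.aForm_one, h.aForm_one,
    h.isSemiInner_aForm.symm u (h.one h0), h.aForm_one]
  simp

theorem bForm_one_one : h.bForm (h.one h0) (h.one h0) = energy A ω χ χ := by
  have : χ * (h.one h0).1 = χ := funext fun x => mul_one _
  rw [bForm_apply, this]

theorem integral_subMean (u : h.harmonic) : ∫ x in ω', (h.subMean h0 u).1 x = 0 := by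
  have hfin : IsFiniteMeasure (volume.restrict ω') :=
    isFiniteMeasure_restrict.2 h.isBounded.measure_lt_top.ne
  have hV : 0 < volume.real ω' := ENNReal.toReal_pos
    (h.isOpen_oversampling.measure_pos _ h.oversampling.isConnected.nonempty).ne'
    h.isBounded.measure_lt_top.ne
  have hfun : (h.subMean h0 u).1 = fun x => u.1 x - h.mean u := by
    funext x
    change u.1 x - h.mean u * 1 = _
    rw [mul_one]
  have hmean : h.mean u = (volume.real ω')⁻¹ * ∫ x in ω', u.1 x := rfl
  rw [hfun, integral_sub ((h.memH1_coe u).1.integrable one_le_two) (integrable_const _),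
    integral_const, measureReal_restrict_apply_univ, hmean, smul_eq_mul, mul_inv_cancel_left₀ hV.ne',
    sub_self]

/-- The reduction by subtraction of the mean. -/
theorem exists_reduction_subMean (hb : h.bForm (h.one h0) (h.one h0) ≠ 0) :
    ∃ C, Reduction h (LinearMap.ker (h.bForm (h.one h0))) (h.subMean h0) C := by
  obtain ⟨C, hC⟩ := h.oversampling.poincare_mean_zero
  have hE : ∀ u, h.aForm (h.subMean h0 u) (h.subMean h0 u) = h.aForm u u := fun u => by
    rw [subMean_apply, show u - h.mean u • h.one h0 = u + (-h.mean u) • h.one h0 by module,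
      h.aForm_add_smul_one]
  refine ⟨|C| * α⁻¹, hE, fun u => ?_, fun u hu => ?_, fun z => ?_⟩
  · rw [← hE u]
    exact h.integral_sq_le_aForm _ (hC _ (h.memH1_coe _) (h.integral_subMean h0 u))
  -- For u that is b-orthogonal to 1, subtracting a constant m adds m² b(1, 1) to b(u, u).
  · have hu' : h.bForm (h.one h0) u = 0 := hu
    have hu2 : h.bForm u (h.one h0) = 0 := (h.isSemiInner_bForm.symm _ _).trans hu'
    have hnn := mul_nonneg (sq_nonneg (h.mean u)) (h.isSemiInner_bForm.nonneg (h.one h0))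
    rw [subMean_apply]
    simp only [map_sub, LinearMap.sub_apply, map_smul, LinearMap.smul_apply, smul_eq_mul, hu', hu2]
    linarith
  -- The limit z is corrected by the constant that makes it b-orthogonal to 1; constants are
  -- invisible to the energy.
  · refine ⟨z - (h.bForm (h.one h0) z / h.bForm (h.one h0) (h.one h0)) • h.one h0, ?_, fun u _ => ?_⟩
    · rw [LinearMap.mem_ker, map_sub, map_smul, smul_eq_mul, div_mul_cancel₀ _ hb, sub_self]
    · rw [← h.aForm_add_smul_one h0 (u - _)
        (-(h.mean u + h.bForm (h.one h0) z / h.bForm (h.one h0) (h.one h0))), subMean_apply]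
      congr 2 <;> module

/-- By ellipticity zero energy means zero gradient, and ω' is connected. -/
theorem exists_ae_eq_smul_one {u : h.harmonic} (hu : h.aForm u u = 0) :
    ∃ c : ℝ, (u - c • h.one h0).1 =ᵐ[volume.restrict ω'] 0 := by
  have h1 := (energy_self_bounds h.elliptic (h.memH1_coe u)).1
  have h2 : 0 ≤ ∫ x in ω', ‖wgrad ω' u.1 x‖ ^ 2 := integral_nonneg fun x => sq_nonneg _
  have h3 : ∫ x in ω', ‖wgrad ω' u.1 x‖ ^ 2 ≤ 0 :=
    le_of_mul_le_mul_left (by rwa [mul_zero, ← hu]) h.elliptic.pos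
  obtain ⟨c, hc⟩ := h.oversampling.ae_eq_const (h.memH1_coe u) (le_antisymm h3 h2)
  refine ⟨c, ?_⟩
  filter_upwards [hc] with x hx
  change u.1 x - c * 1 = 0
  rw [hx, mul_one, sub_self]

theorem one_not_ae_eq_zero : ¬ (h.one h0).1 =ᵐ[volume.restrict ω'] 0 := by
  intro hae
  have : volume.restrict ω' = 0 := by
    rw [← ae_eq_bot, ← eventually_false_iff_eq_bot]
    filter_upwards [hae] with x hx
    exact one_ne_zero hx
  exact (h.isOpen_oversampling.measure_pos volume h.oversampling.isConnected.nonempty).ne'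
    (Measure.restrict_eq_zero.1 this)

theorem ae_eq_zero_of_aForm_eq_zero (hb : h.bForm (h.one h0) (h.one h0) ≠ 0) {u : h.harmonic}
    (hu : h.bForm (h.one h0) u = 0) (ha : h.aForm u u = 0) : u.1 =ᵐ[volume.restrict ω'] 0 := by
  obtain ⟨c, hc⟩ := h.exists_ae_eq_smul_one h0 ha
  have h1 := h.bForm_eq_zero_of_ae hc (h.one h0)
  rw [map_sub, LinearMap.sub_apply, h.isSemiInner_bForm.symm, hu, zero_sub, neg_eq_zero, map_smul,
    LinearMap.smul_apply, smul_eq_mul] at h1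
  have hc0 := (mul_eq_zero.1 h1).resolve_right hb
  rwa [hc0, zero_smul, sub_zero] at hc

/-- The weighted mean is b(u, 1) / b(1, 1). The denominator must be nonzero, since otherwise the
default value of the quotient would make the mean zero for every u. -/
theorem mem_HAN0_iff (hb : h.bForm (h.one h0) (h.one h0) ≠ 0) :
    u ∈ HAN0 Ω A ω ω' χ ↔
      ∃ hu : u ∈ h.harmonic, (⟨u, hu⟩ : h.harmonic) ∈ LinearMap.ker (h.bForm (h.one h0)) := by
  have key : ∀ hu : u ∈ h.harmonic, (⟨u, hu⟩ : h.harmonic) ∈ LinearMap.ker (h.bForm (h.one h0)) ↔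
      weightedMean A ω χ u = 0 := fun hu => by
    have : χ * (h.one h0).1 = χ := funext fun x => mul_one _
    rw [LinearMap.mem_ker, h.isSemiInner_bForm.symm, bForm_apply, this, weightedMean,
      div_eq_zero_iff]
    rw [bForm_one_one] at hb
    exact (or_iff_left hb).symm
  constructor
  · rintro ⟨hu, hm⟩
    have hu' := (h.mem_harmonic_iff_of_null h0).2 hu
    exact ⟨hu', (key hu').2 hm⟩
  · rintro ⟨hu, hm⟩
    exact ⟨(h.mem_harmonic_iff_of_null h0).1 hu, (key hu).1 hm⟩

variable {L : ℕ∞} {lam : ℕ → ℝ} {e : ℕ → Space (m + 1) → ℝ} {n : ℕ}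

/-- The constant 1 is an eigenfunction for μ, so by exhaustiveness it is in the span of the listed
ones; if μ were not listed, the span would be trivial and 1 would be null. -/
theorem exists_eigenvalue_eq
    (he : IsEigensystem A ω ω' χ (HAD0 Ω D A ω') L lam e) {μ : ℝ}
    (hμ : ∀ x, h.aForm (h.one h0) x = μ * h.bForm (h.one h0) x) :
    ∃ k : ℕ, (k : ℕ∞) < L ∧ lam k = μ := by
  obtain ⟨u, hu, hou⟩ := h.exists_mem_span_ae_eq he hμ (h.one_not_ae_eq_zero h0)
  by_contra! hne
  have hempty : {s | ∃ k : ℕ, (k : ℕ∞) < L ∧ lam k = μ ∧ h.eigenvector he k = s} = ∅ :=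
    Set.eq_empty_of_forall_notMem fun s ⟨k, hk, hl, _⟩ => hne k hk hl
  rw [hempty, Submodule.span_empty, Submodule.mem_bot] at hu
  rw [hu] at hou
  exact h.one_not_ae_eq_zero h0 hou

/-- If b(1, 1) were 0, then 1 would lie in the kernels of both forms and be an eigenfunction for
every real number, which a sequence of eigenvalues cannot exhaust. So the existence of an
eigensystem already excludes a degenerate χ. -/
theorem bForm_one_one_ne_zero
    (he : IsEigensystem A ω ω' χ (HAD0 Ω D A ω') L lam e) : h.bForm (h.one h0) (h.one h0) ≠ 0 := by
  intro hb
  have hsurj : Function.Surjective lam := fun μ => by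
    obtain ⟨k, -, hk⟩ := h.exists_eigenvalue_eq h0 he (μ := μ) fun x => by
      rw [h.aForm_one, h.isSemiInner_bForm.eq_zero_of_self hb, mul_zero]
    exact ⟨k, hk⟩
  exact not_countable hsurj.countable

variable (he : IsEigensystem A ω ω' χ (HAD0 Ω D A ω') L lam e)

/-- An eigenfunction with energy zero is constant and nonzero. -/
theorem exists_smul_one_of_aForm_eq_zero {k : ℕ} (hk : (k : ℕ∞) < L)
    (ha : h.aForm (h.eigenvector he k) (h.eigenvector he k) = 0) :
    ∃ c : ℝ, c ≠ 0 ∧ (h.eigenvector he k - c • h.one h0).1 =ᵐ[volume.restrict ω'] 0 := by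
  obtain ⟨c, hc⟩ := h.exists_ae_eq_smul_one h0 ha
  refine ⟨c, fun hc0 => (he.eigenpair k hk).2.1 ?_, hc⟩
  rwa [hc0, zero_smul, sub_zero, h.eigenvector_eq he hk] at hc

/-- A negative eigenvalue forces a and b to vanish on its eigenfunction, which is then a nonzero
constant, in conflict with b(1, 1) ≠ 0. -/
theorem eigenvalue_nonneg (h : LocalSetting Ω D ω ω' A α β χ)
    (h0 : surface (m + 1) (frontier ω' ∩ D) = 0)
    (he : IsEigensystem A ω ω' χ (HAD0 Ω D A ω') L lam e) {k : ℕ} (hk : (k : ℕ∞) < L) : 0 ≤ lam k := by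
  by_contra! hneg
  have hev := h.aForm_eigenvector he k hk
  have h1 := hev (h.eigenvector he k)
  have h2 := h.isSemiInner_aForm.nonneg (h.eigenvector he k)
  have h3 := h.isSemiInner_bForm.nonneg (h.eigenvector he k)
  have h4 : h.aForm (h.eigenvector he k) (h.eigenvector he k) = 0 :=
    le_antisymm (h1.trans_le (mul_nonpos_of_nonpos_of_nonneg hneg.le h3)) h2
  have h5 : h.bForm (h.eigenvector he k) (h.eigenvector he k) = 0 := by
    rw [h4] at h1
    exact (mul_eq_zero.1 h1.symm).resolve_left hneg.ne
  obtain ⟨c, hc0, hc⟩ := h.exists_smul_one_of_aForm_eq_zero h0 he hk h4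
  have h6 := h.bForm_eq_zero_of_ae hc (h.one h0)
  rw [map_sub, LinearMap.sub_apply, h.isSemiInner_bForm.eq_zero_of_self h5, zero_sub, neg_eq_zero,
    map_smul, LinearMap.smul_apply, smul_eq_mul] at h6
  exact (mul_ne_zero hc0 (h.bForm_one_one_ne_zero h0 he)) h6

/-- The constant 1 has eigenvalue 0, so 0 occurs in the list; by monotonicity and nonnegativity it
comes first. -/
theorem zero_lt_length (h : LocalSetting Ω D ω ω' A α β χ)
    (h0 : surface (m + 1) (frontier ω' ∩ D) = 0)
    (he : IsEigensystem A ω ω' χ (HAD0 Ω D A ω') L lam e) : ((0 : ℕ) : ℕ∞) < L ∧ lam 0 = 0 := by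
  obtain ⟨k, hk, hlam⟩ := h.exists_eigenvalue_eq h0 he (μ := 0) fun x => by
    rw [h.aForm_one, zero_mul]
  have hL : ((0 : ℕ) : ℕ∞) < L := lt_of_le_of_lt (by exact_mod_cast k.zero_le) hk
  exact ⟨hL, le_antisymm ((he.mono 0 k k.zero_le hk).trans hlam.le)
    (h.eigenvalue_nonneg h0 he hL)⟩

theorem exists_eigenvector_zero_ae_eq : ∃ c : ℝ, c ≠ 0 ∧
    (h.eigenvector he 0 - c • h.one h0).1 =ᵐ[volume.restrict ω'] 0 := by
  obtain ⟨hL, hlam⟩ := h.zero_lt_length h0 he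
  refine h.exists_smul_one_of_aForm_eq_zero h0 he hL ?_
  rw [h.aForm_eigenvector he 0 hL, hlam, zero_mul]

/-- The eigenvalue 0 is simple: its eigenfunctions have zero energy and are constants, so a second
one would depend linearly on the first. -/
theorem eigenvalue_ne_zero (h : LocalSetting Ω D ω ω' A α β χ)
    (h0 : surface (m + 1) (frontier ω' ∩ D) = 0)
    (he : IsEigensystem A ω ω' χ (HAD0 Ω D A ω') L lam e) {k : ℕ} (hk0 : 1 ≤ k) (hk : (k : ℕ∞) < L) : lam k ≠ 0 := by
  intro hlam
  obtain ⟨c, hc0, hc⟩ := h.exists_eigenvector_zero_ae_eq h0 he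
  obtain ⟨c', -, hc'⟩ := h.exists_smul_one_of_aForm_eq_zero h0 he hk (by
    rw [h.aForm_eigenvector he k hk, hlam, zero_mul])
  rw [h.eigenvector_eq he (h.zero_lt_length h0 he).1] at hc
  rw [h.eigenvector_eq he hk] at hc'
  -- With e 0 = c and e k = c' almost everywhere, c • e k - c' • e 0 is null; its coefficient c at
  -- index k is not zero.
  let t : ℕ → ℝ := fun j => if j = k then c else if j = 0 then -c' else 0
  have hk0' : k ≠ 0 := by omega
  have hsum : ∑ j ∈ Finset.range (k + 1), t j • e j = c • e k + (-c') • e 0 := by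
    rw [Finset.sum_range_succ, Finset.sum_eq_single_of_mem 0 (Finset.mem_range.2 (by omega)),
      add_comm (t 0 • e 0)]
    · simp [t, hk0'.symm]
    · intro j hj hj0
      have : j ≠ k := (Finset.mem_range.1 hj).ne
      simp [t, this, hj0]
  have := he.independent (k + 1) (by exact_mod_cast Order.add_one_le_of_lt hk) t (by
    rw [hsum]
    filter_upwards [hc, hc'] with x hx hx'
    replace hx : e 0 x - c * 1 = 0 := hx
    replace hx' : e k x - c' * 1 = 0 := hx'
    change c * e k x + -c' * e 0 x = 0
    linear_combination c * hx' - c' * hx) k (Nat.lt_succ_self k)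
  exact hc0 (by simpa [t] using this)

/-- Test the eigenvalue equation with 1: the left side is zero, and the eigenvalue on the right is
not. -/
theorem eigenvector_mem_ker {k : ℕ} (hk0 : 1 ≤ k) (hk : (k : ℕ∞) < L) :
    h.eigenvector he k ∈ LinearMap.ker (h.bForm (h.one h0)) := by
  have h1 := h.aForm_eigenvector he k hk (h.one h0)
  rw [h.isSemiInner_aForm.symm, h.aForm_one, h.isSemiInner_bForm.symm] at h1
  exact (mul_eq_zero.1 h1.symm).resolve_left (h.eigenvalue_ne_zero h0 he hk0 hk)

/-- For n ≥ 1 the first eigenfunction, a nonzero constant, is among those to which u is orthogonal.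
-/
theorem orthoCompl_subset_ker (hn : 1 ≤ n) :
    orthoCompl h.bForm L (h.eigenvector he) n ⊆ LinearMap.ker (h.bForm (h.one h0)) := by
  intro u hu
  obtain ⟨c, hc0, hc⟩ := h.exists_eigenvector_zero_ae_eq h0 he
  have h1 := h.bForm_eq_zero_of_ae hc u
  rw [map_sub, LinearMap.sub_apply, h.isSemiInner_bForm.symm,
    hu 0 hn (h.zero_lt_length h0 he).1, zero_sub, neg_eq_zero, map_smul, LinearMap.smul_apply,
    smul_eq_mul] at h1
  exact (mul_eq_zero.1 h1).resolve_left hc0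

end Null

end LocalSetting

end MSGFEM

/-! ### Conclusion -/

namespace MSGFEM

namespace LocalSetting

variable {m : ℕ} {Ω D N ω ω' : Set (Space (m + 1))}
  {A : Space (m + 1) → Matrix (Fin (m + 1)) (Fin (m + 1)) ℝ} {α β : ℝ} {χ : Space (m + 1) → ℝ}
  {L : ℕ∞} {lam : ℕ → ℝ} {e : ℕ → Space (m + 1) → ℝ} {n : ℕ}

/-- Approximation of harmonic functions if the Dirichlet part has positive surface measure. -/
theorem exists_approximation_of_pos (h : LocalSetting Ω D ω ω' A α β χ)
    (he : IsEigensystem A ω ω' χ (HAD0 Ω D A ω') L lam e)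
    (h0 : surface (m + 1) (frontier ω' ∩ D) ≠ 0) (w : h.harmonic) :
    nWidth A ω ω' χ (HAD0 Ω D A ω') (H10D Ω D ω) n ≠ ∞ ∧
      ∃ φ ∈ localSpace L e n, energyNorm A ω (χ * (w.1 - φ)) ≤
        (nWidth A ω ω' χ (HAD0 Ω D A ω') (H10D Ω D ω) n).toReal * energyNorm A ω' w.1 := by
  obtain ⟨C, hT⟩ := h.exists_reduction_id h0
  -- Here W is the whole harmonic space and k₀ = 0.
  refine h.exists_approximation he hT n.zero_le (fun _ _ => trivial) (fun _ _ _ => trivial)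
    (fun u _ hu => ?_) (fun u => ⟨fun hu => ⟨hu, trivial⟩, fun ⟨hu, _⟩ => hu⟩) w
  have := hT.integral_le u
  rw [hu, mul_zero] at this
  exact h.ae_eq_zero_of_integral_sq_le u this

/-- Approximation of harmonic functions if the Dirichlet part is a null set. -/
theorem exists_approximation_of_null (h : LocalSetting Ω D ω ω' A α β χ)
    (he : IsEigensystem A ω ω' χ (HAD0 Ω D A ω') L lam e)
    (h0 : surface (m + 1) (frontier ω' ∩ D) = 0) (hn : 1 ≤ n) (w : h.harmonic) :
    nWidth A ω ω' χ (HAN0 Ω A ω ω' χ) (H10D Ω D ω) (n - 1) ≠ ∞ ∧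
      ∃ φ ∈ localSpace L e n, energyNorm A ω (χ * (w.1 - φ)) ≤
        (nWidth A ω ω' χ (HAN0 Ω A ω ω' χ) (H10D Ω D ω) (n - 1)).toReal * energyNorm A ω' w.1 := by
  have hb := h.bForm_one_one_ne_zero h0 he
  obtain ⟨C, hT⟩ := h.exists_reduction_subMean h0 hb
  -- Here W is the b-orthogonal complement of 1 and k₀ = 1: the first eigenfunction spans the
  -- constants and lies outside W, so the width has index n - 1.
  exact h.exists_approximation he hT hn (h.orthoCompl_subset_ker h0 he hn)
    (fun k hk hkL => h.eigenvector_mem_ker h0 he hk hkL)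
    (fun u hu ha => h.ae_eq_zero_of_aForm_eq_zero h0 hb hu ha) (fun u => h.mem_HAN0_iff h0 hb) w

end LocalSetting

end MSGFEM

open MSGFEM
theorem theorem3p11 {d : ℕ} (hd : d = 2 ∨ d = 3)
    -- the domain, its boundary decomposition, and the coefficient
    (Ω D N : Set (Space d)) (hΩ : IsLipschitzDomain Ω) (hDN : IsBoundaryDecomposition Ω D N)
    (A : Space d → Matrix (Fin d) (Fin d) ℝ) (α β : ℝ) (hA : IsElliptic Ω A α β)
    -- the data and the exact solution
    (f : Space d → ℝ) (hf : MemLp f 2 (volume.restrict Ω))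
    (g : (Space d → ℝ) →ₗ[ℝ] ℝ) (hg : MemHNegHalf Ω D N g)
    (q u₀ : Space d → ℝ) (hu₀ : IsWeakSolution Ω D N A f g q u₀)
    -- the subdomain, the oversampling domain, and the partition of unity function
    (ω ω' : Set (Space d)) (hω : IsOpen ω) (hω' : IsLipschitzDomain ω')
    (hωω' : ω ⊆ ω') (hω'Ω : ω' ⊆ Ω)
    (χ : Space d → ℝ) (hχ : IsPartitionFunction Ω ω χ)
    -- the local particular function is `ψr + ψd`
    (ψr ψd : Space d → ℝ) (hψr : IsLocalLoadSolution Ω D N A f g ω' ψr)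
    (hψd : IsLocalDirichletSolution D A q ω' ψd)
    -- the eigenvalues and eigenfunctions on `H⁰_{A,D}(ω')`
    (L : ℕ∞) (lam : ℕ → ℝ) (v : ℕ → Space d → ℝ)
    (hv : IsEigensystem A ω ω' χ (HAD0 Ω D A ω') L lam v) (n : ℕ) :
    (surface d (frontier ω' ∩ D) ≠ 0 →
      nWidth A ω ω' χ (HAD0 Ω D A ω') (H10D Ω D ω) n ≠ ∞ ∧
      ∃ φ ∈ localSpace L v n,
        energyNorm A ω (χ * (u₀ - (ψr + ψd) - φ)) ≤
          (nWidth A ω ω' χ (HAD0 Ω D A ω') (H10D Ω D ω) n).toReal * energyNorm A ω' u₀) ∧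
    (surface d (frontier ω' ∩ D) = 0 → 1 ≤ n →
      nWidth A ω ω' χ (HAN0 Ω A ω ω' χ) (H10D Ω D ω) (n - 1) ≠ ∞ ∧
      ∃ φ ∈ localSpace L v n,
        energyNorm A ω (χ * (u₀ - (ψr + ψd) - φ)) ≤
          (nWidth A ω ω' χ (HAN0 Ω A ω ω' χ) (H10D Ω D ω) (n - 1)).toReal *
            energyNorm A ω' u₀) := by
  -- In the form m + 1 the dimension leaves m parameters for the boundary, as the surface estimates
  -- require.
  obtain ⟨m, rfl⟩ : ∃ m, d = m + 1 := by
    rcases hd with rfl | rfl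
    exacts [⟨1, rfl⟩, ⟨2, rfl⟩]
  have h : LocalSetting Ω D ω ω' A α β χ := ⟨hΩ, hA, hω, hω', hωω', hω'Ω, hχ⟩
  obtain ⟨hw, hle⟩ := h.sub_particular_mem hDN hg hu₀ hψr hψd
  have hnorm : energyNorm A ω' (u₀ - (ψr + ψd)) ≤ energyNorm A ω' u₀ := Real.sqrt_le_sqrt hle
  refine ⟨fun h0 => ?_, fun h0 hn => ?_⟩
  · obtain ⟨hne, φ, hφ, hest⟩ := h.exists_approximation_of_pos (n := n) hv h0 ⟨_, hw⟩
    exact ⟨hne, φ, hφ, hest.trans (mul_le_mul_of_nonneg_left hnorm ENNReal.toReal_nonneg)⟩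
  · obtain ⟨hne, φ, hφ, hest⟩ := h.exists_approximation_of_null hv h0 hn ⟨_, hw⟩
    exact ⟨hne, φ, hφ, hest.trans (mul_le_mul_of_nonneg_left hnorm ENNReal.toReal_nonneg)⟩
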